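/- Let $d\ge 1$ and let $a,\varphi:\mathbb R^d\to[0,\infty)$ be bounded measurable functions with $\int\varphi\,dx<\infty$, $\int a\,dx=1$ and $\int|x|^l a(x)\,dx<\infty$ for $l=1,\dots,d+1$. Let $\Gamma$ be the space of locally finite configurations in $\mathbb R^d$ (multiple points allowed), with the $\sigma$-field generated by the maps $\gamma\mapsto|\gamma\cap\Lambda|$, $\Lambda$ compact. Put $\psi_\alpha(x)=(1+\alpha|x|^{d+1})^{-1}$, $\psi=\psi_1$, $\Psi(\gamma)=\sum_{x\in\gamma}\psi(x)$, $\Gamma_*=\{\gamma\in\Gamma:\Psi(\gamma)<\infty\}$, with the metric $$\upsilon_*(\gamma,\gamma')=\sup\Big\{\Big|\sum_{x\in\gamma}g(x)\psi(x)-\sum_{x\in\gamma'}g(x)\psi(x)\Big|:\ \|g\|_{\rm Lip}+\|g\|_\infty\le 1\Big\}.$$ Let $\mathcal P_{\rm exp}$ be the set of probability measures $\mu$ on $\Gamma$ for which there is $\varkappa>0$ such that the correlation measures satisfy $\chi_\mu^{(n)}(\theta^{\otimes n})\le\varkappa^n\|\theta\|_{L^1}^n$ for all $n$ and all $\theta\ge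 0$ that are continuous with compact support; such $\mu$ are carried by $\Gamma_*$ and are considered as measures on $\Gamma_*$. For $\alpha\in(0,1]$ consider the operator $$(L^\alpha F)(\gamma)=\sum_{x\in\gamma}\int_{\mathbb R^d}\psi_\alpha(x)a(x-y)e^{-\sum_{z\in\gamma\setminus x}\varphi(z-y)}\,[F(\gamma\setminus x\cup y)-F(\gamma)]\,dy$$ and its predual $L^{\dagger,\alpha}$, acting on the finite signed measures $\mu$ on $\Gamma_*$ with $\int(1+\Psi)\,d|\mu|<\infty$. Then for each $\alpha\in(0,1]$ the closure of $L^{\dagger,\alpha}$ in the total variation norm generates a stochastic semigroup $S^\alpha$ on the finite signed measures on $\Gamma_*$, and $p^\alpha_t(\gamma,\cdot)=S^\alpha(t)\delta_\gamma$ are Markov kernels. For $\mu\in\mathcal P_{\rm exp}$ put $\Pi^\alpha_t=\int p^\alpha_t(\gamma,\cdot)\,\mu(d\gamma)$ and, for $0\le t_1\le t_2\le t_3$, $$\mathcal W^\alpha(t_1,t_2,t_3)=\int\!\!\int\!\!\int \upsilon_*(\gamma_1,\gamma_2)\,\upsilon_*(\gamma_2,\gamma_3)\;p^\alpha_{t_3-t_2}(\gamma_2,d\gamma_3)\,p^\alpha_{t_2-t_1}(\gamma_1,d\gamma_2)\,\Pi^\alpha_{t_1}(d\gamma_1).$$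 Then for each $\mu\in\mathcal P_{\rm exp}$: (1) for every $\delta>0$ there is $C>0$ such that for all $\alpha\in(0,1]$ and all $0\le t_1\le t_2\le t_3$ with $t_3-t_1<\delta$, $$\mathcal W^\alpha(t_1,t_2,t_3)\le C\,e^{2t_1}\,|t_3-t_1|^2;$$ in particular, $\mathcal W^\alpha(t_1,t_2,t_3)\le C_T|t_3-t_1|^2$ on each time interval $[0,T]$, with $C_T$ independent of $\alpha$; (2) for each $t\ge 0$ the family $\{\Pi_t^\alpha:\alpha\in(0,1]\}$ is tight in $\Gamma_*$; (3) for each $\alpha\in(0,1]$ there is a probability measure $P^\alpha$ on the space of cadlag paths $[0,\infty)\to\Gamma_*$ whose finite-dimensional distributions are those of the Markov process with transition function $p^\alpha$ and initial law $\mu$, and the family $\{P^\alpha:\alpha\in(0,1]\}$ is tight in the Skorokhod topology. -/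

import Mathlib

open MeasureTheory ProbabilityTheory Filter Topology Set
open scoped NNReal ENNReal

noncomputable section

namespace Kawasaki

/-- The habitat `ℝ^d` with the Euclidean norm. -/
abbrev Pt (d : ℕ) : Type := EuclideanSpace ℝ (Fin d)

/-! ### Configurations -/

/-- A locally finite configuration in `ℝ^d`, multiple points allowed: `mult x` is the number of
particles located at `x`. -/
@[ext]
structure Configuration (d : ℕ) where
  mult : Pt d → ℕ
  locallyFinite : ∀ Λ : Set (Pt d), IsCompact Λ → (Λ ∩ Function.support mult).Finite

namespace Configuration

variable {d : ℕ}

/-- `∑_{x ∈ γ} f(x)`, every particle counted with its multiplicity. -/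
def sum (γ : Configuration d) (f : Pt d → ℝ≥0∞) : ℝ≥0∞ :=
  ∑' x, (γ.mult x : ℝ≥0∞) * f x

/-- `N_Λ(γ) = |γ ∩ Λ|`. -/
def count (Λ : Set (Pt d)) (γ : Configuration d) : ℝ≥0∞ :=
  γ.sum (Λ.indicator 1)

/-- The σ-field generated by the maps `N_Λ`, `Λ` compact; it is the Borel σ-field of the vague
topology. -/
instance : MeasurableSpace (Configuration d) :=
  ⨆ Λ : {Λ : Set (Pt d) // IsCompact Λ}, MeasurableSpace.comap (count Λ.1) inferInstance

open scoped Classical in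
/-- `γ \ x`: one particle is removed from `x` (if there is one). -/
def erase (γ : Configuration d) (x : Pt d) : Configuration d where
  mult := fun z => γ.mult z - if z = x then 1 else 0
  locallyFinite := fun Λ hΛ => (γ.locallyFinite Λ hΛ).subset fun z hz => by
    refine ⟨hz.1, fun h => hz.2 ?_⟩
    simp [h]

open scoped Classical in
/-- `γ ∪ y`: one particle is added at `y`. -/
def insert (γ : Configuration d) (y : Pt d) : Configuration d where
  mult := fun z => γ.mult z + if z = y then 1 else 0
  locallyFinite := fun Λ hΛ => ((γ.locallyFinite Λ hΛ).union (Set.finite_singleton y)).subset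
    fun z hz => by
      by_cases h : z = y
      · exact Or.inr h
      · exact Or.inl ⟨hz.1, by simpa [h] using hz.2⟩

/-- `∑_{x₁ ∈ γ} θ(x₁) ∑_{x₂ ∈ γ \ x₁} θ(x₂) ⋯ ∑_{xₙ ∈ γ \ {x₁, …, xₙ₋₁}} θ(xₙ)`. -/
def factorialSum (θ : Pt d → ℝ≥0∞) : ℕ → Configuration d → ℝ≥0∞
  | 0, _ => 1
  | n + 1, γ => ∑' x, (γ.mult x : ℝ≥0∞) * (θ x * factorialSum θ n (γ.erase x))

end Configuration

/-- `χ_μ^{(n)}(θ^{⊗ n})`, where `χ_μ^{(n)}` is the `n`-th correlation (factorial moment) measure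
of `μ`. -/
def correlation {d : ℕ} (μ : Measure (Configuration d)) (n : ℕ) (θ : Pt d → ℝ≥0∞) : ℝ≥0∞ :=
  ∫⁻ γ, γ.factorialSum θ n ∂μ

/-- Sub-Poissonian probability measures, i.e. the class `𝒫_exp`. As the correlation measures are
positive, the bound for `|θ|` contains the one for `θ`, and also the finiteness of the
correlations. -/
structure IsSubPoissonian {d : ℕ} (μ : Measure (Configuration d)) : Prop where
  isProbabilityMeasure : IsProbabilityMeasure μ
  bound : ∃ ϰ : ℝ, 0 < ϰ ∧ ∀ (n : ℕ) (θ : Pt d → ℝ), Continuous θ → HasCompactSupport θ →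
    correlation μ n (fun x => ‖θ x‖ₑ) ≤ (ENNReal.ofReal ϰ * ∫⁻ x, ‖θ x‖ₑ) ^ n

/-! ### Tempered configurations -/

/-- `ψ_α(x) = 1 / (1 + α |x|^{d+1})`. -/
def psiα {d : ℕ} (α : ℝ) (x : Pt d) : ℝ := 1 / (1 + α * ‖x‖ ^ (d + 1))

/-- `ψ(x) = 1 / (1 + |x|^{d+1})`. -/
def psi {d : ℕ} (x : Pt d) : ℝ := 1 / (1 + ‖x‖ ^ (d + 1))

/-- `Ψ(γ) = ∑_{x ∈ γ} ψ(x)`. -/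
def Psi {d : ℕ} (γ : Configuration d) : ℝ≥0∞ := γ.sum fun x => ENNReal.ofReal (psi x)

/-- The set `Γ_*` of tempered configurations. -/
def Tempered (d : ℕ) : Type := {γ : Configuration d // Psi γ < ∞}

namespace Tempered

variable {d : ℕ}

/-- The inclusion of `Γ_*` in the space of all configurations. -/
def toConfiguration (γ : Tempered d) : Configuration d := γ.1

/-- The trace on `Γ_*` of the σ-field of the configuration space; it coincides with the Borel
σ-field of the metric `υ_*`. -/
instance : MeasurableSpace (Tempered d) := MeasurableSpace.comap toConfiguration inferInstance

/-- `ν_γ(g) = ∑_{x ∈ γ} g(x) ψ(x)`. -/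
def nu (γ : Tempered d) (g : Pt d → ℝ) : ℝ :=
  ∑' x, (γ.toConfiguration.mult x : ℝ) * (g x * psi x)

/-- The unit ball `‖g‖_BL = ‖g‖_L + sup |g| ≤ 1` of the bounded Lipschitz norm. -/
def unitBL (d : ℕ) : Set (Pt d → ℝ) :=
  {g | ∃ L M : ℝ≥0, L + M ≤ 1 ∧ LipschitzWith L g ∧ ∀ x, |g x| ≤ M}

/-- The metric `υ_*(γ, γ') = sup {|ν_γ(g) - ν_γ'(g)| : ‖g‖_BL ≤ 1}` of `Γ_*`, with its topology. -/
instance : PseudoEMetricSpace (Tempered d) where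
  edist γ γ' := ⨆ g ∈ unitBL d, edist (γ.nu g) (γ'.nu g)
  edist_self γ := by simp
  edist_comm γ γ' := by simp only [edist_comm]
  edist_triangle γ γ' γ'' := iSup₂_le fun g hg => (edist_triangle _ (γ'.nu g) _).trans
    (add_le_add (le_iSup₂ (f := fun g (_ : g ∈ unitBL d) => edist (γ.nu g) (γ'.nu g)) g hg)
      (le_iSup₂ (f := fun g (_ : g ∈ unitBL d) => edist (γ'.nu g) (γ''.nu g)) g hg))

theorem Psi_move_lt (γ : Tempered d) (x y : Pt d) :
    Psi ((γ.toConfiguration.erase x).insert y) < ∞ := by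
  classical
  have h1 : Psi ((γ.toConfiguration.erase x).insert y)
      ≤ Psi γ.toConfiguration + ENNReal.ofReal (psi y) := by
    have h2 : ∑' z, (if z = y then 1 else 0 : ℝ≥0∞) * ENNReal.ofReal (psi z)
        = ENNReal.ofReal (psi y) := by
      rw [tsum_eq_single y]
      · simp
      · intro z hz
        simp [hz]
    rw [← h2]
    unfold Psi Configuration.sum
    rw [← ENNReal.tsum_add]
    refine ENNReal.tsum_le_tsum fun z => ?_
    rw [← add_mul]
    gcongr
    simp only [Configuration.insert, Configuration.erase]
    push_cast
    gcongr
    exact tsub_le_self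
  exact h1.trans_lt (ENNReal.add_lt_top.2 ⟨γ.2, ENNReal.ofReal_lt_top⟩)

/-- `γ \ x ∪ y`: a particle jumps from `x` to `y`. -/
def move (γ : Tempered d) (x y : Pt d) : Tempered d :=
  ⟨(γ.toConfiguration.erase x).insert y, γ.Psi_move_lt x y⟩

/-- A measure on configurations seen as a measure on `Γ_*`. Every sub-Poissonian measure is carried
by `Γ_*`, hence no mass is lost. -/
def lawOn (μ : Measure (Configuration d)) : Measure (Tempered d) := μ.comap toConfiguration

end Tempered

/-! ### The model and the approximating Kolmogorov operators -/

/-- The conditions on the jump kernel `a` and on the repulsion potential `φ`. -/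
structure IsJumpModel {d : ℕ} (a φ : Pt d → ℝ) : Prop where
  measurable_a : Measurable a
  measurable_phi : Measurable φ
  nonneg_a : ∀ x, 0 ≤ a x
  nonneg_phi : ∀ x, 0 ≤ φ x
  bounded_a : ∃ b, ∀ x, a x ≤ b
  bounded_phi : ∃ b, ∀ x, φ x ≤ b
  integrable_phi : Integrable φ
  integrable_a : Integrable a
  integral_a : ∫ x, a x = 1
  moments_a : ∀ l : ℕ, 1 ≤ l → l ≤ d + 1 → Integrable fun x => ‖x‖ ^ l * a x

section Operators

variable {d : ℕ} (a φ : Pt d → ℝ) (α : ℝ)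

/-- The intensity `ψ_α(x) a(x - y) exp(-∑_{z ∈ γ \ x} φ(z - y))` of the jumps from `x` to `y`;
the exponential is `0` where the sum diverges. -/
def rate (γ : Tempered d) (x y : Pt d) : ℝ≥0∞ :=
  ENNReal.ofReal (psiα α x * a (x - y)) *
    EReal.exp (-(((γ.toConfiguration.erase x).sum fun z => ENNReal.ofReal (φ (z - y)) :
      ℝ≥0∞) : EReal))

/-- The measure kernel
`Ω_α^γ(A) = ∑_{x ∈ γ} ∫ ψ_α(x) a(x - y) exp(-∑_{z ∈ γ \ x} φ(z - y)) 1_A(γ \ x ∪ y) dy`. -/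
def jumpKernel (γ : Tempered d) (A : Set (Tempered d)) : ℝ≥0∞ :=
  ∑' x, (γ.toConfiguration.mult x : ℝ≥0∞) *
    ∫⁻ y, rate a φ α γ x y * A.indicator 1 (γ.move x y)

/-- The total jump intensity `Φ_α(γ) = Ω_α^γ(Γ_*)`. -/
def totalRate (γ : Tempered d) : ℝ≥0∞ := jumpKernel a φ α γ univ

/-- `Ω_α^γ(A) - Φ_α(γ) 1_A(γ)`, i.e. the value `(L^α 1_A)(γ)` of the approximating Kolmogorov
operator `(L^α F)(γ) = ∑_{x ∈ γ} ∫ ψ_α(x) a(x - y) exp(-∑_{z ∈ γ \ x} φ(z - y))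
[F(γ \ x ∪ y) - F(γ)] dy`. -/
def kolmogorovIndicator (A : Set (Tempered d)) (γ : Tempered d) : ℝ :=
  (jumpKernel a φ α γ A).toReal - A.indicator (fun γ' => (totalRate a φ α γ').toReal) γ

/-- The graph of the predual operator `L^{†,α}` with domain
`ℳ₁ = {μ : ∫ (1 + Ψ) d|μ| < ∞}`, acting by
`(L^{†,α} μ)(A) = ∫ (Ω_α^γ(A) - Φ_α(γ) 1_A(γ)) μ(dγ)`. -/
def predualGraph : Set (SignedMeasure (Tempered d) × SignedMeasure (Tempered d)) :=
  {q | ∫⁻ γ, (1 + Psi γ.toConfiguration) ∂q.1.totalVariation < ∞ ∧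
    ∀ A, MeasurableSet A → q.2 A =
      ∫ γ, kolmogorovIndicator a φ α A γ ∂q.1.toJordanDecomposition.posPart -
        ∫ γ, kolmogorovIndicator a φ α A γ ∂q.1.toJordanDecomposition.negPart}

end Operators

/-! ### Stochastic semigroups of operators on signed measures -/

section Semigroups

variable {X : Type*} [MeasurableSpace X]

/-- The total variation norm `|μ|(X)`. -/
def tvNorm (μ : SignedMeasure X) : ℝ≥0∞ := μ.totalVariation univ

/-- A stochastic `C₀`-semigroup on the Banach space of finite signed measures. (A positive
operator preserving the total mass is a contraction in the total variation norm.) -/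
structure IsStochasticSemigroup
    (S : ℝ≥0 → SignedMeasure X →ₗ[ℝ] SignedMeasure X) : Prop where
  zero : S 0 = LinearMap.id
  add : ∀ s t, S (s + t) = S s ∘ₗ S t
  nonneg : ∀ t μ, 0 ≤ μ → 0 ≤ S t μ
  mass : ∀ t μ, S t μ univ = μ univ
  continuous : ∀ μ, Tendsto (fun t => tvNorm (S t μ - μ)) (𝓝 0) (𝓝 0)

/-- The graph of the generator of a semigroup: `lim_{h → 0+} (S(h) μ - μ) / h = ν` in the total
variation norm. -/
def generatorGraph (S : ℝ≥0 → SignedMeasure X →ₗ[ℝ] SignedMeasure X) :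
    Set (SignedMeasure X × SignedMeasure X) :=
  {q | Tendsto (fun h : ℝ≥0 => tvNorm ((h : ℝ)⁻¹ • (S h q.1 - q.1) - q.2)) (𝓝[>] 0) (𝓝 0)}

/-- The closure of (the graph of) an operator in the total variation norm. -/
def tvClosure (G : Set (SignedMeasure X × SignedMeasure X)) :
    Set (SignedMeasure X × SignedMeasure X) :=
  {q | ∀ ε : ℝ≥0∞, 0 < ε → ∃ r ∈ G, tvNorm (q.1 - r.1) < ε ∧ tvNorm (q.2 - r.2) < ε}

/-- The Markov kernels `p_t` are the transition function of the semigroup `S`: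
`p_t(γ, ·) = S(t) δ_γ`. -/
def IsTransitionFunction (S : ℝ≥0 → SignedMeasure X →ₗ[ℝ] SignedMeasure X)
    (p : ℝ≥0 → Kernel X X) : Prop :=
  ∀ t, IsMarkovKernel (p t) ∧ ∀ γ A, MeasurableSet A →
    S t (Measure.dirac γ).toSignedMeasure A = (p t γ).real A

end Semigroups

/-! ### Chentsov functionals -/

section Chentsov

variable {d : ℕ} (p : ℝ≥0 → Kernel (Tempered d) (Tempered d))

/-- The one-dimensional marginal `Π_t = ∫ p_t(γ, ·) μ(dγ)`. -/
def marginal (μ : Measure (Tempered d)) (t : ℝ≥0) : Measure (Tempered d) := μ.bind (p t)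

/-- `w_u(γ) = ∫ υ_*(γ, γ') p_u(γ, dγ')`. -/
def chentsov_w (u : ℝ≥0) (γ : Tempered d) : ℝ≥0∞ := ∫⁻ γ', edist γ γ' ∂(p u γ)

/-- `W_{u,v}(γ) = ∫ υ_*(γ, γ') w_u(γ') p_v(γ, dγ')`. -/
def chentsov_W (u v : ℝ≥0) (γ : Tempered d) : ℝ≥0∞ :=
  ∫⁻ γ', edist γ γ' * chentsov_w p u γ' ∂(p v γ)

/-- `𝒲(t₁, t₂, t₃) = ∫ W_{t₃-t₂,t₂-t₁}(γ) Π_{t₁}(dγ)`, for `t₁ ≤ t₂ ≤ t₃`. -/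
def chentsovTriple (μ : Measure (Tempered d)) (t₁ t₂ t₃ : ℝ≥0) : ℝ≥0∞ :=
  ∫⁻ γ, chentsov_W p (t₃ - t₂) (t₂ - t₁) γ ∂(marginal p μ t₁)

end Chentsov

/-! ### Path space -/

/-- Cadlag paths `[0, ∞) → Γ_*`. -/
structure CadlagPath (d : ℕ) where
  toFun : ℝ≥0 → Tempered d
  rightContinuous : ∀ t, ContinuousWithinAt toFun (Ici t) t
  leftLimits : ∀ t, ∃ γ, Tendsto toFun (𝓝[<] t) (𝓝 γ)

namespace CadlagPath

variable {d : ℕ}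

/-- The basic Skorokhod neighbourhood of the path `ω`: those `ω'` for which some increasing
bijection `σ` of `[0, ∞)` satisfies `|σ(t) - t| < ε` and `υ_*(ω'(t), ω(σ(t))) < ε` for all
`t ≤ T`. -/
def nbhd (ω : CadlagPath d) (T : ℝ≥0) (ε : ℝ≥0∞) : Set (CadlagPath d) :=
  {ω' | ∃ σ : ℝ≥0 ≃o ℝ≥0, ∀ t ≤ T, edist (σ t) t < ε ∧ edist (ω'.toFun t) (ω.toFun (σ t)) < ε}

theorem nbhd_mono (ω : CadlagPath d) {T T' : ℝ≥0} {ε ε' : ℝ≥0∞} (hT : T ≤ T') (hε : ε' ≤ ε) :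
    ω.nbhd T' ε' ⊆ ω.nbhd T ε := fun _ ⟨σ, h⟩ =>
  ⟨σ, fun t ht => ⟨(h t (ht.trans hT)).1.trans_le hε, (h t (ht.trans hT)).2.trans_le hε⟩⟩

/-- The Skorokhod `J₁` topology of `D([0, ∞), Γ_*)`. -/
instance : TopologicalSpace (CadlagPath d) where
  IsOpen U := ∀ ω ∈ U, ∃ (T : ℝ≥0) (ε : ℝ≥0∞), 0 < ε ∧ ω.nbhd T ε ⊆ U
  isOpen_univ _ _ := ⟨0, 1, one_pos, subset_univ _⟩
  isOpen_inter U V hU hV ω hω := by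
    obtain ⟨T, ε, hε, h⟩ := hU ω hω.1
    obtain ⟨T', ε', hε', h'⟩ := hV ω hω.2
    exact ⟨max T T', min ε ε', lt_min hε hε', subset_inter
      ((ω.nbhd_mono (le_max_left _ _) (min_le_left _ _)).trans h)
      ((ω.nbhd_mono (le_max_right _ _) (min_le_right _ _)).trans h')⟩
  isOpen_sUnion 𝒰 h𝒰 ω := by
    rintro ⟨U, hU, hω⟩
    obtain ⟨T, ε, hε, h⟩ := h𝒰 U hU ω hω
    exact ⟨T, ε, hε, h.trans (subset_sUnion_of_mem hU)⟩

/-- The σ-field generated by the evaluation maps. -/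
instance : MeasurableSpace (CadlagPath d) :=
  ⨆ t : ℝ≥0, MeasurableSpace.comap (fun ω : CadlagPath d => ω.toFun t) inferInstance

/-- For `l = [(h₁, A₁), …, (hₘ, Aₘ)]`: the paths that visit `A₁` at the time `s + h₁`, `A₂` at the
time `s + h₁ + h₂`, and so on. -/
def cylinder : ℝ≥0 → List (ℝ≥0 × Set (Tempered d)) → Set (CadlagPath d)
  | _, [] => univ
  | s, (h, A) :: l => {ω | ω.toFun (s + h) ∈ A} ∩ cylinder (s + h) l

/-- `∫_{A₁} p_{h₁}(γ, dγ₁) ∫_{A₂} p_{h₂}(γ₁, dγ₂) ⋯ ∫_{Aₘ} p_{hₘ}(γₘ₋₁, dγₘ)`. -/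
def cylinderMass (p : ℝ≥0 → Kernel (Tempered d) (Tempered d)) :
    List (ℝ≥0 × Set (Tempered d)) → Tempered d → ℝ≥0∞
  | [], _ => 1
  | (h, A) :: l, γ => ∫⁻ γ' in A, cylinderMass p l γ' ∂(p h γ)

/-- `P` is the law on the path space of the Markov process with transition function `p` and initial
distribution `μ`, i.e. it has the corresponding finite-dimensional distributions. -/
structure IsPathMeasure (p : ℝ≥0 → Kernel (Tempered d) (Tempered d)) (μ : Measure (Tempered d))
    (P : Measure (CadlagPath d)) : Prop where
  isProbabilityMeasure : IsProbabilityMeasure P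
  finiteDimensional : ∀ l : List (ℝ≥0 × Set (Tempered d)), (∀ q ∈ l, MeasurableSet q.2) →
    P (cylinder 0 l) = ∫⁻ γ, cylinderMass p l γ ∂μ

end CadlagPath

end Kawasaki

end

/-! For fixed `α` the dynamics is a pure jump process with unbounded intensity, and everything is
read off from an explicit construction. A weight `wt`, comparable with `ψ`, satisfies `α ψ_α ≤ wt`,
so the jump intensity at `γ` is at most `lyap γ / α`, where `lyap γ = ∑ wt(x)`. Holding times are
exponential with the larger rate `lam = 1 + lyap / α`, and the embedded chain stays put with the
surplus rate (phantom jumps, which do not change the generator). The inequality `L lyap ≤ lyap`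
bounds the expected number of jumps, so there is no explosion. Conditioning on the first jump gives
a renewal equation; the bound on the number of jumps makes its bounded solutions unique. From this
come the Markov property, the Chapman-Kolmogorov equation, and the principle that a supersolution of
the renewal equation bounds the transition kernels (`JumpData.lintegral_p_le`), so that each drift
inequality becomes a bound on expectations.

The semigroup is `S(t) μ = ∫ p_t(γ, ·) μ(dγ)`. Its generator is the closure of the predual operator
for two reasons (`JumpData.generatorGraph_eq`). On the domain, the backward equation integrates to
`S(t) μ - μ = ∫₀ᵗ S(s) L† μ ds`; this relation survives limits in total variation and implies
membership in the generator graph. Conversely, truncate `μ` to a sublevel set of the Lyapunov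
function and average `S(s)` over `(0, h]`: the result lies in the domain, and these measures
together with their images approximate any pair in the generator graph.

All estimates are uniform in `α` because `ψ_α` and the repulsion factor are at most one, so only the
moments of `a` enter. Put `lyap₂ = lyap² + lyap`, and let `κ` be the constant `kap`. Then `L lyap ≤
lyap`, `L lyap₂ ≤ 2 lyap₂`, `L υ(γ₀, ·) ≤ κ lyap` and `L (υ(γ₀, ·) lyap) ≤ υ(γ₀, ·) lyap + κ lyap₂`.
A Gronwall argument gives `w_u ≤ κ u e^{2u} lyap`, then `W_{u,v} ≤ κ² u v e^{2(u+v)} lyap₂`, and `∫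
lyap₂ dΠ_t ≤ e^{2t} ∫ lyap₂ dμ`. The last integral is finite by the bounds on the first two
correlation measures. The exact exponent `2 t₁` is available because the length scale `scl` of `wt`
can be chosen to make the drift constant of `lyap` equal to one.

Tightness of the marginals uses the compact sets `{∑ hwt(x) ≤ R}` with `hwt(x) = (1 + |x|)^{-(d +
1/2)}`. This weight is integrable, so the sum has finite mean under `μ`. It decays more slowly than
`ψ`, so the tails of `Ψ` are uniformly small on such a set. Its relative increments are controlled
by the moments of `a`, so the mean grows at most exponentially.

For the laws of paths a pathwise form of the quadratic estimate is used. The expected sum of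
products of the sizes of two jumps in a time window of length `ρ` is `O(ρ²)`, and the expected sum
of the sizes up to time `ρ` is `O(ρ)`. With about `k / δ` windows of length `3δ` the union bound
leaves `O(δ)`: outside a small event the jumps larger than `η` before time `k` are separated by `δ`,
and the path oscillates by at most `2η` between them (`JumpPath.oscillation`). Together with a
maximal inequality for `∑ hwt` this confines the path to a set `CadlagPath.regular`. Such a set is
compact: along an ultrafilter one takes limits at a dense set of times and limits of the large-jump
times, passes to the right-continuous modification, and matches the jump times by a piecewise linear
change of time. -/

noncomputable section

/-! ### Homogeneous Markov chains -/

namespace MarkovChain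

/-- The sequence with first term `z` and the given tail. -/
def cons {E : Type*} (z : E) (ω : ℕ → E) : ℕ → E
  | 0 => z
  | n + 1 => ω n

@[simp] theorem cons_zero {E : Type*} (z : E) (ω : ℕ → E) : cons z ω 0 = z := rfl

@[simp] theorem cons_succ {E : Type*} (z : E) (ω : ℕ → E) (n : ℕ) : cons z ω (n + 1) = ω n := rfl

variable {E : Type*} [MeasurableSpace E]

theorem measurable_cons : Measurable fun q : E × (ℕ → E) => cons q.1 q.2 := by
  refine measurable_pi_lambda _ fun n => ?_
  cases n with
  | zero => exact measurable_fst
  | succ n => exact (measurable_pi_apply n).comp measurable_snd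

@[fun_prop]
theorem _root_.Measurable.consSeq {Z : Type*} [MeasurableSpace Z] {f : Z → E} {g : Z → ℕ → E}
    (hf : Measurable f) (hg : Measurable g) : Measurable fun z => cons (f z) (g z) :=
  measurable_cons.comp (hf.prodMk hg)

variable (κ : Kernel E E) [IsMarkovKernel κ]

/-- The transition kernels of a homogeneous chain, as required by the Ionescu-Tulcea theorem. -/
def steps (n : ℕ) : Kernel ((i : Finset.Iic n) → E) E :=
  κ.comap (fun h => h ⟨n, by simp⟩) (by fun_prop)

instance (n : ℕ) : IsMarkovKernel (steps κ n) := by unfold steps; infer_instance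

/-- The law of the chain `Z₀ = z, Z₁, Z₂, …` with transition kernel `κ`. -/
def path : Kernel E (ℕ → E) :=
  (Kernel.traj (X := fun _ => E) (steps κ) 0).comap (fun z _ => z) (by fun_prop)

instance : IsMarkovKernel (path κ) := by unfold path; infer_instance

theorem path_apply (z : E) : path κ z = Kernel.traj (X := fun _ => E) (steps κ) 0 (fun _ => z) := rfl

/-- The Ionescu-Tulcea theorem identifies the joint law of the history up to `n` and the next term
with a composition product; this is that identity in integrated form. -/
theorem lintegral_path_step (z : E) (n : ℕ)
    (F : ((i : Finset.Iic n) → E) × E → ℝ≥0∞) (hF : Measurable F) :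
    ∫⁻ ω, F (Preorder.frestrictLe n ω, ω (n + 1)) ∂path κ z
      = ∫⁻ ω, ∫⁻ y, F (Preorder.frestrictLe n ω, y) ∂κ (ω n) ∂path κ z := by
  have h := Kernel.partialTraj_compProd_eq_map_traj (X := fun _ => E) (κ := steps κ)
    (Nat.zero_le n) (x₀ := fun _ => z)
  have h1 : ∫⁻ ω, F (Preorder.frestrictLe n ω, ω (n + 1)) ∂path κ z
      = ∫⁻ q, F q ∂((Kernel.traj (X := fun _ => E) (steps κ) 0 (fun _ => z)).map
        (fun x => (Preorder.frestrictLe n x, x (n + 1)))) := by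
    rw [lintegral_map hF (by fun_prop), path_apply]
  rw [h1, ← h, Measure.lintegral_compProd hF, ← Kernel.traj_map_frestrictLe_apply,
    lintegral_map (Measurable.lintegral_kernel_prod_right (f := fun a b => F (a, b)) hF) (by fun_prop)]
  rfl

theorem lintegral_path_zero (z : E) (g : E → ℝ≥0∞) (hg : Measurable g) :
    ∫⁻ ω, g (ω 0) ∂path κ z = g z := by
  have h := Kernel.traj_map_frestrictLe_apply (X := fun _ => E) (κ := steps κ) 0 0 (fun _ => z)
  rw [Kernel.partialTraj_self, Kernel.id_apply] at h
  have h1 : ∫⁻ ω, g (ω 0) ∂path κ z = ∫⁻ q, g (q ⟨0, by simp⟩)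
      ∂((Kernel.traj (X := fun _ => E) (steps κ) 0 (fun _ => z)).map (Preorder.frestrictLe 0)) := by
    rw [lintegral_map (by fun_prop) (by fun_prop), path_apply]
    rfl
  rw [h1, h, lintegral_dirac' _ (by fun_prop)]

/-- Removes the last coordinate of a rectangle by conditioning on the past; it drives the induction
in `lintegral_rect_cons`. -/
theorem lintegral_rect_succ (A : ℕ → Set E) (hA : ∀ i, MeasurableSet (A i)) (n : ℕ)
    (g : E → ℝ≥0∞) (hg : Measurable g) (z : E) :
    ∫⁻ ω, (∏ i ∈ Finset.range (n + 1), (A i).indicator 1 (ω i)) * g (ω (n + 1)) ∂path κ z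
      = ∫⁻ ω, (∏ i ∈ Finset.range n, (A i).indicator 1 (ω i)) *
        ((A n).indicator 1 (ω n) * ∫⁻ y, g y ∂κ (ω n)) ∂path κ z := by
  have hm : ∀ i, Measurable ((A i).indicator (1 : E → ℝ≥0∞)) := fun i =>
    measurable_one.indicator (hA i)
  -- The product runs over `attach` because the integrand has to be a function of the restricted
  -- history, whose coordinates carry a proof that the index is at most `n`.
  have h := lintegral_path_step κ z n (fun q => (∏ i ∈ (Finset.range (n + 1)).attach,
    (A i.1).indicator 1 (q.1 ⟨i.1, by have := Finset.mem_range.1 i.2; exact Finset.mem_Iic.2 (by omega)⟩)) * g q.2) (by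
      refine Measurable.mul ?_ (by fun_prop)
      refine Finset.measurable_prod _ fun i _ => ?_
      exact (hm i).comp (by fun_prop))
  simp only [Preorder.frestrictLe_apply] at h
  have e : ∀ ω : ℕ → E, ∏ i ∈ (Finset.range (n + 1)).attach, (A i.1).indicator (1 : E → ℝ≥0∞) (ω i.1)
      = ∏ i ∈ Finset.range (n + 1), (A i).indicator (1 : E → ℝ≥0∞) (ω i) := fun ω =>
    Finset.prod_attach (Finset.range (n + 1)) fun i => (A i).indicator (1 : E → ℝ≥0∞) (ω i)
  simp only [e] at h
  rw [h]
  refine lintegral_congr fun ω => ?_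
  rw [lintegral_const_mul _ hg, Finset.prod_range_succ, mul_assoc]

/-- Regeneration at the first step, on rectangles. Both sides lose their last coordinate by the same
rule `lintegral_rect_succ`, so induction on the length reduces the claim to a single transition. -/
theorem lintegral_rect_cons (n : ℕ) : ∀ (A : ℕ → Set E) (_ : ∀ i, MeasurableSet (A i))
    (g : E → ℝ≥0∞) (_ : Measurable g) (z : E),
    ∫⁻ ω, (∏ i ∈ Finset.range (n + 1), (A i).indicator 1 (ω i)) * g (ω (n + 1)) ∂path κ z
      = (A 0).indicator 1 z * ∫⁻ y, ∫⁻ ω, (∏ i ∈ Finset.range n, (A (i + 1)).indicator 1 (ω i)) *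
        g (ω n) ∂path κ y ∂κ z := by
  induction n with
  | zero =>
    intro A hA g hg z
    rw [lintegral_rect_succ κ A hA 0 g hg]
    simp only [Finset.range_zero, Finset.prod_empty, one_mul]
    rw [lintegral_path_zero κ z (fun y => (A 0).indicator 1 y * ∫⁻ y', g y' ∂κ y)
      ((measurable_one.indicator (hA 0)).mul hg.lintegral_kernel)]
    congr 1
    exact lintegral_congr fun y => (lintegral_path_zero κ y g hg).symm
  | succ n ih =>
    intro A hA g hg z
    rw [lintegral_rect_succ κ A hA (n + 1) g hg]
    have := ih A hA (fun y => (A (n + 1)).indicator 1 y * ∫⁻ y', g y' ∂κ y)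
      ((measurable_one.indicator (hA (n + 1))).mul hg.lintegral_kernel) z
    rw [this]
    congr 1
    refine lintegral_congr fun y => ?_
    exact (lintegral_rect_succ κ (fun i => A (i + 1)) (fun i => hA _) n g hg y).symm

/-- Cylinders over finite index sets form a generating π-system, and each is a rectangle over an
initial segment once the missing factors are filled with the whole space. -/
theorem ext_of_rect {μ ν : Measure (ℕ → E)} [IsProbabilityMeasure μ] [IsProbabilityMeasure ν]
    (h : ∀ (A : ℕ → Set E) (_ : ∀ i, MeasurableSet (A i)) (n : ℕ),
      ∫⁻ ω, ∏ i ∈ Finset.range n, (A i).indicator 1 (ω i) ∂μ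
        = ∫⁻ ω, ∏ i ∈ Finset.range n, (A i).indicator 1 (ω i) ∂ν) : μ = ν := by
  classical
  refine ext_of_generate_finite _ generateFrom_squareCylinders.symm
    (isPiSystem_squareCylinders (fun _ => MeasurableSpace.isPiSystem_measurableSet)
      (fun _ => MeasurableSet.univ)) ?_ (by simp)
  rintro s ⟨I, t, ht, rfl⟩
  obtain ⟨n, hn⟩ : ∃ n, I ⊆ Finset.range n := ⟨I.sup id + 1, fun i hi => by
    simpa [Nat.lt_succ_iff] using Finset.le_sup (f := id) hi⟩
  set A : ℕ → Set E := fun i => if i ∈ I then t i else univ with hAdef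
  have hA : ∀ i, MeasurableSet (A i) := fun i => by
    simp only [hAdef]; split_ifs with hi
    · exact ht i (mem_univ i)
    · exact MeasurableSet.univ
  have e : ∀ ω : ℕ → E, ∏ i ∈ Finset.range n, (A i).indicator (1 : E → ℝ≥0∞) (ω i)
      = ((I : Set ℕ).pi t).indicator 1 ω := by
    intro ω
    by_cases hω : ω ∈ (I : Set ℕ).pi t
    · rw [indicator_of_mem hω]
      refine Finset.prod_eq_one fun i _ => ?_
      rw [indicator_of_mem, Pi.one_apply]
      simp only [hAdef]; split_ifs with hi
      · exact hω i hi
      · trivial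
    · rw [indicator_of_notMem hω]
      simp only [Set.mem_pi, not_forall] at hω
      obtain ⟨i, hi, hω⟩ := hω
      refine Finset.prod_eq_zero (hn hi) ?_
      rw [indicator_of_notMem]
      have hi' : i ∈ I := hi
      simpa [hAdef, hi'] using hω
  have hs : MeasurableSet ((I : Set ℕ).pi t) :=
    MeasurableSet.pi I.countable_toSet fun i _ => ht i (mem_univ i)
  have := h A hA n
  simp only [e] at this
  rwa [lintegral_indicator_one hs, lintegral_indicator_one hs] at this

/-- Regeneration after the first step. -/
theorem lintegral_path_cons (z : E) (F : (ℕ → E) → ℝ≥0∞) (hF : Measurable F) :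
    ∫⁻ ω, F ω ∂path κ z = ∫⁻ y, ∫⁻ ω, F (cons z ω) ∂path κ y ∂κ z := by
  have hc : Measurable (cons z : (ℕ → E) → ℕ → E) := by fun_prop
  -- It suffices to identify the measures, and by `ext_of_rect` rectangles are enough for that.
  have key : path κ z = (path κ ∘ₘ κ z).map (cons z) := by
    have : IsProbabilityMeasure ((path κ ∘ₘ κ z).map (cons z)) :=
      Measure.isProbabilityMeasure_map hc.aemeasurable
    refine ext_of_rect fun A hA n => ?_
    have hm : ∀ i, Measurable ((A i).indicator (1 : E → ℝ≥0∞)) := fun i =>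
      measurable_one.indicator (hA i)
    have hP : ∀ n, Measurable fun ω : ℕ → E => ∏ i ∈ Finset.range n,
        (A i).indicator (1 : E → ℝ≥0∞) (ω i) := fun n =>
      Finset.measurable_prod _ fun i _ => (hm i).comp (measurable_pi_apply i)
    rw [lintegral_map (hP n) hc, Measure.lintegral_bind (path κ).aemeasurable
      (Measurable.aemeasurable (by exact (hP n).comp hc))]
    cases n with
    | zero => simp
    | succ n =>
      have := lintegral_rect_cons κ n A hA 1 measurable_one z
      simp only [Pi.one_apply, mul_one] at this
      rw [this, ← lintegral_const_mul]
      · refine lintegral_congr fun y => ?_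
        rw [← lintegral_const_mul]
        · refine lintegral_congr fun ω => ?_
          rw [Finset.prod_range_succ', mul_comm]
          simp
        · exact Finset.measurable_prod _ fun i _ => (hm (i + 1)).comp (measurable_pi_apply i)
      · exact Measurable.lintegral_kernel
          (Finset.measurable_prod _ fun i _ => (hm (i + 1)).comp (measurable_pi_apply i))
  conv_lhs => rw [key]
  rw [lintegral_map hF hc, Measure.lintegral_bind (path κ).aemeasurable
    (Measurable.aemeasurable (by exact hF.comp hc))]

end MarkovChain

/-! ### Chains with marks -/

namespace MarkovChain

variable {H X : Type*} [MeasurableSpace H] [MeasurableSpace X] (Q : Kernel X (H × X)) [IsMarkovKernel Q]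

/-- The law of the sequence `(h₁, x₁), (h₂, x₂), …` where `(hₙ₊₁, xₙ₊₁)` has the law `Q xₙ`, started
at `x₀ = x`. -/
def marked : Kernel X (ℕ → H × X) :=
  path (Q.comap Prod.snd measurable_snd) ∘ₖ Q

instance : IsMarkovKernel (marked Q) := by unfold marked; infer_instance

theorem lintegral_marked (x : X) (F : (ℕ → H × X) → ℝ≥0∞) (hF : Measurable F) :
    ∫⁻ ω, F ω ∂marked Q x = ∫⁻ z, ∫⁻ ω, F (cons z ω) ∂marked Q z.2 ∂Q x := by
  rw [marked, Kernel.lintegral_comp _ _ _ hF]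
  refine lintegral_congr fun z => ?_
  rw [lintegral_path_cons _ z F hF, Kernel.lintegral_comp _ _ _ (by fun_prop)]
  rfl

end MarkovChain

/-! ### Piecewise constant paths -/

namespace JumpPath

open MarkovChain

variable {X : Type*}

/-- The time of the `n`-th jump. -/
def T (ω : ℕ → ℝ≥0 × X) (n : ℕ) : ℝ≥0 := ∑ k ∈ Finset.range n, (ω k).1

/-- The state after the `n`-th jump. -/
def st (x : X) (ω : ℕ → ℝ≥0 × X) : ℕ → X
  | 0 => x
  | n + 1 => (ω n).2

/-- The number of jumps up to the time `t`. -/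
def idx (ω : ℕ → ℝ≥0 × X) (t : ℝ≥0) : ℕ := sInf {n | t < T ω (n + 1)}

/-- The state at the time `t`. -/
def val (x : X) (ω : ℕ → ℝ≥0 × X) (t : ℝ≥0) : X := st x ω (idx ω t)

/-- The sequence of the holding times and states after the time `t`. -/
def shift (ω : ℕ → ℝ≥0 × X) (t : ℝ≥0) : ℕ → ℝ≥0 × X :=
  cons (T ω (idx ω t + 1) - t, (ω (idx ω t)).2) fun k => ω (idx ω t + 1 + k)

/-- The sequences without explosion. -/
def NE : Set (ℕ → ℝ≥0 × X) := {ω | ∀ t, ∃ n, t < T ω n}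

@[simp] theorem T_zero (ω : ℕ → ℝ≥0 × X) : T ω 0 = 0 := by simp [T]

theorem T_succ (ω : ℕ → ℝ≥0 × X) (n : ℕ) : T ω (n + 1) = T ω n + (ω n).1 :=
  Finset.sum_range_succ _ _

theorem T_mono (ω : ℕ → ℝ≥0 × X) : Monotone (T ω) :=
  monotone_nat_of_le_succ fun n => by rw [T_succ]; exact le_self_add

theorem T_cons (z : ℝ≥0 × X) (ω : ℕ → ℝ≥0 × X) (n : ℕ) : T (cons z ω) (n + 1) = z.1 + T ω n := by
  simp [T, Finset.sum_range_succ', add_comm]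

theorem st_cons (x : X) (z : ℝ≥0 × X) (ω : ℕ → ℝ≥0 × X) (n : ℕ) :
    st x (cons z ω) (n + 1) = st z.2 ω n := by
  cases n <;> rfl

theorem lt_T_idx {ω : ℕ → ℝ≥0 × X} (h : ω ∈ NE) (t : ℝ≥0) : t < T ω (idx ω t + 1) := by
  have : {n | t < T ω (n + 1)}.Nonempty := by
    obtain ⟨n, hn⟩ := h t
    exact ⟨n, hn.trans_le (T_mono ω n.le_succ)⟩
  exact Nat.sInf_mem this

/-- Non-explosion is not needed here: on the empty set the infimum defining `idx` is `0`, and `T ω 0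
= 0`. -/
theorem T_idx_le (ω : ℕ → ℝ≥0 × X) (t : ℝ≥0) : T ω (idx ω t) ≤ t := by
  rcases h : idx ω t with _ | n
  · simp
  · by_contra! hc
    have : idx ω t ≤ n := Nat.sInf_le (show n ∈ {n | t < T ω (n + 1)} from hc)
    omega

theorem idx_eq {ω : ℕ → ℝ≥0 × X} {t : ℝ≥0} {n : ℕ} (h1 : T ω n ≤ t) (h2 : t < T ω (n + 1)) :
    idx ω t = n := by
  refine le_antisymm (Nat.sInf_le h2) ?_
  refine le_csInf ⟨n, h2⟩ fun m hm => ?_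
  by_contra! hc
  exact absurd (hm.trans_le (T_mono ω hc)) (not_lt.2 h1)

theorem idx_cons_of_lt {z : ℝ≥0 × X} {ω : ℕ → ℝ≥0 × X} {t : ℝ≥0} (h : t < z.1) :
    idx (cons z ω) t = 0 := idx_eq (by simp) (by rw [T_cons]; simpa using h)

theorem idx_cons_of_le {z : ℝ≥0 × X} {ω : ℕ → ℝ≥0 × X} {t : ℝ≥0} (hω : ω ∈ NE) (h : z.1 ≤ t) :
    idx (cons z ω) t = idx ω (t - z.1) + 1 := by
  refine idx_eq ?_ ?_
  · rw [T_cons]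
    exact (add_le_add_right (T_idx_le ω _) _).trans_eq (add_tsub_cancel_of_le h)
  · rw [T_cons]
    conv_lhs => rw [← add_tsub_cancel_of_le h]
    exact add_lt_add_right (lt_T_idx hω _) _

/-- This and the next three lemmas are the dichotomy behind the renewal equation: before the first
jump only the residual holding time changes, after it the process has restarted from the new state
with the clock reset. -/
theorem val_cons_of_lt (x : X) {z : ℝ≥0 × X} {ω : ℕ → ℝ≥0 × X} {t : ℝ≥0} (h : t < z.1) :
    val x (cons z ω) t = x := by rw [val, idx_cons_of_lt h, st]

theorem val_cons_of_le (x : X) {z : ℝ≥0 × X} {ω : ℕ → ℝ≥0 × X} {t : ℝ≥0} (hω : ω ∈ NE)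
    (h : z.1 ≤ t) : val x (cons z ω) t = val z.2 ω (t - z.1) := by
  rw [val, idx_cons_of_le hω h, st_cons, val]

theorem shift_cons_of_lt {z : ℝ≥0 × X} {ω : ℕ → ℝ≥0 × X} {t : ℝ≥0} (h : t < z.1) :
    shift (cons z ω) t = cons (z.1 - t, z.2) ω := by
  unfold shift
  rw [idx_cons_of_lt h, T_cons]
  simp only [T_zero, add_zero, cons_zero]
  congr 1
  funext k
  rw [show 0 + 1 + k = k + 1 by omega, cons_succ]

theorem shift_cons_of_le {z : ℝ≥0 × X} {ω : ℕ → ℝ≥0 × X} {t : ℝ≥0} (hω : ω ∈ NE) (h : z.1 ≤ t) :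
    shift (cons z ω) t = shift ω (t - z.1) := by
  unfold shift
  rw [idx_cons_of_le hω h, T_cons]
  congr 1
  · rw [cons_succ, tsub_tsub_eq_add_tsub_of_le h, add_comm z.1]
  · funext k
    rw [show idx ω (t - z.1) + 1 + 1 + k = (idx ω (t - z.1) + 1 + k) + 1 by omega, cons_succ]

/-- Stated only for indices `n + 1`: the zeroth time of a shifted sequence is `0` by definition and
does not come from a jump of `ω`. -/
theorem T_shift {ω : ℕ → ℝ≥0 × X} (hω : ω ∈ NE) (t : ℝ≥0) (n : ℕ) :
    T (shift ω t) (n + 1) = T ω (idx ω t + 1 + n) - t := by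
  induction n with
  | zero => simp [T_cons, shift]
  | succ n ih =>
    rw [T_succ, ih, ← add_assoc, T_succ, tsub_add_eq_add_tsub]
    · rfl
    · exact (lt_T_idx hω t).le.trans (T_mono ω (by omega))

theorem shift_mem_NE {ω : ℕ → ℝ≥0 × X} (hω : ω ∈ NE) (t : ℝ≥0) : shift ω t ∈ NE := fun s => by
  obtain ⟨n, hn⟩ := hω (s + t)
  refine ⟨n + 1, ?_⟩
  rw [T_shift hω, lt_tsub_iff_right]
  exact hn.trans_le (T_mono ω (by omega))

theorem st_shift (x : X) (ω : ℕ → ℝ≥0 × X) (t : ℝ≥0) (n : ℕ) :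
    st (val x ω t) (shift ω t) n = st x ω (idx ω t + n) := by
  cases n with
  | zero => rfl
  | succ n =>
    cases n with
    | zero => rfl
    | succ n =>
      show (ω (idx ω t + 1 + n)).2 = (ω (idx ω t + (n + 1))).2
      rw [show idx ω t + 1 + n = idx ω t + (n + 1) by omega]

/-- The flow property of piecewise constant paths: the numbers of jumps in `[0, t]` and in the
following interval of length `s` add up. -/
theorem val_shift (x : X) {ω : ℕ → ℝ≥0 × X} (hω : ω ∈ NE) (t s : ℝ≥0) :
    val (val x ω t) (shift ω t) s = val x ω (t + s) := by
  set m := idx (shift ω t) s with hm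
  have h1 : idx ω (t + s) = idx ω t + m := by
    have h2 := T_idx_le (shift ω t) s
    have h3 := lt_T_idx (shift_mem_NE hω t) s
    rw [T_shift hω, ← hm, lt_tsub_iff_right, add_comm] at h3
    refine idx_eq ?_ (by rwa [add_right_comm])
    rw [← hm] at h2
    rcases m with _ | m
    · exact (T_idx_le ω t).trans le_self_add
    · rw [T_shift hω, tsub_le_iff_right, add_comm s] at h2
      rwa [show idx ω t + (m + 1) = idx ω t + 1 + m by omega]
  rw [val, ← hm, st_shift, val, h1]

variable [MeasurableSpace X]

theorem measurable_T (n : ℕ) : Measurable fun ω : ℕ → ℝ≥0 × X => T ω n :=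
  Finset.measurable_sum _ fun k _ => measurable_fst.comp (measurable_pi_apply k)

theorem measurable_st (n : ℕ) : Measurable fun q : X × (ℕ → ℝ≥0 × X) => st q.1 q.2 n := by
  cases n with
  | zero => exact measurable_fst
  | succ n => exact measurable_snd.comp ((measurable_pi_apply n).comp measurable_snd)

theorem measurableSet_NE : MeasurableSet (NE : Set (ℕ → ℝ≥0 × X)) := by
  have : (NE : Set (ℕ → ℝ≥0 × X)) = ⋂ m : ℕ, ⋃ n : ℕ, {ω | (m : ℝ≥0) < T ω n} := by
    ext ω
    simp only [NE, mem_ofPred_eq, mem_iInter, mem_iUnion]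
    refine ⟨fun h m => h m, fun h t => ?_⟩
    obtain ⟨m, hm⟩ := exists_nat_ge t
    obtain ⟨n, hn⟩ := h m
    exact ⟨n, hm.trans_lt hn⟩
  rw [this]
  exact MeasurableSet.iInter fun m => MeasurableSet.iUnion fun n =>
    measurableSet_lt measurable_const (measurable_T n)

theorem measurable_idx : Measurable fun q : (ℕ → ℝ≥0 × X) × ℝ≥0 => idx q.1 q.2 := by
  have hlt : ∀ n, MeasurableSet {q : (ℕ → ℝ≥0 × X) × ℝ≥0 | q.2 < T q.1 (n + 1)} := fun n =>
    measurableSet_lt measurable_snd ((measurable_T _).comp measurable_fst)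
  refine measurable_of_Ici fun n => ?_
  cases n with
  | zero => simp
  | succ n =>
    -- The union excludes explosive sequences, for which the infimum takes its default value `0`.
    have : (fun q : (ℕ → ℝ≥0 × X) × ℝ≥0 => idx q.1 q.2) ⁻¹' Ici (n + 1)
        = (⋂ m ∈ Iic n, {q : (ℕ → ℝ≥0 × X) × ℝ≥0 | q.2 < T q.1 (m + 1)}ᶜ) ∩
          ⋃ m, {q | q.2 < T q.1 (m + 1)} := by
      ext q
      simp only [mem_preimage, mem_Ici, mem_inter_iff, mem_iInter, mem_Iic, mem_compl_iff,
        mem_ofPred_eq, mem_iUnion]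
      constructor
      · intro h
        refine ⟨fun m hm hlt => ?_, ?_⟩
        · have : idx q.1 q.2 ≤ m := Nat.sInf_le hlt
          omega
        · by_contra! hc
          have : {n | q.2 < T q.1 (n + 1)} = ∅ := by ext m; simpa using hc m
          rw [idx, this, Nat.sInf_empty] at h
          omega
      · rintro ⟨h1, h2⟩
        refine le_csInf h2 fun m hm => ?_
        by_contra! hc
        exact h1 m (by omega) hm
    rw [this]
    exact (MeasurableSet.biInter (to_countable _) fun m _ => (hlt m).compl).inter
      (MeasurableSet.iUnion hlt)

theorem measurable_val : Measurable fun q : (X × (ℕ → ℝ≥0 × X)) × ℝ≥0 => val q.1.1 q.1.2 q.2 := by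
  have h1 : Measurable fun q : (X × (ℕ → ℝ≥0 × X)) × ℕ => st q.1.1 q.1.2 q.2 :=
    measurable_from_prod_countable_left fun n => measurable_st n
  exact h1.comp (measurable_fst.prodMk (measurable_idx.comp
    ((measurable_snd.comp measurable_fst).prodMk measurable_snd)))

theorem measurable_shift : Measurable fun q : (ℕ → ℝ≥0 × X) × ℝ≥0 => shift q.1 q.2 := by
  have h2 : Measurable fun q : (ℕ → ℝ≥0 × X) × ℝ≥0 => (q, idx q.1 q.2) :=
    measurable_id.prodMk measurable_idx
  refine measurable_pi_lambda _ fun k => ?_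
  cases k with
  | zero =>
    have h1 : Measurable fun q : ((ℕ → ℝ≥0 × X) × ℝ≥0) × ℕ =>
        ((T q.1.1 (q.2 + 1) - q.1.2, (q.1.1 q.2).2) : ℝ≥0 × X) :=
      measurable_from_prod_countable_left fun n =>
        (((measurable_T (n + 1)).comp measurable_fst).sub measurable_snd).prodMk
          (measurable_snd.comp ((measurable_pi_apply n).comp measurable_fst))
    have h3 := h1.comp h2
    simp only [Function.comp_def] at h3
    simpa only [shift, cons_zero, cons_succ] using h3
  | succ k =>
    have h1 : Measurable fun q : ((ℕ → ℝ≥0 × X) × ℝ≥0) × ℕ => q.1.1 (q.2 + 1 + k) :=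
      measurable_from_prod_countable_left fun n => (measurable_pi_apply (n + 1 + k)).comp measurable_fst
    have h3 := h1.comp h2
    simp only [Function.comp_def] at h3
    simpa only [shift, cons_zero, cons_succ] using h3

end JumpPath

/-! ### Jump processes with a Lyapunov function -/

/-- The rate and the transition kernel of a jump process, with a Lyapunov function `U` that bounds
the rate. -/
structure JumpData (X : Type*) [MeasurableSpace X] where
  rate : X → ℝ
  K : Kernel X X
  U : X → ℝ
  C : ℝ
  markov : IsMarkovKernel K
  measurable_rate : Measurable rate
  rate_pos : ∀ x, 0 < rate x
  measurable_U : Measurable U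
  U_nonneg : ∀ x, 0 ≤ U x
  C_nonneg : 0 ≤ C
  rate_le : ∀ x, rate x ≤ C * U x
  lyapunov : ∀ x, ENNReal.ofReal (rate x) * ∫⁻ y, ENNReal.ofReal (U y) ∂K x
    ≤ ENNReal.ofReal ((rate x + 1) * U x)

namespace JumpData

open MarkovChain JumpPath

variable {X : Type*} [MeasurableSpace X] (D : JumpData X)

instance : IsMarkovKernel D.K := D.markov

theorem measurable_density : Measurable (Function.uncurry fun (x : X) (s : ℝ) =>
    ENNReal.ofReal (D.rate x * Real.exp (-D.rate x * s))) := by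
  have := D.measurable_rate
  unfold Function.uncurry
  fun_prop

/-- The law of the holding times. -/
def hold : Kernel X ℝ≥0 :=
  ((Kernel.const X (volume.restrict (Ioi (0 : ℝ)))).withDensity fun x s =>
    ENNReal.ofReal (D.rate x * Real.exp (-D.rate x * s))).map Real.toNNReal

theorem lintegral_hold (x : X) (f : ℝ≥0 → ℝ≥0∞) (hf : Measurable f) :
    ∫⁻ e, f e ∂D.hold x
      = ∫⁻ s in Ioi (0 : ℝ), ENNReal.ofReal (D.rate x * Real.exp (-D.rate x * s)) * f s.toNNReal := by
  rw [hold, Kernel.lintegral_map _ measurable_real_toNNReal _ hf,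
    Kernel.lintegral_withDensity _ D.measurable_density _ (by fun_prop : Measurable fun s : ℝ => f s.toNNReal)]
  simp

theorem lintegral_exp_Ioi {l : ℝ} (hl : 0 < l) (t : ℝ) :
    ∫⁻ s in Ioi t, ENNReal.ofReal (l * Real.exp (-l * s)) = ENNReal.ofReal (Real.exp (-l * t)) := by
  rw [← ofReal_integral_eq_lintegral_ofReal]
  · rw [integral_const_mul, integral_exp_mul_Ioi (by linarith)]
    congr 1
    field_simp
  · exact (integrableOn_exp_mul_Ioi (by linarith) t).const_mul l
  · exact ae_of_all _ fun s => by positivity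

instance : IsMarkovKernel D.hold := ⟨fun x => ⟨by
  have := D.lintegral_hold x 1 measurable_one
  simp only [Pi.one_apply, mul_one, lintegral_one] at this
  rw [this, lintegral_exp_Ioi (D.rate_pos x)]
  simp⟩⟩

/-- Absence of memory. -/
theorem lintegral_hold_shift (x : X) (t : ℝ≥0) (f : ℝ≥0 → ℝ≥0∞) (hf : Measurable f) :
    ∫⁻ e, (if t < e then f (e - t) else 0) ∂D.hold x
      = ENNReal.ofReal (Real.exp (-D.rate x * t)) * ∫⁻ e, f e ∂D.hold x := by
  have hm : Measurable fun e : ℝ≥0 => if t < e then f (e - t) else 0 :=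
    Measurable.ite measurableSet_Ioi (hf.comp (by fun_prop)) measurable_const
  rw [lintegral_hold _ _ _ hm, lintegral_hold _ _ _ hf, ← lintegral_const_mul _ (by fun_prop),
    ← lintegral_indicator measurableSet_Ioi, ← lintegral_indicator measurableSet_Ioi,
    ← lintegral_add_right_eq_self _ (t : ℝ)]
  refine lintegral_congr fun s => ?_
  by_cases h0 : 0 < s
  · have h1 : 0 < s + t := by positivity
    have h2 : (s + (t : ℝ)).toNNReal = s.toNNReal + t := by
      rw [Real.toNNReal_add h0.le t.coe_nonneg, Real.toNNReal_coe]
    have h3 : t < s.toNNReal + t := lt_add_of_pos_left _ (Real.toNNReal_pos.2 h0)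
    rw [indicator_of_mem (mem_Ioi.2 h1), indicator_of_mem (mem_Ioi.2 h0), h2, if_pos h3,
      add_tsub_cancel_right, ← mul_assoc, ← ENNReal.ofReal_mul (by positivity)]
    congr 2
    rw [mul_left_comm, ← Real.exp_add]
    ring_nf
  · rw [indicator_of_notMem (show s ∉ Ioi (0 : ℝ) from h0)]
    by_cases h1 : 0 < s + t
    · rw [indicator_of_mem (mem_Ioi.2 h1), if_neg, mul_zero]
      rw [not_lt, Real.toNNReal_le_iff_le_coe]
      linarith
    · rw [indicator_of_notMem (show s + (t : ℝ) ∉ Ioi (0 : ℝ) from h1)]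

/-- The law of the holding time and of the next state. -/
def Q : Kernel X (ℝ≥0 × X) := D.hold ×ₖ D.K

instance : IsMarkovKernel D.Q := by unfold Q; infer_instance

theorem lintegral_Q (x : X) (f : ℝ≥0 × X → ℝ≥0∞) (hf : Measurable f) :
    ∫⁻ z, f z ∂D.Q x = ∫⁻ e, ∫⁻ y, f (e, y) ∂D.K x ∂D.hold x := Kernel.lintegral_prod _ _ _ hf

/-- The expectation of `f (t - e, y)` on `e ≤ t`, where `e` is the holding time and `y` the next
state. -/
def J (f : ℝ≥0 → X → ℝ≥0∞) (t : ℝ≥0) (x : X) : ℝ≥0∞ :=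
  ∫⁻ z, (if z.1 ≤ t then f (t - z.1) z.2 else 0) ∂D.Q x

theorem measurable_J_integrand {f : ℝ≥0 → X → ℝ≥0∞} (hf : Measurable (Function.uncurry f)) (t : ℝ≥0) :
    Measurable fun z : ℝ≥0 × X => if z.1 ≤ t then f (t - z.1) z.2 else 0 :=
  Measurable.ite (measurableSet_le measurable_fst measurable_const)
    (hf.comp ((measurable_const.sub measurable_fst).prodMk measurable_snd)) measurable_const

theorem measurable_J {f : ℝ≥0 → X → ℝ≥0∞} (hf : Measurable (Function.uncurry f)) :
    Measurable (Function.uncurry (D.J f)) := by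
  have h : Measurable (Function.uncurry fun (q : ℝ≥0 × X) (z : ℝ≥0 × X) =>
      if z.1 ≤ q.1 then f (q.1 - z.1) z.2 else 0) := by
    refine Measurable.ite (measurableSet_le (by fun_prop) (by fun_prop)) ?_ measurable_const
    exact hf.comp (f := fun p : (ℝ≥0 × X) × ℝ≥0 × X => (p.1.1 - p.2.1, p.2.2)) (by fun_prop)
  exact Measurable.lintegral_kernel_prod_right (κ := D.Q.comap Prod.snd measurable_snd) h

theorem J_mono {f g : ℝ≥0 → X → ℝ≥0∞} {t : ℝ≥0} (h : ∀ s ≤ t, ∀ y, f s y ≤ g s y) (x : X) :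
    D.J f t x ≤ D.J g t x := by
  refine lintegral_mono fun z => ?_
  dsimp only
  split_ifs
  · exact h _ tsub_le_self _
  · exact le_rfl

theorem J_add {f g : ℝ≥0 → X → ℝ≥0∞} (hf : Measurable (Function.uncurry f)) (t : ℝ≥0) (x : X) :
    D.J (fun s y => f s y + g s y) t x = D.J f t x + D.J g t x := by
  unfold J
  rw [← lintegral_add_left (measurable_J_integrand hf t)]
  refine lintegral_congr fun z => ?_
  split_ifs <;> simp

/-- A criterion for supersolutions of the renewal equation. -/
theorem J_le_of_deriv {f : ℝ≥0 → X → ℝ≥0∞} (hf : Measurable (Function.uncurry f)) (x : X) (t : ℝ≥0)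
    (g g' : ℝ → ℝ) (hg : ∀ r, HasDerivAt g (g' r) r) (hg' : Continuous g')
    (hg0 : 0 ≤ g 0) (hnn : ∀ r, 0 ≤ r → 0 ≤ D.rate x * g r + g' r)
    (h : ∀ r : ℝ≥0, r ≤ t → ENNReal.ofReal (D.rate x) * ∫⁻ y, f r y ∂D.K x
      ≤ ENNReal.ofReal (D.rate x * g r + g' r)) :
    ENNReal.ofReal (Real.exp (-D.rate x * t) * g 0) + D.J f t x ≤ ENNReal.ofReal (g t) := by
  set l := D.rate x with hl
  have hlpos : 0 < l := D.rate_pos x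
  -- `k` is the derivative of `s ↦ -e^{-ls} g(t - s)`. The hypothesis bounds the integrand of `J` by
  -- `k`, so the renewal inequality reduces to the fundamental theorem of calculus.
  set k : ℝ → ℝ := fun s => Real.exp (-l * s) * (l * g (t - s) + g' (t - s)) with hk
  have hgc : Continuous g := continuous_iff_continuousAt.2 fun r => (hg r).continuousAt
  have hkc : Continuous k := by fun_prop
  have hknn : ∀ s : ℝ, s ≤ t → 0 ≤ k s := fun s hs =>
    mul_nonneg (Real.exp_nonneg _) (hnn _ (by linarith))
  have hint : ∫ s in (0 : ℝ)..t, k s = g t - Real.exp (-l * t) * g 0 := by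
    have hd : ∀ s, HasDerivAt (fun s => -(Real.exp (-l * s) * g (t - s))) (k s) s := fun s => by
      have h1 : HasDerivAt (fun s : ℝ => (t : ℝ) - s) (-1) s := by
        simpa using (hasDerivAt_id s).const_sub (t : ℝ)
      have h2 := (hg (t - s)).comp s h1
      have h3 : HasDerivAt (fun s : ℝ => Real.exp (-l * s)) (Real.exp (-l * s) * (-l)) s := by
        have := ((hasDerivAt_id s).const_mul (-l)).exp
        simpa using this
      convert! (h3.mul h2).neg using 1
      simp only [hk, Function.comp_apply]
      ring
    rw [intervalIntegral.integral_eq_sub_of_hasDerivAt (fun s _ => hd s) (hkc.intervalIntegrable _ _)]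
    simp only [sub_self, sub_zero, mul_zero, Real.exp_zero, one_mul]
    ring
  have hJ : D.J f t x ≤ ENNReal.ofReal (∫ s in (0 : ℝ)..t, k s) := by
    rw [J, lintegral_Q _ _ _ (measurable_J_integrand hf t), lintegral_hold _ _ _
      (measurable_J_integrand hf t).lintegral_prod_right',
      intervalIntegral.integral_of_le t.coe_nonneg, ofReal_integral_eq_lintegral_ofReal
        ((hkc.intervalIntegrable _ _).1) ((ae_restrict_iff' measurableSet_Ioc).2
          (ae_of_all _ fun s hs => hknn s hs.2)), ← lintegral_indicator measurableSet_Ioc,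
      ← lintegral_indicator measurableSet_Ioi]
    refine lintegral_mono fun s => ?_
    by_cases h0 : 0 < s
    · rw [indicator_of_mem (mem_Ioi.2 h0)]
      by_cases h1 : s ≤ t
      · have h2 : s.toNNReal ≤ t := Real.toNNReal_le_iff_le_coe.2 h1
        rw [indicator_of_mem (mem_Ioc.2 ⟨h0, h1⟩)]
        simp only [h2, if_true]
        have h3 := h (t - s.toNNReal) tsub_le_self
        rw [NNReal.coe_sub h2, Real.coe_toNNReal _ h0.le] at h3
        calc _ = ENNReal.ofReal (Real.exp (-l * s)) *
              (ENNReal.ofReal l * ∫⁻ y, f (t - s.toNNReal) y ∂D.K x) := by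
              rw [mul_comm (D.rate x), ENNReal.ofReal_mul (Real.exp_nonneg _), mul_assoc]
          _ ≤ ENNReal.ofReal (Real.exp (-l * s)) * ENNReal.ofReal (l * g (t - s) + g' (t - s)) := by
              gcongr
          _ = _ := by rw [← ENNReal.ofReal_mul (Real.exp_nonneg _)]
      · have h2 : ¬ s.toNNReal ≤ t := fun h' => h1 (Real.toNNReal_le_iff_le_coe.1 h')
        simp [h2]
    · rw [indicator_of_notMem (by simpa using h0)]
      exact zero_le
  have hle : 0 ≤ ∫ s in (0 : ℝ)..t, k s :=
    intervalIntegral.integral_nonneg t.coe_nonneg fun s hs => hknn s hs.2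
  calc _ ≤ ENNReal.ofReal (Real.exp (-l * t) * g 0) + ENNReal.ofReal (∫ s in (0 : ℝ)..t, k s) := by
        gcongr
    _ = ENNReal.ofReal (g t) := by
        rw [← ENNReal.ofReal_add (mul_nonneg (Real.exp_nonneg _) hg0) hle, hint]
        congr 1; ring

/-! ### Non-explosion -/

/-- The probability that the `n`-th jump occurs up to the time `t`. -/
def jumpProb : ℕ → ℝ≥0 → X → ℝ≥0∞
  | 0 => fun _ _ => 1
  | n + 1 => D.J (jumpProb n)

theorem measurable_jumpProb (n : ℕ) : Measurable (Function.uncurry (D.jumpProb n)) := by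
  induction n with
  | zero => exact measurable_const
  | succ n ih => exact D.measurable_J ih

/-- The sum is a truncated expected number of jumps `N`, which satisfies `N = J (1 + N)`. The
function `C r e^r U` is a supersolution: the drift inequality on `U` produces the factor `e^r`, and
the derivative of `C r` leaves `C e^r U`, which absorbs the rate since `rate ≤ C U`. -/
theorem sum_jumpProb_le (n : ℕ) : ∀ (t : ℝ≥0) (x : X), ∑ k ∈ Finset.range n, D.jumpProb (k + 1) t x
    ≤ ENNReal.ofReal (D.C * t * Real.exp t * D.U x) := by
  induction n with
  | zero => intro t x; simp
  | succ n ih =>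
    intro t x
    have hm : Measurable (Function.uncurry fun (s : ℝ≥0) (y : X) =>
        ∑ k ∈ Finset.range n, D.jumpProb (k + 1) s y) :=
      Finset.measurable_sum _ fun k _ => D.measurable_jumpProb (k + 1)
    have e1 : ∀ m, ∑ k ∈ Finset.range m, D.jumpProb (k + 2) t x
        = D.J (fun s y => ∑ k ∈ Finset.range m, D.jumpProb (k + 1) s y) t x := by
      intro m
      induction m with
      | zero => simp [J]
      | succ m ihm =>
        have := D.J_add (f := fun s y => ∑ k ∈ Finset.range m, D.jumpProb (k + 1) s y)
          (g := D.jumpProb (m + 1))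
          (Finset.measurable_sum _ fun k _ => D.measurable_jumpProb (k + 1)) t x
        rw [Finset.sum_range_succ, ihm]
        simp only [Finset.sum_range_succ]
        exact this.symm
    have e2 : ∑ k ∈ Finset.range (n + 1), D.jumpProb (k + 1) t x
        = D.J (fun s y => 1 + ∑ k ∈ Finset.range n, D.jumpProb (k + 1) s y) t x := by
      rw [J_add _ (f := fun _ _ => 1) measurable_const, ← e1, Finset.sum_range_succ', add_comm]
      rfl
    rw [e2]
    have hU := D.U_nonneg x
    have hC := D.C_nonneg
    have hr := D.rate_pos x
    have hl := D.rate_le x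
    have := D.J_le_of_deriv (f := fun s y => 1 + ∑ k ∈ Finset.range n, D.jumpProb (k + 1) s y)
      (Measurable.add (f := fun _ => 1) measurable_const hm) x t (fun r => D.C * r * Real.exp r * D.U x)
      (fun r => (D.C * Real.exp r + D.C * r * Real.exp r) * D.U x)
      (fun r => by
        have := ((((hasDerivAt_id r).const_mul D.C).mul (Real.hasDerivAt_exp r)).mul_const (D.U x))
        simpa using this)
      (by fun_prop) (by simp) (fun r hr0 => by positivity)
      (fun r hrt => by
        have h1 : ∫⁻ y, (1 + ∑ k ∈ Finset.range n, D.jumpProb (k + 1) r y) ∂D.K x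
            ≤ 1 + ENNReal.ofReal (D.C * r * Real.exp r) * ∫⁻ y, ENNReal.ofReal (D.U y) ∂D.K x := by
          rw [← lintegral_const_mul _ D.measurable_U.ennreal_ofReal, lintegral_add_left measurable_const]
          simp only [lintegral_const, measure_univ, mul_one]
          gcongr with y
          rw [← ENNReal.ofReal_mul (by positivity)]
          exact ih r y
        calc _ ≤ ENNReal.ofReal (D.rate x) * (1 + ENNReal.ofReal (D.C * r * Real.exp r) *
                ∫⁻ y, ENNReal.ofReal (D.U y) ∂D.K x) := by gcongr
          _ = ENNReal.ofReal (D.rate x) + ENNReal.ofReal (D.C * r * Real.exp r) *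
                (ENNReal.ofReal (D.rate x) * ∫⁻ y, ENNReal.ofReal (D.U y) ∂D.K x) := by ring
          _ ≤ ENNReal.ofReal (D.rate x) + ENNReal.ofReal (D.C * r * Real.exp r) *
                ENNReal.ofReal ((D.rate x + 1) * D.U x) := by gcongr; exact D.lyapunov x
          _ = ENNReal.ofReal (D.rate x + D.C * r * Real.exp r * ((D.rate x + 1) * D.U x)) := by
              rw [← ENNReal.ofReal_mul (by positivity), ← ENNReal.ofReal_add hr.le (by positivity)]
          _ ≤ _ := by
              apply ENNReal.ofReal_le_ofReal
              have h2 : D.rate x ≤ D.C * D.U x * Real.exp r := by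
                have h3 : 1 ≤ Real.exp (r : ℝ) := Real.one_le_exp r.2
                have h4 : 0 ≤ D.C * D.U x := by positivity
                nlinarith
              nlinarith)
    exact (le_add_self).trans this

/-- The expected number of jumps is finite, hence these probabilities are summable. Both
non-explosion and the uniqueness for the renewal equation rest on this limit. -/
theorem tendsto_jumpProb (t : ℝ≥0) (x : X) :
    Tendsto (fun n => D.jumpProb n t x) atTop (𝓝 0) := by
  have h : ∑' k, D.jumpProb (k + 1) t x ≠ ∞ := by
    refine ne_top_of_le_ne_top ENNReal.ofReal_ne_top (ENNReal.tsum_le_of_sum_range_le fun n =>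
      D.sum_jumpProb_le n t x)
  exact (tendsto_add_atTop_iff_nat 1).1 (ENNReal.tendsto_atTop_zero_of_tsum_ne_top h)

theorem J_const_mul (c : ℝ≥0∞) {f : ℝ≥0 → X → ℝ≥0∞} (hf : Measurable (Function.uncurry f))
    (t : ℝ≥0) (x : X) : D.J (fun s y => c * f s y) t x = c * D.J f t x := by
  unfold J
  rw [← lintegral_const_mul _ (measurable_J_integrand hf t)]
  refine lintegral_congr fun z => ?_
  split_ifs <;> simp

/-- Uniqueness for the renewal equation, as a comparison principle. -/
theorem le_of_renewal {A : ℝ≥0 → X → ℝ≥0∞} {f g : ℝ≥0 → X → ℝ≥0∞} {M : ℝ≥0∞} (hM : M ≠ ∞)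
    (hf1 : ∀ t x, f t x ≤ M) (hfm : ∀ t x, f t x ≤ A t x + D.J f t x)
    (hg : ∀ t x, A t x + D.J g t x ≤ g t x) (t : ℝ≥0) (x : X) : f t x ≤ g t x := by
  -- Iterating the renewal inequality `n` times leaves the bound `M` only on the event that `n`
  -- jumps have occurred.
  have h : ∀ n, ∀ t x, f t x ≤ g t x + M * D.jumpProb n t x := by
    intro n
    induction n with
    | zero => intro t x; exact (hf1 t x).trans (by simp [jumpProb])
    | succ n ih =>
      intro t x
      calc f t x ≤ A t x + D.J f t x := hfm t x
        _ ≤ A t x + D.J (fun s y => M * D.jumpProb n s y + g s y) t x := by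
            gcongr
            exact D.J_mono (fun s _ y => (ih s y).trans_eq (add_comm _ _)) x
        _ = A t x + D.J g t x + M * D.J (D.jumpProb n) t x := by
            rw [D.J_add (f := fun s y => M * D.jumpProb n s y)
              ((D.measurable_jumpProb n).const_mul M), D.J_const_mul _ (D.measurable_jumpProb n)]
            ring
        _ ≤ _ := by gcongr; exacts [hg t x, le_rfl]
  refine ge_of_tendsto' (x := atTop) (f := fun n => g t x + M * D.jumpProb n t x) ?_ fun n => h n t x
  have := ENNReal.Tendsto.const_mul (D.tendsto_jumpProb t x) (Or.inr hM)
  simpa using tendsto_const_nhds.add this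

end JumpData

/-! ### The Markov property and Lyapunov bounds for the transition kernels. -/

namespace JumpData

open MarkovChain JumpPath

variable {X : Type*} [MeasurableSpace X] (D : JumpData X)

/-! ### The law of the process -/

/-- The law of the sequence of the holding times and states. -/
def law : Kernel X (ℕ → ℝ≥0 × X) := marked D.Q

instance : IsMarkovKernel D.law := by unfold law; infer_instance

theorem lintegral_law (x : X) (F : (ℕ → ℝ≥0 × X) → ℝ≥0∞) (hF : Measurable F) :
    ∫⁻ ω, F ω ∂D.law x = ∫⁻ z, ∫⁻ ω, F (cons z ω) ∂D.law z.2 ∂D.Q x := lintegral_marked _ x F hF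

/-- Conditioning on the first pair shows that the probability on the left obeys the recursion that
defines `jumpProb`. -/
theorem law_T_le (n : ℕ) : ∀ (t : ℝ≥0) (x : X), D.law x {ω | T ω n ≤ t} = D.jumpProb n t x := by
  have hm : ∀ n (t : ℝ≥0), MeasurableSet {ω : ℕ → ℝ≥0 × X | T ω n ≤ t} := fun n t =>
    measurableSet_le (measurable_T n) measurable_const
  induction n with
  | zero => intro t x; simp [jumpProb]
  | succ n ih =>
    intro t x
    rw [← lintegral_indicator_one (hm _ t), lintegral_law _ _ _ (measurable_one.indicator (hm _ t)),
      jumpProb, J]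
    refine lintegral_congr fun z => ?_
    split_ifs with hz
    · rw [← ih, ← lintegral_indicator_one (hm _ _)]
      refine lintegral_congr fun ω => ?_
      have : cons z ω ∈ {ω | T ω (n + 1) ≤ t} ↔ ω ∈ {ω | T ω n ≤ t - z.1} := by
        simp only [mem_ofPred_eq, T_cons]
        rw [add_comm, le_tsub_iff_right hz]
      by_cases h : ω ∈ {ω | T ω n ≤ t - z.1}
      · rw [indicator_of_mem h, indicator_of_mem (this.2 h)]; rfl
      · rw [indicator_of_notMem h, indicator_of_notMem (fun h' => h (this.1 h'))]
    · have : ∀ ω : ℕ → ℝ≥0 × X, cons z ω ∉ {ω | T ω (n + 1) ≤ t} := fun ω h => by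
        simp only [mem_ofPred_eq, T_cons] at h
        exact hz (le_self_add.trans h)
      simp [this]

theorem ae_NE (x : X) : ∀ᵐ ω ∂D.law x, ω ∈ NE := by
  have h : ∀ m : ℕ, ∀ᵐ ω ∂D.law x, ∃ n, (m : ℝ≥0) < T ω n := by
    intro m
    rw [ae_iff]
    refine le_antisymm (ge_of_tendsto' (D.tendsto_jumpProb m x) fun n => ?_) zero_le
    rw [← law_T_le]
    refine measure_mono fun ω hω => ?_
    simp only [mem_ofPred_eq, not_exists, not_lt] at hω ⊢
    exact hω n
  filter_upwards [ae_all_iff.2 h] with ω hω t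
  obtain ⟨m, hm⟩ := exists_nat_ge t
  obtain ⟨n, hn⟩ := hω m
  exact ⟨n, hm.trans_lt hn⟩

/-- The transition kernels, as a kernel in the time and the initial state. -/
def pJoint : Kernel (ℝ≥0 × X) X :=
  (Kernel.id ×ₖ (D.law.comap Prod.snd measurable_snd)).map
    fun q : (ℝ≥0 × X) × (ℕ → ℝ≥0 × X) => val q.1.2 q.2 q.1.1

/-- The transition kernels. -/
def p (t : ℝ≥0) : Kernel X X := D.pJoint.comap (fun x => (t, x)) (by fun_prop)

theorem measurable_val_at (x : X) (t : ℝ≥0) : Measurable fun ω : ℕ → ℝ≥0 × X => val x ω t :=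
  measurable_val.comp (f := fun ω => ((x, ω), t)) (by fun_prop)

theorem measurable_shift_at (t : ℝ≥0) : Measurable fun ω : ℕ → ℝ≥0 × X => shift ω t :=
  measurable_shift.comp (f := fun ω => (ω, t)) (by fun_prop)

theorem measurable_val_joint :
    Measurable fun q : (ℝ≥0 × X) × (ℕ → ℝ≥0 × X) => val q.1.2 q.2 q.1.1 :=
  measurable_val.comp (f := fun q : (ℝ≥0 × X) × (ℕ → ℝ≥0 × X) => ((q.1.2, q.2), q.1.1)) (by fun_prop)

instance : IsMarkovKernel D.pJoint := by
  unfold pJoint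
  exact Kernel.IsMarkovKernel.map _ measurable_val_joint

instance (t : ℝ≥0) : IsMarkovKernel (D.p t) := by unfold p; infer_instance

theorem pJoint_apply (t : ℝ≥0) (x : X) : D.pJoint (t, x) = D.p t x := rfl

theorem lintegral_p (t : ℝ≥0) (x : X) (f : X → ℝ≥0∞) (hf : Measurable f) :
    ∫⁻ y, f y ∂D.p t x = ∫⁻ ω, f (val x ω t) ∂D.law x := by
  have h1 : Measurable fun q : (ℝ≥0 × X) × (ℕ → ℝ≥0 × X) => f (val q.1.2 q.2 q.1.1) :=
    hf.comp measurable_val_joint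
  rw [← pJoint_apply, pJoint, Kernel.lintegral_map _ measurable_val_joint _ hf,
    Kernel.lintegral_id_prod h1]
  rfl

/-! ### The renewal equation and the Markov property -/

/-- Split according to the first jump. If it comes after `t`, the residual holding time has the
original law by absence of memory, which gives the exponential factor; otherwise the process
restarts, which gives the term with `J`. -/
theorem renewal (F : X × (ℕ → ℝ≥0 × X) → ℝ≥0∞) (hF : Measurable F) (t : ℝ≥0) (x : X) :
    ∫⁻ ω, F (val x ω t, shift ω t) ∂D.law x
      = ENNReal.ofReal (Real.exp (-D.rate x * t)) * ∫⁻ ω, F (x, ω) ∂D.law x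
        + D.J (fun s y => ∫⁻ ω, F (val y ω s, shift ω s) ∂D.law y) t x := by
  have hG : Measurable (Function.uncurry fun (s : ℝ≥0) (y : X) =>
      ∫⁻ ω, F (val y ω s, shift ω s) ∂D.law y) := by
    have h : Measurable (Function.uncurry fun (q : ℝ≥0 × X) (ω : ℕ → ℝ≥0 × X) =>
        F (val q.2 ω q.1, shift ω q.1)) :=
      hF.comp (measurable_val_joint.prodMk
        (measurable_shift.comp (f := fun q : (ℝ≥0 × X) × (ℕ → ℝ≥0 × X) => (q.2, q.1.1)) (by fun_prop)))
    exact h.lintegral_kernel_prod_right (κ := D.law.comap Prod.snd measurable_snd)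
  have hH : Measurable fun z : ℝ≥0 × X => ∫⁻ ω, F (x, cons z ω) ∂D.law z.2 := by
    have h : Measurable (Function.uncurry fun (z : ℝ≥0 × X) (ω : ℕ → ℝ≥0 × X) => F (x, cons z ω)) :=
      hF.comp (measurable_const.prodMk measurable_cons)
    exact h.lintegral_kernel_prod_right (κ := D.law.comap Prod.snd measurable_snd)
  have hHt : Measurable fun z : ℝ≥0 × X =>
      if t < z.1 then ∫⁻ ω, F (x, cons (z.1 - t, z.2) ω) ∂D.law z.2 else 0 :=
    Measurable.ite (measurableSet_lt measurable_const measurable_fst)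
      (hH.comp (f := fun z : ℝ≥0 × X => (z.1 - t, z.2)) (by fun_prop)) measurable_const
  rw [lintegral_law _ _ (fun ω => F (val x ω t, shift ω t))
    (hF.comp ((measurable_val_at x t).prodMk (measurable_shift_at t)))]
  have e1 : ∀ z : ℝ≥0 × X, ∫⁻ ω, F (val x (cons z ω) t, shift (cons z ω) t) ∂D.law z.2
      = (if t < z.1 then ∫⁻ ω, F (x, cons (z.1 - t, z.2) ω) ∂D.law z.2 else 0)
        + (if z.1 ≤ t then ∫⁻ ω, F (val z.2 ω (t - z.1), shift ω (t - z.1)) ∂D.law z.2 else 0) := by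
    intro z
    by_cases hz : t < z.1
    · simp only [hz, not_le.2 hz, if_true, if_false, add_zero, val_cons_of_lt x hz,
        shift_cons_of_lt hz]
    · rw [if_neg hz, if_pos (not_lt.1 hz), zero_add]
      refine lintegral_congr_ae ?_
      filter_upwards [D.ae_NE z.2] with ω hω
      rw [val_cons_of_le x hω (not_lt.1 hz), shift_cons_of_le hω (not_lt.1 hz)]
  rw [lintegral_congr e1, lintegral_add_left hHt]
  congr 1
  rw [lintegral_Q _ _ _ hHt, lintegral_law _ _ (fun ω => F (x, ω)) (hF.comp (by fun_prop)),
    lintegral_Q _ _ _ hH, ← D.lintegral_hold_shift x t _ hH.lintegral_prod_right']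
  refine lintegral_congr fun e => ?_
  split_ifs <;> simp

theorem renewal_p (f : X → ℝ≥0∞) (hf : Measurable f) (t : ℝ≥0) (x : X) :
    ∫⁻ y, f y ∂D.p t x = ENNReal.ofReal (Real.exp (-D.rate x * t)) * f x
      + D.J (fun s y => ∫⁻ y', f y' ∂D.p s y) t x := by
  have := D.renewal (fun q => f q.1) (hf.comp measurable_fst) t x
  simp only [lintegral_const, measure_univ, mul_one] at this
  rw [lintegral_p _ _ _ _ hf, this]
  congr 2
  funext s y
  rw [lintegral_p _ _ _ _ hf]

/-- The Markov property. -/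
theorem lintegral_markov (F : X × (ℕ → ℝ≥0 × X) → ℝ≥0∞) (hF : Measurable F) (t : ℝ≥0) (x : X) :
    ∫⁻ ω, F (val x ω t, shift ω t) ∂D.law x = ∫⁻ y, ∫⁻ ω, F (y, ω) ∂D.law y ∂D.p t x := by
  -- As functions of `(t, x)` both sides solve the same renewal equation, and the comparison
  -- principle in both directions makes them equal. The principle needs boundedness; general `F`
  -- follow because indicators determine the measures.
  have hb : ∀ F : X × (ℕ → ℝ≥0 × X) → ℝ≥0∞, Measurable F → (∀ q, F q ≤ 1) → 
      ∫⁻ ω, F (val x ω t, shift ω t) ∂D.law x = ∫⁻ y, ∫⁻ ω, F (y, ω) ∂D.law y ∂D.p t x := by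
    intro F hF hF1
    have hw : Measurable fun y => ∫⁻ ω, F (y, ω) ∂D.law y :=
      Measurable.lintegral_kernel_prod_right (f := fun y ω => F (y, ω)) hF
    have h1 : ∀ y, ∫⁻ ω, F (y, ω) ∂D.law y ≤ 1 := fun y =>
      (lintegral_mono fun ω => hF1 _).trans_eq (by simp)
    refine le_antisymm
      (D.le_of_renewal (f := fun t x => ∫⁻ ω, F (val x ω t, shift ω t) ∂D.law x)
        (g := fun t x => ∫⁻ y, ∫⁻ ω, F (y, ω) ∂D.law y ∂D.p t x) ENNReal.one_ne_top
        (fun t x => (lintegral_mono fun ω => hF1 _).trans_eq (by simp))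
        (fun t x => (D.renewal F hF t x).le) (fun t x => (D.renewal_p _ hw t x).ge) t x)
      (D.le_of_renewal (g := fun t x => ∫⁻ ω, F (val x ω t, shift ω t) ∂D.law x)
        (f := fun t x => ∫⁻ y, ∫⁻ ω, F (y, ω) ∂D.law y ∂D.p t x) ENNReal.one_ne_top
        (fun t x => (lintegral_mono fun y => h1 _).trans_eq (by simp))
        (fun t x => (D.renewal_p _ hw t x).le) (fun t x => (D.renewal F hF t x).ge) t x)
  have hvs : Measurable fun ω : ℕ → ℝ≥0 × X => (val x ω t, shift ω t) :=
    (measurable_val_at x t).prodMk (measurable_shift_at t)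
  have key : (D.law x).map (fun ω => (val x ω t, shift ω t)) = D.p t x ⊗ₘ D.law := by
    ext A hA
    rw [Measure.map_apply hvs hA, Measure.compProd_apply hA, ← lintegral_indicator_one (hvs hA)]
    have := hb (A.indicator 1) (measurable_one.indicator hA)
      (fun q => indicator_le_self' (fun _ _ => zero_le) q)
    refine Eq.trans this (lintegral_congr fun y => ?_)
    rw [← lintegral_indicator_one (measurable_prodMk_left hA)]
    rfl
  rw [← lintegral_map hF hvs, key, Measure.lintegral_compProd hF]

/-- The Chapman-Kolmogorov equation: the Markov property at `s` is applied to the functional that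
evaluates the remaining path at `t`. -/
theorem lintegral_p_add (s t : ℝ≥0) (x : X) (f : X → ℝ≥0∞) (hf : Measurable f) :
    ∫⁻ y, f y ∂D.p (s + t) x = ∫⁻ y, ∫⁻ y', f y' ∂D.p t y ∂D.p s x := by
  have hv : Measurable fun q : X × (ℕ → ℝ≥0 × X) => f (val q.1 q.2 t) :=
    hf.comp (measurable_val.comp (f := fun q : X × (ℕ → ℝ≥0 × X) => (q, t)) (by fun_prop))
  have := D.lintegral_markov (fun q => f (val q.1 q.2 t)) hv s x
  rw [lintegral_p _ _ _ _ hf]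
  simp only [lintegral_p _ _ _ f hf]
  rw [← this]
  refine lintegral_congr_ae ?_
  filter_upwards [D.ae_NE x] with ω hω
  rw [val_shift x hω]

/-- Supersolutions of the renewal equation bound the transition kernels. -/
theorem lintegral_p_le {f : X → ℝ≥0∞} (hf : Measurable f) {g : ℝ≥0 → X → ℝ≥0∞}
    (hg : ∀ (t : ℝ≥0) x, ENNReal.ofReal (Real.exp (-D.rate x * t)) * f x + D.J g t x ≤ g t x)
    (t : ℝ≥0) (x : X) : ∫⁻ y, f y ∂D.p t x ≤ g t x := by
  -- The comparison principle requires a bounded subsolution, hence the truncation, removed by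
  -- monotone convergence.
  have h : ∀ n : ℕ, ∫⁻ y, min (f y) n ∂D.p t x ≤ g t x := fun n => by
    refine D.le_of_renewal (M := n) (f := fun t x => ∫⁻ y, min (f y) n ∂D.p t x)
      (A := fun t x => ENNReal.ofReal (Real.exp (-D.rate x * t)) * f x) (by simp) ?_ ?_ hg t x
    · exact fun t x => (lintegral_mono fun y => min_le_right _ _).trans_eq (by simp)
    · intro t x
      rw [D.renewal_p _ (hf.min measurable_const)]
      gcongr
      exact min_le_left _ _
  have hsup : ∀ y, f y = ⨆ n : ℕ, min (f y) n := fun y => by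
    refine le_antisymm ?_ (iSup_le fun n => min_le_left _ _)
    refine le_of_forall_lt fun c hc => ?_
    obtain ⟨n, hn⟩ := ENNReal.exists_nat_gt hc.ne_top
    exact (lt_min hc hn).trans_le (le_iSup (fun n : ℕ => min (f y) n) n)
  rw [lintegral_congr hsup, lintegral_iSup (fun n => hf.min measurable_const)
    (fun m n hmn y => min_le_min le_rfl (by exact_mod_cast hmn))]
  exact iSup_le h

/-- A Lyapunov estimate with a source term. -/
theorem lintegral_p_le_of_lyapunov {F W : X → ℝ} (hF : Measurable F) (hW : Measurable W)
    (hF0 : ∀ x, 0 ≤ F x) (hW0 : ∀ x, 0 ≤ W x) {c κ : ℝ} (hc : 0 ≤ c) (hκ : 0 ≤ κ)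
    (h1 : ∀ x, ENNReal.ofReal (D.rate x) * ∫⁻ y, ENNReal.ofReal (F y) ∂D.K x
      ≤ ENNReal.ofReal ((D.rate x + c) * F x + κ * W x))
    (h2 : ∀ x, ENNReal.ofReal (D.rate x) * ∫⁻ y, ENNReal.ofReal (W y) ∂D.K x
      ≤ ENNReal.ofReal ((D.rate x + c) * W x)) (t : ℝ≥0) (x : X) :
    ∫⁻ y, ENNReal.ofReal (F y) ∂D.p t x
      ≤ ENNReal.ofReal (Real.exp (c * t) * F x + κ * t * Real.exp (c * t) * W x) := by
  -- The supersolution solves the linear system `F' = c F + κ W`, `W' = c W`.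
  refine D.lintegral_p_le hF.ennreal_ofReal (g := fun t x =>
    ENNReal.ofReal (Real.exp (c * t) * F x + κ * t * Real.exp (c * t) * W x)) ?_ t x
  intro t x
  have hr := D.rate_pos x
  have := hF0 x
  have := hW0 x
  have key := D.J_le_of_deriv (f := fun (t : ℝ≥0) x =>
      ENNReal.ofReal (Real.exp (c * t) * F x + κ * t * Real.exp (c * t) * W x)) (by
      unfold Function.uncurry; fun_prop) x t
    (fun r => Real.exp (c * r) * F x + κ * r * Real.exp (c * r) * W x)
    (fun r => c * Real.exp (c * r) * F x
      + (κ * Real.exp (c * r) + κ * r * (c * Real.exp (c * r))) * W x)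
    (fun r => by
      have h3 : HasDerivAt (fun r => Real.exp (c * r)) (c * Real.exp (c * r)) r := by
        have := ((hasDerivAt_id r).const_mul c).exp
        simpa [mul_comm] using this
      have h4 := ((hasDerivAt_id r).const_mul κ).mul h3
      simp only [id, mul_one] at h4
      exact (h3.mul_const (F x)).add (h4.mul_const (W x)))
    (by fun_prop) (by simpa) (fun r hr0 => by positivity)
    (fun r hrt => by
      have e : ∀ y, ENNReal.ofReal (Real.exp (c * r) * F y + κ * r * Real.exp (c * r) * W y)
          = ENNReal.ofReal (Real.exp (c * r)) * ENNReal.ofReal (F y)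
            + ENNReal.ofReal (κ * r * Real.exp (c * r)) * ENNReal.ofReal (W y) := fun y => by
        have := hF0 y
        have := hW0 y
        rw [ENNReal.ofReal_add (by positivity) (by positivity), ENNReal.ofReal_mul (by positivity),
          ENNReal.ofReal_mul (p := κ * r * Real.exp (c * r)) (by positivity)]
      simp only [e]
      rw [lintegral_add_left (by fun_prop), lintegral_const_mul _ (by fun_prop),
        lintegral_const_mul _ (by fun_prop)]
      calc _ = ENNReal.ofReal (Real.exp (c * r)) *
              (ENNReal.ofReal (D.rate x) * ∫⁻ y, ENNReal.ofReal (F y) ∂D.K x)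
            + ENNReal.ofReal (κ * r * Real.exp (c * r)) *
              (ENNReal.ofReal (D.rate x) * ∫⁻ y, ENNReal.ofReal (W y) ∂D.K x) := by ring
        _ ≤ ENNReal.ofReal (Real.exp (c * r)) * ENNReal.ofReal ((D.rate x + c) * F x + κ * W x)
            + ENNReal.ofReal (κ * r * Real.exp (c * r)) * ENNReal.ofReal ((D.rate x + c) * W x) := by
            gcongr
            exacts [h1 x, h2 x]
        _ = ENNReal.ofReal (Real.exp (c * r) * ((D.rate x + c) * F x + κ * W x)
            + κ * r * Real.exp (c * r) * ((D.rate x + c) * W x)) := by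
            rw [← ENNReal.ofReal_mul (by positivity), ← ENNReal.ofReal_mul (by positivity),
              ← ENNReal.ofReal_add (by positivity) (by positivity)]
        _ ≤ _ := by
            apply ENNReal.ofReal_le_ofReal
            apply le_of_eq
            ring)
  refine le_trans ?_ key
  gcongr
  rw [← ENNReal.ofReal_mul (by positivity)]
  apply ENNReal.ofReal_le_ofReal
  simp

theorem lintegral_p_U_le (t : ℝ≥0) (x : X) : ∫⁻ y, ENNReal.ofReal (D.U y) ∂D.p t x
    ≤ ENNReal.ofReal (Real.exp t * D.U x) := by
  have := D.lintegral_p_le_of_lyapunov (F := D.U) (W := fun _ => 0) (c := 1) (κ := 0) D.measurable_U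
    measurable_const D.U_nonneg (fun _ => le_rfl) zero_le_one le_rfl
    (fun x => by simpa using D.lyapunov x) (fun x => by simp) t x
  simpa using this

end JumpData

/-! ### Oscillation of the paths -/

namespace JumpPath

open MarkovChain

variable {X : Type*}

theorem T_cons_le_iff {z : ℝ≥0 × X} {ω : ℕ → ℝ≥0 × X} {ρ : ℝ≥0} (hz : z.1 ≤ ρ) (n : ℕ) :
    T (cons z ω) (n + 1) ≤ ρ ↔ T ω n ≤ ρ - z.1 := by
  rw [T_cons, add_comm, le_tsub_iff_right hz]

theorem not_T_cons_le {z : ℝ≥0 × X} {ω : ℕ → ℝ≥0 × X} {ρ : ℝ≥0} (hz : ¬ z.1 ≤ ρ) (n : ℕ) :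
    ¬ T (cons z ω) (n + 1) ≤ ρ := fun h => hz (by rw [T_cons] at h; exact le_self_add.trans h)

variable [PseudoEMetricSpace X]

/-- The size of the `n`-th jump. -/
def jump (x : X) (ω : ℕ → ℝ≥0 × X) (n : ℕ) : ℝ≥0∞ := edist (st x ω n) (st x ω (n + 1))

/-- The sum of the sizes of the jumps up to the time `ρ`. -/
def variation (x : X) (ω : ℕ → ℝ≥0 × X) (ρ : ℝ≥0) : ℝ≥0∞ :=
  ∑' n, if T ω (n + 1) ≤ ρ then jump x ω n else 0

/-- The sum of the products of the sizes of two jumps up to the time `ρ`. -/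
def pairs (x : X) (ω : ℕ → ℝ≥0 × X) (ρ : ℝ≥0) : ℝ≥0∞ :=
  ∑' n, ∑' m, if n < m ∧ T ω (m + 1) ≤ ρ then jump x ω n * jump x ω m else 0

theorem jump_cons_succ (x : X) (z : ℝ≥0 × X) (ω : ℕ → ℝ≥0 × X) (n : ℕ) :
    jump x (cons z ω) (n + 1) = jump z.2 ω n := by
  rw [jump, st_cons, st_cons, jump]

theorem jump_cons_zero (x : X) (z : ℝ≥0 × X) (ω : ℕ → ℝ≥0 × X) :
    jump x (cons z ω) 0 = edist x z.2 := rfl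

/-- The recursion at the first jump for a truncated variation. The truncation to `N` terms allows
the expectation to be bounded by induction. -/
theorem sum_range_ite_cons (x : X) (z : ℝ≥0 × X) (ω : ℕ → ℝ≥0 × X) (ρ : ℝ≥0) (N : ℕ) :
    ∑ n ∈ Finset.range (N + 1), (if T (cons z ω) (n + 1) ≤ ρ then jump x (cons z ω) n else 0)
      = if z.1 ≤ ρ then edist x z.2 +
          ∑ n ∈ Finset.range N, (if T ω (n + 1) ≤ ρ - z.1 then jump z.2 ω n else 0) else 0 := by
  split_ifs with hz
  · rw [Finset.sum_range_succ', add_comm, jump_cons_zero]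
    simp only [T_cons_le_iff hz, T_zero, zero_le, if_true, jump_cons_succ]
  · simp [not_T_cons_le hz]

theorem pairs_cons_term_zero (x : X) (z : ℝ≥0 × X) (ω : ℕ → ℝ≥0 × X) {ρ : ℝ≥0} (hz : z.1 ≤ ρ) :
    ∑' m, (if 0 < m ∧ T (cons z ω) (m + 1) ≤ ρ then jump x (cons z ω) 0 * jump x (cons z ω) m else 0)
      = edist x z.2 * variation z.2 ω (ρ - z.1) := by
  rw [tsum_eq_zero_add' ENNReal.summable, variation, ← ENNReal.tsum_mul_left]
  simp only [T_cons_le_iff hz, jump_cons_zero, jump_cons_succ, lt_irrefl, false_and, if_false,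
    zero_add, Nat.succ_pos', true_and, mul_ite, mul_zero]

theorem pairs_cons_term_succ (x : X) (z : ℝ≥0 × X) (ω : ℕ → ℝ≥0 × X) {ρ : ℝ≥0} (hz : z.1 ≤ ρ) (n : ℕ) :
    ∑' m, (if n + 1 < m ∧ T (cons z ω) (m + 1) ≤ ρ then
        jump x (cons z ω) (n + 1) * jump x (cons z ω) m else 0)
      = ∑' m, if n < m ∧ T ω (m + 1) ≤ ρ - z.1 then jump z.2 ω n * jump z.2 ω m else 0 := by
  rw [tsum_eq_zero_add' ENNReal.summable]
  simp only [T_cons_le_iff hz, jump_cons_succ, Nat.not_lt_zero, false_and, if_false,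
    zero_add, add_lt_add_iff_right]

theorem sum_range_pairs_cons (x : X) (z : ℝ≥0 × X) (ω : ℕ → ℝ≥0 × X) (ρ : ℝ≥0) (N : ℕ) :
    ∑ n ∈ Finset.range (N + 1), (∑' m, if n < m ∧ T (cons z ω) (m + 1) ≤ ρ then
        jump x (cons z ω) n * jump x (cons z ω) m else 0)
      = if z.1 ≤ ρ then edist x z.2 * variation z.2 ω (ρ - z.1) +
          ∑ n ∈ Finset.range N, (∑' m, if n < m ∧ T ω (m + 1) ≤ ρ - z.1 then
            jump z.2 ω n * jump z.2 ω m else 0) else 0 := by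
  split_ifs with hz
  · rw [Finset.sum_range_succ', add_comm, pairs_cons_term_zero x z ω hz]
    simp only [pairs_cons_term_succ x z ω hz]
  · simp [not_T_cons_le hz]

theorem edist_val_le {x : X} {ω : ℕ → ℝ≥0 × X} (hω : ω ∈ NE) {r t : ℝ≥0} (hrt : r ≤ t) :
    ∃ i j, edist (val x ω r) (val x ω t) ≤ ∑ n ∈ Finset.Ico i j, jump x ω n ∧
      ∀ n ∈ Finset.Ico i j, r < T ω (n + 1) ∧ T ω (n + 1) ≤ t := by
  have hij : idx ω r ≤ idx ω t := by
    by_contra! h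
    exact absurd ((lt_T_idx hω t).trans_le ((T_mono ω (by omega)).trans (T_idx_le ω r))) (not_lt.2 hrt)
  refine ⟨idx ω r, idx ω t, edist_le_Ico_sum_edist (st x ω) hij, fun n hn => ?_⟩
  rw [Finset.mem_Ico] at hn
  exact ⟨(lt_T_idx hω r).trans_le (T_mono ω (by omega)), (T_mono ω (by omega)).trans (T_idx_le ω t)⟩

/-- If no term of a finite sum exceeds `η` and the products of two terms sum up to at most `η²`,
then the sum is at most `2 η`. -/
theorem sum_le_two_mul {f : ℕ → ℝ≥0∞} {η : ℝ≥0} (i j : ℕ) (hf : ∀ n ∈ Finset.Ico i j, f n ≤ η)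
    (h : ∑ n ∈ Finset.Ico i j, ∑ m ∈ Finset.Ico i j, (if n < m then f n * f m else 0) ≤ (η : ℝ≥0∞) ^ 2) :
    ∑ n ∈ Finset.Ico i j, f n ≤ 2 * η := by
  rcases le_or_gt j i with hij | hij
  · simp [Finset.Ico_eq_empty_of_le hij]
  -- The square of the sum is its diagonal part plus twice the sum over pairs, and the diagonal is
  -- at most `η` times the sum.
  have key : ∀ k, i ≤ k → k ≤ j → (∑ n ∈ Finset.Ico i k, f n) ^ 2 ≤ η * ∑ n ∈ Finset.Ico i k, f n
      + 2 * ∑ n ∈ Finset.Ico i k, ∑ m ∈ Finset.Ico i k, (if n < m then f n * f m else 0) := by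
    intro k hk
    induction k, hk using Nat.le_induction with
    | base => simp
    | succ k hk ih =>
      intro hkj
      have ih := ih (by omega)
      have h1 : ∑ n ∈ Finset.Ico i (k + 1), ∑ m ∈ Finset.Ico i (k + 1), (if n < m then f n * f m else 0)
          = ∑ n ∈ Finset.Ico i k, ∑ m ∈ Finset.Ico i k, (if n < m then f n * f m else 0)
            + (∑ n ∈ Finset.Ico i k, f n) * f k := by
        rw [Finset.sum_Ico_succ_top hk, Finset.sum_mul, ← Finset.sum_add_distrib]
        have h2 : ∑ m ∈ Finset.Ico i (k + 1), (if k < m then f k * f m else 0) = 0 :=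
          Finset.sum_eq_zero fun m hm => by
            rw [Finset.mem_Ico] at hm
            rw [if_neg (by omega)]
        rw [h2, add_zero]
        refine Finset.sum_congr rfl fun n hn => ?_
        rw [Finset.mem_Ico] at hn
        rw [Finset.sum_Ico_succ_top hk, if_pos hn.2]
      rw [h1, Finset.sum_Ico_succ_top hk]
      have h3 : f k ≤ η := hf k (Finset.mem_Ico.2 ⟨hk, by omega⟩)
      set S := ∑ n ∈ Finset.Ico i k, f n
      calc (S + f k) ^ 2 = S ^ 2 + 2 * (S * f k) + f k * f k := by ring
        _ ≤ (η * S + 2 * ∑ n ∈ Finset.Ico i k, ∑ m ∈ Finset.Ico i k, (if n < m then f n * f m else 0))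
            + 2 * (S * f k) + η * f k := by gcongr
        _ = _ := by ring
  have h1 := key j hij.le le_rfl
  generalize hS : ∑ n ∈ Finset.Ico i j, f n = S at h1 ⊢
  have hfin : S ≠ ∞ := by
    rw [← hS]
    exact (ENNReal.sum_lt_top.2 fun n hn => (hf n hn).trans_lt ENNReal.coe_lt_top).ne
  -- This reads `(S - 2η)(S + η) ≤ 0`, whence `S ≤ 2η`.
  have h2 : S ^ 2 ≤ η * S + 2 * (η : ℝ≥0∞) ^ 2 := h1.trans (by gcongr)
  lift S to ℝ≥0 using hfin
  have h3 : S ^ 2 ≤ η * S + 2 * η ^ 2 := by exact_mod_cast h2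
  have h4 : S ≤ 2 * η := by
    have h5 : (S : ℝ) ^ 2 ≤ η * S + 2 * (η : ℝ) ^ 2 := by exact_mod_cast h3
    have h6 : (S : ℝ) ≤ 2 * η := by
      by_contra! hc
      have := η.coe_nonneg
      nlinarith
    exact_mod_cast h6
  exact_mod_cast h4

theorem mul_jump_le_pairs {x : X} {ω : ℕ → ℝ≥0 × X} {ρ : ℝ≥0} {n m : ℕ} (h : n < m)
    (hm : T ω (m + 1) ≤ ρ) : jump x ω n * jump x ω m ≤ pairs x ω ρ := by
  refine le_trans ?_ (ENNReal.le_tsum n)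
  refine le_trans ?_ (ENNReal.le_tsum m)
  rw [if_pos ⟨h, hm⟩]

theorem jump_le_variation {x : X} {ω : ℕ → ℝ≥0 × X} {ρ : ℝ≥0} {n : ℕ} (h : T ω (n + 1) ≤ ρ) :
    jump x ω n ≤ variation x ω ρ := by
  refine le_trans ?_ (ENNReal.le_tsum n)
  rw [if_pos h]

theorem sum_pairs_le {x : X} {ω : ℕ → ℝ≥0 × X} {ρ : ℝ≥0} {I : Finset ℕ}
    (hI : ∀ n ∈ I, T ω (n + 1) ≤ ρ) :
    ∑ n ∈ I, ∑ m ∈ I, (if n < m then jump x ω n * jump x ω m else 0) ≤ pairs x ω ρ := by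
  refine le_trans (Finset.sum_le_sum fun n _ => ?_) (ENNReal.sum_le_tsum I)
  refine le_trans (Finset.sum_le_sum fun m hm => ?_) (ENNReal.sum_le_tsum I)
  simp [hI m hm]

theorem jump_shift (x : X) (ω : ℕ → ℝ≥0 × X) (τ : ℝ≥0) (n : ℕ) :
    jump (val x ω τ) (shift ω τ) n = jump x ω (idx ω τ + n) := by
  rw [jump, st_shift, st_shift, jump, add_assoc]

/-- The times before `k` of the jumps of a size larger than `η`. -/
def nodes (x : X) (ω : ℕ → ℝ≥0 × X) (k : ℝ≥0) (η : ℝ≥0) : Set ℝ≥0 :=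
  {s | s < k ∧ ∃ n, T ω (n + 1) = s ∧ η < jump x ω n}

/-- A jump larger than `η` before `δ` would violate the bound on the variation. Two such jumps
closer than `δ` fall into one window of length `3δ` and their product exceeds `η²`. On an interval
without large jumps every jump is at most `η` and the pair products sum to at most `η²`, so
`sum_le_two_mul` applies. -/
theorem oscillation {x : X} {ω : ℕ → ℝ≥0 × X} (hω : ω ∈ NE) {k δ η : ℝ≥0} (hδ : 0 < δ) {M : ℕ}
    (hM : k ≤ M * δ) (hV : variation x ω δ ≤ η)
    (hB : ∀ j < M, pairs (val x ω (j * δ)) (shift ω (j * δ)) (3 * δ) ≤ (η : ℝ≥0∞) ^ 2) :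
    (∀ s ∈ nodes x ω k η, δ ≤ s) ∧
    (∀ s ∈ nodes x ω k η, ∀ s' ∈ nodes x ω k η, s < s' → s + δ ≤ s') ∧
    ∀ r t, r ≤ t → t < k → t < r + δ → (∀ s ∈ nodes x ω k η, ¬ (r < s ∧ s ≤ t)) →
      edist (val x ω r) (val x ω t) ≤ 2 * η := by
  have h1 : ∀ s ∈ nodes x ω k η, δ ≤ s := by
    rintro s ⟨-, n, rfl, hn⟩
    by_contra! hc
    exact absurd ((jump_le_variation hc.le).trans hV) (not_le.2 hn)
  refine ⟨h1, ?_, ?_⟩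
  · intro s hs s' hs' hss
    have hδs := h1 s hs
    obtain ⟨-, n, rfl, hn⟩ := hs
    obtain ⟨hk, m, rfl, hm⟩ := hs'
    by_contra! hc
    set i := ⌊T ω (n + 1) / δ⌋₊ with hi
    have hi1 : (i : ℝ≥0) * δ ≤ T ω (n + 1) := by
      rw [← le_div_iff₀ hδ]; exact Nat.floor_le zero_le
    have hi2 : T ω (n + 1) < (i + 1) * δ := by
      rw [← div_lt_iff₀ hδ]; exact Nat.lt_floor_add_one _
    have hi0 : 1 ≤ i := by
      rw [hi, Nat.le_floor_iff zero_le, Nat.cast_one, le_div_iff₀ hδ, one_mul]; exact hδs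
    -- The window starts one grid step before the cell of the first jump, so that this jump lies
    -- strictly after `τ`. The second jump is then before `(j + 2) δ + δ = τ + 3δ`, which explains
    -- the length `3δ`.
    obtain ⟨j, hj⟩ : ∃ j, i = j + 1 := ⟨i - 1, by omega⟩
    rw [hj] at hi1 hi2
    push_cast at hi1 hi2
    set τ : ℝ≥0 := j * δ with hτ
    have hτ1 : τ < T ω (n + 1) := lt_of_lt_of_le (by rw [add_mul, one_mul]; exact lt_add_of_pos_right _ hδ) hi1
    have hjM : j < M := by
      have : (j : ℝ≥0) * δ < M * δ := hτ1.trans (hss.trans (hk.trans_le hM))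
      exact_mod_cast lt_of_mul_lt_mul_right this zero_le
    have hn1 : idx ω τ ≤ n := by
      by_contra! h
      exact absurd (hτ1.trans_le ((T_mono ω h).trans (T_idx_le ω τ))) (lt_irrefl _)
    have hnm : n < m := by
      by_contra! h
      exact absurd (hss.trans_le (T_mono ω (by omega : m + 1 ≤ n + 1))) (lt_irrefl _)
    have h2 := mul_jump_le_pairs (x := val x ω τ) (ω := shift ω τ) (ρ := 3 * δ)
      (n := n - idx ω τ) (m := m - idx ω τ) (by omega) (by
        rw [T_shift hω, show idx ω τ + 1 + (m - idx ω τ) = m + 1 by omega, tsub_le_iff_left]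
        refine hc.le.trans ?_
        calc T ω (n + 1) + δ ≤ (j + 1 + 1) * δ + δ := by gcongr
          _ = τ + 3 * δ := by rw [hτ]; ring)
    rw [jump_shift, jump_shift, show idx ω τ + (n - idx ω τ) = n by omega,
      show idx ω τ + (m - idx ω τ) = m by omega] at h2
    have h3 : (η : ℝ≥0∞) ^ 2 < jump x ω n * jump x ω m := by
      rw [pow_two]; exact ENNReal.mul_lt_mul hn hm
    exact absurd (h2.trans (hB j hjM)) (not_le.2 h3)
  · intro r t hrt htk htr hno
    set j := ⌊r / δ⌋₊ with hj
    have hj1 : (j : ℝ≥0) * δ ≤ r := by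
      rw [← le_div_iff₀ hδ]; exact Nat.floor_le zero_le
    have hj2 : r < (j + 1) * δ := by
      rw [← div_lt_iff₀ hδ]; exact Nat.lt_floor_add_one _
    set τ : ℝ≥0 := j * δ with hτ
    have hjM : j < M := by
      have : (j : ℝ≥0) * δ < M * δ := hj1.trans_lt (hrt.trans_lt (htk.trans_le hM))
      exact_mod_cast lt_of_mul_lt_mul_right this zero_le
    have hr : val x ω r = val (val x ω τ) (shift ω τ) (r - τ) := by
      rw [val_shift x hω, add_tsub_cancel_of_le hj1]
    have ht : val x ω t = val (val x ω τ) (shift ω τ) (t - τ) := by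
      rw [val_shift x hω, add_tsub_cancel_of_le (hj1.trans hrt)]
    obtain ⟨i, l, h2, h3⟩ := edist_val_le (x := val x ω τ) (shift_mem_NE hω τ)
      (tsub_le_tsub_right hrt τ)
    rw [hr, ht]
    refine h2.trans (sum_le_two_mul i l ?_ ?_)
    · intro n hn
      by_contra! hc
      obtain ⟨h4, h5⟩ := h3 n hn
      have h6 : τ ≤ T ω (idx ω τ + 1 + n) := (lt_T_idx hω τ).le.trans (T_mono ω (by omega))
      rw [T_shift hω, tsub_lt_tsub_iff_right hj1] at h4
      rw [T_shift hω, tsub_le_tsub_iff_right (hj1.trans hrt)] at h5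
      refine hno (T ω (idx ω τ + 1 + n)) ⟨h5.trans_lt htk, idx ω τ + n, by congr 1; omega, ?_⟩ ⟨h4, h5⟩
      rwa [jump_shift] at hc
    · refine (sum_pairs_le fun n hn => (h3 n hn).2.trans ?_).trans (hB j hjM)
      rw [tsub_le_iff_left]
      refine htr.le.trans ?_
      calc r + δ ≤ (j + 1) * δ + δ := by gcongr
        _ ≤ τ + 3 * δ := by
          rw [hτ, show ((j : ℝ≥0) + 1) * δ + δ = j * δ + 2 * δ by ring]
          gcongr
          norm_num

end JumpPath

/-! ### Expectations of path functionals -/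

namespace JumpData

open MarkovChain JumpPath

variable {X : Type*} [MeasurableSpace X] (D : JumpData X)

/-- The drift inequality makes `e^{cs} F` a supersolution of the renewal equation. `F` may be
infinite, as is needed for `∑ hwt`; at such points the claim is trivial. -/
theorem J_exp_le {F : X → ℝ≥0∞} (hF : Measurable F) {c : ℝ} (hc : 0 ≤ c)
    (h : ∀ x, ENNReal.ofReal (D.rate x) * ∫⁻ y, F y ∂D.K x ≤ ENNReal.ofReal (D.rate x + c) * F x)
    (t : ℝ≥0) (x : X) :
    ENNReal.ofReal (Real.exp (-D.rate x * t)) * F x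
      + D.J (fun s y => ENNReal.ofReal (Real.exp (c * s)) * F y) t x
      ≤ ENNReal.ofReal (Real.exp (c * t)) * F x := by
  by_cases hx : F x = ∞
  · have h1 : ENNReal.ofReal (Real.exp (c * t)) ≠ 0 := by simpa using Real.exp_pos _
    rw [hx, ENNReal.mul_top h1]
    exact le_top
  have hr := D.rate_pos x
  set v := (F x).toReal with hv
  have hvx : F x = ENNReal.ofReal v := (ENNReal.ofReal_toReal hx).symm
  have hv0 : 0 ≤ v := ENNReal.toReal_nonneg
  have key := D.J_le_of_deriv (f := fun (s : ℝ≥0) y => ENNReal.ofReal (Real.exp (c * s)) * F y)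
    (by unfold Function.uncurry; fun_prop) x t (fun r => Real.exp (c * r) * v)
    (fun r => c * Real.exp (c * r) * v)
    (fun r => by
      have := (((hasDerivAt_id r).const_mul c).exp).mul_const v
      simpa [mul_comm c] using this)
    (by fun_prop) (by simpa) (fun r _ => by positivity)
    (fun r _ => by
      rw [lintegral_const_mul _ hF, mul_left_comm]
      calc _ ≤ ENNReal.ofReal (Real.exp (c * r)) * (ENNReal.ofReal (D.rate x + c) * F x) := by
            gcongr ?_ * ?_; exacts [le_rfl, h x]
        _ = ENNReal.ofReal (Real.exp (c * r) * ((D.rate x + c) * v)) := by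
            rw [hvx, ← ENNReal.ofReal_mul (by positivity), ← ENNReal.ofReal_mul (by positivity)]
        _ ≤ _ := by
            apply ENNReal.ofReal_le_ofReal
            apply le_of_eq; ring)
  rw [hvx, ← ENNReal.ofReal_mul (by positivity), ← ENNReal.ofReal_mul (by positivity)]
  simpa using key

theorem lintegral_p_exp_le {F : X → ℝ≥0∞} (hF : Measurable F) {c : ℝ} (hc : 0 ≤ c)
    (h : ∀ x, ENNReal.ofReal (D.rate x) * ∫⁻ y, F y ∂D.K x ≤ ENNReal.ofReal (D.rate x + c) * F x)
    (t : ℝ≥0) (x : X) : ∫⁻ y, F y ∂D.p t x ≤ ENNReal.ofReal (Real.exp (c * t)) * F x :=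
  D.lintegral_p_le hF (g := fun t x => ENNReal.ofReal (Real.exp (c * t)) * F x)
    (D.J_exp_le hF hc h) t x

theorem measurableSet_exceed {F : X → ℝ≥0∞} (hF : Measurable F) (R : ℝ≥0∞) (n : ℕ) :
    MeasurableSet {q : (ℝ≥0 × X) × (ℕ → ℝ≥0 × X) | T q.2 n ≤ q.1.1 ∧ R < F (st q.1.2 q.2 n)} :=
  (measurableSet_le ((measurable_T n).comp measurable_snd) (by fun_prop)).inter
    (measurableSet_lt measurable_const (hF.comp ((measurable_st n).comp
      (f := fun q : (ℝ≥0 × X) × (ℕ → ℝ≥0 × X) => (q.1.2, q.2)) (by fun_prop))))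

/-- A maximal inequality. -/
theorem mul_law_exceed_le {F : X → ℝ≥0∞} (hF : Measurable F) {c : ℝ} (hc : 0 ≤ c)
    (h : ∀ x, ENNReal.ofReal (D.rate x) * ∫⁻ y, F y ∂D.K x ≤ ENNReal.ofReal (D.rate x + c) * F x)
    (R : ℝ≥0) (t : ℝ≥0) (x : X) :
    R * D.law x {ω | ∃ n, T ω n ≤ t ∧ R < F (st x ω n)} ≤ ENNReal.ofReal (Real.exp (c * t)) * F x := by
  set S : ℕ → Set ((ℝ≥0 × X) × (ℕ → ℝ≥0 × X)) := fun N =>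
    {q | ∃ n < N, T q.2 n ≤ q.1.1 ∧ R < F (st q.1.2 q.2 n)} with hS
  have hSm : ∀ N, MeasurableSet (S N) := fun N => by
    have : S N = ⋃ n ∈ Finset.range N, {q | T q.2 n ≤ q.1.1 ∧ R < F (st q.1.2 q.2 n)} := by
      ext q
      simp only [hS, mem_ofPred_eq, mem_iUnion, Finset.mem_range, exists_prop]
    rw [this]
    exact Finset.measurableSet_biUnion _ fun n _ => measurableSet_exceed hF R n
  have hN : ∀ N (t : ℝ≥0) (x : X), R * D.law x (Prod.mk (t, x) ⁻¹' S N)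
      ≤ ENNReal.ofReal (Real.exp (c * t)) * F x := by
    intro N
    induction N with
    | zero => intro t x; simp [hS]
    | succ N ih =>
      intro t x
      -- If the threshold is exceeded at the start, probability at most one suffices. Otherwise it
      -- can only be exceeded after the first jump, so the event regenerates with one state fewer
      -- and the supersolution carries the bound over.
      by_cases hx : R < F x
      · calc R * D.law x (Prod.mk (t, x) ⁻¹' S (N + 1)) ≤ F x * 1 := by
              gcongr; exact prob_le_one
          _ = 1 * F x := by ring
          _ ≤ _ := by
              gcongr
              rw [ENNReal.one_le_ofReal]
              exact Real.one_le_exp (by positivity)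
      · refine le_trans ?_ (D.J_exp_le hF hc h t x)
        refine le_trans ?_ le_add_self
        have hm : ∀ N (t : ℝ≥0) (x : X), MeasurableSet (Prod.mk (t, x) ⁻¹' S N) := fun N t x =>
          measurable_prodMk_left (hSm N)
        have e : D.law x (Prod.mk (t, x) ⁻¹' S (N + 1))
            = D.J (fun s y => D.law y (Prod.mk (s, y) ⁻¹' S N)) t x := by
          rw [← lintegral_indicator_one (hm _ _ _),
            lintegral_law _ _ _ (measurable_one.indicator (hm _ _ _)), J]
          refine lintegral_congr fun z => ?_
          have hiff : ∀ ω, (cons z ω ∈ Prod.mk (t, x) ⁻¹' S (N + 1)) ↔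
              z.1 ≤ t ∧ ω ∈ Prod.mk (t - z.1, z.2) ⁻¹' S N := by
            intro ω
            simp only [hS, mem_preimage, mem_ofPred_eq]
            constructor
            · rintro ⟨n, hn, h1, h2⟩
              cases n with
              | zero => exact absurd h2 hx
              | succ n =>
                have hz : z.1 ≤ t := by rw [T_cons] at h1; exact le_self_add.trans h1
                refine ⟨hz, n, by omega, ?_, by rwa [st_cons] at h2⟩
                rw [T_cons, add_comm] at h1
                exact (le_tsub_iff_right hz).2 h1
            · rintro ⟨hz, n, hn, h1, h2⟩
              refine ⟨n + 1, by omega, ?_, by rwa [st_cons]⟩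
              rw [T_cons, add_comm]
              exact (le_tsub_iff_right hz).1 h1
          split_ifs with hz
          · rw [← lintegral_indicator_one (hm _ _ _)]
            refine lintegral_congr fun ω => ?_
            by_cases h' : ω ∈ Prod.mk (t - z.1, z.2) ⁻¹' S N
            · rw [indicator_of_mem h', indicator_of_mem ((hiff ω).2 ⟨hz, h'⟩)]; rfl
            · rw [indicator_of_notMem h', indicator_of_notMem (fun h'' => h' ((hiff ω).1 h'').2)]
          · have : ∀ ω, cons z ω ∉ Prod.mk (t, x) ⁻¹' S (N + 1) := fun ω h' => hz ((hiff ω).1 h').1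
            simp only [indicator_of_notMem (this _), lintegral_zero]
        have hmj : Measurable (Function.uncurry fun (s : ℝ≥0) (y : X) =>
            D.law y (Prod.mk (s, y) ⁻¹' S N)) :=
          Kernel.measurable_kernel_prodMk_left (κ := D.law.comap Prod.snd measurable_snd) (hSm N)
        rw [e, ← D.J_const_mul _ hmj]
        exact D.J_mono (fun s _ y => ih s y) x
  have hmono : Monotone fun N => Prod.mk (t, x) ⁻¹' S N := fun N M hNM ω ⟨n, hn, h1⟩ =>
    ⟨n, hn.trans_le hNM, h1⟩
  have hU : {ω | ∃ n, T ω n ≤ t ∧ R < F (st x ω n)} = ⋃ N, Prod.mk (t, x) ⁻¹' S N := by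
    ext ω
    simp only [hS, mem_ofPred_eq, mem_iUnion, mem_preimage]
    exact ⟨fun ⟨n, hn⟩ => ⟨n + 1, n, by omega, hn⟩, fun ⟨N, n, _, hn⟩ => ⟨n, hn⟩⟩
  rw [hU, hmono.measure_iUnion, ENNReal.mul_iSup]
  exact iSup_le fun N => hN N t x

variable [PseudoEMetricSpace X]

theorem measurable_jump (hd : Measurable fun q : X × X => edist q.1 q.2) (n : ℕ) :
    Measurable fun q : X × (ℕ → ℝ≥0 × X) => jump q.1 q.2 n :=
  hd.comp ((measurable_st n).prodMk (measurable_st (n + 1)))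

theorem measurable_variation_term (hd : Measurable fun q : X × X => edist q.1 q.2) (n : ℕ) :
    Measurable fun q : (ℝ≥0 × X) × (ℕ → ℝ≥0 × X) =>
      if T q.2 (n + 1) ≤ q.1.1 then jump q.1.2 q.2 n else 0 :=
  Measurable.ite (measurableSet_le ((measurable_T _).comp measurable_snd) (by fun_prop))
    ((measurable_jump hd n).comp (f := fun q : (ℝ≥0 × X) × (ℕ → ℝ≥0 × X) => (q.1.2, q.2))
      (by fun_prop)) measurable_const

theorem measurable_variation (hd : Measurable fun q : X × X => edist q.1 q.2) :
    Measurable fun q : (ℝ≥0 × X) × (ℕ → ℝ≥0 × X) => variation q.1.2 q.2 q.1.1 :=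
  Measurable.tsum fun n => measurable_variation_term hd n

theorem measurable_pairs_term (hd : Measurable fun q : X × X => edist q.1 q.2) (n : ℕ) :
    Measurable fun q : (ℝ≥0 × X) × (ℕ → ℝ≥0 × X) =>
      ∑' m, if n < m ∧ T q.2 (m + 1) ≤ q.1.1 then jump q.1.2 q.2 n * jump q.1.2 q.2 m else 0 := by
  have hj : ∀ m, Measurable fun q : (ℝ≥0 × X) × (ℕ → ℝ≥0 × X) => jump q.1.2 q.2 m := fun m =>
    (measurable_jump hd m).comp (f := fun q : (ℝ≥0 × X) × (ℕ → ℝ≥0 × X) => (q.1.2, q.2)) (by fun_prop)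
  refine Measurable.tsum fun m => Measurable.ite ?_ ((hj n).mul (hj m)) measurable_const
  have h : MeasurableSet {q : (ℝ≥0 × X) × (ℕ → ℝ≥0 × X) | T q.2 (m + 1) ≤ q.1.1} :=
    measurableSet_le ((measurable_T (m + 1)).comp measurable_snd) (measurable_fst.comp measurable_fst)
  exact (MeasurableSet.const (n < m)).inter h

theorem measurable_pairs (hd : Measurable fun q : X × X => edist q.1 q.2) :
    Measurable fun q : (ℝ≥0 × X) × (ℕ → ℝ≥0 × X) => pairs q.1.2 q.2 q.1.1 :=
  Measurable.tsum fun n => measurable_pairs_term hd n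

/-- The expectation of the variation. -/
theorem lintegral_variation_le (hd : Measurable fun q : X × X => edist q.1 q.2) {W : X → ℝ}
    (hW : Measurable W) (hW0 : ∀ x, 0 ≤ W x) {c κ : ℝ} (hc : 0 ≤ c) (hκ : 0 ≤ κ)
    (h1 : ∀ x, ENNReal.ofReal (D.rate x) * ∫⁻ y, edist x y ∂D.K x ≤ ENNReal.ofReal (κ * W x))
    (h2 : ∀ x, ENNReal.ofReal (D.rate x) * ∫⁻ y, ENNReal.ofReal (W y) ∂D.K x
      ≤ ENNReal.ofReal ((D.rate x + c) * W x)) (ρ : ℝ≥0) (x : X) :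
    ∫⁻ ω, variation x ω ρ ∂D.law x ≤ ENNReal.ofReal (κ * ρ * Real.exp (c * ρ) * W x) := by
  have hm : ∀ N, Measurable (Function.uncurry fun (q : ℝ≥0 × X) (ω : ℕ → ℝ≥0 × X) =>
      ∑ n ∈ Finset.range N, if T ω (n + 1) ≤ q.1 then jump q.2 ω n else 0) := fun N =>
    Finset.measurable_sum _ fun n _ => measurable_variation_term hd n
  have hI : ∀ N, Measurable (Function.uncurry fun (ρ : ℝ≥0) (x : X) => ∫⁻ ω,
      ∑ n ∈ Finset.range N, (if T ω (n + 1) ≤ ρ then jump x ω n else 0) ∂D.law x) := fun N =>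
    (hm N).lintegral_kernel_prod_right (κ := D.law.comap Prod.snd measurable_snd)
  have hxm : ∀ x : X, Measurable fun y => edist x y := fun x => hd.comp measurable_prodMk_left
  have hN : ∀ N (ρ : ℝ≥0) (x : X), ∫⁻ ω,
      ∑ n ∈ Finset.range N, (if T ω (n + 1) ≤ ρ then jump x ω n else 0) ∂D.law x
      ≤ ENNReal.ofReal (κ * ρ * Real.exp (c * ρ) * W x) := by
    intro N
    induction N with
    | zero => intro ρ x; simp
    | succ N ih =>
      intro ρ x
      have hr := D.rate_pos x
      have hWx := hW0 x
      -- The first jump contributes its size; the later ones are a variation with one term fewer,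
      -- started afresh from the new state.
      have e : ∫⁻ ω, ∑ n ∈ Finset.range (N + 1), (if T ω (n + 1) ≤ ρ then jump x ω n else 0) ∂D.law x
          = D.J (fun s y => edist x y + ∫⁻ ω, ∑ n ∈ Finset.range N,
            (if T ω (n + 1) ≤ s then jump y ω n else 0) ∂D.law y) ρ x := by
        have hm1 : Measurable fun ω : ℕ → ℝ≥0 × X =>
            ∑ n ∈ Finset.range (N + 1), (if T ω (n + 1) ≤ ρ then jump x ω n else 0) :=
          (hm (N + 1)).comp (f := fun ω => ((ρ, x), ω)) (by fun_prop)
        rw [lintegral_law _ _ _ hm1, J]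
        refine lintegral_congr fun z => ?_
        simp only [sum_range_ite_cons]
        split_ifs with hz
        · rw [lintegral_add_left measurable_const]; simp
        · simp
      rw [e]
      have key := D.J_le_of_deriv (f := fun s y => edist x y + ∫⁻ ω, ∑ n ∈ Finset.range N,
            (if T ω (n + 1) ≤ s then jump y ω n else 0) ∂D.law y)
        (((hxm x).comp measurable_snd).add (hI N)) x ρ (fun r => κ * r * Real.exp (c * r) * W x)
        (fun r => (κ * Real.exp (c * r) + κ * r * (c * Real.exp (c * r))) * W x)
        (fun r => by
          have h3 : HasDerivAt (fun r => Real.exp (c * r)) (c * Real.exp (c * r)) r := by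
            have := ((hasDerivAt_id r).const_mul c).exp
            simpa [mul_comm] using this
          have h4 := ((hasDerivAt_id r).const_mul κ).mul h3
          simp only [id, mul_one] at h4
          exact h4.mul_const (W x))
        (by fun_prop) (by simp) (fun r hr0 => by positivity)
        (fun r _ => by
          rw [lintegral_add_left (hxm x), mul_add]
          have h5 : ENNReal.ofReal (D.rate x) * ∫⁻ y, ∫⁻ ω, ∑ n ∈ Finset.range N,
              (if T ω (n + 1) ≤ r then jump y ω n else 0) ∂D.law y ∂D.K x
              ≤ ENNReal.ofReal (κ * r * Real.exp (c * r) * ((D.rate x + c) * W x)) := by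
            calc _ ≤ ENNReal.ofReal (D.rate x) * ∫⁻ y, ENNReal.ofReal (κ * r * Real.exp (c * r)) *
                    ENNReal.ofReal (W y) ∂D.K x := by
                  gcongr with y
                  rw [← ENNReal.ofReal_mul (by positivity)]
                  exact ih r y
              _ = ENNReal.ofReal (κ * r * Real.exp (c * r)) *
                    (ENNReal.ofReal (D.rate x) * ∫⁻ y, ENNReal.ofReal (W y) ∂D.K x) := by
                  rw [lintegral_const_mul _ (by fun_prop)]; ring
              _ ≤ ENNReal.ofReal (κ * r * Real.exp (c * r)) *
                    ENNReal.ofReal ((D.rate x + c) * W x) := by gcongr; exact h2 x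
              _ = _ := by rw [← ENNReal.ofReal_mul (by positivity)]
          refine (add_le_add (h1 x) h5).trans ?_
          rw [← ENNReal.ofReal_add (by positivity) (by positivity)]
          apply ENNReal.ofReal_le_ofReal
          have h6 : κ * W x ≤ κ * W x * Real.exp (c * r) :=
            le_mul_of_one_le_right (by positivity) (Real.one_le_exp (by positivity))
          nlinarith)
      exact le_add_self.trans key
  have ht : ∀ n, Measurable fun ω : ℕ → ℝ≥0 × X => if T ω (n + 1) ≤ ρ then jump x ω n else 0 := fun n =>
    (measurable_variation_term hd n).comp (f := fun ω => ((ρ, x), ω)) (by fun_prop)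
  unfold variation
  rw [lintegral_tsum fun n => (ht n).aemeasurable]
  refine ENNReal.tsum_le_of_sum_range_le fun N => ?_
  rw [← lintegral_finsetSum _ fun n _ => ht n]
  exact hN N ρ x

/-- The expectation of the sum over pairs of jumps. -/
theorem lintegral_pairs_le (hd : Measurable fun q : X × X => edist q.1 q.2) {W W₂ : X → ℝ}
    (hW : Measurable W) (hW0 : ∀ x, 0 ≤ W x) (hW₂ : Measurable W₂) (hW₂0 : ∀ x, 0 ≤ W₂ x)
    {c κ : ℝ} (hc : 0 ≤ c) (hκ : 0 ≤ κ)
    (h1 : ∀ x, ENNReal.ofReal (D.rate x) * ∫⁻ y, edist x y ∂D.K x ≤ ENNReal.ofReal (κ * W x))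
    (h2 : ∀ x, ENNReal.ofReal (D.rate x) * ∫⁻ y, ENNReal.ofReal (W y) ∂D.K x
      ≤ ENNReal.ofReal ((D.rate x + c) * W x))
    (h3 : ∀ x, ENNReal.ofReal (D.rate x) * ∫⁻ y, edist x y * ENNReal.ofReal (W y) ∂D.K x
      ≤ ENNReal.ofReal (κ * W₂ x))
    (h4 : ∀ x, ENNReal.ofReal (D.rate x) * ∫⁻ y, ENNReal.ofReal (W₂ y) ∂D.K x
      ≤ ENNReal.ofReal ((D.rate x + c) * W₂ x)) (ρ : ℝ≥0) (x : X) :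
    ∫⁻ ω, pairs x ω ρ ∂D.law x ≤ ENNReal.ofReal (κ ^ 2 * ρ ^ 2 * Real.exp (c * ρ) * W₂ x) := by
  have hm : ∀ N, Measurable (Function.uncurry fun (q : ℝ≥0 × X) (ω : ℕ → ℝ≥0 × X) =>
      ∑ n ∈ Finset.range N, ∑' m, if n < m ∧ T ω (m + 1) ≤ q.1 then jump q.2 ω n * jump q.2 ω m
        else 0) := fun N =>
    Finset.measurable_sum _ fun n _ => measurable_pairs_term hd n
  have hI : ∀ N, Measurable (Function.uncurry fun (ρ : ℝ≥0) (x : X) => ∫⁻ ω,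
      ∑ n ∈ Finset.range N, (∑' m, if n < m ∧ T ω (m + 1) ≤ ρ then jump x ω n * jump x ω m
        else 0) ∂D.law x) := fun N =>
    (hm N).lintegral_kernel_prod_right (κ := D.law.comap Prod.snd measurable_snd)
  have hxm : ∀ x : X, Measurable fun y => edist x y := fun x => hd.comp measurable_prodMk_left
  have hvm : Measurable (Function.uncurry fun (ρ : ℝ≥0) (x : X) => ∫⁻ ω, variation x ω ρ ∂D.law x) :=
    Measurable.lintegral_kernel_prod_right (κ := D.law.comap Prod.snd measurable_snd)
      (f := fun (q : ℝ≥0 × X) ω => variation q.2 ω q.1) (measurable_variation hd)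
  have hN : ∀ N (ρ : ℝ≥0) (x : X), ∫⁻ ω,
      ∑ n ∈ Finset.range N, (∑' m, if n < m ∧ T ω (m + 1) ≤ ρ then jump x ω n * jump x ω m
        else 0) ∂D.law x
      ≤ ENNReal.ofReal (κ ^ 2 * ρ ^ 2 * Real.exp (c * ρ) * W₂ x) := by
    intro N
    induction N with
    | zero => intro ρ x; simp
    | succ N ih =>
      intro ρ x
      have hr := D.rate_pos x
      have hWx := hW₂0 x
      have hvx : Measurable (Function.uncurry fun (s : ℝ≥0) (y : X) =>
          edist x y * ∫⁻ ω, variation y ω s ∂D.law y) := ((hxm x).comp measurable_snd).mul hvm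
      -- The pairs that contain the first jump contribute its size times the variation of the
      -- restarted path; the others form a truncated pair sum for that path.
      have e : ∫⁻ ω, ∑ n ∈ Finset.range (N + 1), (∑' m, if n < m ∧ T ω (m + 1) ≤ ρ then
            jump x ω n * jump x ω m else 0) ∂D.law x
          = D.J (fun s y => edist x y * (∫⁻ ω, variation y ω s ∂D.law y) +
            ∫⁻ ω, ∑ n ∈ Finset.range N, (∑' m, if n < m ∧ T ω (m + 1) ≤ s then
              jump y ω n * jump y ω m else 0) ∂D.law y) ρ x := by
        have hm1 : Measurable fun ω : ℕ → ℝ≥0 × X => ∑ n ∈ Finset.range (N + 1),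
            (∑' m, if n < m ∧ T ω (m + 1) ≤ ρ then jump x ω n * jump x ω m else 0) :=
          (hm (N + 1)).comp (f := fun ω => ((ρ, x), ω)) (by fun_prop)
        rw [lintegral_law _ _ _ hm1, J]
        refine lintegral_congr fun z => ?_
        simp only [sum_range_pairs_cons]
        have hvz : Measurable fun ω : ℕ → ℝ≥0 × X => variation z.2 ω (ρ - z.1) :=
          (measurable_variation hd).comp (f := fun ω => ((ρ - z.1, z.2), ω)) (by fun_prop)
        split_ifs with hz
        · rw [lintegral_add_left (hvz.const_mul _), lintegral_const_mul _ hvz]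
        · simp
      rw [e]
      have key := D.J_le_of_deriv (f := fun s y => edist x y * (∫⁻ ω, variation y ω s ∂D.law y) +
            ∫⁻ ω, ∑ n ∈ Finset.range N, (∑' m, if n < m ∧ T ω (m + 1) ≤ s then
              jump y ω n * jump y ω m else 0) ∂D.law y)
        (hvx.add (hI N)) x ρ (fun r => κ ^ 2 * r ^ 2 * Real.exp (c * r) * W₂ x)
        (fun r => (κ ^ 2 * (2 * r) * Real.exp (c * r) + κ ^ 2 * r ^ 2 * (c * Real.exp (c * r))) * W₂ x)
        (fun r => by
          have h3 : HasDerivAt (fun r => Real.exp (c * r)) (c * Real.exp (c * r)) r := by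
            have := ((hasDerivAt_id r).const_mul c).exp
            simpa [mul_comm] using this
          have h4 := (((hasDerivAt_pow 2 r)).const_mul (κ ^ 2)).mul h3
          simpa using h4.mul_const (W₂ x))
        (by fun_prop) (by simp) (fun r hr0 => by positivity)
        (fun r _ => by
          have hvr : Measurable fun y => edist x y * ∫⁻ ω, variation y ω r ∂D.law y :=
            hvx.comp (measurable_prodMk_left (x := r))
          rw [lintegral_add_left hvr, mul_add]
          have h5 : ENNReal.ofReal (D.rate x) * ∫⁻ y, ∫⁻ ω, ∑ n ∈ Finset.range N,
              (∑' m, if n < m ∧ T ω (m + 1) ≤ r then jump y ω n * jump y ω m else 0) ∂D.law y ∂D.K x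
              ≤ ENNReal.ofReal (κ ^ 2 * r ^ 2 * Real.exp (c * r) * ((D.rate x + c) * W₂ x)) := by
            calc _ ≤ ENNReal.ofReal (D.rate x) * ∫⁻ y,
                    ENNReal.ofReal (κ ^ 2 * r ^ 2 * Real.exp (c * r)) * ENNReal.ofReal (W₂ y) ∂D.K x := by
                  gcongr with y
                  rw [← ENNReal.ofReal_mul (by positivity)]
                  exact ih r y
              _ = ENNReal.ofReal (κ ^ 2 * r ^ 2 * Real.exp (c * r)) *
                    (ENNReal.ofReal (D.rate x) * ∫⁻ y, ENNReal.ofReal (W₂ y) ∂D.K x) := by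
                  rw [lintegral_const_mul _ (by fun_prop)]; ring
              _ ≤ ENNReal.ofReal (κ ^ 2 * r ^ 2 * Real.exp (c * r)) *
                    ENNReal.ofReal ((D.rate x + c) * W₂ x) := by gcongr; exact h4 x
              _ = _ := by rw [← ENNReal.ofReal_mul (by positivity)]
          have h6 : ENNReal.ofReal (D.rate x) * ∫⁻ y, edist x y * (∫⁻ ω, variation y ω r ∂D.law y) ∂D.K x
              ≤ ENNReal.ofReal (κ * r * Real.exp (c * r) * (κ * W₂ x)) := by
            calc _ ≤ ENNReal.ofReal (D.rate x) * ∫⁻ y, ENNReal.ofReal (κ * r * Real.exp (c * r)) *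
                    (edist x y * ENNReal.ofReal (W y)) ∂D.K x := by
                  refine mul_le_mul_right (lintegral_mono fun y => ?_) _
                  dsimp only
                  rw [mul_left_comm, ← ENNReal.ofReal_mul (by positivity)]
                  gcongr
                  exact D.lintegral_variation_le hd hW hW0 hc hκ h1 h2 r y
              _ = ENNReal.ofReal (κ * r * Real.exp (c * r)) *
                    (ENNReal.ofReal (D.rate x) * ∫⁻ y, edist x y * ENNReal.ofReal (W y) ∂D.K x) := by
                  have hxW : Measurable fun y => edist x y * ENNReal.ofReal (W y) :=
                    (hxm x).mul hW.ennreal_ofReal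
                  rw [lintegral_const_mul _ hxW]; ring
              _ ≤ ENNReal.ofReal (κ * r * Real.exp (c * r)) * ENNReal.ofReal (κ * W₂ x) := by
                  gcongr; exact h3 x
              _ = _ := by rw [← ENNReal.ofReal_mul (by positivity)]
          refine (add_le_add h6 h5).trans ?_
          rw [← ENNReal.ofReal_add (by positivity) (by positivity)]
          apply ENNReal.ofReal_le_ofReal
          have h7 : 0 ≤ κ ^ 2 * r * Real.exp (c * r) * W₂ x := by positivity
          nlinarith)
      exact le_add_self.trans key
  have ht : ∀ n, Measurable fun ω : ℕ → ℝ≥0 × X => ∑' m, if n < m ∧ T ω (m + 1) ≤ ρ then jump x ω n * jump x ω m else 0 := fun n =>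
    (measurable_pairs_term hd n).comp (f := fun ω => ((ρ, x), ω)) (by fun_prop)
  unfold pairs
  rw [lintegral_tsum fun n => (ht n).aemeasurable]
  refine ENNReal.tsum_le_of_sum_range_le fun N => ?_
  rw [← lintegral_finsetSum _ fun n _ => ht n]
  exact hN N ρ x

end JumpData

/-! ### Kernels acting on signed measures -/

namespace SignedAction

variable {X Y : Type*} [MeasurableSpace X] [MeasurableSpace Y]

/-- The positive part of a signed measure. -/
abbrev pos (μ : SignedMeasure X) : Measure X := μ.toJordanDecomposition.posPart

/-- The negative part of a signed measure. -/
abbrev neg (μ : SignedMeasure X) : Measure X := μ.toJordanDecomposition.negPart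

theorem pos_sub_neg (μ : SignedMeasure X) : (pos μ).toSignedMeasure - (neg μ).toSignedMeasure = μ :=
  μ.toSignedMeasure_toJordanDecomposition

/-- Two representations of a signed measure as a difference of positive measures become equal after
cross-adding. Writing this in sums avoids subtraction of measures. -/
theorem add_neg_eq (ρ₁ ρ₂ : Measure X) [IsFiniteMeasure ρ₁] [IsFiniteMeasure ρ₂] :
    ρ₁ + neg (ρ₁.toSignedMeasure - ρ₂.toSignedMeasure)
      = ρ₂ + pos (ρ₁.toSignedMeasure - ρ₂.toSignedMeasure) := by
  rw [← Measure.toSignedMeasure_eq_toSignedMeasure_iff, Measure.toSignedMeasure_add,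
    Measure.toSignedMeasure_add]
  have := pos_sub_neg (ρ₁.toSignedMeasure - ρ₂.toSignedMeasure)
  rw [sub_eq_sub_iff_add_eq_add] at this
  rw [← this, add_comm]

/-- Minimality of the Jordan decomposition: on each half of the Hahn decomposition, discarding the
subtracted measure only increases the value. -/
theorem totalVariation_le (ρ₁ ρ₂ : Measure X) [IsFiniteMeasure ρ₁] [IsFiniteMeasure ρ₂] :
    (ρ₁.toSignedMeasure - ρ₂.toSignedMeasure).totalVariation ≤ ρ₁ + ρ₂ := by
  set μ := ρ₁.toSignedMeasure - ρ₂.toSignedMeasure with hμ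
  obtain ⟨i, hi, h0, h1, hp, hn⟩ := μ.toJordanDecomposition_spec
  unfold SignedMeasure.totalVariation
  refine Measure.le_iff.2 fun A hA => ?_
  have key : ∀ ρ ρ' : Measure X, IsFiniteMeasure ρ → IsFiniteMeasure ρ' →
      (ρ A).toReal ≤ ρ'.real A → ρ A ≤ ρ' A := fun ρ ρ' _ _ h =>
    (ENNReal.toReal_le_toReal (measure_ne_top _ _) (measure_ne_top _ _)).1 h
  rw [Measure.add_apply, Measure.add_apply]
  refine add_le_add (key _ _ inferInstance inferInstance ?_) (key _ _ inferInstance inferInstance ?_)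
  · rw [hp, SignedMeasure.toMeasureOfZeroLE_apply _ _ _ hA]
    change μ (i ∩ A) ≤ _
    rw [hμ, Measure.toSignedMeasure_sub_apply (hi.inter hA)]
    have := measureReal_mono (μ := ρ₁) (inter_subset_right : i ∩ A ⊆ A)
    have := measureReal_nonneg (μ := ρ₂) (s := i ∩ A)
    linarith
  · rw [hn, SignedMeasure.toMeasureOfLEZero_apply _ _ _ hA]
    change -μ (iᶜ ∩ A) ≤ _
    rw [hμ, Measure.toSignedMeasure_sub_apply (hi.compl.inter hA)]
    have := measureReal_mono (μ := ρ₂) (inter_subset_right : iᶜ ∩ A ⊆ A)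
    have := measureReal_nonneg (μ := ρ₁) (s := iᶜ ∩ A)
    linarith

theorem integrable_of_bound (ρ : Measure X) [IsFiniteMeasure ρ] {f : X → ℝ} (hf : Measurable f)
    {C : ℝ} (hC : ∀ x, |f x| ≤ C) : Integrable f ρ :=
  Integrable.of_bound hf.aestronglyMeasurable C (ae_of_all _ hC)

/-- The integral with respect to a signed measure. -/
def integ (μ : SignedMeasure X) (f : X → ℝ) : ℝ := ∫ x, f x ∂pos μ - ∫ x, f x ∂neg μ

/-- Any decomposition, not only that of Jordan, computes the integral; linearity in the signed
measure is a consequence. -/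
theorem integ_sub (ρ₁ ρ₂ : Measure X) [IsFiniteMeasure ρ₁] [IsFiniteMeasure ρ₂] {f : X → ℝ}
    (hf : Measurable f) {C : ℝ} (hC : ∀ x, |f x| ≤ C) :
    integ (ρ₁.toSignedMeasure - ρ₂.toSignedMeasure) f = ∫ x, f x ∂ρ₁ - ∫ x, f x ∂ρ₂ := by
  have h := congrArg (fun ρ : Measure X => ∫ x, f x ∂ρ) (add_neg_eq ρ₁ ρ₂)
  rw [integral_add_measure (integrable_of_bound _ hf hC) (integrable_of_bound _ hf hC),
    integral_add_measure (integrable_of_bound _ hf hC) (integrable_of_bound _ hf hC)] at h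
  unfold integ
  linarith

theorem integ_add (μ ν : SignedMeasure X) {f : X → ℝ}
    (hf : Measurable f) {C : ℝ} (hC : ∀ x, |f x| ≤ C) :
    integ (μ + ν) f = integ μ f + integ ν f := by
  have h : μ + ν = (pos μ + pos ν).toSignedMeasure - (neg μ + neg ν).toSignedMeasure := by
    rw [Measure.toSignedMeasure_add, Measure.toSignedMeasure_add, add_sub_add_comm, pos_sub_neg,
      pos_sub_neg]
  rw [h, integ_sub _ _ hf hC,
    integral_add_measure (integrable_of_bound _ hf hC) (integrable_of_bound _ hf hC),
    integral_add_measure (integrable_of_bound _ hf hC) (integrable_of_bound _ hf hC)]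
  unfold integ
  ring

theorem integ_neg (μ : SignedMeasure X) (f : X → ℝ) : integ (-μ) f = -integ μ f := by
  unfold integ pos neg
  rw [SignedMeasure.toJordanDecomposition_neg, JordanDecomposition.neg_posPart,
    JordanDecomposition.neg_negPart]
  ring

theorem integ_smul (c : ℝ) (μ : SignedMeasure X) (f : X → ℝ) : integ (c • μ) f = c * integ μ f := by
  unfold integ pos neg
  rw [SignedMeasure.toJordanDecomposition_smul_real]
  rcases le_or_gt 0 c with hc | hc
  · rw [JordanDecomposition.real_smul_posPart_nonneg _ _ hc,
      JordanDecomposition.real_smul_negPart_nonneg _ _ hc, integral_smul_nnreal_measure,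
      integral_smul_nnreal_measure, NNReal.smul_def, NNReal.smul_def, Real.coe_toNNReal _ hc,
      smul_eq_mul, smul_eq_mul]
    ring
  · rw [JordanDecomposition.real_smul_posPart_neg _ _ hc,
      JordanDecomposition.real_smul_negPart_neg _ _ hc, integral_smul_nnreal_measure,
      integral_smul_nnreal_measure, NNReal.smul_def, NNReal.smul_def,
      Real.coe_toNNReal _ (neg_nonneg.2 hc.le), smul_eq_mul, smul_eq_mul]
    ring

theorem integ_sub_measure (μ ν : SignedMeasure X) {f : X → ℝ}
    (hf : Measurable f) {C : ℝ} (hC : ∀ x, |f x| ≤ C) :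
    integ (μ - ν) f = integ μ f - integ ν f := by
  rw [sub_eq_add_neg, integ_add _ _ hf hC, integ_neg, sub_eq_add_neg]

theorem integ_sub_fun (μ : SignedMeasure X) {f g : X → ℝ} (hf : Measurable f) (hg : Measurable g)
    {C : ℝ} (hC : ∀ x, |f x| ≤ C) {C' : ℝ} (hC' : ∀ x, |g x| ≤ C') :
    integ μ (fun x => f x - g x) = integ μ f - integ μ g := by
  unfold integ
  rw [integral_sub (integrable_of_bound _ hf hC) (integrable_of_bound _ hg hC'),
    integral_sub (integrable_of_bound _ hf hC) (integrable_of_bound _ hg hC')]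
  ring

theorem integ_indicator (μ : SignedMeasure X) {A : Set X} (hA : MeasurableSet A) :
    integ μ (A.indicator 1) = μ A := by
  unfold integ
  rw [integral_indicator_one hA, integral_indicator_one hA]
  exact (μ.apply_eq_posPart_real_sub_negPart_real hA).symm

theorem abs_integ_le (μ : SignedMeasure X) (f : X → ℝ) {g : X → ℝ}
    (hg : Integrable g μ.totalVariation) (h : ∀ x, |f x| ≤ g x) :
    |integ μ f| ≤ ∫ x, g x ∂μ.totalVariation := by
  have h1 : Integrable g (pos μ) := hg.left_of_add_measure
  have h2 : Integrable g (neg μ) := hg.right_of_add_measure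
  have e : ∫ x, g x ∂μ.totalVariation = ∫ x, g x ∂pos μ + ∫ x, g x ∂neg μ :=
    integral_add_measure h1 h2
  rw [e]
  unfold integ
  refine (abs_sub _ _).trans (add_le_add ?_ ?_)
  · exact norm_integral_le_of_norm_le (f := f) h1 (ae_of_all _ h)
  · exact norm_integral_le_of_norm_le (f := f) h2 (ae_of_all _ h)

instance (μ : SignedMeasure X) : IsFiniteMeasure μ.totalVariation := by
  unfold SignedMeasure.totalVariation; infer_instance

/-! ### The total variation norm -/

open Kawasaki in
theorem tvNorm_ne_top (μ : SignedMeasure X) : tvNorm μ ≠ ∞ := measure_ne_top _ _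

open Kawasaki in
theorem abs_le_tvNorm (μ : SignedMeasure X) {A : Set X} (hA : MeasurableSet A) :
    |μ A| ≤ (tvNorm μ).toReal := by
  have := abs_integ_le μ (A.indicator 1) (g := fun _ => 1) (integrable_const _) (fun x => by
    by_cases h : x ∈ A <;> simp [h])
  rw [integ_indicator μ hA] at this
  simpa [tvNorm, Measure.real] using this

open Kawasaki in
-- The norm is the value on a Hahn set minus the value on its complement, hence the factor `2`.
-- Convergence in norm thus follows from uniform convergence on sets.
theorem tvNorm_le (μ : SignedMeasure X) {C : ℝ} (h : ∀ A, MeasurableSet A → |μ A| ≤ C) :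
    tvNorm μ ≤ ENNReal.ofReal (2 * C) := by
  obtain ⟨i, hi, h0, h1, hp, hn⟩ := μ.toJordanDecomposition_spec
  have e : (tvNorm μ).toReal = μ i - μ iᶜ := by
    unfold tvNorm SignedMeasure.totalVariation
    rw [hp, hn, Measure.add_apply, SignedMeasure.toMeasureOfZeroLE_apply _ _ _ .univ,
      SignedMeasure.toMeasureOfLEZero_apply _ _ _ .univ]
    rw [ENNReal.toReal_add ENNReal.coe_ne_top ENNReal.coe_ne_top]
    simp [sub_eq_add_neg]
  rw [← ENNReal.ofReal_toReal (tvNorm_ne_top μ), e]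
  apply ENNReal.ofReal_le_ofReal
  have := abs_le.1 (h i hi)
  have := abs_le.1 (h iᶜ hi.compl)
  linarith

open Kawasaki in
theorem tendsto_tvNorm {ι : Type*} {l : Filter ι} (μ : ι → SignedMeasure X) (b : ι → ℝ)
    (hb : Tendsto b l (𝓝 0)) (h : ∀ᶠ i in l, ∀ A, MeasurableSet A → |μ i A| ≤ b i) :
    Tendsto (fun i => tvNorm (μ i)) l (𝓝 0) := by
  have h2 : Tendsto (fun i => ENNReal.ofReal (2 * b i)) l (𝓝 0) := by
    have := ENNReal.tendsto_ofReal (hb.const_mul 2)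
    simpa using this
  exact tendsto_of_tendsto_of_tendsto_of_le_of_le' tendsto_const_nhds h2
    (Eventually.of_forall fun _ => zero_le) (h.mono fun i hi => tvNorm_le _ hi)

/-! ### The action of a Markov kernel -/

theorem measurable_real (κ : Kernel X Y) {A : Set Y} (hA : MeasurableSet A) :
    Measurable fun x => (κ x).real A := (κ.measurable_coe hA).ennreal_toReal

theorem abs_real_le (κ : Kernel X Y) [IsMarkovKernel κ] (A : Set Y) (x : X) : |(κ x).real A| ≤ 1 := by
  rw [abs_of_nonneg measureReal_nonneg]
  exact measureReal_le_one

theorem bind_real (κ : Kernel X Y) [IsMarkovKernel κ] (ρ : Measure X) {A : Set Y}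
    (hA : MeasurableSet A) : (ρ.bind κ).real A = ∫ x, (κ x).real A ∂ρ := by
  rw [Measure.real, Measure.bind_apply hA κ.aemeasurable]
  exact (integral_toReal (κ.measurable_coe hA).aemeasurable
    (ae_of_all _ fun x => measure_lt_top _ _)).symm

theorem act_aux (κ : Kernel X Y) [IsMarkovKernel κ] (μ : SignedMeasure X) {A : Set Y}
    (hA : MeasurableSet A) :
    (((pos μ).bind κ).toSignedMeasure - ((neg μ).bind κ).toSignedMeasure) A
      = integ μ fun x => (κ x).real A := by
  rw [Measure.toSignedMeasure_sub_apply hA, bind_real _ _ hA, bind_real _ _ hA]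
  rfl

/-- The operator on signed measures given by a Markov kernel. -/
def act (κ : Kernel X Y) [IsMarkovKernel κ] : SignedMeasure X →ₗ[ℝ] SignedMeasure Y where
  toFun μ := ((pos μ).bind κ).toSignedMeasure - ((neg μ).bind κ).toSignedMeasure
  map_add' μ ν := by
    ext A hA
    rw [act_aux _ _ hA, integ_add _ _ (measurable_real κ hA) (abs_real_le κ A), ← act_aux _ _ hA,
      ← act_aux _ _ hA]
    rfl
  map_smul' c μ := by
    ext A hA
    rw [act_aux _ _ hA, integ_smul, ← act_aux _ _ hA]
    rfl

theorem act_apply (κ : Kernel X Y) [IsMarkovKernel κ] (μ : SignedMeasure X) {A : Set Y}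
    (hA : MeasurableSet A) : act κ μ A = integ μ fun x => (κ x).real A := act_aux κ μ hA

theorem integral_bind_kernel (κ : Kernel X Y) [IsMarkovKernel κ] (ρ : Measure X) [IsFiniteMeasure ρ]
    {f : Y → ℝ} (hf : Measurable f) {C : ℝ} (hC : ∀ x, |f x| ≤ C) :
    ∫ y, f y ∂ρ.bind κ = ∫ x, ∫ y, f y ∂κ x ∂ρ := by
  have h := Kernel.integral_comp (η := κ) (κ := Kernel.const Unit ρ) (a := ()) (f := f)
    (integrable_of_bound _ hf hC)
  rwa [Kernel.comp_apply, Kernel.const_apply] at h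

theorem integ_act (κ : Kernel X Y) [IsMarkovKernel κ] (μ : SignedMeasure X) {f : Y → ℝ}
    (hf : Measurable f) {C : ℝ} (hC : ∀ x, |f x| ≤ C) :
    integ (act κ μ) f = integ μ fun x => ∫ y, f y ∂κ x := by
  have h := integ_sub ((pos μ).bind κ) ((neg μ).bind κ) hf hC
  rw [integral_bind_kernel κ _ hf hC, integral_bind_kernel κ _ hf hC] at h
  exact h

theorem act_sub_toSignedMeasure (κ : Kernel X Y) [IsMarkovKernel κ] (ρ₁ ρ₂ : Measure X)
    [IsFiniteMeasure ρ₁] [IsFiniteMeasure ρ₂] :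
    act κ (ρ₁.toSignedMeasure - ρ₂.toSignedMeasure)
      = (ρ₁.bind κ).toSignedMeasure - (ρ₂.bind κ).toSignedMeasure := by
  ext A hA
  rw [act_apply _ _ hA, integ_sub _ _ (measurable_real κ hA) (abs_real_le κ A),
    Measure.toSignedMeasure_sub_apply hA, bind_real _ _ hA, bind_real _ _ hA]

open Kawasaki in
theorem abs_integ_le_tvNorm (μ : SignedMeasure X) (f : X → ℝ) {C : ℝ} (hC : ∀ x, |f x| ≤ C) :
    |integ μ f| ≤ C * (tvNorm μ).toReal := by
  have := abs_integ_le μ f (g := fun _ => C) (integrable_const _) hC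
  simpa [tvNorm, Measure.real, mul_comm] using this

open Kawasaki in
theorem abs_act_le (κ : Kernel X Y) [IsMarkovKernel κ] (μ : SignedMeasure X) {A : Set Y}
    (hA : MeasurableSet A) : |act κ μ A| ≤ (tvNorm μ).toReal := by
  rw [act_apply κ μ hA]
  simpa using abs_integ_le_tvNorm μ _ (abs_real_le κ A)

theorem integ_intervalIntegral (μ : SignedMeasure X) {k : ℝ → X → ℝ}
    (hk : Measurable (Function.uncurry k)) {C : ℝ} (hC : ∀ s x, |k s x| ≤ C) (t : ℝ) (ht : 0 ≤ t) :
    integ μ (fun x => ∫ s in (0 : ℝ)..t, k s x) = ∫ s in (0 : ℝ)..t, integ μ (k s) := by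
  have h1 : ∀ ρ : Measure X, IsFiniteMeasure ρ →
      ∫ x, (∫ s in (0 : ℝ)..t, k s x) ∂ρ = ∫ s in (0 : ℝ)..t, ∫ x, k s x ∂ρ := by
    intro ρ _
    simp only [intervalIntegral.integral_of_le ht]
    refine integral_integral_swap (f := fun x s => k s x) ?_
    exact integrable_of_bound _ (hk.comp measurable_swap) fun q => hC _ _
  have h2 : ∀ ρ : Measure X, IsFiniteMeasure ρ →
      IntervalIntegrable (fun s => ∫ x, k s x ∂ρ) volume 0 t := by
    intro ρ _
    rw [intervalIntegrable_iff_integrableOn_Ioc_of_le ht]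
    have h3 : Integrable (Function.uncurry k) ((volume.restrict (Ioc 0 t)).prod ρ) :=
      integrable_of_bound _ hk fun q => hC _ _
    exact h3.integral_prod_left
  unfold integ
  rw [h1 _ inferInstance, h1 _ inferInstance,
    intervalIntegral.integral_sub (h2 _ inferInstance) (h2 _ inferInstance)]

end SignedAction

/-! ### Time regularity of the kernels, the backward equation and the semigroup. -/

namespace JumpData

open SignedAction Kawasaki

variable {X : Type*} [MeasurableSpace X] (D : JumpData X)

/-! ### Regularity of the transition kernels in time -/

/-- With probability `e^{-rate t}` no jump has occurred up to `t`; the term with `J` in the renewal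
equation is dropped. -/
theorem dirac_le_p (t : ℝ≥0) (x : X) :
    ENNReal.ofReal (Real.exp (-D.rate x * t)) • Measure.dirac x ≤ D.p t x := by
  refine Measure.le_iff.2 fun A hA => ?_
  have := D.renewal_p (A.indicator 1) (measurable_one.indicator hA) t x
  rw [lintegral_indicator_one hA] at this
  rw [this, Measure.smul_apply, Measure.dirac_apply' _ hA, smul_eq_mul]
  exact le_self_add

theorem exp_le_integral_p (t : ℝ≥0) (x : X) {f : X → ℝ} (hf : Measurable f) (h0 : ∀ x, 0 ≤ f x)
    (h1 : ∀ x, f x ≤ 1) : Real.exp (-D.rate x * t) * f x ≤ ∫ y, f y ∂D.p t x := by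
  have hb : ∀ x, |f x| ≤ 1 := fun x => abs_le.2 ⟨by linarith [h0 x], h1 x⟩
  have := integral_mono_measure (D.dirac_le_p t x) (ae_of_all _ h0) (integrable_of_bound _ hf hb)
  rw [integral_smul_measure, integral_dirac' _ _ hf.stronglyMeasurable,
    ENNReal.toReal_ofReal (Real.exp_nonneg _)] at this
  exact this

/-- The lower bound `exp_le_integral_p` for `f` and for `1 - f` gives the two sides. -/
theorem abs_integral_p_sub_le (t : ℝ≥0) (x : X) {f : X → ℝ} (hf : Measurable f) (h0 : ∀ x, 0 ≤ f x)
    (h1 : ∀ x, f x ≤ 1) : |∫ y, f y ∂D.p t x - f x| ≤ 1 - Real.exp (-D.rate x * t) := by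
  have hb : ∀ x, |f x| ≤ 1 := fun x => abs_le.2 ⟨by linarith [h0 x], h1 x⟩
  have e1 := D.exp_le_integral_p t x hf h0 h1
  have e2 := D.exp_le_integral_p t x (f := fun y => 1 - f y) (measurable_const.sub hf)
    (fun y => sub_nonneg.2 (h1 y)) (fun y => sub_le_self _ (h0 y))
  rw [integral_sub (integrable_const _) (integrable_of_bound _ hf hb)] at e2
  simp only [integral_const, probReal_univ, smul_eq_mul, mul_one] at e2
  have h3 : Real.exp (-D.rate x * t) ≤ 1 := Real.exp_le_one_iff.2
    (mul_nonpos_of_nonpos_of_nonneg (neg_nonpos.2 (D.rate_pos x).le) t.coe_nonneg)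
  have := h0 x
  have := h1 x
  rw [abs_le]
  constructor <;> nlinarith

theorem p_real_add (s t : ℝ≥0) (x : X) {A : Set X} (hA : MeasurableSet A) :
    (D.p (s + t) x).real A = ∫ y, (D.p t y).real A ∂D.p s x := by
  have := D.lintegral_p_add s t x (A.indicator 1) (measurable_one.indicator hA)
  simp only [lintegral_indicator_one hA] at this
  rw [Measure.real, this]
  exact (integral_toReal ((D.p t).measurable_coe hA).aemeasurable
    (ae_of_all _ fun x => measure_lt_top _ _)).symm

/-- The short step `h` is taken first, so that the Lipschitz constant is the rate at the initial
point, and no average over the state at time `s` appears. -/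
theorem abs_p_real_sub_le (s h : ℝ≥0) (x : X) {A : Set X} (hA : MeasurableSet A) :
    |(D.p (s + h) x).real A - (D.p s x).real A| ≤ D.rate x * h := by
  rw [add_comm, D.p_real_add h s x hA]
  refine (D.abs_integral_p_sub_le h x (measurable_real _ hA) (fun _ => measureReal_nonneg)
    (fun _ => measureReal_le_one)).trans ?_
  have := Real.add_one_le_exp (-D.rate x * h)
  linarith

theorem continuous_p_real (x : X) {A : Set X} (hA : MeasurableSet A) :
    Continuous fun t : ℝ≥0 => (D.p t x).real A := by
  refine (LipschitzWith.of_dist_le_mul (K := (D.rate x).toNNReal) fun s t => ?_).continuous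
  rw [Real.coe_toNNReal _ (D.rate_pos x).le]
  wlog h : s ≤ t generalizing s t
  · rw [dist_comm, dist_comm s]
    exact this t s (le_of_not_ge h)
  obtain ⟨u, rfl⟩ := exists_add_of_le h
  rw [dist_comm, Real.dist_eq]
  refine (D.abs_p_real_sub_le s u x hA).trans_eq ?_
  rw [NNReal.dist_eq]
  push_cast
  rw [abs_sub_comm, add_sub_cancel_left, abs_of_nonneg u.coe_nonneg]

theorem measurable_p_real {A : Set X} (hA : MeasurableSet A) :
    Measurable (Function.uncurry fun (s : ℝ) (x : X) => (D.p s.toNNReal x).real A) :=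
  (measurable_real D.pJoint hA).comp (f := fun q : ℝ × X => (q.1.toNNReal, q.2)) (by fun_prop)

theorem p_zero_real (x : X) {A : Set X} (hA : MeasurableSet A) :
    (D.p 0 x).real A = A.indicator 1 x := by
  have h := D.abs_integral_p_sub_le 0 x (f := A.indicator 1) (measurable_one.indicator hA)
    (fun _ => indicator_nonneg (fun _ _ => zero_le_one) _)
    (fun _ => indicator_le_self' (fun _ _ => zero_le_one) _)
  rw [integral_indicator_one hA] at h
  simp only [NNReal.coe_zero, mul_zero, Real.exp_zero, sub_self] at h
  exact sub_eq_zero.1 (abs_nonpos_iff.1 h)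

/-! ### The backward equation -/

/-- `∫ p_s(y, A) K(x, dy)`. -/
def avgK (A : Set X) (s : ℝ) (x : X) : ℝ := ∫ y, (D.p s.toNNReal y).real A ∂D.K x

theorem measurable_avgK {A : Set X} (hA : MeasurableSet A) :
    Measurable (Function.uncurry (D.avgK A)) := by
  have h : StronglyMeasurable (Function.uncurry fun (q : ℝ × X) (y : X) =>
      (D.p q.1.toNNReal y).real A) :=
    ((D.measurable_p_real hA).comp (f := fun r : (ℝ × X) × X => (r.1.1, r.2))
      (by fun_prop)).stronglyMeasurable
  exact (h.integral_kernel_prod_right (κ := D.K.comap Prod.snd measurable_snd)).measurable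

theorem avgK_nonneg (A : Set X) (s : ℝ) (x : X) : 0 ≤ D.avgK A s x :=
  integral_nonneg fun _ => measureReal_nonneg

theorem avgK_le_one {A : Set X} (s : ℝ) (x : X) : D.avgK A s x ≤ 1 := by
  have : D.avgK A s x ≤ ∫ _, 1 ∂D.K x :=
    integral_mono_of_nonneg (ae_of_all _ fun _ => measureReal_nonneg) (integrable_const _)
      (ae_of_all _ fun _ => measureReal_le_one)
  simpa using this

theorem continuous_avgK {A : Set X} (hA : MeasurableSet A) (x : X) :
    Continuous fun s => D.avgK A s x := by
  refine continuous_of_dominated (bound := fun _ => 1) (fun s => ?_)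
    (fun s => ae_of_all _ fun y => abs_real_le _ _ _) (integrable_const _)
    (ae_of_all _ fun y => (D.continuous_p_real y hA).comp continuous_real_toNNReal)
  exact (measurable_real _ hA).aestronglyMeasurable

/-- The differential equation is the renewal equation in differentiated form, so `J_le_of_deriv`
yields one inequality. Its use for `A` and for the complement gives equality in `backward`. -/
theorem p_real_le_of_deriv (x : X) {A : Set X} (hA : MeasurableSet A) (t : ℝ≥0) (g : ℝ → ℝ)
    (hg : ∀ r, HasDerivAt g (D.rate x * (D.avgK A r x - g r)) r)
    (hg0 : g 0 = A.indicator 1 x) : (D.p t x).real A ≤ g t := by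
  have hr := D.rate_pos x
  have hgc : Continuous g := continuous_iff_continuousAt.2 fun r => (hg r).continuousAt
  have hkc := D.continuous_avgK hA x
  have hm : Measurable (Function.uncurry fun (s : ℝ≥0) (y : X) => D.p s y A) :=
    D.pJoint.measurable_coe hA
  have h0 : 0 ≤ g 0 := by rw [hg0]; exact indicator_nonneg (fun _ _ => zero_le_one) _
  have key := D.J_le_of_deriv hm x t g _ hg (by fun_prop) h0 (fun r _ => by
      have := D.avgK_nonneg A r x
      have e : D.rate x * g r + D.rate x * (D.avgK A r x - g r) = D.rate x * D.avgK A r x := by ring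
      rw [e]; positivity) (fun r _ => by
      have e : D.rate x * g r + D.rate x * (D.avgK A r x - g r) = D.rate x * D.avgK A r x := by ring
      rw [e, ENNReal.ofReal_mul hr.le]
      gcongr
      unfold avgK
      rw [Real.toNNReal_coe]
      simp only [Measure.real]
      rw [integral_toReal ((D.p r).measurable_coe hA).aemeasurable
        (ae_of_all _ fun x => measure_lt_top _ _), ENNReal.ofReal_toReal]
      exact (lt_of_le_of_lt (lintegral_mono fun y => prob_le_one) (by simp)).ne)
  have e := D.renewal_p (A.indicator 1) (measurable_one.indicator hA) t x
  simp only [lintegral_indicator_one hA] at e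
  rw [hg0, ENNReal.ofReal_mul (Real.exp_nonneg _)] at key
  have e2 : ENNReal.ofReal (A.indicator (1 : X → ℝ) x) = A.indicator 1 x := by
    by_cases h : x ∈ A <;> simp [h]
  rw [e2, ← e] at key
  -- `ENNReal.ofReal` forgets negative values, so the sign of `g` needs a separate argument:
  -- `e^{rate r} g(r)` has a nonnegative derivative and starts at an indicator.
  have h1 : 0 ≤ g t := by
    by_contra hneg
    rw [ENNReal.ofReal_of_nonpos (not_le.1 hneg).le] at key
    have hc : D.p t x Aᶜ = 1 := by
      rw [prob_compl_eq_one_iff hA]; exact le_antisymm key zero_le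
    have hmono : ∀ r ∈ Icc (0 : ℝ) t, 0 ≤ Real.exp (D.rate x * r) * g r := by
      intro r hr
      have hmon : MonotoneOn (fun r => Real.exp (D.rate x * r) * g r) (Icc 0 t) := by
        refine monotoneOn_of_deriv_nonneg (convex_Icc _ _) (by fun_prop) (fun r _ => ?_) fun r _ => ?_
        · exact (((hasDerivAt_id r).const_mul (D.rate x)).exp.mul (hg r)).differentiableAt.differentiableWithinAt
        · have := (((hasDerivAt_id r).const_mul (D.rate x)).exp.mul (hg r)).deriv
          simp only [id, mul_one] at this
          erw [this]
          have h5 := D.avgK_nonneg A r x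
          have : Real.exp (D.rate x * r) * D.rate x * g r + Real.exp (D.rate x * r) * (D.rate x * (D.avgK A r x - g r)) = Real.exp (D.rate x * r) * D.rate x * D.avgK A r x := by ring
          rw [this]; positivity
      have := hmon (left_mem_Icc.2 t.coe_nonneg) hr hr.1
      simp only [mul_zero, Real.exp_zero, one_mul] at this
      exact h0.trans this
    have := hmono t (right_mem_Icc.2 t.coe_nonneg)
    exact hneg (nonneg_of_mul_nonneg_right (by linarith) (Real.exp_pos _))
  exact ENNReal.toReal_le_of_le_ofReal h1 key

/-- The backward equation. -/
theorem backward (x : X) {A : Set X} (hA : MeasurableSet A) (t : ℝ≥0) :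
    (D.p t x).real A - A.indicator 1 x
      = ∫ s in (0 : ℝ)..t, D.rate x * (D.avgK A s x - (D.p s.toNNReal x).real A) := by
  have hkc := D.continuous_avgK hA x
  -- The variation-of-constants solution of the backward equation at the fixed point `x`, with
  -- `avgK` as a given source.
  set g : ℝ → ℝ := fun r => Real.exp (-D.rate x * r) *
    (A.indicator 1 x + ∫ s in (0 : ℝ)..r, D.rate x * Real.exp (D.rate x * s) * D.avgK A s x) with hgdef
  have hg : ∀ r, HasDerivAt g (D.rate x * (D.avgK A r x - g r)) r := fun r => by
    have h1 : HasDerivAt (fun r : ℝ => Real.exp (-D.rate x * r))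
        (Real.exp (-D.rate x * r) * (-D.rate x)) r := by
      simpa using ((hasDerivAt_id r).const_mul (-D.rate x)).exp
    have hc : Continuous fun s => D.rate x * Real.exp (D.rate x * s) * D.avgK A s x := by fun_prop
    have h2 := intervalIntegral.integral_hasDerivAt_right (hc.intervalIntegrable 0 r)
      hc.aestronglyMeasurable.stronglyMeasurableAtFilter hc.continuousAt
    refine (h1.mul (h2.const_add (A.indicator 1 x))).congr_deriv ?_
    have h3 : Real.exp (-D.rate x * r) * Real.exp (D.rate x * r) = 1 := by
      rw [← Real.exp_add]; simp
    rw [hgdef]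
    linear_combination D.rate x * D.avgK A r x * h3
  have hg0 : g 0 = A.indicator 1 x := by simp [hgdef]
  have h1 : ∀ t : ℝ≥0, (D.p t x).real A = g t := by
    intro t
    refine le_antisymm (D.p_real_le_of_deriv x hA t g hg hg0) ?_
    -- `1 - g` solves the equation of the complement, so the same one-sided bound gives the reverse
    -- inequality.
    have := D.p_real_le_of_deriv x hA.compl t (fun r => 1 - g r) (fun r => by
        refine ((hg r).const_sub 1).congr_deriv ?_
        have : D.avgK Aᶜ r x = 1 - D.avgK A r x := by
          unfold avgK
          simp only [probReal_compl_eq_one_sub hA]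
          rw [integral_sub (integrable_const _)
            (integrable_of_bound _ (measurable_real _ hA) (abs_real_le _ A))]
          simp
        rw [this]; ring) (by
        rw [hg0]
        by_cases h : x ∈ A <;> simp [h])
    rw [probReal_compl_eq_one_sub hA] at this
    linarith
  have hgc : Continuous g := continuous_iff_continuousAt.2 fun r => (hg r).continuousAt
  have hftc := intervalIntegral.integral_eq_sub_of_hasDerivAt (a := 0) (b := t) (fun s _ => hg s)
    ((by fun_prop : Continuous fun r => D.rate x * (D.avgK A r x - g r)).intervalIntegrable _ _)
  rw [h1, ← hg0, ← hftc]
  refine intervalIntegral.integral_congr fun s hs => ?_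
  rw [uIcc_of_le t.coe_nonneg] at hs
  have := h1 s.toNNReal
  rw [Real.coe_toNNReal _ hs.1] at this
  simp only [this]

/-! ### The semigroup on signed measures -/

/-- The semigroup on signed measures. -/
def semigroup (t : ℝ≥0) : SignedMeasure X →ₗ[ℝ] SignedMeasure X := act (D.p t)

theorem semigroup_apply (t : ℝ≥0) (μ : SignedMeasure X) {A : Set X} (hA : MeasurableSet A) :
    D.semigroup t μ A = integ μ fun x => (D.p t x).real A := act_apply _ _ hA

theorem semigroup_zero : D.semigroup 0 = LinearMap.id := by
  ext μ A hA
  rw [semigroup_apply _ _ _ hA, LinearMap.id_apply, ← integ_indicator μ hA]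
  congr 1
  funext x
  exact D.p_zero_real x hA

theorem semigroup_add (s t : ℝ≥0) : D.semigroup (s + t) = D.semigroup s ∘ₗ D.semigroup t := by
  ext μ A hA
  rw [semigroup_apply _ _ _ hA, LinearMap.comp_apply, semigroup_apply _ _ _ hA]
  unfold semigroup
  rw [integ_act _ _ (measurable_real _ hA) (abs_real_le _ A)]
  congr 1
  funext x
  rw [add_comm, D.p_real_add t s x hA]

/-- The modulus of the strong continuity. -/
def err (μ : SignedMeasure X) (t : ℝ) : ℝ := ∫ x, (1 - Real.exp (-D.rate x * t)) ∂μ.totalVariation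

theorem measurable_err_integrand (t : ℝ) : Measurable fun x => 1 - Real.exp (-D.rate x * t) := by
  have := D.measurable_rate
  fun_prop

theorem err_integrand_bound {t : ℝ} (ht : 0 ≤ t) (x : X) : |1 - Real.exp (-D.rate x * t)| ≤ 1 := by
  have h3 : Real.exp (-D.rate x * t) ≤ 1 := Real.exp_le_one_iff.2
    (mul_nonpos_of_nonpos_of_nonneg (neg_nonpos.2 (D.rate_pos x).le) ht)
  have := Real.exp_pos (-D.rate x * t)
  rw [abs_le]; constructor <;> linarith

theorem err_mono (μ : SignedMeasure X) {s t : ℝ} (hs : 0 ≤ s) (h : s ≤ t) : D.err μ s ≤ D.err μ t := by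
  refine integral_mono (integrable_of_bound _ (D.measurable_err_integrand s) (D.err_integrand_bound hs))
    (integrable_of_bound _ (D.measurable_err_integrand t) (D.err_integrand_bound (hs.trans h)))
    fun x => ?_
  have := D.rate_pos x
  simp only [neg_mul, tsub_le_iff_right]
  have : Real.exp (-(D.rate x * t)) ≤ Real.exp (-(D.rate x * s)) := by gcongr
  linarith

/-- The rate need not be bounded, so there is no uniform modulus; dominated convergence under the
total variation of `μ` gives strong continuity. -/
theorem tendsto_err (μ : SignedMeasure X) : Tendsto (D.err μ) (𝓝[≥] 0) (𝓝 0) := by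
  have h := tendsto_integral_filter_of_dominated_convergence (μ := μ.totalVariation)
    (l := 𝓝[≥] (0 : ℝ)) (F := fun t x => 1 - Real.exp (-D.rate x * t)) (f := fun _ => 0)
    (fun _ => 1) (Eventually.of_forall fun t => (D.measurable_err_integrand t).aestronglyMeasurable)
    (by filter_upwards [self_mem_nhdsWithin] with t ht
        exact ae_of_all _ (D.err_integrand_bound ht)) (integrable_const _)
    (ae_of_all _ fun x => by
      have : Continuous fun t : ℝ => 1 - Real.exp (-D.rate x * t) := by fun_prop
      have := this.tendsto 0
      simp only [mul_zero, Real.exp_zero, sub_self] at this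
      exact this.mono_left nhdsWithin_le_nhds)
  rw [integral_zero] at h
  exact h

theorem abs_semigroup_sub_le (μ : SignedMeasure X) (t : ℝ≥0) {A : Set X} (hA : MeasurableSet A) :
    |D.semigroup t μ A - μ A| ≤ D.err μ t := by
  rw [semigroup_apply _ _ _ hA, ← integ_indicator μ hA, ← integ_sub_fun _ (measurable_real _ hA)
    (measurable_one.indicator hA) (abs_real_le _ A) (C' := 1)
    (fun x => by by_cases h : x ∈ A <;> simp [h])]
  refine abs_integ_le _ _ (integrable_of_bound _ (D.measurable_err_integrand t)
    (D.err_integrand_bound t.coe_nonneg)) fun x => ?_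
  have := D.abs_integral_p_sub_le t x (f := A.indicator 1) (measurable_one.indicator hA)
    (fun _ => indicator_nonneg (fun _ _ => zero_le_one) _)
    (fun _ => indicator_le_self' (fun _ _ => zero_le_one) _)
  rwa [integral_indicator_one hA] at this

theorem isStochasticSemigroup : IsStochasticSemigroup D.semigroup where
  zero := D.semigroup_zero
  add := D.semigroup_add
  nonneg t μ hμ := by
    have h0 : 0 ≤[univ] μ := (VectorMeasure.le_restrict_univ_iff_le _ _).2 hμ
    have e : μ = (μ.toMeasureOfZeroLE univ .univ h0).toSignedMeasure
        - (0 : Measure X).toSignedMeasure := by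
      rw [SignedMeasure.toMeasureOfZeroLE_toSignedMeasure, Measure.toSignedMeasure_zero, sub_zero]
    rw [e, semigroup, act_sub_toSignedMeasure]
    refine VectorMeasure.le_iff.2 fun A hA => ?_
    rw [Measure.toSignedMeasure_sub_apply hA]
    simp
  mass t μ := by
    rw [semigroup_apply _ _ _ .univ, ← integ_indicator μ .univ]
    simp only [probReal_univ, indicator_univ]
    rfl
  continuous μ := by
    have h : Tendsto (fun t : ℝ≥0 => D.err μ t) (𝓝 0) (𝓝 0) := by
      refine (D.tendsto_err μ).comp (tendsto_nhdsWithin_iff.2 ⟨?_, Eventually.of_forall fun t => ?_⟩)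
      · exact (NNReal.continuous_coe.tendsto 0)
      · exact t.coe_nonneg
    exact tendsto_tvNorm _ _ h (Eventually.of_forall fun t A hA => by
      simpa using D.abs_semigroup_sub_le μ t hA)

theorem isTransitionFunction : IsTransitionFunction D.semigroup D.p := fun t => ⟨inferInstance,
  fun x A hA => by
    have e : (Measure.dirac x).toSignedMeasure
        = (Measure.dirac x).toSignedMeasure - (0 : Measure X).toSignedMeasure := by
      rw [Measure.toSignedMeasure_zero, sub_zero]
    rw [e, semigroup, act_sub_toSignedMeasure, Measure.toSignedMeasure_sub_apply hA]
    simp [Measure.dirac_bind (D.p t).measurable]⟩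

theorem continuous_semigroup (μ : SignedMeasure X) {A : Set X} (hA : MeasurableSet A) :
    Continuous fun t : ℝ≥0 => D.semigroup t μ A := by
  have h : ∀ ρ : Measure X, IsFiniteMeasure ρ →
      Continuous fun t : ℝ≥0 => ∫ x, (D.p t x).real A ∂ρ := fun ρ _ =>
    continuous_of_dominated (bound := fun _ => 1)
      (fun t => (measurable_real _ hA).aestronglyMeasurable)
      (fun t => ae_of_all _ (abs_real_le _ A)) (integrable_const _)
      (ae_of_all _ fun x => D.continuous_p_real x hA)
  simp only [D.semigroup_apply _ _ hA]
  exact (h _ inferInstance).sub (h _ inferInstance)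

theorem continuous_semigroup_real (μ : SignedMeasure X) {A : Set X} (hA : MeasurableSet A) :
    Continuous fun t : ℝ => D.semigroup t.toNNReal μ A :=
  (D.continuous_semigroup μ hA).comp continuous_real_toNNReal

theorem abs_average_sub_le (μ : SignedMeasure X) (h : ℝ≥0) (hh : 0 < h) {A : Set X}
    (hA : MeasurableSet A) :
    |(h : ℝ)⁻¹ * (∫ s in (0 : ℝ)..h, D.semigroup s.toNNReal μ A) - μ A| ≤ D.err μ h := by
  have hh' : (0 : ℝ) < h := hh
  have hc := D.continuous_semigroup_real μ hA
  have e : (h : ℝ)⁻¹ * (∫ s in (0 : ℝ)..h, D.semigroup s.toNNReal μ A) - μ A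
      = (h : ℝ)⁻¹ * ∫ s in (0 : ℝ)..h, (D.semigroup s.toNNReal μ A - μ A) := by
    rw [intervalIntegral.integral_sub (hc.intervalIntegrable _ _) (by simp)]
    simp
    field_simp
  have b := intervalIntegral.norm_integral_le_of_norm_le_const (a := 0) (b := h)
    (f := fun s => D.semigroup s.toNNReal μ A - μ A) (C := D.err μ h) fun s hs => by
      rw [uIoc_of_le hh'.le] at hs
      refine (D.abs_semigroup_sub_le μ s.toNNReal hA).trans ?_
      rw [Real.coe_toNNReal _ hs.1.le]
      exact D.err_mono μ hs.1.le hs.2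
  rw [sub_zero, abs_of_pos hh', Real.norm_eq_abs] at b
  rw [e, abs_mul, abs_of_pos (inv_pos.2 hh')]
  calc _ ≤ (h : ℝ)⁻¹ * (D.err μ h * h) := by gcongr
    _ = _ := by field_simp

end JumpData

/-! ### The generator is the closure of the predual operator. -/

namespace JumpData

open SignedAction Kawasaki

variable {X : Type*} [MeasurableSpace X] (D : JumpData X)

/-! ### The integrated form of the generator -/

/-- `S(t) μ - μ = ∫₀ᵗ S(s) ν ds`. -/
def Integrated (μ ν : SignedMeasure X) : Prop := ∀ (t : ℝ≥0) A, MeasurableSet A →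
  D.semigroup t μ A - μ A = ∫ s in (0 : ℝ)..t, D.semigroup s.toNNReal ν A

/-- The difference quotient is the time average of `S(s) ν`, which is close to `ν` uniformly on sets
by `abs_average_sub_le`. -/
theorem mem_generatorGraph_of_integrated {μ ν : SignedMeasure X} (h : D.Integrated μ ν) :
    (μ, ν) ∈ generatorGraph D.semigroup := by
  have h1 : Tendsto (fun t : ℝ≥0 => D.err ν t) (𝓝[>] 0) (𝓝 0) := by
    refine (D.tendsto_err ν).comp (tendsto_nhdsWithin_iff.2 ⟨?_, Eventually.of_forall fun t => ?_⟩)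
    · exact (NNReal.continuous_coe.tendsto 0).mono_left nhdsWithin_le_nhds
    · exact t.coe_nonneg
  refine tendsto_tvNorm _ _ h1 ?_
  filter_upwards [self_mem_nhdsWithin] with t ht A hA
  have := D.abs_average_sub_le ν t ht hA
  rw [← h t A hA] at this
  simpa using this

theorem integrated_unique {μ ν ν' : SignedMeasure X} (h : D.Integrated μ ν)
    (h' : D.Integrated μ ν') : ν = ν' := by
  ext A hA
  have h1 := h
  have key : ∀ ν'' : SignedMeasure X, D.Integrated μ ν'' →
      Tendsto (fun t : ℝ≥0 => (t : ℝ)⁻¹ * (D.semigroup t μ A - μ A)) (𝓝[>] 0) (𝓝 (ν'' A)) := by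
    intro ν'' h
    have h1 : Tendsto (fun t : ℝ≥0 => D.err ν'' t) (𝓝[>] 0) (𝓝 0) := by
      refine (D.tendsto_err ν'').comp (tendsto_nhdsWithin_iff.2 ⟨?_, Eventually.of_forall fun t => ?_⟩)
      · exact (NNReal.continuous_coe.tendsto 0).mono_left nhdsWithin_le_nhds
      · exact t.coe_nonneg
    rw [tendsto_iff_norm_sub_tendsto_zero]
    refine tendsto_of_tendsto_of_tendsto_of_le_of_le' tendsto_const_nhds h1
      (Eventually.of_forall fun _ => norm_nonneg _) ?_
    filter_upwards [self_mem_nhdsWithin] with t ht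
    rw [h t A hA]
    exact D.abs_average_sub_le ν'' t ht hA
  exact tendsto_nhds_unique (key ν h) (key ν' h')

/-- Each `S(s)` moves values on sets by at most the norm of the perturbation. An `ε`-approximation
therefore changes the integrated identity by at most `(2 + t) ε`. -/
theorem integrated_of_mem_tvClosure {G : Set (SignedMeasure X × SignedMeasure X)}
    (hG : ∀ r ∈ G, D.Integrated r.1 r.2) {q : SignedMeasure X × SignedMeasure X}
    (hq : q ∈ tvClosure G) : D.Integrated q.1 q.2 := by
  intro t A hA
  have key : ∀ ε : ℝ, 0 < ε → |D.semigroup t q.1 A - q.1 A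
      - ∫ s in (0 : ℝ)..t, D.semigroup s.toNNReal q.2 A| ≤ (2 + t) * ε := by
    intro ε hε
    obtain ⟨r, hr, h1, h2⟩ := hq (ENNReal.ofReal ε) (ENNReal.ofReal_pos.2 hε)
    have h1' : (tvNorm (q.1 - r.1)).toReal ≤ ε := ENNReal.toReal_le_of_le_ofReal hε.le h1.le
    have h2' : (tvNorm (q.2 - r.2)).toReal ≤ ε := ENNReal.toReal_le_of_le_ofReal hε.le h2.le
    have e := hG r hr t A hA
    have b1 := (abs_act_le (D.p t) (q.1 - r.1) hA).trans h1'
    have b2 := (abs_le_tvNorm (q.1 - r.1) hA).trans h1'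
    have b3 := intervalIntegral.norm_integral_le_of_norm_le_const (a := 0) (b := t)
      (f := fun s => D.semigroup s.toNNReal (q.2 - r.2) A) (C := ε)
      fun s _ => (abs_act_le _ _ hA).trans h2'
    rw [sub_zero, abs_of_nonneg t.coe_nonneg, Real.norm_eq_abs] at b3
    have e2 : ∫ s in (0 : ℝ)..t, D.semigroup s.toNNReal (q.2 - r.2) A
        = (∫ s in (0 : ℝ)..t, D.semigroup s.toNNReal q.2 A)
          - ∫ s in (0 : ℝ)..t, D.semigroup s.toNNReal r.2 A := by
      rw [← intervalIntegral.integral_sub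
        ((D.continuous_semigroup_real _ hA).intervalIntegrable _ _)
        ((D.continuous_semigroup_real _ hA).intervalIntegrable _ _)]
      simp
    have e3 : D.semigroup t (q.1 - r.1) A = D.semigroup t q.1 A - D.semigroup t r.1 A := by simp
    change |D.semigroup t (q.1 - r.1) A| ≤ _ at b1
    rw [e3] at b1
    rw [e2] at b3
    have e4 : (q.1 - r.1) A = q.1 A - r.1 A := by simp
    rw [e4] at b2
    rw [abs_le] at *
    constructor <;> linarith
  have h0 : Tendsto (fun ε : ℝ => (2 + (t : ℝ)) * ε) (𝓝[>] 0) (𝓝 0) := by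
    have : Tendsto (fun ε : ℝ => (2 + (t : ℝ)) * ε) (𝓝 0) (𝓝 ((2 + (t : ℝ)) * 0)) :=
      (by fun_prop : Continuous fun ε : ℝ => (2 + (t : ℝ)) * ε).tendsto 0
    rw [mul_zero] at this
    exact this.mono_left nhdsWithin_le_nhds
  have := ge_of_tendsto (x := 𝓝[>] (0 : ℝ)) h0 (by
    filter_upwards [self_mem_nhdsWithin] with ε hε
    exact key ε hε)
  exact sub_eq_zero.1 (abs_nonpos_iff.1 this)

/-! ### The predual of the Kolmogorov operator -/

/-- The graph of the predual operator. -/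
def predual : Set (SignedMeasure X × SignedMeasure X) :=
  {q | ∫⁻ x, ENNReal.ofReal (D.U x) ∂q.1.totalVariation < ∞ ∧ ∀ A, MeasurableSet A →
    q.2 A = integ q.1 fun x => D.rate x * ((D.K x).real A - A.indicator 1 x)}

/-- `w` is `rate · μ`, a finite measure because `rate ≤ C U`. It serves to write the unbounded
operator as `L† μ = w K - w`, with bounded operations on `w`. -/
theorem exists_weighted (μ : SignedMeasure X)
    (hμ : ∫⁻ x, ENNReal.ofReal (D.U x) ∂μ.totalVariation < ∞) : ∃ w : SignedMeasure X,
      ∀ f : X → ℝ, Measurable f → ∀ C, (∀ x, |f x| ≤ C) →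
        integ w f = integ μ fun x => D.rate x * f x := by
  have hr : Measurable fun x => ENNReal.ofReal (D.rate x) := D.measurable_rate.ennreal_ofReal
  have h1 : ∫⁻ x, ENNReal.ofReal (D.rate x) ∂μ.totalVariation < ∞ := by
    calc _ ≤ ∫⁻ x, ENNReal.ofReal D.C * ENNReal.ofReal (D.U x) ∂μ.totalVariation :=
          lintegral_mono fun x => by
            rw [← ENNReal.ofReal_mul D.C_nonneg]
            exact ENNReal.ofReal_le_ofReal (D.rate_le x)
      _ = ENNReal.ofReal D.C * ∫⁻ x, ENNReal.ofReal (D.U x) ∂μ.totalVariation :=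
          lintegral_const_mul _ D.measurable_U.ennreal_ofReal
      _ < ∞ := ENNReal.mul_lt_top ENNReal.ofReal_lt_top hμ
  unfold SignedMeasure.totalVariation at h1
  rw [lintegral_add_measure, ENNReal.add_lt_top] at h1
  have f1 : IsFiniteMeasure ((pos μ).withDensity fun x => ENNReal.ofReal (D.rate x)) :=
    isFiniteMeasure_withDensity h1.1.ne
  have f2 : IsFiniteMeasure ((neg μ).withDensity fun x => ENNReal.ofReal (D.rate x)) :=
    isFiniteMeasure_withDensity h1.2.ne
  refine ⟨((pos μ).withDensity fun x => ENNReal.ofReal (D.rate x)).toSignedMeasure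
    - ((neg μ).withDensity fun x => ENNReal.ofReal (D.rate x)).toSignedMeasure, fun f hf C hC => ?_⟩
  rw [integ_sub _ _ hf hC, integral_withDensity_eq_integral_toReal_smul hr (by simp),
    integral_withDensity_eq_integral_toReal_smul hr (by simp)]
  simp only [ENNReal.toReal_ofReal (D.rate_pos _).le, smul_eq_mul]
  rfl

theorem predual_apply {μ w : SignedMeasure X}
    (hw : ∀ f : X → ℝ, Measurable f → ∀ C, (∀ x, |f x| ≤ C) →
      integ w f = integ μ fun x => D.rate x * f x) {A : Set X} (hA : MeasurableSet A) :
    (act D.K w - w) A = integ μ fun x => D.rate x * ((D.K x).real A - A.indicator 1 x) := by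
  have hi : ∀ x, |A.indicator (1 : X → ℝ) x| ≤ 1 := fun x => by
    by_cases h : x ∈ A <;> simp [h]
  have hm : Measurable fun x => (D.K x).real A - A.indicator (1 : X → ℝ) x :=
    (measurable_real D.K hA).sub (measurable_one.indicator hA)
  rw [← hw _ hm (1 + 1) fun x => (abs_sub _ _).trans (add_le_add (abs_real_le _ A x) (hi x)),
    integ_sub_fun _ (measurable_real _ hA) (measurable_one.indicator hA) (abs_real_le _ A) hi,
    integ_indicator w hA, ← act_apply _ _ hA, sub_apply]

theorem exists_predual (μ : SignedMeasure X)
    (hμ : ∫⁻ x, ENNReal.ofReal (D.U x) ∂μ.totalVariation < ∞) : ∃ ν, (μ, ν) ∈ D.predual := by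
  obtain ⟨w, hw⟩ := D.exists_weighted μ hμ
  exact ⟨act D.K w - w, hμ, fun A hA => D.predual_apply hw hA⟩

/-- Integrate the backward equation against `μ`. After the rate is absorbed into `w` the integrands
are bounded, so Fubini applies, and `w K - w` is recognised under `S(s)`. -/
theorem integrated_of_mem_predual {q : SignedMeasure X × SignedMeasure X} (hq : q ∈ D.predual) :
    D.Integrated q.1 q.2 := by
  obtain ⟨hμ, hν⟩ := hq
  obtain ⟨w, hw⟩ := D.exists_weighted q.1 hμ
  have hν' : q.2 = act D.K w - w := by
    ext A hA
    rw [hν A hA, D.predual_apply hw hA]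
  intro t A hA
  have hi : ∀ x, |A.indicator (1 : X → ℝ) x| ≤ 1 := fun x => by
    by_cases h : x ∈ A <;> simp [h]
  have hm : Measurable (Function.uncurry fun (s : ℝ) x => D.avgK A s x - (D.p s.toNNReal x).real A) :=
    (D.measurable_avgK hA).sub (D.measurable_p_real hA)
  have hb : ∀ (s : ℝ) x, |D.avgK A s x - (D.p s.toNNReal x).real A| ≤ 1 := fun s x => by
    have h1 := D.avgK_nonneg A s x
    have h2 := D.avgK_le_one (A := A) s x
    have h3 : 0 ≤ (D.p s.toNNReal x).real A := measureReal_nonneg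
    have h4 : (D.p s.toNNReal x).real A ≤ 1 := measureReal_le_one
    rw [abs_le]; constructor <;> linarith
  have e1 : D.semigroup t q.1 A - q.1 A
      = integ q.1 fun x => D.rate x * ∫ s in (0 : ℝ)..t, (D.avgK A s x - (D.p s.toNNReal x).real A) := by
    rw [D.semigroup_apply _ _ hA, ← integ_indicator q.1 hA, ← integ_sub_fun _ (measurable_real _ hA)
      (measurable_one.indicator hA) (abs_real_le _ A) hi]
    congr 1
    funext x
    rw [D.backward x hA t, intervalIntegral.integral_const_mul]
  have hI : ∀ x, |∫ s in (0 : ℝ)..t, (D.avgK A s x - (D.p s.toNNReal x).real A)| ≤ 1 * |(t : ℝ) - 0| :=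
    fun x => intervalIntegral.norm_integral_le_of_norm_le_const (f := fun s =>
      D.avgK A s x - (D.p s.toNNReal x).real A) fun s _ => hb s x
  have hIm : Measurable fun x => ∫ s in (0 : ℝ)..t, (D.avgK A s x - (D.p s.toNNReal x).real A) := by
    simp only [intervalIntegral.integral_of_le t.coe_nonneg]
    have h : StronglyMeasurable (Function.uncurry fun x (s : ℝ) =>
      D.avgK A s x - (D.p s.toNNReal x).real A) := (hm.comp measurable_swap).stronglyMeasurable
    exact h.integral_prod_right.measurable
  rw [e1, ← hw _ hIm _ hI, integ_intervalIntegral w hm hb _ t.coe_nonneg]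
  refine intervalIntegral.integral_congr fun s _ => ?_
  have hk : Measurable (D.avgK A s) := (D.measurable_avgK hA).comp measurable_prodMk_left
  have hkb : ∀ x, |D.avgK A s x| ≤ 1 := fun x => by
    rw [abs_of_nonneg (D.avgK_nonneg A s x)]; exact D.avgK_le_one s x
  rw [integ_sub_fun w hk (measurable_real _ hA) hkb (abs_real_le _ A), hν',
    D.semigroup_apply _ _ hA, integ_sub_measure _ _ (measurable_real _ hA) (abs_real_le _ A),
    integ_act _ _ (measurable_real _ hA) (abs_real_le _ A)]
  rfl

/-! ### The domain is a core -/

/-- The uniform distribution on `(0, h]`. -/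
def uniformTime (h : ℝ≥0) : Measure ℝ≥0 :=
  ((ENNReal.ofReal (h : ℝ)⁻¹) • (volume.restrict (Ioc (0 : ℝ) h))).map Real.toNNReal

theorem isProbabilityMeasure_uniformTime {h : ℝ≥0} (hh : 0 < h) :
    IsProbabilityMeasure (uniformTime h) := by
  have hh' : (0 : ℝ) < h := hh
  refine ⟨?_⟩
  rw [uniformTime, Measure.map_apply measurable_real_toNNReal .univ]
  simp only [preimage_univ, Measure.smul_apply, Measure.restrict_apply_univ, Real.volume_Ioc,
    sub_zero, smul_eq_mul]
  rw [← ENNReal.ofReal_mul (by positivity), inv_mul_cancel₀ hh'.ne', ENNReal.ofReal_one]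

theorem integral_uniformTime (h : ℝ≥0) {f : ℝ≥0 → ℝ} (hf : Measurable f) :
    ∫ s, f s ∂uniformTime h = (h : ℝ)⁻¹ * ∫ s in (0 : ℝ)..h, f s.toNNReal := by
  rw [uniformTime, integral_map (by fun_prop) hf.aestronglyMeasurable, integral_smul_measure,
    ENNReal.toReal_ofReal (by positivity), intervalIntegral.integral_of_le h.coe_nonneg]
  rfl

/-- The average of the transition kernels over `(0, h]`. -/
def average (h : ℝ≥0) : Kernel X X := D.pJoint ∘ₖ (Kernel.const X (uniformTime h) ×ₖ Kernel.id)

theorem lintegral_average {h : ℝ≥0} (hh : 0 < h) (x : X) {f : X → ℝ≥0∞} (hf : Measurable f) :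
    ∫⁻ y, f y ∂D.average h x = ∫⁻ s, ∫⁻ y, f y ∂D.p s x ∂uniformTime h := by
  have := isProbabilityMeasure_uniformTime hh
  have hm : Measurable fun q : ℝ≥0 × X => ∫⁻ y, f y ∂D.pJoint q := hf.lintegral_kernel
  rw [average, Kernel.lintegral_comp _ _ _ hf, Kernel.lintegral_prod _ _ _ hm]
  refine lintegral_congr fun s => ?_
  have hms : Measurable fun c => ∫⁻ y, f y ∂D.pJoint (s, c) := hm.comp measurable_prodMk_left
  rw [Kernel.id_apply, lintegral_dirac' _ hms]
  rfl

theorem isMarkovKernel_average {h : ℝ≥0} (hh : 0 < h) : IsMarkovKernel (D.average h) := by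
  have := isProbabilityMeasure_uniformTime hh
  unfold average; infer_instance

theorem average_real {h : ℝ≥0} (hh : 0 < h) (x : X) {A : Set X} (hA : MeasurableSet A) :
    (D.average h x).real A = (h : ℝ)⁻¹ * ∫ s in (0 : ℝ)..h, (D.p s.toNNReal x).real A := by
  have := isProbabilityMeasure_uniformTime hh
  rw [← integral_uniformTime h (f := fun s => (D.p s x).real A) (D.continuous_p_real x hA).measurable,
    Measure.real, ← lintegral_indicator_one hA,
    D.lintegral_average hh x (measurable_one.indicator hA)]
  simp only [lintegral_indicator_one hA]
  exact (integral_toReal ((D.pJoint.measurable_coe hA).comp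
    (measurable_prodMk_right (y := x))).aemeasurable (ae_of_all _ fun x => measure_lt_top _ _)).symm

theorem act_average {h : ℝ≥0} (hh : 0 < h) [IsMarkovKernel (D.average h)] (μ : SignedMeasure X)
    {A : Set X} (hA : MeasurableSet A) :
    act (D.average h) μ A = (h : ℝ)⁻¹ * ∫ s in (0 : ℝ)..h, D.semigroup s.toNNReal μ A := by
  rw [act_apply _ _ hA]
  simp only [D.average_real hh _ hA, D.semigroup_apply _ _ hA]
  rw [← integ_intervalIntegral μ (D.measurable_p_real hA) (fun s => abs_real_le _ A) _ h.coe_nonneg]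
  unfold integ
  rw [integral_const_mul, integral_const_mul]
  ring

/-- The average is a mixture of the operators `S(s)`, each of which commutes with `S(t)`. -/
theorem semigroup_act_average {h : ℝ≥0} (hh : 0 < h) [IsMarkovKernel (D.average h)]
    (μ : SignedMeasure X) (t : ℝ≥0) : D.semigroup t (act (D.average h) μ)
      = act (D.average h) (D.semigroup t μ) := by
  ext A hA
  rw [D.act_average hh _ hA, semigroup_apply _ _ _ hA,
    integ_act _ _ (measurable_real _ hA) (abs_real_le _ A)]
  have e : ∀ x, ∫ y, (D.p t y).real A ∂D.average h x
      = (h : ℝ)⁻¹ * ∫ s in (0 : ℝ)..h, ∫ y, (D.p s.toNNReal y).real A ∂D.p t x := by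
    intro x
    have h1 : ∫ y, (D.p t y).real A ∂D.average h x
        = ((D.average h x).bind (D.p t)).real A := (bind_real _ _ hA).symm
    have h2 : (D.average h x).bind (D.p t) = (D.p t x).bind (D.average h) := by
      ext B hB
      have hm : Measurable fun y => D.p t y B := (D.p t).measurable_coe hB
      have hmj : Measurable (Function.uncurry fun (s : ℝ≥0) (y : X) => D.p s y B) :=
        D.pJoint.measurable_coe hB
      have := isProbabilityMeasure_uniformTime hh
      rw [Measure.bind_apply hB (Kernel.aemeasurable _), Measure.bind_apply hB (Kernel.aemeasurable _),
        D.lintegral_average hh x hm]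
      have e3 : ∀ y, D.average h y B = ∫⁻ s, D.p s y B ∂uniformTime h := fun y => by
        rw [← lintegral_indicator_one hB, D.lintegral_average hh y (measurable_one.indicator hB)]
        simp only [lintegral_indicator_one hB]
      simp only [e3]
      rw [lintegral_lintegral_swap (f := fun y s => D.p s y B)
        (hmj.comp measurable_swap).aemeasurable]
      refine lintegral_congr fun s => ?_
      have a1 := D.lintegral_p_add s t x (B.indicator 1) (measurable_one.indicator hB)
      have a2 := D.lintegral_p_add t s x (B.indicator 1) (measurable_one.indicator hB)
      simp only [lintegral_indicator_one hB] at a1 a2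
      rw [← a1, ← a2, add_comm]
    rw [h1, h2, bind_real _ _ hA]
    simp only [D.average_real hh _ hA]
    rw [integral_const_mul]
    congr 1
    simp only [intervalIntegral.integral_of_le h.coe_nonneg]
    refine integral_integral_swap (f := fun y (s : ℝ) => (D.p s.toNNReal y).real A) ?_
    exact integrable_of_bound _ ((D.measurable_p_real hA).comp measurable_swap)
      fun q => abs_real_le _ A _
  simp only [e]
  have hj : Measurable (Function.uncurry fun (s : ℝ) (x : X) =>
      ∫ y, (D.p s.toNNReal y).real A ∂D.p t x) := by
    have h : StronglyMeasurable (Function.uncurry fun (q : ℝ × X) (y : X) =>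
        (D.p q.1.toNNReal y).real A) :=
      ((D.measurable_p_real hA).comp (f := fun r : (ℝ × X) × X => (r.1.1, r.2))
        (by fun_prop)).stronglyMeasurable
    exact (h.integral_kernel_prod_right (κ := (D.p t).comap Prod.snd measurable_snd)).measurable
  have hjb : ∀ (s : ℝ) x, |∫ y, (D.p s.toNNReal y).real A ∂D.p t x| ≤ 1 := fun s x => by
    rw [← bind_real _ _ hA, abs_of_nonneg measureReal_nonneg]
    exact measureReal_le_one
  have e4 : ∀ s : ℝ, D.semigroup s.toNNReal (D.semigroup t μ) A
      = integ μ fun x => ∫ y, (D.p s.toNNReal y).real A ∂D.p t x := fun s => by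
    rw [semigroup_apply _ _ _ hA]
    exact integ_act _ _ (measurable_real _ hA) (abs_real_le _ A)
  simp only [e4]
  rw [← integ_intervalIntegral μ hj hjb _ h.coe_nonneg]
  unfold integ
  rw [integral_const_mul, integral_const_mul]
  ring

/-- Both sides rest on `∫_t^{t+h} - ∫_0^h = ∫_h^{t+h} - ∫_0^t` for the function `s ↦ S(s) μ (A)`. No
moment of `μ` is required. -/
theorem integrated_average {h : ℝ≥0} (hh : 0 < h) [IsMarkovKernel (D.average h)]
    (μ : SignedMeasure X) :
    D.Integrated (act (D.average h) μ) ((h : ℝ)⁻¹ • (D.semigroup h μ - μ)) := by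
  intro t A hA
  set F : ℝ → ℝ := fun s => D.semigroup s.toNNReal μ A with hF
  have hc : Continuous F := D.continuous_semigroup_real μ hA
  have hsum : ∀ (s : ℝ) (u : ℝ≥0), 0 ≤ s → D.semigroup s.toNNReal (D.semigroup u μ) A = F (s + u) := by
    intro s u hs
    rw [hF]
    simp only
    rw [Real.toNNReal_add hs u.coe_nonneg, Real.toNNReal_coe, D.semigroup_add]
    rfl
  have e1 : D.semigroup t (act (D.average h) μ) A = (h : ℝ)⁻¹ * ∫ s in (0 : ℝ)..h, F (s + t) := by
    rw [D.semigroup_act_average hh, D.act_average hh _ hA]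
    congr 1
    refine intervalIntegral.integral_congr fun s hs => ?_
    rw [uIcc_of_le h.coe_nonneg] at hs
    exact hsum s t hs.1
  have e2 : ∫ s in (0 : ℝ)..t, D.semigroup s.toNNReal ((h : ℝ)⁻¹ • (D.semigroup h μ - μ)) A
      = (h : ℝ)⁻¹ * ((∫ s in (0 : ℝ)..t, F (s + h)) - ∫ s in (0 : ℝ)..t, F s) := by
    rw [← intervalIntegral.integral_sub ((by fun_prop : Continuous fun s => F (s + h)).intervalIntegrable _ _)
      (hc.intervalIntegrable _ _), ← intervalIntegral.integral_const_mul]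
    refine intervalIntegral.integral_congr fun s hs => ?_
    rw [uIcc_of_le t.coe_nonneg] at hs
    simp only [map_smul, map_sub]
    rw [← hsum s h hs.1]
    simp [hF]
  rw [e1, D.act_average hh _ hA, e2, ← mul_sub]
  congr 1
  rw [intervalIntegral.integral_comp_add_right, intervalIntegral.integral_comp_add_right, zero_add,
    zero_add, add_comm (h : ℝ)]
  have i1 := intervalIntegral.integral_add_adjacent_intervals (hc.intervalIntegrable (μ := volume) 0 h)
    (hc.intervalIntegrable h (t + h))
  have i2 := intervalIntegral.integral_add_adjacent_intervals (hc.intervalIntegrable (μ := volume) 0 t)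
    (hc.intervalIntegrable t (t + h))
  change _ - (∫ s in (0 : ℝ)..h, F s) = _
  linarith

/-- The expectation of `U` grows by at most `e^s` in time `s`, so averaging preserves finiteness of
the moment that defines the domain. -/
theorem average_mem_domain {h : ℝ≥0} (hh : 0 < h) [IsMarkovKernel (D.average h)] (ρ₁ ρ₂ : Measure X)
    [IsFiniteMeasure ρ₁] [IsFiniteMeasure ρ₂] (h₁ : ∫⁻ x, ENNReal.ofReal (D.U x) ∂ρ₁ < ∞)
    (h₂ : ∫⁻ x, ENNReal.ofReal (D.U x) ∂ρ₂ < ∞) :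
    ∫⁻ x, ENNReal.ofReal (D.U x) ∂(act (D.average h)
      (ρ₁.toSignedMeasure - ρ₂.toSignedMeasure)).totalVariation < ∞ := by
  have hU := D.measurable_U.ennreal_ofReal
  have := isProbabilityMeasure_uniformTime hh
  have key : ∀ ρ : Measure X, ∫⁻ x, ENNReal.ofReal (D.U x) ∂ρ < ∞ →
      ∫⁻ x, ENNReal.ofReal (D.U x) ∂ρ.bind (D.average h) < ∞ := by
    intro ρ hρ
    rw [Measure.lintegral_bind (Kernel.aemeasurable _) hU.aemeasurable]
    refine lt_of_le_of_lt (b := ∫⁻ x, ENNReal.ofReal (Real.exp h) * ENNReal.ofReal (D.U x) ∂ρ)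
      (lintegral_mono fun x => ?_) ?_
    · rw [D.lintegral_average hh x hU]
      have hae : ∀ᵐ s ∂uniformTime h, s ≤ h := by
        rw [uniformTime, ae_map_iff (by fun_prop) measurableSet_Iic]
        refine Measure.ae_smul_measure ?_ _
        filter_upwards [ae_restrict_mem measurableSet_Ioc] with s hs
        exact Real.toNNReal_le_iff_le_coe.2 hs.2
      refine (lintegral_mono_ae (g := fun _ => ENNReal.ofReal (Real.exp h) * ENNReal.ofReal (D.U x))
        ?_).trans_eq (by simp)
      filter_upwards [hae] with s hs
      refine (D.lintegral_p_U_le s x).trans ?_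
      rw [← ENNReal.ofReal_mul (Real.exp_nonneg _)]
      apply ENNReal.ofReal_le_ofReal
      have := D.U_nonneg x
      have : Real.exp s ≤ Real.exp h := Real.exp_le_exp.2 (by exact_mod_cast hs)
      gcongr
    · rw [lintegral_const_mul _ hU]
      exact ENNReal.mul_lt_top ENNReal.ofReal_lt_top hρ
  rw [act_sub_toSignedMeasure]
  refine lt_of_le_of_lt (lintegral_mono' (totalVariation_le _ _) le_rfl) ?_
  rw [lintegral_add_measure]
  exact ENNReal.add_lt_top.2 ⟨key _ h₁, key _ h₂⟩

/-- The restriction of a signed measure to `U ≤ n`. -/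
def cutoff (μ : SignedMeasure X) (n : ℕ) : SignedMeasure X :=
  ((pos μ).restrict {x | D.U x ≤ n}).toSignedMeasure
    - ((neg μ).restrict {x | D.U x ≤ n}).toSignedMeasure

theorem tendsto_cutoff (μ : SignedMeasure X) :
    Tendsto (fun n => tvNorm (D.cutoff μ n - μ)) atTop (𝓝 0) := by
  have hm : ∀ n : ℕ, MeasurableSet {x | D.U x ≤ n} := fun n =>
    measurableSet_le D.measurable_U measurable_const
  have h1 : Tendsto (fun n : ℕ => μ.totalVariation {x | D.U x ≤ n}ᶜ) atTop (𝓝 0) := by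
    have := tendsto_measure_iInter_atTop (μ := μ.totalVariation)
      (s := fun n : ℕ => {x | D.U x ≤ n}ᶜ) (fun n => (hm n).compl.nullMeasurableSet)
      (fun m n hmn x hx hx' => hx (le_trans (show D.U x ≤ m from hx') (by exact_mod_cast hmn)))
      ⟨0, measure_ne_top _ _⟩
    have e : (⋂ n : ℕ, {x | D.U x ≤ n}ᶜ) = ∅ := by
      ext x
      simp only [mem_iInter, mem_compl_iff, mem_empty_iff_false, iff_false, not_forall, not_not]
      exact exists_nat_ge (D.U x)
    rwa [e, measure_empty] at this
  have h2 := (ENNReal.tendsto_toReal ENNReal.zero_ne_top).comp h1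
  refine tendsto_tvNorm _ _ h2 (Eventually.of_forall fun n A hA => ?_)
  have e : (D.cutoff μ n - μ) A
      = (neg μ).real (A \ {x | D.U x ≤ n}) - (pos μ).real (A \ {x | D.U x ≤ n}) := by
    have e1 : μ A = (pos μ).real A - (neg μ).real A := μ.apply_eq_posPart_real_sub_negPart_real hA
    rw [sub_apply, cutoff, Measure.toSignedMeasure_sub_apply hA, measureReal_restrict_apply hA,
      measureReal_restrict_apply hA, e1]
    have e2 := measureReal_inter_add_sdiff (μ := pos μ) (s := A) (hm n)
    have e3 := measureReal_inter_add_sdiff (μ := neg μ) (s := A) (hm n)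
    linarith
  have b1 : (pos μ).real (A \ {x | D.U x ≤ n}) ≤ (pos μ).real {x | D.U x ≤ n}ᶜ :=
    measureReal_mono fun x hx => hx.2
  have b2 : (neg μ).real (A \ {x | D.U x ≤ n}) ≤ (neg μ).real {x | D.U x ≤ n}ᶜ :=
    measureReal_mono fun x hx => hx.2
  have b3 : (μ.totalVariation {x | D.U x ≤ n}ᶜ).toReal
      = (pos μ).real {x | D.U x ≤ n}ᶜ + (neg μ).real {x | D.U x ≤ n}ᶜ :=
    measureReal_add_apply
  have := measureReal_nonneg (μ := pos μ) (s := A \ {x | D.U x ≤ n})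
  have := measureReal_nonneg (μ := neg μ) (s := A \ {x | D.U x ≤ n})
  rw [e, Function.comp_apply, b3, abs_le]
  constructor <;> linarith

theorem lintegral_U_restrict_lt (ρ : Measure X) [IsFiniteMeasure ρ] (n : ℕ) :
    ∫⁻ x, ENNReal.ofReal (D.U x) ∂ρ.restrict {x | D.U x ≤ n} < ∞ := by
  refine lt_of_le_of_lt (setLIntegral_mono (g := fun _ => ENNReal.ofReal n) measurable_const
    fun x hx => ENNReal.ofReal_le_ofReal hx) ?_
  rw [lintegral_const]
  exact ENNReal.mul_lt_top ENNReal.ofReal_lt_top (measure_lt_top _ _)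

theorem cutoff_average_mem_domain (μ : SignedMeasure X) (n : ℕ) {h : ℝ≥0} (hh : 0 < h)
    [IsMarkovKernel (D.average h)] : ∫⁻ x, ENNReal.ofReal (D.U x)
      ∂(act (D.average h) (D.cutoff μ n)).totalVariation < ∞ :=
  D.average_mem_domain hh _ _ (D.lintegral_U_restrict_lt _ n) (D.lintegral_U_restrict_lt _ n)

/-- On the domain the predual has some value, for which the integrated relation holds. That relation
determines its second component, which therefore is the difference quotient. -/
theorem average_mem_predual (κ : SignedMeasure X) {h : ℝ≥0} (hh : 0 < h)
    [IsMarkovKernel (D.average h)] (hκ : ∫⁻ x, ENNReal.ofReal (D.U x)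
      ∂(act (D.average h) κ).totalVariation < ∞) :
    (act (D.average h) κ, (h : ℝ)⁻¹ • (D.semigroup h κ - κ)) ∈ D.predual := by
  obtain ⟨ν', hν'⟩ := D.exists_predual _ hκ
  have huniq : ν' = (h : ℝ)⁻¹ • (D.semigroup h κ - κ) := by
    have a1 := D.integrated_of_mem_predual hν'
    have a2 := D.integrated_average hh κ
    exact D.integrated_unique a1 a2
  rw [← huniq]
  exact hν'

theorem abs_sub_average_le (μ κ : SignedMeasure X) {h : ℝ≥0} (hh : 0 < h)
    [IsMarkovKernel (D.average h)] {A : Set X} (hA : MeasurableSet A) :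
    |(μ - act (D.average h) κ) A| ≤ (tvNorm (κ - μ)).toReal + D.err μ h := by
  have b1 := abs_act_le (D.average h) (κ - μ) hA
  have b2 := D.abs_average_sub_le μ h hh hA
  rw [← D.act_average hh μ hA] at b2
  rw [map_sub, sub_apply] at b1
  rw [sub_apply, abs_sub_comm]
  have e : act (D.average h) κ A - μ A
    = (act (D.average h) κ A - act (D.average h) μ A) + (act (D.average h) μ A - μ A) := by ring
  rw [e]
  exact (abs_add_le _ _).trans (add_le_add b1 b2)

theorem abs_sub_quotient_le (μ ν κ : SignedMeasure X) {h : ℝ≥0} (hh : 0 < h) {A : Set X}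
    (hA : MeasurableSet A) :
    |(ν - (h : ℝ)⁻¹ • (D.semigroup h κ - κ)) A|
      ≤ (tvNorm ((h : ℝ)⁻¹ • (D.semigroup h μ - μ) - ν)).toReal
        + (h : ℝ)⁻¹ * (2 * (tvNorm (κ - μ)).toReal) := by
  have hh' : (0 : ℝ) < h := hh
  have b1 := abs_act_le (D.p h) (κ - μ) hA
  have b2 := abs_le_tvNorm (κ - μ) hA
  have b3 := abs_le_tvNorm ((h : ℝ)⁻¹ • (D.semigroup h μ - μ) - ν) hA
  change |D.semigroup h (κ - μ) A| ≤ _ at b1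
  have e : (ν - (h : ℝ)⁻¹ • (D.semigroup h κ - κ)) A
      = -(((h : ℝ)⁻¹ • (D.semigroup h μ - μ) - ν) A)
        - (h : ℝ)⁻¹ * (D.semigroup h (κ - μ) A - (κ - μ) A) := by
    simp
    ring
  rw [e]
  refine (abs_sub _ _).trans ?_
  rw [abs_neg, abs_mul, abs_of_pos (inv_pos.2 hh')]
  refine add_le_add b3 (mul_le_mul_of_nonneg_left ((abs_sub _ _).trans ?_) (inv_pos.2 hh').le)
  linarith

/-- The core property: averages of truncations of `μ` lie in the domain, approximate `μ`, and are
mapped to difference quotients that approximate `ν`. -/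
theorem mem_tvClosure_predual {μ ν : SignedMeasure X} (h : (μ, ν) ∈ generatorGraph D.semigroup) :
    (μ, ν) ∈ tvClosure D.predual := by
  intro ε hε
  obtain ⟨c, hc0, hcε⟩ := ENNReal.lt_iff_exists_nnreal_btwn.1 hε
  have hc0' : (0 : ℝ) < c := by exact_mod_cast hc0
  have hcε' : ENNReal.ofReal (2 * (c / 2)) < ε := by
    rw [mul_div_cancel₀ _ two_ne_zero, ENNReal.ofReal_coe_nnreal]; exact hcε
  have h1 : Tendsto (fun t : ℝ≥0 => D.err μ t) (𝓝[>] 0) (𝓝 0) := by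
    refine (D.tendsto_err μ).comp (tendsto_nhdsWithin_iff.2 ⟨?_, Eventually.of_forall fun t => ?_⟩)
    · exact (NNReal.continuous_coe.tendsto 0).mono_left nhdsWithin_le_nhds
    · exact t.coe_nonneg
  have h2 : Tendsto (fun t : ℝ≥0 => (tvNorm ((t : ℝ)⁻¹ • (D.semigroup t μ - μ) - ν)).toReal)
      (𝓝[>] 0) (𝓝 0) := (ENNReal.tendsto_toReal ENNReal.zero_ne_top).comp h
  -- In each component two errors below `c / 4` add up, and `tvNorm_le` doubles the result to `c <
  -- ε`. The time `t` is fixed before the truncation level `n`, since the truncation error is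
  -- divided by `t` in the second component.
  have hc4 : (0 : ℝ) < c / 4 := by positivity
  obtain ⟨t, ht, ht1, ht2⟩ := ((eventually_mem_nhdsWithin (a := (0 : ℝ≥0)) (s := Ioi 0)).and
    ((h1.eventually_lt_const hc4).and (h2.eventually_lt_const hc4))).exists
  have ht' : (0 : ℝ) < t := ht
  have h3 : Tendsto (fun n => (tvNorm (D.cutoff μ n - μ)).toReal) atTop (𝓝 0) :=
    (ENNReal.tendsto_toReal ENNReal.zero_ne_top).comp (D.tendsto_cutoff μ)
  obtain ⟨n, hn1, hn2⟩ := ((h3.eventually_lt_const hc4).and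
    (h3.eventually_lt_const (u := (t : ℝ) * (c / 8)) (by positivity))).exists
  have := D.isMarkovKernel_average ht
  refine ⟨_, D.average_mem_predual _ ht (D.cutoff_average_mem_domain μ n ht), lt_of_le_of_lt (tvNorm_le _ fun A hA => ?_) hcε',
    lt_of_le_of_lt (tvNorm_le _ fun A hA => ?_) hcε'⟩
  · refine (D.abs_sub_average_le μ _ ht hA).trans ?_
    linarith
  · refine (D.abs_sub_quotient_le μ ν _ ht hA).trans ?_
    have b5 : (t : ℝ)⁻¹ * (2 * (tvNorm (D.cutoff μ n - μ)).toReal) ≤ (t : ℝ)⁻¹ * (t * (c / 4)) :=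
      mul_le_mul_of_nonneg_left (by linarith) (inv_pos.2 ht').le
    rw [inv_mul_cancel_left₀ ht'.ne'] at b5
    linarith

theorem generatorGraph_eq : generatorGraph D.semigroup = tvClosure D.predual := by
  ext q
  exact ⟨fun h => D.mem_tvClosure_predual h, fun h => D.mem_generatorGraph_of_integrated
    (D.integrated_of_mem_tvClosure (fun _ hr => D.integrated_of_mem_predual hr) h)⟩

end JumpData

/-! ### Measurability on the space of configurations. -/

namespace Kawasaki

/-! ### Configurations as measures -/

namespace Configuration

variable {d : ℕ}

/-- The counting measure of a configuration. -/
def toMeasure (γ : Configuration d) : Measure (Pt d) :=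
  Measure.sum fun x => (γ.mult x : ℝ≥0∞) • Measure.dirac x

theorem lintegral_toMeasure (γ : Configuration d) (f : Pt d → ℝ≥0∞) :
    ∫⁻ x, f x ∂γ.toMeasure = γ.sum f := by
  rw [toMeasure, lintegral_sum_measure]
  refine tsum_congr fun x => ?_
  rw [lintegral_smul_measure, lintegral_dirac, smul_eq_mul]

theorem toMeasure_apply (γ : Configuration d) {A : Set (Pt d)} (hA : MeasurableSet A) :
    γ.toMeasure A = γ.sum (A.indicator 1) := by
  rw [← lintegral_toMeasure, lintegral_indicator_one hA]

theorem sum_indicator_lt_top (γ : Configuration d) {Λ : Set (Pt d)} (hΛ : IsCompact Λ) :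
    γ.sum (Λ.indicator 1) < ∞ := by
  have hf := γ.locallyFinite Λ hΛ
  rw [sum, tsum_eq_sum (s := hf.toFinset)]
  · refine ENNReal.sum_lt_top.2 fun x _ => ENNReal.mul_lt_top (by simp) ?_
    by_cases h : x ∈ Λ <;> simp [h]
  · intro x hx
    simp only [Finite.mem_toFinset, mem_inter_iff, Function.mem_support, not_and, not_not] at hx
    by_cases h : x ∈ Λ
    · simp [hx h]
    · simp [h]

theorem measurable_count {Λ : Set (Pt d)} (hΛ : IsCompact Λ) :
    Measurable fun γ : Configuration d => γ.sum (Λ.indicator 1) := by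
  have h : Measurable (count (d := d) Λ) := by
    refine Measurable.of_comap_le ?_
    exact le_iSup (fun Λ : {Λ : Set (Pt d) // IsCompact Λ} =>
      MeasurableSpace.comap (count Λ.1) inferInstance) ⟨Λ, hΛ⟩
  exact h

/-- On a ball the counting measure is finite, so it is determined by the π-system of closed sets,
whose traces on the ball are compact and hence have measurable counts. The balls then exhaust the
space. -/
theorem measurable_toMeasure : Measurable (toMeasure (d := d)) := by
  have h1 : ∀ n : ℕ, Measurable fun γ : Configuration d =>
      γ.toMeasure.restrict (Metric.closedBall 0 n) := by
    intro n
    have hB : MeasurableSet (Metric.closedBall (0 : Pt d) n) := measurableSet_closedBall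
    have : ∀ γ : Configuration d, IsFiniteMeasure (γ.toMeasure.restrict (Metric.closedBall 0 n)) :=
      fun γ => ⟨by
        rw [Measure.restrict_apply_univ, toMeasure_apply _ hB]
        exact γ.sum_indicator_lt_top (isCompact_closedBall _ _)⟩
    refine Measurable.measure_of_isPiSystem (S := {s : Set (Pt d) | IsClosed s})
      (BorelSpace.measurable_eq.trans borel_eq_generateFrom_isClosed) isPiSystem_isClosed ?_ ?_
    · intro s hs
      have e : ∀ γ : Configuration d, γ.toMeasure.restrict (Metric.closedBall 0 n) s
          = γ.sum ((s ∩ Metric.closedBall 0 n).indicator 1) := fun γ => by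
        rw [Measure.restrict_apply (IsClosed.measurableSet hs),
          toMeasure_apply _ ((IsClosed.measurableSet hs).inter hB)]
      simp only [e]
      exact measurable_count ((isCompact_closedBall _ _).inter_left hs)
    · have e : ∀ γ : Configuration d, γ.toMeasure.restrict (Metric.closedBall 0 n) univ
          = γ.sum ((Metric.closedBall 0 n).indicator 1) := fun γ => by
        rw [Measure.restrict_apply_univ, toMeasure_apply _ hB]
      simp only [e]
      exact measurable_count (isCompact_closedBall _ _)
  refine Measure.measurable_of_measurable_coe _ fun s hs => ?_
  have e : ∀ γ : Configuration d,
      γ.toMeasure s = ⨆ n : ℕ, γ.toMeasure.restrict (Metric.closedBall 0 n) s := by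
    intro γ
    simp only [Measure.restrict_apply hs]
    rw [← Monotone.measure_iUnion]
    · rw [← inter_iUnion, Metric.iUnion_closedBall_nat, inter_univ]
    · exact fun m n hmn => inter_subset_inter_right _
        (Metric.closedBall_subset_closedBall (by exact_mod_cast hmn))
  simp only [e]
  exact Measurable.iSup fun n => (Measure.measurable_coe hs).comp (h1 n)

theorem measurable_sum {f : Pt d → ℝ≥0∞} (hf : Measurable f) :
    Measurable fun γ : Configuration d => γ.sum f := by
  simp only [← lintegral_toMeasure]
  exact (Measure.measurable_lintegral hf).comp measurable_toMeasure

theorem sum_mono (γ : Configuration d) {f g : Pt d → ℝ≥0∞} (h : ∀ x, f x ≤ g x) :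
    γ.sum f ≤ γ.sum g := ENNReal.tsum_le_tsum fun x => by gcongr; exact h x

theorem sum_add (γ : Configuration d) (f g : Pt d → ℝ≥0∞) :
    γ.sum (fun x => f x + g x) = γ.sum f + γ.sum g := by
  unfold sum
  rw [← ENNReal.tsum_add]
  exact tsum_congr fun x => mul_add _ _ _

theorem sum_const_mul (γ : Configuration d) (c : ℝ≥0∞) (f : Pt d → ℝ≥0∞) :
    γ.sum (fun x => c * f x) = c * γ.sum f := by
  unfold sum
  rw [← ENNReal.tsum_mul_left]
  exact tsum_congr fun x => by ring

theorem le_sum (γ : Configuration d) (f : Pt d → ℝ≥0∞) {x : Pt d} (hx : γ.mult x ≠ 0) :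
    f x ≤ γ.sum f := by
  refine le_trans ?_ (ENNReal.le_tsum x)
  refine le_mul_of_one_le_left zero_le ?_
  exact_mod_cast Nat.one_le_iff_ne_zero.2 hx

theorem sum_erase_add (γ : Configuration d) (f : Pt d → ℝ≥0∞) {x : Pt d} (hx : γ.mult x ≠ 0) :
    (γ.erase x).sum f + f x = γ.sum f := by
  classical
  have h2 : ∑' z, (if z = x then 1 else 0 : ℝ≥0∞) * f z = f x := by
    rw [tsum_eq_single x]
    · simp
    · intro z hz
      simp [hz]
  rw [← h2]
  unfold sum
  rw [← ENNReal.tsum_add]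
  refine tsum_congr fun z => ?_
  rw [← add_mul]
  congr 1
  simp only [erase]
  by_cases h : z = x
  · subst h
    have : 1 ≤ γ.mult z := Nat.one_le_iff_ne_zero.2 hx
    simp only [if_true]
    exact_mod_cast Nat.sub_add_cancel this
  · simp [h]

theorem sum_insert (γ : Configuration d) (f : Pt d → ℝ≥0∞) (y : Pt d) :
    (γ.insert y).sum f = γ.sum f + f y := by
  classical
  have h2 : ∑' z, (if z = y then 1 else 0 : ℝ≥0∞) * f z = f y := by
    rw [tsum_eq_single y]
    · simp
    · intro z hz
      simp [hz]
  rw [← h2]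
  unfold sum
  rw [← ENNReal.tsum_add]
  refine tsum_congr fun z => ?_
  rw [← add_mul]
  congr 1
  simp [insert]

/-- With truncated subtraction the formula also holds when no particle is at `x`. It expresses
erasure through plain sums and so gives joint measurability in `γ` and `x`. -/
theorem sum_erase (γ : Configuration d) (f : Pt d → ℝ≥0∞) (x : Pt d) :
    (γ.erase x).sum f
      = γ.sum (({x}ᶜ : Set (Pt d)).indicator f) + (γ.sum (({x} : Set (Pt d)).indicator 1) - 1) * f x := by
  classical
  have h1 : γ.sum (({x} : Set (Pt d)).indicator 1) = γ.mult x := by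
    rw [sum, tsum_eq_single x]
    · simp
    · intro z hz
      simp [hz]
  have h2 : ∑' z, (if z = x then ((γ.mult x : ℝ≥0∞) - 1) else 0) * f z = ((γ.mult x : ℝ≥0∞) - 1) * f x := by
    rw [tsum_eq_single x]
    · simp
    · intro z hz
      simp [hz]
  rw [h1, ← h2]
  unfold sum
  rw [← ENNReal.tsum_add]
  refine tsum_congr fun z => ?_
  by_cases h : z = x
  · subst h; simp [erase]
  · simp [erase, h]

end Configuration

namespace Tempered

variable {d : ℕ}

theorem measurable_toConfiguration : Measurable (toConfiguration (d := d)) :=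
  comap_measurable _

theorem psi_pos (x : Pt d) : 0 < psi x := by unfold psi; positivity

theorem psi_le_one (x : Pt d) : psi x ≤ 1 := by
  unfold psi
  rw [div_le_one (by positivity)]
  simp

theorem continuous_psi : Continuous (psi (d := d)) := by
  unfold psi
  refine Continuous.div (by fun_prop) (by fun_prop) fun x => ?_
  positivity

/-- The summation over a configuration, as a kernel. -/
def pts (d : ℕ) : Kernel (Tempered d) (Pt d) where
  toFun γ := γ.toConfiguration.toMeasure
  measurable' := Configuration.measurable_toMeasure.comp measurable_toConfiguration

theorem lintegral_pts (γ : Tempered d) (f : Pt d → ℝ≥0∞) :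
    ∫⁻ x, f x ∂pts d γ = γ.toConfiguration.sum f := Configuration.lintegral_toMeasure _ _

theorem measurable_Psi : Measurable (Psi (d := d)) :=
  Configuration.measurable_sum continuous_psi.measurable.ennreal_ofReal

/-- A tempered configuration can have infinite mass. Weighting the particles by `ψ / (1 + Ψ)` gives
a kernel of mass at most one, and the weight is undone by a finite density. -/
instance : IsSFiniteKernel (pts d) := by
  have hψ : Measurable fun x : Pt d => ENNReal.ofReal (psi x) :=
    continuous_psi.measurable.ennreal_ofReal
  have hΨ : Measurable fun γ : Tempered d => (1 + Psi γ.toConfiguration)⁻¹ :=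
    (measurable_const.add (measurable_Psi.comp measurable_toConfiguration)).inv
  let κ : Kernel (Tempered d) (Pt d) :=
    { toFun := fun γ => (1 + Psi γ.toConfiguration)⁻¹ •
        (γ.toConfiguration.toMeasure.withDensity fun x => ENNReal.ofReal (psi x))
      measurable' := by
        refine Measure.measurable_of_measurable_coe _ fun s hs => ?_
        simp only [Measure.smul_apply, smul_eq_mul]
        refine hΨ.mul ?_
        simp only [withDensity_apply _ hs, ← lintegral_indicator hs, Configuration.lintegral_toMeasure]
        exact (Configuration.measurable_sum (hψ.indicator hs)).comp measurable_toConfiguration }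
  have hκ : IsFiniteKernel κ := ⟨1, ENNReal.one_lt_top, fun γ => by
    change ((1 + Psi γ.toConfiguration)⁻¹ •
        (γ.toConfiguration.toMeasure.withDensity fun x => ENNReal.ofReal (psi x))) univ ≤ 1
    rw [Measure.smul_apply, withDensity_apply _ .univ, setLIntegral_univ,
      Configuration.lintegral_toMeasure, smul_eq_mul]
    calc _ ≤ (1 + Psi γ.toConfiguration)⁻¹ * (1 + Psi γ.toConfiguration) := by
          gcongr; exact le_add_self
      _ ≤ 1 := ENNReal.inv_mul_le_one _⟩
  have hd : Measurable (Function.uncurry fun (γ : Tempered d) (x : Pt d) =>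
      (1 + Psi γ.toConfiguration) * (ENNReal.ofReal (psi x))⁻¹) := by
    refine Measurable.mul ?_ (hψ.inv.comp measurable_snd)
    exact measurable_const.add ((measurable_Psi.comp measurable_toConfiguration).comp measurable_fst)
  have e : pts d = κ.withDensity fun γ x => (1 + Psi γ.toConfiguration) * (ENNReal.ofReal (psi x))⁻¹ := by
    ext γ s hs
    have hfin : 1 + Psi γ.toConfiguration ≠ ∞ := ENNReal.add_ne_top.2 ⟨by simp, γ.2.ne⟩
    have h0 : 1 + Psi γ.toConfiguration ≠ 0 := (lt_of_lt_of_le one_pos le_self_add).ne'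
    rw [Kernel.withDensity_apply' _ hd]
    change _ = ∫⁻ x in s, (1 + Psi γ.toConfiguration) * (ENNReal.ofReal (psi x))⁻¹
      ∂((1 + Psi γ.toConfiguration)⁻¹ •
        (γ.toConfiguration.toMeasure.withDensity fun x => ENNReal.ofReal (psi x)))
    have hψ' : Measurable fun x : Pt d => (ENNReal.ofReal (psi x))⁻¹ := hψ.inv
    rw [Measure.restrict_smul, lintegral_smul_measure, lintegral_const_mul _ hψ', smul_eq_mul,
      ← mul_assoc, ENNReal.inv_mul_cancel h0 hfin, one_mul,
      setLIntegral_withDensity_eq_setLIntegral_mul _ hψ hψ' hs]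
    refine Eq.trans (setLIntegral_one s).symm (lintegral_congr fun x =>
      (ENNReal.mul_inv_cancel (ENNReal.ofReal_pos.2 (psi_pos x)).ne' ENNReal.ofReal_ne_top).symm)
  rw [e]
  exact Kernel.IsSFiniteKernel.withDensity _ fun γ x => ENNReal.mul_ne_top
    (ENNReal.add_ne_top.2 ⟨by simp, γ.2.ne⟩)
    (ENNReal.inv_ne_top.2 (ENNReal.ofReal_pos.2 (psi_pos x)).ne')

/-- Sums over a configuration of a jointly measurable function. -/
theorem measurable_sum_joint {Z : Type*} [MeasurableSpace Z] {g : Z → Tempered d} (hg : Measurable g)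
    {f : Z → Pt d → ℝ≥0∞} (hf : Measurable (Function.uncurry f)) :
    Measurable fun z => (g z).toConfiguration.sum (f z) := by
  simp only [← lintegral_pts]
  exact Measurable.lintegral_kernel_prod_right (κ := (pts d).comap g hg) hf

theorem measurable_sum_erase {Z : Type*} [MeasurableSpace Z] {g : Z → Tempered d} (hg : Measurable g)
    {x : Z → Pt d} (hx : Measurable x) {f : Z → Pt d → ℝ≥0∞} (hf : Measurable (Function.uncurry f)) :
    Measurable fun z => ((g z).toConfiguration.erase (x z)).sum (f z) := by
  simp only [Configuration.sum_erase]
  have hs : MeasurableSet {q : Z × Pt d | q.2 = x q.1} :=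
    measurableSet_eq_fun measurable_snd (hx.comp measurable_fst)
  refine Measurable.add (measurable_sum_joint hg ?_) (Measurable.mul ?_ ?_)
  · have e : (Function.uncurry fun (z : Z) => ({x z}ᶜ : Set (Pt d)).indicator (f z))
        = {q : Z × Pt d | q.2 = x q.1}ᶜ.indicator (Function.uncurry f) := by
      funext q
      by_cases h : q.2 = x q.1 <;> simp [Function.uncurry, h]
    rw [e]
    exact hf.indicator hs.compl
  · refine Measurable.sub (measurable_sum_joint hg ?_) measurable_const
    have e : (Function.uncurry fun (z : Z) => ({x z} : Set (Pt d)).indicator (1 : Pt d → ℝ≥0∞))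
        = {q : Z × Pt d | q.2 = x q.1}.indicator 1 := by
      funext q
      by_cases h : q.2 = x q.1 <;> simp [Function.uncurry, h]
    rw [e]
    exact measurable_one.indicator hs
  · exact hf.comp (measurable_id.prodMk hx)

theorem measurable_of_count {Z : Type*} [MeasurableSpace Z] {g : Z → Tempered d}
    (h : ∀ Λ : Set (Pt d), IsCompact Λ →
      Measurable fun z => (g z).toConfiguration.sum (Λ.indicator 1)) : Measurable g := by
  rw [measurable_comap_iff]
  refine Measurable.of_le_map ?_
  refine iSup_le fun Λ => ?_
  rw [MeasurableSpace.comap_le_iff_le_map]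
  exact fun s hs => h Λ.1 Λ.2 hs

theorem sum_move (γ : Tempered d) (f : Pt d → ℝ≥0∞) (x y : Pt d) :
    (γ.move x y).toConfiguration.sum f = (γ.toConfiguration.erase x).sum f + f y :=
  Configuration.sum_insert _ _ _

theorem measurable_move : Measurable fun q : Tempered d × Pt d × Pt d => q.1.move q.2.1 q.2.2 := by
  refine measurable_of_count fun Λ hΛ => ?_
  simp only [sum_move]
  have hi : Measurable (Λ.indicator (1 : Pt d → ℝ≥0∞)) := measurable_one.indicator hΛ.measurableSet
  refine Measurable.add (measurable_sum_erase measurable_fst (by fun_prop)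
    (f := fun _ => Λ.indicator 1) (hi.comp measurable_snd)) (hi.comp (by fun_prop))

theorem measurableEmbedding_toConfiguration : MeasurableEmbedding (toConfiguration (d := d)) := by
  have h : MeasurableSet {γ : Configuration d | Psi γ < ∞} :=
    measurableSet_lt measurable_Psi measurable_const
  exact MeasurableEmbedding.subtype_coe h

end Tempered

end Kawasaki

/-! ### The metric of `Γ_*` and the jump kernel. -/

namespace Kawasaki

namespace Tempered

variable {d : ℕ}

/-! ### The metric -/

theorem summable_psi (γ : Tempered d) :
    Summable fun x => (γ.toConfiguration.mult x : ℝ) * psi x := by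
  have h : ∑' x, (γ.toConfiguration.mult x : ℝ≥0∞) * ENNReal.ofReal (psi x) ≠ ∞ := γ.2.ne
  refine (ENNReal.summable_toReal h).congr fun x => ?_
  rw [ENNReal.toReal_mul, ENNReal.toReal_natCast, ENNReal.toReal_ofReal (psi_pos x).le]

theorem abs_nu_term_le (γ : Tempered d) {g : Pt d → ℝ} {M : ℝ} (hg : ∀ x, |g x| ≤ M) (x : Pt d) :
    ‖(γ.toConfiguration.mult x : ℝ) * (g x * psi x)‖
      ≤ M * ((γ.toConfiguration.mult x : ℝ) * psi x) := by
  have h1 := psi_pos x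
  have h2 := hg x
  rw [Real.norm_eq_abs, abs_mul, abs_mul, abs_of_pos h1, Nat.abs_cast]
  have h3 : (0 : ℝ) ≤ γ.toConfiguration.mult x * psi x := by positivity
  nlinarith

theorem summable_nu (γ : Tempered d) {g : Pt d → ℝ} {M : ℝ} (hg : ∀ x, |g x| ≤ M) :
    Summable fun x => (γ.toConfiguration.mult x : ℝ) * (g x * psi x) :=
  Summable.of_norm_bounded (γ.summable_psi.mul_left M) (γ.abs_nu_term_le hg)

theorem tendsto_nu (γ : Tempered d) {g : ℕ → Pt d → ℝ} {g' : Pt d → ℝ} {M : ℝ}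
    (hg : ∀ n x, |g n x| ≤ M) (h : ∀ x, Tendsto (fun n => g n x) atTop (𝓝 (g' x))) :
    Tendsto (fun n => γ.nu (g n)) atTop (𝓝 (γ.nu g')) :=
  tendsto_tsum_of_dominated_convergence (γ.summable_psi.mul_left M)
    (fun x => ((h x).mul_const _).const_mul _)
    (Eventually.of_forall fun n x => γ.abs_nu_term_le (hg n) x)

theorem nu_of_nonneg (γ : Tempered d) {g : Pt d → ℝ} (hg : ∀ x, 0 ≤ g x) :
    γ.nu g = (γ.toConfiguration.sum fun x => ENNReal.ofReal (g x * psi x)).toReal := by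
  rw [nu, Configuration.sum, ENNReal.tsum_toReal_eq fun x =>
    ENNReal.mul_ne_top (by simp) ENNReal.ofReal_ne_top]
  refine tsum_congr fun x => ?_
  rw [ENNReal.toReal_mul, ENNReal.toReal_natCast,
    ENNReal.toReal_ofReal (mul_nonneg (hg x) (psi_pos x).le)]

/-- Adding the constant `M` makes the summands nonnegative, where measurability of extended
nonnegative sums applies. -/
theorem measurable_nu {g : Pt d → ℝ} (hm : Measurable g) {M : ℝ} (hg : ∀ x, |g x| ≤ M) :
    Measurable fun γ : Tempered d => γ.nu g := by
  have hM : ∀ x : Pt d, |(fun _ : Pt d => M) x| ≤ |M| := fun x => le_rfl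
  have e : ∀ γ : Tempered d, γ.nu g = γ.nu (fun x => g x + M) - γ.nu (fun _ => M) := by
    intro γ
    unfold nu
    rw [← Summable.tsum_sub]
    · exact tsum_congr fun x => by ring
    · refine γ.summable_nu (M := M + |M|) fun x => (abs_add_le _ _).trans ?_
      gcongr
      exact hg x
    · exact γ.summable_nu hM
  have hM0 : 0 ≤ M := (abs_nonneg _).trans (hg 0)
  have h : ∀ f : Pt d → ℝ, Measurable f → (∀ x, 0 ≤ f x) → Measurable fun γ : Tempered d => γ.nu f := by
    intro f hf hf0
    simp only [fun γ : Tempered d => γ.nu_of_nonneg hf0]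
    exact ((Configuration.measurable_sum (hf.mul continuous_psi.measurable).ennreal_ofReal).comp
      measurable_toConfiguration).ennreal_toReal
  simp only [e]
  exact (h _ (hm.add_const M) fun x => by linarith [neg_le_of_abs_le (hg x)]).sub
    (h _ measurable_const fun _ => hM0)

theorem abs_le_one_of_mem {g : Pt d → ℝ} (hg : g ∈ unitBL d) (x : Pt d) : |g x| ≤ 1 := by
  obtain ⟨L, M, h, -, h2⟩ := hg
  have : M ≤ 1 := le_add_self.trans h
  exact (h2 x).trans (by exact_mod_cast this)

theorem continuous_of_mem {g : Pt d → ℝ} (hg : g ∈ unitBL d) : Continuous g := by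
  obtain ⟨L, M, -, h, -⟩ := hg
  exact h.continuous

theorem edist_eq (γ γ' : Tempered d) : edist γ γ' = ⨆ g ∈ unitBL d, edist (γ.nu g) (γ'.nu g) := rfl

/-- The unit ball is separable in the topology of locally uniform convergence, and convergence there
implies pointwise convergence. -/
theorem exists_countable_dense : ∃ D : ℕ → Pt d → ℝ, (∀ n, D n ∈ unitBL d) ∧
    ∀ g ∈ unitBL d, ∃ u : ℕ → ℕ, ∀ x, Tendsto (fun n => D (u n) x) atTop (𝓝 (g x)) := by
  let B : Set C(Pt d, ℝ) := {g | (g : Pt d → ℝ) ∈ unitBL d}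
  have hne : Nonempty B := ⟨⟨0, 0, 0, by simp, LipschitzWith.const 0, by simp⟩⟩
  obtain ⟨D, hD⟩ := TopologicalSpace.exists_dense_seq B
  refine ⟨fun n => (D n).1, fun n => (D n).2, fun g hg => ?_⟩
  let g' : B := ⟨⟨g, continuous_of_mem hg⟩, hg⟩
  obtain ⟨v, hv, hvt⟩ := mem_closure_iff_seq_limit.1 (hD g')
  choose u hu using hv
  refine ⟨u, fun x => ?_⟩
  have hc : Continuous fun f : B => (f.1 : Pt d → ℝ) x :=
    (ContinuousEvalConst.continuous_eval_const x).comp continuous_subtype_val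
  have := (hc.tendsto g').comp hvt
  refine this.congr fun n => ?_
  simp [← hu n]

/-- The σ-field is defined by counts and not by the metric. Since `ν_γ` respects bounded pointwise
convergence, the supremum can be restricted to a countable family of measurable functions. -/
theorem measurable_edist : Measurable fun q : Tempered d × Tempered d => edist q.1 q.2 := by
  obtain ⟨D, hD, hdense⟩ := exists_countable_dense (d := d)
  have e : ∀ γ γ' : Tempered d, edist γ γ' = ⨆ n, edist (γ.nu (D n)) (γ'.nu (D n)) := by
    intro γ γ'
    rw [edist_eq]
    refine le_antisymm (iSup₂_le fun g hg => ?_) (iSup_le fun n => le_iSup₂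
      (f := fun g (_ : g ∈ unitBL d) => edist (γ.nu g) (γ'.nu g)) _ (hD n))
    obtain ⟨u, hu⟩ := hdense g hg
    have h1 := γ.tendsto_nu (fun n x => abs_le_one_of_mem (hD (u n)) x) hu
    have h2 := γ'.tendsto_nu (fun n x => abs_le_one_of_mem (hD (u n)) x) hu
    exact le_of_tendsto' (h1.edist h2) fun n =>
      le_iSup (fun n => edist (γ.nu (D n)) (γ'.nu (D n))) (u n)
  simp only [e]
  refine Measurable.iSup fun n => ?_
  have h := measurable_nu (continuous_of_mem (hD n)).measurable (abs_le_one_of_mem (hD n))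
  exact (h.comp measurable_fst).edist (h.comp measurable_snd)

theorem nu_move (γ : Tempered d) {x : Pt d} (hx : γ.toConfiguration.mult x ≠ 0) (y : Pt d)
    {g : Pt d → ℝ} {M : ℝ} (hg : ∀ x, |g x| ≤ M) :
    (γ.move x y).nu g = γ.nu g - g x * psi x + g y * psi y := by
  classical
  have h2 : ∀ w : Pt d, HasSum (fun z => (if z = w then 1 else 0 : ℝ) * (g z * psi z)) (g w * psi w) := by
    intro w
    have := hasSum_single (f := fun z => (if z = w then 1 else 0 : ℝ) * (g z * psi z)) w
      (fun z hz => by simp [hz])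
    simpa using this
  have h := ((γ.summable_nu hg).hasSum.sub (h2 x)).add (h2 y)
  refine Eq.trans ?_ h.tsum_eq
  unfold nu
  refine tsum_congr fun z => ?_
  have e : ((γ.move x y).toConfiguration.mult z : ℝ) = γ.toConfiguration.mult z
      - (if z = x then 1 else 0) + (if z = y then 1 else 0) := by
    change (((γ.toConfiguration.mult z - if z = x then 1 else 0) + if z = y then 1 else 0 : ℕ) : ℝ) = _
    by_cases h : z = x
    · subst h
      have : 1 ≤ γ.toConfiguration.mult z := Nat.one_le_iff_ne_zero.2 hx
      simp only [if_true]
      push_cast [Nat.cast_sub this]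
      ring
    · simp [h]
  rw [e]
  ring

/-- A jump changes `ν_γ(g)` only by the terms at `x` and `y`, and `|g| ≤ 1`. -/
theorem edist_move_le (γ : Tempered d) {x : Pt d} (hx : γ.toConfiguration.mult x ≠ 0) (y : Pt d) :
    edist γ (γ.move x y) ≤ ENNReal.ofReal (psi x + psi y) := by
  rw [edist_eq]
  refine iSup₂_le fun g hg => ?_
  have hb := abs_le_one_of_mem hg
  rw [γ.nu_move hx y hb, edist_dist, Real.dist_eq]
  apply ENNReal.ofReal_le_ofReal
  have e : γ.nu g - (γ.nu g - g x * psi x + g y * psi y) = g x * psi x - g y * psi y := by ring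
  rw [e]
  refine (abs_sub _ _).trans ?_
  have h1 := psi_pos x
  have h2 := psi_pos y
  rw [abs_mul, abs_mul, abs_of_pos h1, abs_of_pos h2]
  have := hb x
  have := hb y
  nlinarith

/-! ### The jump kernel -/

section Kernel

variable (a φ : Pt d → ℝ) (α : ℝ)

theorem measurable_rate (ha : Measurable a) (hφ : Measurable φ) :
    Measurable fun q : Tempered d × Pt d × Pt d => rate a φ α q.1 q.2.1 q.2.2 := by
  unfold rate
  have h1 : Measurable fun x : Pt d => psiα α x := by
    unfold psiα; fun_prop
  have h2 : Measurable fun q : Tempered d × Pt d × Pt d =>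
      (q.1.toConfiguration.erase q.2.1).sum fun z => ENNReal.ofReal (φ (z - q.2.2)) := by
    refine measurable_sum_erase measurable_fst (by fun_prop)
      (f := fun (q : Tempered d × Pt d × Pt d) z => ENNReal.ofReal (φ (z - q.2.2))) ?_
    unfold Function.uncurry
    fun_prop
  refine Measurable.mul ?_ ?_
  · refine Measurable.ennreal_ofReal (Measurable.mul ?_ ?_)
    · exact h1.comp (by fun_prop)
    · exact ha.comp (by fun_prop)
  · exact EReal.measurable_exp.comp (measurable_coe_ennreal_ereal.comp h2).neg

theorem rate_ne_top (γ : Tempered d) (x y : Pt d) : rate a φ α γ x y ≠ ∞ := by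
  unfold rate
  refine ENNReal.mul_ne_top ENNReal.ofReal_ne_top ?_
  intro h
  rw [EReal.exp_eq_top_iff] at h
  simp at h

theorem rate_le (γ : Tempered d) (x y : Pt d) :
    rate a φ α γ x y ≤ ENNReal.ofReal (psiα α x * a (x - y)) := by
  unfold rate
  refine mul_le_of_le_one_right zero_le ?_
  rw [EReal.exp_le_one_iff, EReal.neg_le_zero]
  exact EReal.coe_ennreal_nonneg _

/-- The intensity of the jumps, as a kernel. -/
def jumpPairs : Kernel (Tempered d) (Pt d × Pt d) :=
  (pts d ×ₖ Kernel.const (Tempered d) (volume : Measure (Pt d))).withDensity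
    fun γ q => rate a φ α γ q.1 q.2

instance : IsSFiniteKernel (jumpPairs a φ α) :=
  Kernel.IsSFiniteKernel.withDensity _ fun γ q => rate_ne_top a φ α γ q.1 q.2

/-- The jump kernel, as a kernel. -/
def omegaK : Kernel (Tempered d) (Tempered d) :=
  (Kernel.id ×ₖ jumpPairs a φ α).map fun r => r.1.move r.2.1 r.2.2

variable {a φ}

theorem lintegral_omegaK (ha : Measurable a) (hφ : Measurable φ) (γ : Tempered d)
    {F : Tempered d → ℝ≥0∞} (hF : Measurable F) :
    ∫⁻ γ', F γ' ∂omegaK a φ α γ = γ.toConfiguration.sum fun x =>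
      ∫⁻ y, rate a φ α γ x y * F (γ.move x y) := by
  have hr : Measurable (Function.uncurry fun (γ : Tempered d) (q : Pt d × Pt d) =>
      rate a φ α γ q.1 q.2) := measurable_rate a φ α ha hφ
  have hFm : Measurable fun r : Tempered d × Pt d × Pt d => F (r.1.move r.2.1 r.2.2) :=
    hF.comp measurable_move
  have hFγ : Measurable fun q : Pt d × Pt d => F (γ.move q.1 q.2) :=
    hFm.comp (f := fun q => (γ, q)) (by fun_prop)
  have hrγ : Measurable fun q : Pt d × Pt d => rate a φ α γ q.1 q.2 :=
    (measurable_rate a φ α ha hφ).comp (f := fun q => (γ, q)) (by fun_prop)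
  have hprod : Measurable fun q : Pt d × Pt d => rate a φ α γ q.1 q.2 * F (γ.move q.1 q.2) :=
    hrγ.mul hFγ
  rw [omegaK, Kernel.lintegral_map _ measurable_move _ hF, Kernel.lintegral_id_prod hFm,
    jumpPairs, Kernel.lintegral_withDensity _ hr γ hFγ, Kernel.lintegral_prod _ _ _ hprod]
  exact lintegral_pts _ _

theorem omegaK_apply (ha : Measurable a) (hφ : Measurable φ) (γ : Tempered d)
    {A : Set (Tempered d)} (hA : MeasurableSet A) :
    omegaK a φ α γ A = jumpKernel a φ α γ A := by
  rw [← lintegral_indicator_one hA, lintegral_omegaK _ ha hφ _ (measurable_one.indicator hA)]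
  rfl

end Kernel

end Tempered

end Kawasaki

/-! ### Weights and the general estimate for the jump kernel. -/

namespace Kawasaki

variable {d : ℕ}

/-! ### Weights -/

theorem pow_succ_le_add {u v : ℝ} (hv : 0 ≤ v) (h : v ≤ u) (n : ℕ) :
    u ^ (n + 1) ≤ v ^ (n + 1) + (n + 1) * u ^ n * (u - v) := by
  induction n with
  | zero => simp
  | succ n ih =>
    have hu : 0 ≤ u := hv.trans h
    have h1 : v ^ (n + 1) ≤ u ^ (n + 1) := pow_le_pow_left₀ hv h _
    have h2 := mul_le_mul_of_nonneg_left ih hu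
    have h3 := mul_le_mul_of_nonneg_right h1 (sub_nonneg.2 h)
    push_cast
    have e1 : u ^ (n + 1 + 1) = u * u ^ (n + 1) := by ring
    have e2 : v ^ (n + 1 + 1) = v * v ^ (n + 1) := by ring
    have e3 : u * (v ^ (n + 1) + (n + 1) * u ^ n * (u - v))
      = v * v ^ (n + 1) + (u - v) * v ^ (n + 1) + (n + 1) * u ^ (n + 1) * (u - v) := by ring
    rw [e1, e2]
    linarith

theorem pow_le_one_add_pow_succ {v : ℝ} (hv : 0 ≤ v) (n : ℕ) : v ^ n ≤ 1 + v ^ (n + 1) := by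
  rcases le_total v 1 with h | h
  · have := pow_le_one₀ (n := n) hv h
    have : 0 ≤ v ^ (n + 1) := by positivity
    linarith
  · have : v ^ n ≤ v ^ (n + 1) := pow_le_pow_right₀ h (Nat.le_succ n)
    linarith

theorem add_pow_le_two_pow {u v : ℝ} (hu : 0 ≤ u) (hv : 0 ≤ v) (n : ℕ) :
    (u + v) ^ n ≤ 2 ^ n * (u ^ n + v ^ n) := by
  refine (add_pow_le hu hv n).trans ?_
  gcongr
  · norm_num
  · omega

/-- The increment of the weight `psiα (s ^ (d + 1))`. -/
def incr (d : ℕ) (s : ℝ) (z : Pt d) : ℝ := (d + 1) * 2 ^ d * s * (‖z‖ + ‖z‖ ^ (d + 1))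

theorem psiα_pos {α : ℝ} (hα : 0 ≤ α) (x : Pt d) : 0 < psiα α x := by unfold psiα; positivity

theorem psiα_le_one {α : ℝ} (hα : 0 ≤ α) (x : Pt d) : psiα α x ≤ 1 := by
  unfold psiα
  rw [div_le_one (by positivity)]
  have : 0 ≤ α * ‖x‖ ^ (d + 1) := by positivity
  linarith

theorem continuous_psiα {α : ℝ} (hα : 0 ≤ α) : Continuous (psiα (d := d) α) := by
  unfold psiα
  refine Continuous.div (by fun_prop) (by fun_prop) fun x => ?_
  positivity

/-- In rescaled variables the increment of `|x|^{d+1}` is at most its derivative times `s |x - y|`.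
Dividing by the weight gives a relative increment that is linear in `s`; a small scale therefore
makes the drift as small as desired. -/
theorem psiα_le_mul {s : ℝ} (hs : 0 ≤ s) (hs1 : s ≤ 1) (x y : Pt d) :
    psiα (s ^ (d + 1)) y ≤ psiα (s ^ (d + 1)) x * (1 + incr d s (x - y)) := by
  set u := s * ‖x‖ with hu
  set v := s * ‖y‖ with hv
  set r := ‖x - y‖ with hr
  have hu0 : 0 ≤ u := by positivity
  have hv0 : 0 ≤ v := by positivity
  have hr0 : 0 ≤ r := norm_nonneg _
  have huv : u ≤ v + s * r := by
    have : ‖x‖ ≤ ‖y‖ + r := by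
      have := norm_add_le y (x - y)
      rwa [add_sub_cancel] at this
    rw [hu, hv, ← mul_add]
    gcongr
  have h1 : u ^ (d + 1) ≤ v ^ (d + 1) + (d + 1) * (v + s * r) ^ d * (s * r) := by
    have := pow_succ_le_add hv0 (le_add_of_nonneg_right (by positivity) : v ≤ v + s * r) d
    rw [add_sub_cancel_left] at this
    exact (pow_le_pow_left₀ hu0 huv _).trans this
  have h2 : (v + s * r) ^ d * (s * r) ≤ 2 ^ d * ((1 + v ^ (d + 1)) * (s * (r + r ^ (d + 1)))) := by
    have e1 := add_pow_le_two_pow hv0 (by positivity : 0 ≤ s * r) d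
    have e2 := pow_le_one_add_pow_succ hv0 d
    -- Here `s ≤ 1` is used to keep only one power of `s`.
    have e3 : (s * r) ^ d * (s * r) ≤ s * r ^ (d + 1) := by
      rw [← pow_succ, mul_pow]
      gcongr
      exact pow_le_of_le_one hs hs1 (by omega)
    have e4 : 0 ≤ v ^ (d + 1) := by positivity
    have e5 : 0 ≤ s * r ^ (d + 1) := by positivity
    calc (v + s * r) ^ d * (s * r) ≤ 2 ^ d * (v ^ d + (s * r) ^ d) * (s * r) := by gcongr
      _ = 2 ^ d * (v ^ d * (s * r) + (s * r) ^ d * (s * r)) := by ring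
      _ ≤ 2 ^ d * ((1 + v ^ (d + 1)) * (s * r) + s * r ^ (d + 1)) := by gcongr
      _ ≤ _ := by
        gcongr
        nlinarith [mul_nonneg e4 e5]
  have h3 : 1 + u ^ (d + 1) ≤ (1 + v ^ (d + 1)) * (1 + incr d s (x - y)) := by
    unfold incr
    rw [← hr]
    have e6 : ((d : ℝ) + 1) * ((v + s * r) ^ d * (s * r))
        ≤ (d + 1) * (2 ^ d * ((1 + v ^ (d + 1)) * (s * (r + r ^ (d + 1))))) := by gcongr
    linarith
  unfold psiα
  rw [← mul_pow, ← mul_pow, ← hu, ← hv, div_mul_eq_mul_div, one_mul, div_le_div_iff₀ (by positivity)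
    (by positivity), one_mul, mul_comm]
  exact h3

theorem psi_le_mul (x y : Pt d) :
    psi y ≤ psi x * (2 ^ (d + 1) * (1 + ‖x - y‖ ^ (d + 1))) := by
  set r := ‖x - y‖ with hr
  have hr0 : 0 ≤ r := norm_nonneg _
  have h1 : ‖x‖ ^ (d + 1) ≤ 2 ^ (d + 1) * (‖y‖ ^ (d + 1) + r ^ (d + 1)) := by
    have : ‖x‖ ≤ ‖y‖ + r := by
      have := norm_add_le y (x - y)
      rwa [add_sub_cancel] at this
    exact (pow_le_pow_left₀ (norm_nonneg _) this _).trans (add_pow_le_two_pow (norm_nonneg _) hr0 _)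
  have h2 : (1 : ℝ) ≤ 2 ^ (d + 1) := one_le_pow₀ (by norm_num)
  have h3 : 0 ≤ ‖y‖ ^ (d + 1) := by positivity
  have h4 : 0 ≤ r ^ (d + 1) := by positivity
  unfold psi
  rw [div_mul_eq_mul_div, one_mul, div_le_div_iff₀ (by positivity) (by positivity), one_mul]
  have h5 : 0 ≤ (2 : ℝ) ^ (d + 1) * (r ^ (d + 1) * ‖y‖ ^ (d + 1)) := by positivity
  calc 1 + ‖x‖ ^ (d + 1) ≤ 2 ^ (d + 1) + 2 ^ (d + 1) * (‖y‖ ^ (d + 1) + r ^ (d + 1)) :=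
        add_le_add h2 h1
    _ ≤ _ := by nlinarith

/-- The weight of the compact sets. -/
def hwt (x : Pt d) : ℝ := (1 + ‖x‖) ^ (-((d : ℝ) + 1 / 2))

theorem hwt_pos (x : Pt d) : 0 < hwt x := by unfold hwt; positivity

theorem continuous_hwt : Continuous (hwt (d := d)) := by
  unfold hwt
  refine Continuous.rpow_const (by fun_prop) fun x => Or.inl ?_
  positivity

theorem hwt_le_mul (x y : Pt d) :
    hwt y ≤ hwt x * (2 ^ (d + 1) * (1 + ‖x - y‖ ^ (d + 1))) := by
  set r := ‖x - y‖ with hr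
  have hr0 : 0 ≤ r := norm_nonneg _
  have h0 : ‖x‖ ≤ ‖y‖ + r := by
    have := norm_add_le y (x - y)
    rwa [add_sub_cancel] at this
  have h1 : 1 + ‖x‖ ≤ (1 + ‖y‖) * (1 + r) := by
    have := mul_nonneg (norm_nonneg y) hr0
    nlinarith
  set t : ℝ := (d : ℝ) + 1 / 2 with ht
  have h2 : (1 + ‖x‖) ^ t ≤ (1 + ‖y‖) ^ t * (1 + r) ^ t := by
    rw [← Real.mul_rpow (by positivity) (by positivity)]
    exact Real.rpow_le_rpow (by positivity) h1 (by positivity)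
  have h3 : (1 + r) ^ t ≤ 2 ^ (d + 1) * (1 + r ^ (d + 1)) := by
    calc (1 + r) ^ t ≤ (1 + r) ^ ((d + 1 : ℕ) : ℝ) := by
          apply Real.rpow_le_rpow_of_exponent_le (by linarith)
          push_cast
          linarith
      _ = (1 + r) ^ (d + 1) := Real.rpow_natCast _ _
      _ ≤ 2 ^ (d + 1) * (1 ^ (d + 1) + r ^ (d + 1)) := add_pow_le_two_pow zero_le_one hr0 _
      _ = _ := by rw [one_pow]
  unfold hwt
  rw [← ht, Real.rpow_neg (by positivity), Real.rpow_neg (by positivity)]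
  rw [inv_mul_eq_div, inv_eq_one_div, div_le_div_iff₀ (by positivity) (by positivity), one_mul, mul_comm]
  exact h2.trans (by gcongr)

/-! ### Estimates for the jump kernel -/

namespace Tempered

variable {a φ : Pt d → ℝ} {α : ℝ}

/-- The common source of all drift bounds. The rate is at most `a(x - y)`, since `ψ_α` and the
repulsion factor are at most one, so the last term does not depend on `α`. One takes `G = F γ` for
Lyapunov functions and `G = 0` for functions that vanish at `γ`. -/
theorem omegaK_le (hm : IsJumpModel a φ) (hα : 0 ≤ α) (γ : Tempered d) {F : Tempered d → ℝ≥0∞}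
    (hF : Measurable F) {G : ℝ≥0∞} {b q : Pt d → ℝ≥0∞} (hq : Measurable q)
    (h : ∀ x, γ.toConfiguration.mult x ≠ 0 → ∀ y,
      F (γ.move x y) ≤ G + b x * q (x - y)) :
    ∫⁻ γ', F γ' ∂omegaK a φ α γ ≤ omegaK a φ α γ univ * G
      + (∫⁻ z, ENNReal.ofReal (a z) * q z) * γ.toConfiguration.sum b := by
  have ham := hm.measurable_a
  have hr : ∀ x, Measurable fun y => rate a φ α γ x y := fun x =>
    (measurable_rate a φ α ham hm.measurable_phi).comp (f := fun y => (γ, x, y)) (by fun_prop)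
  have h0 : omegaK a φ α γ univ = γ.toConfiguration.sum fun x => ∫⁻ y, rate a φ α γ x y := by
    rw [omegaK_apply _ ham hm.measurable_phi _ .univ]
    simp [jumpKernel, Configuration.sum]
  have hi : ∀ x, ∫⁻ y, rate a φ α γ x y * q (x - y) ≤ ∫⁻ z, ENNReal.ofReal (a z) * q z := by
    intro x
    rw [← lintegral_sub_left_eq_self (fun z => ENNReal.ofReal (a z) * q z) x]
    refine lintegral_mono fun y => ?_
    gcongr
    refine (rate_le a φ α γ x y).trans (ENNReal.ofReal_le_ofReal ?_)
    exact mul_le_of_le_one_left (hm.nonneg_a _) (psiα_le_one hα x)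
  rw [lintegral_omegaK _ ham hm.measurable_phi _ hF, h0]
  have e : (γ.toConfiguration.sum fun x => ∫⁻ y, rate a φ α γ x y) * G
      + (∫⁻ z, ENNReal.ofReal (a z) * q z) * γ.toConfiguration.sum b
      = γ.toConfiguration.sum fun x => G * (∫⁻ y, rate a φ α γ x y)
        + (∫⁻ z, ENNReal.ofReal (a z) * q z) * b x := by
    rw [Configuration.sum_add, Configuration.sum_const_mul, Configuration.sum_const_mul, mul_comm G]
  rw [e]
  refine ENNReal.tsum_le_tsum fun x => ?_
  by_cases hx : γ.toConfiguration.mult x = 0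
  · simp [hx]
  gcongr
  calc ∫⁻ y, rate a φ α γ x y * F (γ.move x y)
      ≤ ∫⁻ y, (G * rate a φ α γ x y + b x * (rate a φ α γ x y * q (x - y))) := by
        refine lintegral_mono fun y => ?_
        calc _ ≤ rate a φ α γ x y * (G + b x * q (x - y)) := by
              gcongr
              exact h x hx y
          _ = _ := by ring
    _ = G * (∫⁻ y, rate a φ α γ x y) + b x * (∫⁻ y, rate a φ α γ x y * q (x - y)) := by
        have := hr x
        rw [lintegral_add_right _ (by fun_prop), lintegral_const_mul _ (hr x),
          lintegral_const_mul _ (by fun_prop)]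
    _ ≤ _ := by
        rw [mul_comm (b x)]
        exact add_le_add le_rfl (mul_le_mul_left (hi x) _)

/-- The sum of the values of a weight. -/
def wsum (w : Pt d → ℝ) (γ : Tempered d) : ℝ≥0∞ := γ.toConfiguration.sum fun x => ENNReal.ofReal (w x)

theorem measurable_wsum {w : Pt d → ℝ} (hw : Measurable w) : Measurable (wsum w) :=
  (Configuration.measurable_sum hw.ennreal_ofReal).comp measurable_toConfiguration

theorem wsum_move_le (γ : Tempered d) {w : Pt d → ℝ} {x y : Pt d}
    (hx : γ.toConfiguration.mult x ≠ 0) {δ : ℝ≥0∞}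
    (h : ENNReal.ofReal (w y) ≤ ENNReal.ofReal (w x) + δ) : wsum w (γ.move x y) ≤ wsum w γ + δ := by
  unfold wsum
  rw [sum_move, ← γ.toConfiguration.sum_erase_add _ hx, add_assoc]
  gcongr

theorem ofReal_le_add {w q : Pt d → ℝ} (hw : ∀ x, 0 ≤ w x) (hq : ∀ z, 0 ≤ q z)
    (h : ∀ x y, w y ≤ w x * (1 + q (x - y))) (x y : Pt d) :
    ENNReal.ofReal (w y) ≤ ENNReal.ofReal (w x) + ENNReal.ofReal (w x) * ENNReal.ofReal (q (x - y)) := by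
  rw [← ENNReal.ofReal_mul (hw x), ← ENNReal.ofReal_add (hw x) (mul_nonneg (hw x) (hq _))]
  exact ENNReal.ofReal_le_ofReal ((h x y).trans_eq (by ring))

theorem omegaK_wsum_le (hm : IsJumpModel a φ) (hα : 0 ≤ α) {w q : Pt d → ℝ} (hwm : Measurable w)
    (hqm : Measurable q) (hw : ∀ x, 0 ≤ w x) (hq : ∀ z, 0 ≤ q z)
    (h : ∀ x y, w y ≤ w x * (1 + q (x - y))) (γ : Tempered d) :
    ∫⁻ γ', wsum w γ' ∂omegaK a φ α γ ≤ omegaK a φ α γ univ * wsum w γ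
      + (∫⁻ z, ENNReal.ofReal (a z) * ENNReal.ofReal (q z)) * wsum w γ := by
  exact omegaK_le (q := fun z => ENNReal.ofReal (q z)) hm hα γ (measurable_wsum hwm)
    hqm.ennreal_ofReal (b := fun x => ENNReal.ofReal (w x)) fun x hx y =>
      γ.wsum_move_le hx (ofReal_le_add hw hq h x y)

end Tempered

end Kawasaki

/-! ### Drift inequalities for the model, uniform in `α`. -/

namespace Kawasaki

variable {d : ℕ}

/-! ### Constants of the model -/

/-- The moment that determines the scale of the weight. -/
def mom (a : Pt d → ℝ) : ℝ := (d + 1) * 2 ^ d * ((∫ z, ‖z‖ * a z) + ∫ z, ‖z‖ ^ (d + 1) * a z)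

/-- The scale of the weight. -/
def scl (a : Pt d → ℝ) : ℝ := 1 / (1 + mom a)

/-- The weight. -/
def wt (a : Pt d → ℝ) (x : Pt d) : ℝ := psiα (scl a ^ (d + 1)) x

/-- The constant in the estimates of the displacements. -/
def kap (a : Pt d → ℝ) : ℝ := ∫ z, (1 + 2 ^ (d + 1) * (1 + ‖z‖ ^ (d + 1))) * a z

section Model

variable {a φ : Pt d → ℝ}

theorem IsJumpModel.integrable_norm (hm : IsJumpModel a φ) : Integrable fun z => ‖z‖ * a z := by
  simpa using hm.moments_a 1 le_rfl (by omega)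

theorem IsJumpModel.integrable_pow (hm : IsJumpModel a φ) :
    Integrable fun z => ‖z‖ ^ (d + 1) * a z := hm.moments_a (d + 1) (by omega) le_rfl

theorem mom_nonneg (hm : IsJumpModel a φ) : 0 ≤ mom a := by
  have h1 : 0 ≤ ∫ z, ‖z‖ * a z := integral_nonneg fun z => mul_nonneg (norm_nonneg _) (hm.nonneg_a z)
  have h2 : 0 ≤ ∫ z, ‖z‖ ^ (d + 1) * a z :=
    integral_nonneg fun z => mul_nonneg (by positivity) (hm.nonneg_a z)
  unfold mom
  positivity

theorem scl_pos (hm : IsJumpModel a φ) : 0 < scl a := by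
  have := mom_nonneg hm
  unfold scl
  positivity

theorem scl_le_one (hm : IsJumpModel a φ) : scl a ≤ 1 := by
  have := mom_nonneg hm
  unfold scl
  rw [div_le_one (by positivity)]
  linarith

theorem lintegral_a_mul (hm : IsJumpModel a φ) {q : Pt d → ℝ} (hq : ∀ z, 0 ≤ q z)
    (hi : Integrable fun z => q z * a z) :
    ∫⁻ z, ENNReal.ofReal (a z) * ENNReal.ofReal (q z) = ENNReal.ofReal (∫ z, q z * a z) := by
  rw [ofReal_integral_eq_lintegral_ofReal hi (ae_of_all _ fun z => mul_nonneg (hq z) (hm.nonneg_a z))]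
  refine lintegral_congr fun z => ?_
  rw [ENNReal.ofReal_mul (hq z), mul_comm]

theorem incr_nonneg {s : ℝ} (hs : 0 ≤ s) (z : Pt d) : 0 ≤ incr d s z := by
  unfold incr; positivity

theorem measurable_incr (s : ℝ) : Measurable (incr d s) := by unfold incr; fun_prop

/-- With `scl = 1 / (1 + mom)` the mean increment equals `mom / (1 + mom)`. This normalisation gives
`lyap` the drift constant one. -/
theorem lintegral_incr_le (hm : IsJumpModel a φ) :
    ∫⁻ z, ENNReal.ofReal (a z) * ENNReal.ofReal (incr d (scl a) z) ≤ 1 := by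
  have h1 := hm.integrable_norm
  have h2 := hm.integrable_pow
  have e : ∀ z : Pt d, incr d (scl a) z * a z
      = (d + 1) * 2 ^ d * scl a * (‖z‖ * a z + ‖z‖ ^ (d + 1) * a z) := fun z => by unfold incr; ring
  have hi : Integrable fun z => incr d (scl a) z * a z := by
    simp only [e]
    exact (h1.add h2).const_mul _
  rw [lintegral_a_mul hm (incr_nonneg (scl_pos hm).le) hi]
  simp only [e]
  rw [integral_const_mul, integral_add h1 h2, ← ENNReal.ofReal_one]
  apply ENNReal.ofReal_le_ofReal
  have h3 := mom_nonneg hm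
  have e2 : (d + 1) * 2 ^ d * scl a * ((∫ z, ‖z‖ * a z) + ∫ z, ‖z‖ ^ (d + 1) * a z)
      = mom a / (1 + mom a) := by unfold scl mom; ring
  rw [e2, div_le_one (by positivity)]
  linarith

theorem integrable_kap (hm : IsJumpModel a φ) :
    Integrable fun z => (1 + 2 ^ (d + 1) * (1 + ‖z‖ ^ (d + 1))) * a z := by
  have e : ∀ z : Pt d, (1 + 2 ^ (d + 1) * (1 + ‖z‖ ^ (d + 1))) * a z
      = (1 + 2 ^ (d + 1)) * a z + 2 ^ (d + 1) * (‖z‖ ^ (d + 1) * a z) := fun z => by ring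
  simp only [e]
  exact (hm.integrable_a.const_mul _).add (hm.integrable_pow.const_mul _)

theorem lintegral_kap (hm : IsJumpModel a φ) :
    ∫⁻ z, ENNReal.ofReal (a z) * ENNReal.ofReal (1 + 2 ^ (d + 1) * (1 + ‖z‖ ^ (d + 1)))
      = ENNReal.ofReal (kap a) :=
  lintegral_a_mul hm (q := fun z => 1 + 2 ^ (d + 1) * (1 + ‖z‖ ^ (d + 1))) (fun z => by positivity)
    (integrable_kap hm)

theorem kap_nonneg (hm : IsJumpModel a φ) : 0 ≤ kap a :=
  integral_nonneg fun z => mul_nonneg (by positivity) (hm.nonneg_a z)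

theorem wt_pos (hm : IsJumpModel a φ) (x : Pt d) : 0 < wt a x :=
  psiα_pos (pow_nonneg (scl_pos hm).le _) x

theorem wt_le_one (hm : IsJumpModel a φ) (x : Pt d) : wt a x ≤ 1 :=
  psiα_le_one (pow_nonneg (scl_pos hm).le _) x

theorem continuous_wt (hm : IsJumpModel a φ) : Continuous (wt a) :=
  continuous_psiα (pow_nonneg (scl_pos hm).le _)

theorem psi_le_wt (hm : IsJumpModel a φ) (x : Pt d) : psi x ≤ wt a x := by
  have h0 := scl_pos hm
  have h1 : scl a ^ (d + 1) ≤ 1 := pow_le_one₀ h0.le (scl_le_one hm)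
  have h2 : 0 ≤ ‖x‖ ^ (d + 1) := by positivity
  unfold psi wt psiα
  apply one_div_le_one_div_of_le (by positivity)
  nlinarith

/-- Together with `psi_le_wt` this makes the two weights comparable: `lyap` is finite on `Γ_*`, and
`1 + lyap` and `1 + Ψ` define the same domain. -/
theorem mul_wt_le_psi (hm : IsJumpModel a φ) (x : Pt d) : scl a ^ (d + 1) * wt a x ≤ psi x := by
  have h0 := scl_pos hm
  have h1 : scl a ^ (d + 1) ≤ 1 := pow_le_one₀ h0.le (scl_le_one hm)
  have h3 : 0 < scl a ^ (d + 1) := by positivity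
  have h2 : 0 ≤ ‖x‖ ^ (d + 1) := by positivity
  unfold psi wt psiα
  rw [mul_one_div, div_le_div_iff₀ (by positivity) (by positivity)]
  nlinarith

theorem mul_psiα_le_wt (hm : IsJumpModel a φ) {α : ℝ} (hα : α ∈ Ioc (0 : ℝ) 1) (x : Pt d) :
    α * psiα α x ≤ wt a x := by
  have h0 := scl_pos hm
  have h1 : scl a ^ (d + 1) ≤ 1 := pow_le_one₀ h0.le (scl_le_one hm)
  have h3 : 0 < scl a ^ (d + 1) := by positivity
  have h2 : 0 ≤ ‖x‖ ^ (d + 1) := by positivity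
  have h4 := hα.1
  have h5 := hα.2
  unfold wt psiα
  rw [mul_one_div, div_le_div_iff₀ (by positivity) (by positivity)]
  have : α * (scl a ^ (d + 1) * ‖x‖ ^ (d + 1)) ≤ α * ‖x‖ ^ (d + 1) := by
    gcongr
    exact mul_le_of_le_one_left h2 h1
  nlinarith

end Model

namespace Tempered

variable {a φ : Pt d → ℝ} {α : ℝ}

/-- The Lyapunov function. -/
def lyap (a : Pt d → ℝ) (γ : Tempered d) : ℝ := (wsum (wt a) γ).toReal

theorem lyap_nonneg (γ : Tempered d) : 0 ≤ lyap a γ := ENNReal.toReal_nonneg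

theorem measurable_lyap (hm : IsJumpModel a φ) : Measurable (lyap (d := d) a) :=
  (measurable_wsum (continuous_wt hm).measurable).ennreal_toReal

theorem mul_wsum_le (hm : IsJumpModel a φ) (γ : Tempered d) :
    ENNReal.ofReal (scl a ^ (d + 1)) * wsum (wt a) γ ≤ Psi γ.toConfiguration := by
  unfold wsum Psi
  rw [← Configuration.sum_const_mul]
  refine Configuration.sum_mono _ fun x => ?_
  rw [← ENNReal.ofReal_mul (pow_nonneg (scl_pos hm).le _)]
  exact ENNReal.ofReal_le_ofReal (mul_wt_le_psi hm x)

theorem wsum_ne_top (hm : IsJumpModel a φ) (γ : Tempered d) : wsum (wt a) γ ≠ ∞ := by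
  intro h
  have := mul_wsum_le hm γ
  rw [h, ENNReal.mul_top (ENNReal.ofReal_pos.2 (pow_pos (scl_pos hm) _)).ne'] at this
  exact γ.2.ne (top_le_iff.1 this)

theorem ofReal_lyap (hm : IsJumpModel a φ) (γ : Tempered d) :
    ENNReal.ofReal (lyap a γ) = wsum (wt a) γ := ENNReal.ofReal_toReal (wsum_ne_top hm γ)

theorem Psi_le (hm : IsJumpModel a φ) (γ : Tempered d) :
    Psi γ.toConfiguration ≤ ENNReal.ofReal (lyap a γ) := by
  rw [ofReal_lyap hm]
  exact Configuration.sum_mono _ fun x => ENNReal.ofReal_le_ofReal (psi_le_wt hm x)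

/-! ### The jump process -/

/-- The rate of the jumps, phantom jumps included. -/
def lam (a : Pt d → ℝ) (α : ℝ) (γ : Tempered d) : ℝ := 1 + lyap a γ / α

theorem lam_pos (hα : α ∈ Ioc (0 : ℝ) 1) (γ : Tempered d) : 0 < lam a α γ := by
  have := hα.1
  have := lyap_nonneg (a := a) γ
  unfold lam
  positivity

/-- Since `∫ a = 1`, a particle at `x` jumps with intensity at most `ψ_α(x) ≤ wt(x) / α`. The
constant `1` in `lam` only keeps the rate positive. -/
theorem omegaK_univ_le (hm : IsJumpModel a φ) (hα : α ∈ Ioc (0 : ℝ) 1) (γ : Tempered d) :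
    omegaK a φ α γ univ ≤ ENNReal.ofReal (lam a α γ) := by
  have h0 := hα.1
  have h1 : omegaK a φ α γ univ ≤ ENNReal.ofReal α⁻¹ * wsum (wt a) γ := by
    rw [omegaK_apply _ hm.measurable_a hm.measurable_phi _ .univ, wsum, ← Configuration.sum_const_mul]
    refine ENNReal.tsum_le_tsum fun x => ?_
    gcongr
    calc ∫⁻ y, rate a φ α γ x y * indicator univ 1 (γ.move x y)
        ≤ ∫⁻ y, ENNReal.ofReal (psiα α x) * ENNReal.ofReal (a (x - y)) := by
          refine lintegral_mono fun y => ?_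
          rw [indicator_of_mem (mem_univ _), Pi.one_apply, mul_one,
            ← ENNReal.ofReal_mul (psiα_pos h0.le x).le]
          exact rate_le a φ α γ x y
      _ = ENNReal.ofReal (psiα α x) := by
          have ham := hm.measurable_a
          rw [lintegral_const_mul _ (by fun_prop),
            lintegral_sub_left_eq_self (fun z => ENNReal.ofReal (a z)) x,
            ← ofReal_integral_eq_lintegral_ofReal hm.integrable_a (ae_of_all _ hm.nonneg_a),
            hm.integral_a, ENNReal.ofReal_one, mul_one]
      _ ≤ ENNReal.ofReal α⁻¹ * ENNReal.ofReal (wt a x) := by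
          rw [← ENNReal.ofReal_mul (by positivity)]
          apply ENNReal.ofReal_le_ofReal
          rw [inv_mul_eq_div, le_div_iff₀ h0, mul_comm]
          exact mul_psiα_le_wt hm hα x
  refine h1.trans ?_
  rw [← ofReal_lyap hm, ← ENNReal.ofReal_mul (by positivity)]
  apply ENNReal.ofReal_le_ofReal
  unfold lam
  rw [inv_mul_eq_div]
  linarith

theorem measurable_lam (hm : IsJumpModel a φ) : Measurable (lam (d := d) a α) := by
  have := measurable_lyap hm
  unfold lam
  fun_prop

/-- The transition kernel of the embedded chain, phantom jumps included. -/
def stepK (hm : IsJumpModel a φ) (α : ℝ) : Kernel (Tempered d) (Tempered d) where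
  toFun γ := (ENNReal.ofReal (lam a α γ))⁻¹ • (omegaK a φ α γ
    + (ENNReal.ofReal (lam a α γ) - omegaK a φ α γ univ) • Measure.dirac γ)
  measurable' := by
    refine Measure.measurable_of_measurable_coe _ fun s hs => ?_
    simp only [Measure.smul_apply, Measure.add_apply, smul_eq_mul, Measure.dirac_apply' _ hs]
    have h1 : Measurable fun γ => ENNReal.ofReal (lam a α γ) := (measurable_lam hm).ennreal_ofReal
    have h2 := (omegaK a φ α).measurable_coe hs
    have h3 := (omegaK a φ α).measurable_coe .univ
    have h4 : Measurable fun γ : Tempered d => s.indicator (1 : Tempered d → ℝ≥0∞) γ :=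
      measurable_one.indicator hs
    exact h1.inv.mul (h2.add ((h1.sub h3).mul h4))

theorem mul_lintegral_stepK (hm : IsJumpModel a φ) (hα : α ∈ Ioc (0 : ℝ) 1) (γ : Tempered d)
    {F : Tempered d → ℝ≥0∞} (hF : Measurable F) :
    ENNReal.ofReal (lam a α γ) * ∫⁻ γ', F γ' ∂stepK hm α γ = ∫⁻ γ', F γ' ∂omegaK a φ α γ
      + (ENNReal.ofReal (lam a α γ) - omegaK a φ α γ univ) * F γ := by
  change ENNReal.ofReal (lam a α γ) * ∫⁻ γ', F γ' ∂((ENNReal.ofReal (lam a α γ))⁻¹ • (omegaK a φ α γ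
    + (ENNReal.ofReal (lam a α γ) - omegaK a φ α γ univ) • Measure.dirac γ)) = _
  rw [lintegral_smul_measure, smul_eq_mul, ← mul_assoc,
    ENNReal.mul_inv_cancel (ENNReal.ofReal_pos.2 (lam_pos hα γ)).ne' ENNReal.ofReal_ne_top, one_mul,
    lintegral_add_measure, lintegral_smul_measure, lintegral_dirac' _ hF, smul_eq_mul]

/-- A phantom jump contributes exactly `F γ`, so a drift bound for the true jumps carries over with
the same source. -/
theorem mul_lintegral_stepK_le (hm : IsJumpModel a φ) (hα : α ∈ Ioc (0 : ℝ) 1) (γ : Tempered d)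
    {F : Tempered d → ℝ≥0∞} (hF : Measurable F) {S : ℝ≥0∞}
    (h : ∫⁻ γ', F γ' ∂omegaK a φ α γ ≤ omegaK a φ α γ univ * F γ + S) :
    ENNReal.ofReal (lam a α γ) * ∫⁻ γ', F γ' ∂stepK hm α γ ≤ ENNReal.ofReal (lam a α γ) * F γ + S := by
  rw [mul_lintegral_stepK hm hα γ hF]
  calc _ ≤ omegaK a φ α γ univ * F γ + S
        + (ENNReal.ofReal (lam a α γ) - omegaK a φ α γ univ) * F γ := by gcongr
    _ = (omegaK a φ α γ univ + (ENNReal.ofReal (lam a α γ) - omegaK a φ α γ univ)) * F γ + S := by ring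
    _ = _ := by rw [add_tsub_cancel_of_le (omegaK_univ_le hm hα γ)]

theorem isMarkovKernel_stepK (hm : IsJumpModel a φ) (hα : α ∈ Ioc (0 : ℝ) 1) :
    IsMarkovKernel (stepK hm α) := ⟨fun γ => ⟨by
  have h := mul_lintegral_stepK hm hα γ (F := fun _ => 1) measurable_const
  simp only [lintegral_const, one_mul, mul_one] at h
  rw [add_tsub_cancel_of_le (omegaK_univ_le hm hα γ)] at h
  have h0 := (ENNReal.ofReal_pos.2 (lam_pos (a := a) hα γ)).ne'
  exact (ENNReal.mul_eq_left h0 ENNReal.ofReal_ne_top).1 h⟩⟩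

theorem mul_lintegral_lyap_le (hm : IsJumpModel a φ) (hα : α ∈ Ioc (0 : ℝ) 1) (γ : Tempered d) :
    ENNReal.ofReal (lam a α γ) * ∫⁻ γ', ENNReal.ofReal (lyap a γ') ∂stepK hm α γ
      ≤ ENNReal.ofReal ((lam a α γ + 1) * lyap a γ) := by
  have hw : Measurable (wt a) := (continuous_wt hm).measurable
  have h := omegaK_wsum_le hm hα.1.le hw (measurable_incr (scl a)) (fun x => (wt_pos hm x).le)
    (incr_nonneg (scl_pos hm).le) (psiα_le_mul (scl_pos hm).le (scl_le_one hm)) γ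
  have h2 := mul_lintegral_stepK_le hm hα γ (measurable_wsum hw) h
  simp only [← ofReal_lyap hm] at h2
  refine h2.trans ?_
  rw [ENNReal.ofReal_mul (by linarith [lam_pos (a := a) hα γ]),
    ENNReal.ofReal_add (lam_pos hα γ).le zero_le_one, add_mul, ENNReal.ofReal_one]
  gcongr
  exact lintegral_incr_le hm

/-- The jump process of the model. -/
def jumpData (hm : IsJumpModel a φ) (hα : α ∈ Ioc (0 : ℝ) 1) : JumpData (Tempered d) where
  rate := lam a α
  K := stepK hm α
  -- The summand `1` is needed for `rate ≤ C U`, because the rate is at least one even where `lyap`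
  -- vanishes.
  U γ := 1 + lyap a γ
  C := 1 / α
  markov := isMarkovKernel_stepK hm hα
  measurable_rate := measurable_lam hm
  rate_pos := lam_pos hα
  measurable_U := (measurable_lyap hm).const_add 1
  U_nonneg γ := add_nonneg zero_le_one (lyap_nonneg γ)
  C_nonneg := one_div_nonneg.2 hα.1.le
  rate_le γ := by
    have h1 := hα.1
    have h2 : 1 ≤ 1 / α := (one_le_div h1).2 hα.2
    unfold lam
    rw [mul_add, mul_one, one_div_mul_eq_div]
    linarith
  lyapunov γ := by
    have := isMarkovKernel_stepK hm hα
    have hl := lyap_nonneg (a := a) γ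
    have hr := lam_pos (a := a) hα γ
    have hml := (measurable_lyap hm).ennreal_ofReal
    have e : ∀ γ' : Tempered d, ENNReal.ofReal (1 + lyap a γ') = 1 + ENNReal.ofReal (lyap a γ') :=
      fun γ' => by rw [ENNReal.ofReal_add zero_le_one (lyap_nonneg γ'), ENNReal.ofReal_one]
    simp only [e]
    rw [lintegral_add_left measurable_const]
    simp only [lintegral_const, measure_univ, mul_one]
    rw [mul_add, mul_one]
    refine (add_le_add le_rfl (mul_lintegral_lyap_le hm hα γ)).trans ?_
    rw [← ENNReal.ofReal_add hr.le (by positivity)]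
    apply ENNReal.ofReal_le_ofReal
    nlinarith

/-- The second Lyapunov function. -/
def lyap₂ (a : Pt d → ℝ) (γ : Tempered d) : ℝ := lyap a γ ^ 2 + lyap a γ

theorem lyap₂_nonneg (γ : Tempered d) : 0 ≤ lyap₂ a γ := by
  have := lyap_nonneg (a := a) γ
  unfold lyap₂
  positivity

theorem measurable_lyap₂ (hm : IsJumpModel a φ) : Measurable (lyap₂ (d := d) a) := by
  have := measurable_lyap hm
  unfold lyap₂
  fun_prop

/-- The increment is at most the weight at the target, hence at most one. This cap makes the square
of the increment controllable by the increment itself, when only moments of `a` up to order `d + 1`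
are available. -/
theorem lyap_move_le (hm : IsJumpModel a φ) (γ : Tempered d) {x : Pt d}
    (hx : γ.toConfiguration.mult x ≠ 0) (y : Pt d) :
    lyap a (γ.move x y) ≤ lyap a γ + min 1 (wt a x * incr d (scl a) (x - y)) := by
  have h1 : 0 ≤ wt a x * incr d (scl a) (x - y) :=
    mul_nonneg (wt_pos hm x).le (incr_nonneg (scl_pos hm).le _)
  have h2 : 0 ≤ min 1 (wt a x * incr d (scl a) (x - y)) := le_min zero_le_one h1
  have h3 : wt a y ≤ wt a x + min 1 (wt a x * incr d (scl a) (x - y)) := by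
    have e1 := psiα_le_mul (scl_pos hm).le (scl_le_one hm) x y
    have e2 := wt_le_one hm y
    have e3 := wt_pos hm x
    rw [← min_add_add_left]
    refine le_min (by linarith) ?_
    exact e1.trans_eq (by unfold wt; ring)
  have h := γ.wsum_move_le (w := wt a) hx (y := y)
    (δ := ENNReal.ofReal (min 1 (wt a x * incr d (scl a) (x - y)))) (by
      rw [← ENNReal.ofReal_add (wt_pos hm x).le h2]
      exact ENNReal.ofReal_le_ofReal h3)
  rw [← ofReal_lyap hm, ← ofReal_lyap hm, ← ENNReal.ofReal_add (lyap_nonneg γ) h2] at h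
  exact (ENNReal.ofReal_le_ofReal_iff (add_nonneg (lyap_nonneg γ) h2)).1 h

/-- For an increment `δ ≤ 1` the change of `l² + l` is `2lδ + δ² + δ ≤ (2l + 2)δ`. Summation over
the particles gives at most `(2l + 2) l`, which is twice `lyap₂`. -/
theorem mul_lintegral_lyap₂_le (hm : IsJumpModel a φ) (hα : α ∈ Ioc (0 : ℝ) 1) (γ : Tempered d) :
    ENNReal.ofReal (lam a α γ) * ∫⁻ γ', ENNReal.ofReal (lyap₂ a γ') ∂stepK hm α γ
      ≤ ENNReal.ofReal ((lam a α γ + 2) * lyap₂ a γ) := by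
  have hl := lyap_nonneg (a := a) γ
  have hr := lam_pos (a := a) hα γ
  have hl2 := lyap₂_nonneg (a := a) γ
  have hM := (measurable_lyap₂ hm).ennreal_ofReal
  have h := omegaK_le hm hα.1.le γ (G := ENNReal.ofReal (lyap₂ a γ)) hM
    (measurable_incr (scl a)).ennreal_ofReal
    (b := fun x => ENNReal.ofReal (2 * lyap a γ + 2) * ENNReal.ofReal (wt a x)) fun x hx y => by
      have e1 := lyap_move_le hm γ hx y
      have e2 : 0 ≤ incr d (scl a) (x - y) := incr_nonneg (scl_pos hm).le _
      have e3 := (wt_pos hm x).le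
      have e4 : 0 ≤ min 1 (wt a x * incr d (scl a) (x - y)) := le_min zero_le_one (mul_nonneg e3 e2)
      have e5 := min_le_left 1 (wt a x * incr d (scl a) (x - y))
      have e6 := min_le_right 1 (wt a x * incr d (scl a) (x - y))
      rw [← ENNReal.ofReal_mul (by positivity), ← ENNReal.ofReal_mul (by positivity),
        ← ENNReal.ofReal_add hl2 (by positivity)]
      apply ENNReal.ofReal_le_ofReal
      set δ := min 1 (wt a x * incr d (scl a) (x - y)) with hδ
      have e7 : lyap₂ a (γ.move x y) ≤ (lyap a γ + δ) ^ 2 + (lyap a γ + δ) := by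
        unfold lyap₂
        have := lyap_nonneg (a := a) (γ.move x y)
        gcongr
      have e8 : (2 * lyap a γ + 2) * δ ≤ (2 * lyap a γ + 2) * (wt a x * incr d (scl a) (x - y)) := by
        gcongr
      have e9 : δ * δ ≤ δ := mul_le_of_le_one_left e4 e5
      unfold lyap₂ at e7 ⊢
      linarith
  have h2 := mul_lintegral_stepK_le hm hα γ hM h
  refine h2.trans ?_
  have e : (γ.toConfiguration.sum fun x => ENNReal.ofReal (2 * lyap a γ + 2) * ENNReal.ofReal (wt a x))
      = ENNReal.ofReal (2 * lyap₂ a γ) := by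
    rw [Configuration.sum_const_mul]
    change _ * wsum (wt a) γ = _
    rw [← ofReal_lyap hm, ← ENNReal.ofReal_mul (by positivity)]
    congr 1
    unfold lyap₂
    ring
  rw [e, add_mul, ENNReal.ofReal_add (by positivity) (by positivity), ENNReal.ofReal_mul hr.le]
  gcongr
  exact mul_le_of_le_one_left zero_le (lintegral_incr_le hm)

theorem edist_move_le_wt (hm : IsJumpModel a φ) (γ : Tempered d) {x : Pt d}
    (hx : γ.toConfiguration.mult x ≠ 0) (y : Pt d) :
    edist γ (γ.move x y) ≤ ENNReal.ofReal (wt a x)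
      * ENNReal.ofReal (1 + 2 ^ (d + 1) * (1 + ‖x - y‖ ^ (d + 1))) := by
  refine (γ.edist_move_le hx y).trans ?_
  rw [← ENNReal.ofReal_mul (wt_pos hm x).le]
  apply ENNReal.ofReal_le_ofReal
  have h1 := psi_le_mul x y
  have h2 : psi x * (1 + 2 ^ (d + 1) * (1 + ‖x - y‖ ^ (d + 1)))
      ≤ wt a x * (1 + 2 ^ (d + 1) * (1 + ‖x - y‖ ^ (d + 1))) := by
    gcongr
    exact psi_le_wt hm x
  linarith

theorem measurable_edist_right (γ : Tempered d) : Measurable fun γ' => edist γ γ' :=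
  measurable_edist.comp (f := fun γ' => (γ, γ')) (by fun_prop)

theorem mul_lintegral_edist_le (hm : IsJumpModel a φ) (hα : α ∈ Ioc (0 : ℝ) 1) (γ : Tempered d) :
    ENNReal.ofReal (lam a α γ) * ∫⁻ γ', edist γ γ' ∂stepK hm α γ
      ≤ ENNReal.ofReal (kap a * lyap a γ) := by
  have h := omegaK_le hm hα.1.le γ (G := 0) (measurable_edist_right γ)
    (q := fun z => ENNReal.ofReal (1 + 2 ^ (d + 1) * (1 + ‖z‖ ^ (d + 1)))) (by fun_prop)
    (b := fun x => ENNReal.ofReal (wt a x)) fun x hx y => by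
      rw [zero_add]
      exact edist_move_le_wt hm γ hx y
  have h2 := mul_lintegral_stepK_le hm hα γ (measurable_edist_right γ)
    (S := ENNReal.ofReal (kap a * lyap a γ)) (by
      refine h.trans ?_
      rw [lintegral_kap hm, ENNReal.ofReal_mul (kap_nonneg hm), ofReal_lyap hm, edist_self]
      exact le_rfl)
  rwa [edist_self, mul_zero, zero_add] at h2

/-- After one jump `lyap` is at most `lyap γ + 1`, and the distance contributes `κ lyap γ`; the
product is `κ lyap₂ γ`. Phantom jumps have distance zero. -/
theorem mul_lintegral_edist_mul_le (hm : IsJumpModel a φ) (hα : α ∈ Ioc (0 : ℝ) 1) (γ : Tempered d) :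
    ENNReal.ofReal (lam a α γ) * ∫⁻ γ', edist γ γ' * ENNReal.ofReal (lyap a γ') ∂stepK hm α γ
      ≤ ENNReal.ofReal (kap a * lyap₂ a γ) := by
  have hl := lyap_nonneg (a := a) γ
  have hM : Measurable fun γ' => edist γ γ' * ENNReal.ofReal (lyap a γ') :=
    (measurable_edist_right γ).mul (measurable_lyap hm).ennreal_ofReal
  have h := omegaK_le hm hα.1.le γ (G := 0) hM
    (q := fun z => ENNReal.ofReal (1 + 2 ^ (d + 1) * (1 + ‖z‖ ^ (d + 1)))) (by fun_prop)
    (b := fun x => ENNReal.ofReal (lyap a γ + 1) * ENNReal.ofReal (wt a x)) fun x hx y => by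
      rw [zero_add, mul_comm (ENNReal.ofReal (lyap a γ + 1)), mul_right_comm]
      gcongr
      · exact edist_move_le_wt hm γ hx y
      · exact (lyap_move_le hm γ hx y).trans (by gcongr; exact min_le_left _ _)
  have h2 := mul_lintegral_stepK_le hm hα γ hM
    (S := ENNReal.ofReal (kap a * lyap₂ a γ)) (by
      refine h.trans ?_
      rw [lintegral_kap hm, Configuration.sum_const_mul]
      change _ + _ * (_ * wsum (wt a) γ) ≤ _
      rw [← ofReal_lyap hm, mul_zero, zero_add, ← ENNReal.ofReal_mul (by positivity),
        ← ENNReal.ofReal_mul (kap_nonneg hm), edist_self, zero_mul, mul_zero, zero_add]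
      apply ENNReal.ofReal_le_ofReal
      apply le_of_eq
      unfold lyap₂
      ring)
  rwa [edist_self, zero_mul, mul_zero, zero_add] at h2

theorem mul_lintegral_hwt_le (hm : IsJumpModel a φ) (hα : α ∈ Ioc (0 : ℝ) 1) (γ : Tempered d) :
    ENNReal.ofReal (lam a α γ) * ∫⁻ γ', wsum hwt γ' ∂stepK hm α γ
      ≤ ENNReal.ofReal (lam a α γ + kap a) * wsum hwt γ := by
  have hw : Measurable (hwt (d := d)) := continuous_hwt.measurable
  have h := omegaK_wsum_le hm hα.1.le hw (q := fun z => 1 + 2 ^ (d + 1) * (1 + ‖z‖ ^ (d + 1)))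
    (by fun_prop) (fun x => (hwt_pos x).le) (fun z => by positivity) (fun x y => by
      refine (hwt_le_mul x y).trans (mul_le_mul_of_nonneg_left ?_ (hwt_pos x).le)
      linarith) γ
  have h2 := mul_lintegral_stepK_le hm hα γ (measurable_wsum hw) h
  rwa [lintegral_kap hm, ← add_mul, ← ENNReal.ofReal_add (lam_pos hα γ).le (kap_nonneg hm)] at h2

/-- Phantom jumps cancel in `rate · (K - 1)`, so the constructed process has the prescribed
generator. -/
theorem kolmogorovIndicator_eq (hm : IsJumpModel a φ) (hα : α ∈ Ioc (0 : ℝ) 1)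
    {A : Set (Tempered d)} (hA : MeasurableSet A) (γ : Tempered d) :
    kolmogorovIndicator a φ α A γ = lam a α γ * ((stepK hm α γ).real A - A.indicator 1 γ) := by
  have h := mul_lintegral_stepK hm hα γ (F := A.indicator 1) (measurable_one.indicator hA)
  rw [lintegral_indicator_one hA, lintegral_indicator_one hA] at h
  have hle := omegaK_univ_le hm hα γ
  have hfin : omegaK a φ α γ univ ≠ ∞ := ne_top_of_le_ne_top ENNReal.ofReal_ne_top hle
  have hfinA : omegaK a φ α γ A ≠ ∞ := ne_top_of_le_ne_top hfin (measure_mono (subset_univ _))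
  have h2 := congrArg ENNReal.toReal h
  rw [ENNReal.toReal_mul, ENNReal.toReal_ofReal (lam_pos hα γ).le, ENNReal.toReal_add hfinA
    (ENNReal.mul_ne_top (ENNReal.sub_ne_top ENNReal.ofReal_ne_top) (by
      by_cases h : γ ∈ A <;> simp [h])), ENNReal.toReal_mul,
    ENNReal.toReal_sub_of_le hle ENNReal.ofReal_ne_top, ENNReal.toReal_ofReal (lam_pos hα γ).le] at h2
  unfold kolmogorovIndicator totalRate
  rw [← omegaK_apply α hm.measurable_a hm.measurable_phi γ hA, mul_sub]
  change _ = lam a α γ * ((stepK hm α γ) A).toReal - _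
  rw [h2]
  by_cases h : γ ∈ A
  · simp only [indicator_of_mem h, Pi.one_apply, ENNReal.toReal_one,
      omegaK_apply α hm.measurable_a hm.measurable_phi γ .univ]
    ring
  · simp [indicator_of_notMem h]

theorem predualGraph_eq (hm : IsJumpModel a φ) (hα : α ∈ Ioc (0 : ℝ) 1) :
    predualGraph a φ α = (jumpData hm hα).predual := by
  have h0 : 0 < scl a ^ (d + 1) := pow_pos (scl_pos hm) _
  have h1 : ∀ γ : Tempered d, 1 + Psi γ.toConfiguration ≤ ENNReal.ofReal (1 + lyap a γ) := fun γ => by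
    rw [ENNReal.ofReal_add zero_le_one (lyap_nonneg γ), ENNReal.ofReal_one]
    gcongr
    exact Psi_le hm γ
  have h2 : ∀ γ : Tempered d, ENNReal.ofReal (1 + lyap a γ)
      ≤ ENNReal.ofReal (scl a ^ (d + 1))⁻¹ * (1 + Psi γ.toConfiguration) := fun γ => by
    have h3 := mul_wsum_le hm γ
    have h4 : scl a ^ (d + 1) ≤ 1 := pow_le_one₀ (scl_pos hm).le (scl_le_one hm)
    rw [ENNReal.ofReal_inv_of_pos h0, ENNReal.ofReal_add zero_le_one (lyap_nonneg γ), ofReal_lyap hm,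
      ENNReal.ofReal_one, ← ENNReal.mul_le_iff_le_inv (ENNReal.ofReal_pos.2 h0).ne' ENNReal.ofReal_ne_top,
      mul_add, mul_one]
    exact add_le_add (ENNReal.ofReal_le_one.2 h4) h3
  ext q
  refine and_congr ⟨fun h => ?_, fun h => (lintegral_mono h1).trans_lt h⟩
    (forall₂_congr fun A hA => ?_)
  · refine (lintegral_mono h2).trans_lt ?_
    rw [lintegral_const_mul' _ _ ENNReal.ofReal_ne_top]
    exact ENNReal.mul_lt_top ENNReal.ofReal_lt_top h
  · simp only [kolmogorovIndicator_eq hm hα hA]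
    rfl

end Tempered

end Kawasaki

/-! ### Moments of the initial law. -/

namespace Kawasaki

variable {d : ℕ}

/-! ### Sub-Poissonian measures -/

/-- The exponent `d + 1/2` exceeds the dimension, as integrability requires, but is below `d + 1`,
so that `ψ` decays faster than `hwt`. -/
theorem integrable_hwt : Integrable (hwt (d := d)) := by
  have h : (Module.finrank ℝ (Pt d) : ℝ) < (d : ℝ) + 1 / 2 := by
    rw [finrank_euclideanSpace_fin]; linarith
  exact integrable_one_add_norm h

theorem hwt_le_one (x : Pt d) : hwt x ≤ 1 :=
  Real.rpow_le_one_of_one_le_of_nonpos (by linarith [norm_nonneg x])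
    (by linarith [(Nat.cast_nonneg d : (0 : ℝ) ≤ d)])

theorem psi_le_hwt (x : Pt d) : psi x ≤ 2 ^ (d + 1) * hwt x := by
  have h0 := norm_nonneg x
  have h1 : (1 + ‖x‖) ^ (d + 1) ≤ 2 ^ (d + 1) * (1 + ‖x‖ ^ (d + 1)) := by
    have := add_pow_le_two_pow zero_le_one h0 (d + 1)
    rwa [one_pow] at this
  have h2 : (1 + ‖x‖) ^ ((d : ℝ) + 1 / 2) ≤ (1 + ‖x‖) ^ (d + 1) := by
    rw [← Real.rpow_natCast]
    apply Real.rpow_le_rpow_of_exponent_le (by linarith)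
    push_cast
    linarith
  unfold psi hwt
  rw [Real.rpow_neg (by positivity), ← div_eq_mul_inv,
    div_le_div_iff₀ (by positivity) (by positivity), one_mul]
  exact h2.trans h1

/-- A cutoff of a weight. -/
def cut (w : Pt d → ℝ) (n : ℕ) (x : Pt d) : ℝ := w x * max 0 (min 1 (n + 1 - ‖x‖))

theorem continuous_cut {w : Pt d → ℝ} (hw : Continuous w) (n : ℕ) : Continuous (cut w n) := by
  unfold cut; fun_prop

theorem hasCompactSupport_cut (w : Pt d → ℝ) (n : ℕ) : HasCompactSupport (cut w n) := by
  refine HasCompactSupport.intro (isCompact_closedBall (0 : Pt d) (n + 1)) fun x hx => ?_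
  have : (n : ℝ) + 1 < ‖x‖ := by simpa using hx
  unfold cut
  rw [max_eq_left, mul_zero]
  exact (min_le_right _ _).trans (by linarith)

theorem cut_nonneg {w : Pt d → ℝ} (hw : ∀ x, 0 ≤ w x) (n : ℕ) (x : Pt d) : 0 ≤ cut w n x :=
  mul_nonneg (hw x) (le_max_left _ _)

theorem cut_le {w : Pt d → ℝ} (hw : ∀ x, 0 ≤ w x) (n : ℕ) (x : Pt d) : cut w n x ≤ w x :=
  mul_le_of_le_one_right (hw x) (max_le zero_le_one (min_le_left _ _))

theorem cut_mono {w : Pt d → ℝ} (hw : ∀ x, 0 ≤ w x) (x : Pt d) : Monotone fun n => cut w n x := by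
  intro m n hmn
  have : (m : ℝ) ≤ n := by exact_mod_cast hmn
  have := hw x
  unfold cut
  dsimp only
  gcongr

theorem iSup_cut {w : Pt d → ℝ} (hw : ∀ x, 0 ≤ w x) (x : Pt d) :
    ⨆ n, ENNReal.ofReal (cut w n x) = ENNReal.ofReal (w x) := by
  refine le_antisymm (iSup_le fun n => ENNReal.ofReal_le_ofReal (cut_le hw n x)) ?_
  obtain ⟨n, hn⟩ := exists_nat_ge ‖x‖
  refine le_iSup_of_le n (ENNReal.ofReal_le_ofReal (le_of_eq ?_))
  unfold cut
  rw [min_eq_left (by linarith), max_eq_right zero_le_one, mul_one]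

namespace Configuration

theorem iSup_sum (γ : Configuration d) {f : ℕ → Pt d → ℝ≥0∞} (hm : ∀ n, Measurable (f n))
    (hf : ∀ x, Monotone fun n => f n x) : γ.sum (fun x => ⨆ n, f n x) = ⨆ n, γ.sum (f n) := by
  simp only [← lintegral_toMeasure]
  exact lintegral_iSup hm fun m n hmn x => hf x hmn

theorem factorialSum_one (γ : Configuration d) (θ : Pt d → ℝ≥0∞) : γ.factorialSum θ 1 = γ.sum θ := by
  simp [factorialSum, sum]

/-- A square is the sum over ordered pairs of different particles plus the diagonal. Thus the second
correlation measure controls the second moment. -/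
theorem factorialSum_two (γ : Configuration d) (θ : Pt d → ℝ≥0∞) :
    γ.factorialSum θ 2 + γ.sum (fun x => θ x ^ 2) = γ.sum θ ^ 2 := by
  have h : ∀ x, (γ.mult x : ℝ≥0∞) * (θ x * (γ.erase x).factorialSum θ 1) + γ.mult x * θ x ^ 2
      = γ.sum θ * (γ.mult x * θ x) := by
    intro x
    by_cases hx : γ.mult x = 0
    · simp [hx]
    · rw [← γ.sum_erase_add θ hx, factorialSum_one]
      ring
  change (∑' x, (γ.mult x : ℝ≥0∞) * (θ x * (γ.erase x).factorialSum θ 1)) + _ = _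
  unfold sum
  rw [← ENNReal.tsum_add, tsum_congr h, ENNReal.tsum_mul_left, sq]
  rfl

end Configuration

open Kawasaki.Configuration

/-- The moments of sums of a weight. -/
theorem lintegral_sum_le {μ : Measure (Configuration d)} {ϰ : ℝ}
    (hμ : ∀ (n : ℕ) (θ : Pt d → ℝ), Continuous θ → HasCompactSupport θ →
      correlation μ n (fun x => ‖θ x‖ₑ) ≤ (ENNReal.ofReal ϰ * ∫⁻ x, ‖θ x‖ₑ) ^ n)
    {w : Pt d → ℝ} (hwc : Continuous w) (hw : ∀ x, 0 ≤ w x) (hw1 : ∀ x, w x ≤ 1) :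
    ∫⁻ γ, γ.sum (fun x => ENNReal.ofReal (w x)) ∂μ ≤ ENNReal.ofReal ϰ * ∫⁻ x, ENNReal.ofReal (w x) ∧
    ∫⁻ γ, γ.sum (fun x => ENNReal.ofReal (w x)) ^ 2 ∂μ
      ≤ (ENNReal.ofReal ϰ * ∫⁻ x, ENNReal.ofReal (w x)) ^ 2
        + ENNReal.ofReal ϰ * ∫⁻ x, ENNReal.ofReal (w x) := by
  have hen : ∀ n (x : Pt d), ‖cut w n x‖ₑ = ENNReal.ofReal (cut w n x) := fun n x =>
    Real.enorm_eq_ofReal (cut_nonneg hw n x)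
  have hmc : ∀ n, Measurable fun x => ENNReal.ofReal (cut w n x) := fun n =>
    (continuous_cut hwc n).measurable.ennreal_ofReal
  have hI : ∀ n, ENNReal.ofReal ϰ * ∫⁻ x, ENNReal.ofReal (cut w n x)
      ≤ ENNReal.ofReal ϰ * ∫⁻ x, ENNReal.ofReal (w x) := fun n => by
    gcongr with x
    exact cut_le hw n x
  have h1 : ∀ n, ∫⁻ γ, γ.sum (fun x => ENNReal.ofReal (cut w n x)) ∂μ
      ≤ ENNReal.ofReal ϰ * ∫⁻ x, ENNReal.ofReal (w x) := by
    intro n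
    have := hμ 1 (cut w n) (continuous_cut hwc n) (hasCompactSupport_cut w n)
    unfold correlation at this
    simp only [factorialSum_one, hen, pow_one] at this
    exact this.trans (hI n)
  have h2 : ∀ n, ∫⁻ γ, γ.sum (fun x => ENNReal.ofReal (cut w n x)) ^ 2 ∂μ
      ≤ (ENNReal.ofReal ϰ * ∫⁻ x, ENNReal.ofReal (w x)) ^ 2
        + ENNReal.ofReal ϰ * ∫⁻ x, ENNReal.ofReal (w x) := by
    intro n
    have := hμ 2 (cut w n) (continuous_cut hwc n) (hasCompactSupport_cut w n)
    unfold correlation at this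
    simp only [hen] at this
    calc ∫⁻ γ, γ.sum (fun x => ENNReal.ofReal (cut w n x)) ^ 2 ∂μ
        -- The diagonal is linearised by `w² ≤ w`, which is where `w ≤ 1` enters.
        ≤ ∫⁻ γ, (γ.factorialSum (fun x => ENNReal.ofReal (cut w n x)) 2
          + γ.sum (fun x => ENNReal.ofReal (cut w n x))) ∂μ := by
          refine lintegral_mono fun γ => ?_
          rw [← factorialSum_two]
          gcongr
          refine γ.sum_mono fun x => ?_
          rw [sq]
          refine mul_le_of_le_one_left zero_le ?_
          exact ENNReal.ofReal_le_one.2 ((cut_le hw n x).trans (hw1 x))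
      _ = ∫⁻ γ, γ.factorialSum (fun x => ENNReal.ofReal (cut w n x)) 2 ∂μ
          + ∫⁻ γ, γ.sum (fun x => ENNReal.ofReal (cut w n x)) ∂μ :=
          lintegral_add_right _ (measurable_sum (hmc n))
      _ ≤ _ := add_le_add (this.trans (by gcongr; exact cut_le hw n _)) (h1 n)
  have hmono : ∀ γ : Configuration d, Monotone fun n => γ.sum fun x => ENNReal.ofReal (cut w n x) :=
    fun γ m n hmn => γ.sum_mono fun x => ENNReal.ofReal_le_ofReal (cut_mono hw x hmn)
  have hs : ∀ γ : Configuration d, γ.sum (fun x => ENNReal.ofReal (w x))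
      = ⨆ n, γ.sum fun x => ENNReal.ofReal (cut w n x) := fun γ => by
    rw [← γ.iSup_sum hmc fun x m n hmn => ENNReal.ofReal_le_ofReal (cut_mono hw x hmn)]
    simp only [iSup_cut hw]
  constructor
  · simp only [hs]
    rw [lintegral_iSup (fun n => measurable_sum (hmc n)) fun m n hmn γ => hmono γ hmn]
    exact iSup_le h1
  · have hs2 : ∀ γ : Configuration d, γ.sum (fun x => ENNReal.ofReal (w x)) ^ 2
        = ⨆ n, (γ.sum fun x => ENNReal.ofReal (cut w n x)) ^ 2 := fun γ => by
      rw [hs]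
      have ht := tendsto_atTop_iSup (hmono γ)
      have ht2 : Monotone fun n => (γ.sum fun x => ENNReal.ofReal (cut w n x)) ^ 2 :=
        fun m n hmn => pow_le_pow_left' (hmono γ hmn) 2
      exact tendsto_nhds_unique ((ENNReal.continuous_pow 2).continuousAt.tendsto.comp ht) (tendsto_atTop_iSup ht2)
    simp only [hs2]
    rw [lintegral_iSup (fun n => (measurable_sum (hmc n)).pow_const 2) fun m n hmn γ =>
      pow_le_pow_left' (hmono γ hmn) 2]
    exact iSup_le h2

section LawOn

variable {μ : Measure (Configuration d)}

theorem IsSubPoissonian.lintegral_hwt_lt (hμ : IsSubPoissonian μ) :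
    ∫⁻ γ, γ.sum (fun x => ENNReal.ofReal (hwt x)) ∂μ < ∞ ∧
    ∫⁻ γ, γ.sum (fun x => ENNReal.ofReal (hwt x)) ^ 2 ∂μ < ∞ := by
  obtain ⟨ϰ, -, hb⟩ := hμ.bound
  obtain ⟨h1, h2⟩ := lintegral_sum_le hb continuous_hwt (fun x => (hwt_pos x).le) hwt_le_one
  have h3 : ∫⁻ x : Pt d, ENNReal.ofReal (hwt x) < ∞ := by
    rw [← ofReal_integral_eq_lintegral_ofReal integrable_hwt (ae_of_all _ fun x => (hwt_pos x).le)]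
    exact ENNReal.ofReal_lt_top
  have h4 := ENNReal.mul_lt_top (ENNReal.ofReal_lt_top (r := ϰ)) h3
  exact ⟨h1.trans_lt h4, h2.trans_lt (ENNReal.add_lt_top.2 ⟨ENNReal.pow_lt_top h4, h4⟩)⟩

theorem Psi_le_hwt (γ : Configuration d) :
    Psi γ ≤ ENNReal.ofReal (2 ^ (d + 1)) * γ.sum (fun x => ENNReal.ofReal (hwt x)) := by
  rw [← sum_const_mul]
  refine γ.sum_mono fun x => ?_
  rw [← ENNReal.ofReal_mul (by positivity)]
  exact ENNReal.ofReal_le_ofReal (psi_le_hwt x)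

theorem lintegral_lawOn_le (μ : Measure (Configuration d)) {G : Configuration d → ℝ≥0∞}
    (hG : Measurable G) : ∫⁻ γ, G γ.toConfiguration ∂Tempered.lawOn μ ≤ ∫⁻ γ, G γ ∂μ := by
  have he := Tempered.measurableEmbedding_toConfiguration (d := d)
  rw [Tempered.lawOn, ← lintegral_map hG he.measurable, he.map_comap]
  exact lintegral_mono' Measure.restrict_le_self le_rfl

/-- The sum of `hwt` has finite mean, hence is almost surely finite, and it dominates `Ψ` up to a
constant. -/
theorem IsSubPoissonian.isProbabilityMeasure_lawOn (hμ : IsSubPoissonian μ) :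
    IsProbabilityMeasure (Tempered.lawOn μ) := by
  have := hμ.isProbabilityMeasure
  have he := Tempered.measurableEmbedding_toConfiguration (d := d)
  refine ⟨?_⟩
  rw [Tempered.lawOn, he.comap_apply, image_univ]
  have hae : ∀ᵐ γ ∂μ, γ ∈ range (Tempered.toConfiguration (d := d)) := by
    filter_upwards [ae_lt_top (measurable_sum continuous_hwt.measurable.ennreal_ofReal)
      hμ.lintegral_hwt_lt.1.ne] with γ hγ
    exact ⟨⟨γ, (Psi_le_hwt γ).trans_lt (ENNReal.mul_lt_top ENNReal.ofReal_lt_top hγ)⟩, rfl⟩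
  exact (mem_ae_iff_prob_eq_one he.measurableSet_range).1 hae

theorem IsSubPoissonian.lintegral_wsum_hwt (hμ : IsSubPoissonian μ) :
    ∫⁻ γ, Tempered.wsum hwt γ ∂Tempered.lawOn μ < ∞ :=
  (lintegral_lawOn_le μ (measurable_sum continuous_hwt.measurable.ennreal_ofReal)).trans_lt
    hμ.lintegral_hwt_lt.1

variable {a φ : Pt d → ℝ}

theorem IsSubPoissonian.lintegral_lyap₂ (hμ : IsSubPoissonian μ) (hm : IsJumpModel a φ) :
    ∫⁻ γ, ENNReal.ofReal (Tempered.lyap₂ a γ) ∂Tempered.lawOn μ < ∞ := by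
  have h0 : 0 < scl a ^ (d + 1) := pow_pos (scl_pos hm) _
  set c : ℝ := 2 ^ (d + 1) / scl a ^ (d + 1) with hc
  have hc0 : 0 ≤ c := by positivity
  set H : Configuration d → ℝ≥0∞ := fun γ => γ.sum (fun x => ENNReal.ofReal (hwt x)) with hH
  have hHm : Measurable H := measurable_sum continuous_hwt.measurable.ennreal_ofReal
  have h1 : ∀ γ : Tempered d, ENNReal.ofReal (Tempered.lyap a γ)
      ≤ ENNReal.ofReal c * H γ.toConfiguration := fun γ => by
    rw [Tempered.ofReal_lyap hm, hH]
    simp only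
    rw [← sum_const_mul]
    refine sum_mono _ fun x => ?_
    rw [← ENNReal.ofReal_mul hc0]
    apply ENNReal.ofReal_le_ofReal
    have h2 := (mul_wt_le_psi hm x).trans (psi_le_hwt x)
    rw [hc, div_mul_eq_mul_div, le_div_iff₀ h0, mul_comm]
    exact h2
  have h2 : ∀ γ : Tempered d, ENNReal.ofReal (Tempered.lyap₂ a γ)
      ≤ ENNReal.ofReal c ^ 2 * H γ.toConfiguration ^ 2 + ENNReal.ofReal c * H γ.toConfiguration :=
    fun γ => by
      have hl := Tempered.lyap_nonneg (a := a) γ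
      unfold Tempered.lyap₂
      rw [ENNReal.ofReal_add (by positivity) hl, ENNReal.ofReal_pow hl, ← mul_pow]
      gcongr
      exacts [h1 γ, h1 γ]
  refine (lintegral_mono h2).trans_lt ?_
  refine (lintegral_lawOn_le μ (G := fun γ => ENNReal.ofReal c ^ 2 * H γ ^ 2 + ENNReal.ofReal c * H γ)
    (by fun_prop)).trans_lt ?_
  rw [lintegral_add_left (by fun_prop), lintegral_const_mul _ (by fun_prop),
    lintegral_const_mul _ hHm]
  obtain ⟨e1, e2⟩ := hμ.lintegral_hwt_lt
  exact ENNReal.add_lt_top.2 ⟨ENNReal.mul_lt_top (ENNReal.pow_lt_top ENNReal.ofReal_lt_top) e2,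
    ENNReal.mul_lt_top ENNReal.ofReal_lt_top e1⟩

end LawOn

end Kawasaki

/-! ### The quadratic estimate for three times. -/

namespace Kawasaki

variable {d : ℕ}

namespace Tempered

variable {a φ : Pt d → ℝ} {α : ℝ}

/-! ### Chentsov functionals -/

theorem abs_nu_le (γ : Tempered d) {g : Pt d → ℝ} (hg : ∀ x, |g x| ≤ 1) :
    |γ.nu g| ≤ ∑' x, (γ.toConfiguration.mult x : ℝ) * psi x := by
  rw [← Real.norm_eq_abs]
  exact tsum_of_norm_bounded γ.summable_psi.hasSum fun x => by simpa using γ.abs_nu_term_le hg x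

theorem edist_ne_top' (γ γ' : Tempered d) : edist γ γ' ≠ ∞ := by
  refine ne_top_of_le_ne_top (b := ENNReal.ofReal ((∑' x, (γ.toConfiguration.mult x : ℝ) * psi x)
    + ∑' x, (γ'.toConfiguration.mult x : ℝ) * psi x)) ENNReal.ofReal_ne_top ?_
  rw [edist_eq]
  refine iSup₂_le fun g hg => ?_
  have hb := abs_le_one_of_mem hg
  rw [edist_dist, Real.dist_eq]
  exact ENNReal.ofReal_le_ofReal ((abs_sub _ _).trans (add_le_add (γ.abs_nu_le hb) (γ'.abs_nu_le hb)))

theorem ofReal_edist (γ γ' : Tempered d) : ENNReal.ofReal (edist γ γ').toReal = edist γ γ' :=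
  ENNReal.ofReal_toReal (edist_ne_top' γ γ')

theorem mul_lintegral_edist_from (hm : IsJumpModel a φ) (hα : α ∈ Ioc (0 : ℝ) 1) (γ₀ γ : Tempered d) :
    ENNReal.ofReal (lam a α γ) * ∫⁻ γ', edist γ₀ γ' ∂stepK hm α γ
      ≤ ENNReal.ofReal (lam a α γ * (edist γ₀ γ).toReal + kap a * lyap a γ) := by
  have := isMarkovKernel_stepK hm hα
  have hr := (lam_pos (a := a) hα γ).le
  calc ENNReal.ofReal (lam a α γ) * ∫⁻ γ', edist γ₀ γ' ∂stepK hm α γ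
      ≤ ENNReal.ofReal (lam a α γ) * ∫⁻ γ', (edist γ₀ γ + edist γ γ') ∂stepK hm α γ := by
        gcongr
        exact edist_triangle _ _ _
    _ = ENNReal.ofReal (lam a α γ) * edist γ₀ γ
        + ENNReal.ofReal (lam a α γ) * ∫⁻ γ', edist γ γ' ∂stepK hm α γ := by
        rw [lintegral_add_left measurable_const, lintegral_const, measure_univ, mul_one, mul_add]
    _ ≤ ENNReal.ofReal (lam a α γ) * ENNReal.ofReal (edist γ₀ γ).toReal
        + ENNReal.ofReal (kap a * lyap a γ) := by
        rw [ofReal_edist]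
        gcongr
        exact mul_lintegral_edist_le hm hα γ
    _ = _ := by
        rw [← ENNReal.ofReal_mul hr, ← ENNReal.ofReal_add (mul_nonneg hr ENNReal.toReal_nonneg)
          (mul_nonneg (kap_nonneg hm) (lyap_nonneg γ))]

/-- By the triangle inequality the distance from `γ₀` splits into its present value, on which only
the drift of `lyap` acts, and the size of the jump. -/
theorem mul_lintegral_edist_mul_from (hm : IsJumpModel a φ) (hα : α ∈ Ioc (0 : ℝ) 1)
    (γ₀ γ : Tempered d) :
    ENNReal.ofReal (lam a α γ) * ∫⁻ γ', edist γ₀ γ' * ENNReal.ofReal (lyap a γ') ∂stepK hm α γ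
      ≤ ENNReal.ofReal ((lam a α γ + 1) * ((edist γ₀ γ).toReal * lyap a γ) + kap a * lyap₂ a γ) := by
  have := isMarkovKernel_stepK hm hα
  have hr := (lam_pos (a := a) hα γ).le
  have hl := lyap_nonneg (a := a) γ
  have hml := (measurable_lyap hm).ennreal_ofReal
  calc ENNReal.ofReal (lam a α γ) * ∫⁻ γ', edist γ₀ γ' * ENNReal.ofReal (lyap a γ') ∂stepK hm α γ
      ≤ ENNReal.ofReal (lam a α γ) * ∫⁻ γ', (edist γ₀ γ * ENNReal.ofReal (lyap a γ')
          + edist γ γ' * ENNReal.ofReal (lyap a γ')) ∂stepK hm α γ := by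
        gcongr with γ'
        rw [← add_mul]
        gcongr
        exact edist_triangle _ _ _
    _ = edist γ₀ γ * (ENNReal.ofReal (lam a α γ) * ∫⁻ γ', ENNReal.ofReal (lyap a γ') ∂stepK hm α γ)
        + ENNReal.ofReal (lam a α γ)
          * ∫⁻ γ', edist γ γ' * ENNReal.ofReal (lyap a γ') ∂stepK hm α γ := by
        rw [lintegral_add_left (by fun_prop), lintegral_const_mul _ hml]
        ring
    _ ≤ ENNReal.ofReal (edist γ₀ γ).toReal * ENNReal.ofReal ((lam a α γ + 1) * lyap a γ)
        + ENNReal.ofReal (kap a * lyap₂ a γ) := by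
        rw [ofReal_edist]
        gcongr
        · exact mul_lintegral_lyap_le hm hα γ
        · exact mul_lintegral_edist_mul_le hm hα γ
    _ = _ := by
        rw [← ENNReal.ofReal_mul ENNReal.toReal_nonneg, ← ENNReal.ofReal_add
          (mul_nonneg ENNReal.toReal_nonneg (by positivity))
          (mul_nonneg (kap_nonneg hm) (lyap₂_nonneg γ))]
        congr 1
        ring

theorem mul_lintegral_lyap_le_two (hm : IsJumpModel a φ) (hα : α ∈ Ioc (0 : ℝ) 1) (γ : Tempered d) :
    ENNReal.ofReal (lam a α γ) * ∫⁻ γ', ENNReal.ofReal (lyap a γ') ∂stepK hm α γ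
      ≤ ENNReal.ofReal ((lam a α γ + 2) * lyap a γ) := by
  refine (mul_lintegral_lyap_le hm hα γ).trans (ENNReal.ofReal_le_ofReal ?_)
  have hl := lyap_nonneg (a := a) γ
  linarith

/-- The distance from `γ` vanishes at time `0` and has source `κ lyap`. The Lyapunov estimate with a
source leaves only the term linear in `u`. -/
theorem chentsov_w_le (hm : IsJumpModel a φ) (hα : α ∈ Ioc (0 : ℝ) 1) (u : ℝ≥0) (γ : Tempered d) :
    chentsov_w (jumpData hm hα).p u γ ≤ ENNReal.ofReal (kap a * u * Real.exp (2 * u) * lyap a γ) := by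
  have h := (jumpData hm hα).lintegral_p_le_of_lyapunov (F := fun γ' => (edist γ γ').toReal)
    (W := lyap a) (c := 2) (κ := kap a) (measurable_edist_right γ).ennreal_toReal (measurable_lyap hm)
    (fun _ => ENNReal.toReal_nonneg) lyap_nonneg zero_le_two (kap_nonneg hm)
    (fun γ' => by
      simp only [ofReal_edist]
      refine (mul_lintegral_edist_from hm hα γ γ').trans (ENNReal.ofReal_le_ofReal ?_)
      have : 0 ≤ (edist γ γ').toReal := ENNReal.toReal_nonneg
      change _ ≤ (lam a α γ' + 2) * _ + _
      linarith) (mul_lintegral_lyap_le_two hm hα) u γ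
  unfold chentsov_w
  simpa [ofReal_edist] using h

theorem lintegral_edist_mul_lyap_le (hm : IsJumpModel a φ) (hα : α ∈ Ioc (0 : ℝ) 1) (v : ℝ≥0)
    (γ : Tempered d) :
    ∫⁻ γ', edist γ γ' * ENNReal.ofReal (lyap a γ') ∂(jumpData hm hα).p v γ
      ≤ ENNReal.ofReal (kap a * v * Real.exp (2 * v) * lyap₂ a γ) := by
  have h := (jumpData hm hα).lintegral_p_le_of_lyapunov
    (F := fun γ' => (edist γ γ').toReal * lyap a γ')
    (W := lyap₂ a) (c := 2) (κ := kap a)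
    ((measurable_edist_right γ).ennreal_toReal.mul (measurable_lyap hm)) (measurable_lyap₂ hm)
    (fun γ' => mul_nonneg ENNReal.toReal_nonneg (lyap_nonneg γ')) lyap₂_nonneg zero_le_two
    (kap_nonneg hm)
    (fun γ' => by
      simp only [ENNReal.ofReal_mul ENNReal.toReal_nonneg, ofReal_edist]
      refine (mul_lintegral_edist_mul_from hm hα γ γ').trans (ENNReal.ofReal_le_ofReal ?_)
      have : 0 ≤ (edist γ γ').toReal * lyap a γ' := mul_nonneg ENNReal.toReal_nonneg (lyap_nonneg γ')
      change _ ≤ (lam a α γ' + 2) * _ + _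
      linarith) (mul_lintegral_lyap₂_le hm hα) v γ
  simpa [ofReal_edist, ENNReal.ofReal_mul ENNReal.toReal_nonneg] using h

theorem lintegral_p_lyap₂_le (hm : IsJumpModel a φ) (hα : α ∈ Ioc (0 : ℝ) 1) (t : ℝ≥0)
    (γ : Tempered d) : ∫⁻ γ', ENNReal.ofReal (lyap₂ a γ') ∂(jumpData hm hα).p t γ
      ≤ ENNReal.ofReal (Real.exp (2 * t)) * ENNReal.ofReal (lyap₂ a γ) := by
  refine (jumpData hm hα).lintegral_p_exp_le (measurable_lyap₂ hm).ennreal_ofReal zero_le_two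
    (fun γ' => ?_) t γ
  rw [← ENNReal.ofReal_mul (add_pos ((jumpData hm hα).rate_pos γ') zero_lt_two).le]
  exact mul_lintegral_lyap₂_le hm hα γ'

theorem lintegral_p_hwt_le (hm : IsJumpModel a φ) (hα : α ∈ Ioc (0 : ℝ) 1) (t : ℝ≥0)
    (γ : Tempered d) : ∫⁻ γ', wsum hwt γ' ∂(jumpData hm hα).p t γ
      ≤ ENNReal.ofReal (Real.exp (kap a * t)) * wsum hwt γ :=
  (jumpData hm hα).lintegral_p_exp_le (measurable_wsum continuous_hwt.measurable) (kap_nonneg hm)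
    (mul_lintegral_hwt_le hm hα) t γ

theorem chentsov_W_le (hm : IsJumpModel a φ) (hα : α ∈ Ioc (0 : ℝ) 1) (u v : ℝ≥0) (γ : Tempered d) :
    chentsov_W (jumpData hm hα).p u v γ
      ≤ ENNReal.ofReal (kap a ^ 2 * (u * v) * Real.exp (2 * (u + v)) * lyap₂ a γ) := by
  have hk := kap_nonneg hm
  have hl := lyap₂_nonneg (a := a) γ
  unfold chentsov_W
  calc ∫⁻ γ', edist γ γ' * chentsov_w (jumpData hm hα).p u γ' ∂(jumpData hm hα).p v γ
      ≤ ∫⁻ γ', ENNReal.ofReal (kap a * u * Real.exp (2 * u)) *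
          (edist γ γ' * ENNReal.ofReal (lyap a γ')) ∂(jumpData hm hα).p v γ := by
        refine lintegral_mono fun γ' => ?_
        have := chentsov_w_le hm hα u γ'
        rw [ENNReal.ofReal_mul (by positivity)] at this
        calc _ ≤ edist γ γ' * (ENNReal.ofReal (kap a * u * Real.exp (2 * u))
                * ENNReal.ofReal (lyap a γ')) := by gcongr
          _ = _ := by ring
    _ = ENNReal.ofReal (kap a * u * Real.exp (2 * u)) *
          ∫⁻ γ', edist γ γ' * ENNReal.ofReal (lyap a γ') ∂(jumpData hm hα).p v γ :=
        lintegral_const_mul _ ((measurable_edist_right γ).mul (measurable_lyap hm).ennreal_ofReal)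
    _ ≤ ENNReal.ofReal (kap a * u * Real.exp (2 * u)) *
          ENNReal.ofReal (kap a * v * Real.exp (2 * v) * lyap₂ a γ) := by
        gcongr
        exact lintegral_edist_mul_lyap_le hm hα v γ
    _ = _ := by
        rw [← ENNReal.ofReal_mul (by positivity)]
        congr 1
        rw [mul_add, Real.exp_add]
        ring

theorem chentsovTriple_le (hm : IsJumpModel a φ) {μ : Measure (Configuration d)}
    (hμ : IsSubPoissonian μ) (δ : ℝ) (_ : 0 < δ) : ∃ C : ℝ, 0 < C ∧ ∀ α (hα : α ∈ Ioc (0 : ℝ) 1),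
      ∀ t₁ t₂ t₃ : ℝ≥0, t₁ ≤ t₂ → t₂ ≤ t₃ → (t₃ : ℝ) - t₁ < δ →
        chentsovTriple (jumpData hm hα).p (lawOn μ) t₁ t₂ t₃
          ≤ ENNReal.ofReal (C * Real.exp (2 * t₁) * |(t₃ : ℝ) - t₁| ^ 2) := by
  set M : ℝ := (∫⁻ γ, ENNReal.ofReal (lyap₂ a γ) ∂lawOn μ).toReal with hM
  have hM0 : 0 ≤ M := ENNReal.toReal_nonneg
  have hMe : ∫⁻ γ, ENNReal.ofReal (lyap₂ a γ) ∂lawOn μ = ENNReal.ofReal M :=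
    (ENNReal.ofReal_toReal (hμ.lintegral_lyap₂ hm).ne).symm
  have hk := kap_nonneg hm
  -- `M` is the initial mean of `lyap₂`; the factor `e^{2δ}` bounds `e^{2(t₃ - t₁)}`, and the
  -- summand `1` keeps the constant positive.
  refine ⟨kap a ^ 2 * Real.exp (2 * δ) * M + 1, by positivity, ?_⟩
  intro α hα t₁ t₂ t₃ h12 h23 hlt
  have hm2 := (measurable_lyap₂ hm).ennreal_ofReal
  set c : ℝ := kap a ^ 2 * (((t₃ - t₂ : ℝ≥0) : ℝ) * (t₂ - t₁ : ℝ≥0))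
    * Real.exp (2 * (((t₃ - t₂ : ℝ≥0) : ℝ) + (t₂ - t₁ : ℝ≥0))) with hc
  have hc0 : 0 ≤ c := by positivity
  have h12' : (t₁ : ℝ) ≤ t₂ := by exact_mod_cast h12
  have h23' : (t₂ : ℝ) ≤ t₃ := by exact_mod_cast h23
  have h1 : chentsovTriple (jumpData hm hα).p (lawOn μ) t₁ t₂ t₃
      ≤ ENNReal.ofReal c * (ENNReal.ofReal (Real.exp (2 * t₁)) * ENNReal.ofReal M) := by
    unfold chentsovTriple marginal
    calc _ ≤ ∫⁻ γ, ENNReal.ofReal c * ENNReal.ofReal (lyap₂ a γ)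
            ∂(lawOn μ).bind ((jumpData hm hα).p t₁) := by
          refine lintegral_mono fun γ => ?_
          rw [← ENNReal.ofReal_mul hc0]
          exact chentsov_W_le hm hα _ _ γ
      _ = ENNReal.ofReal c * ∫⁻ γ, ∫⁻ γ', ENNReal.ofReal (lyap₂ a γ') ∂(jumpData hm hα).p t₁ γ
            ∂lawOn μ := by
          rw [lintegral_const_mul _ hm2, Measure.lintegral_bind (Kernel.aemeasurable _) hm2.aemeasurable]
      _ ≤ ENNReal.ofReal c * ∫⁻ γ, ENNReal.ofReal (Real.exp (2 * t₁)) * ENNReal.ofReal (lyap₂ a γ)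
            ∂lawOn μ := by
          gcongr with γ
          exact lintegral_p_lyap₂_le hm hα t₁ γ
      _ = _ := by rw [lintegral_const_mul _ hm2, hMe]
  refine h1.trans ?_
  rw [← ENNReal.ofReal_mul (Real.exp_nonneg _), ← ENNReal.ofReal_mul hc0]
  apply ENNReal.ofReal_le_ofReal
  have e1 : ((t₃ - t₂ : ℝ≥0) : ℝ) = t₃ - t₂ := NNReal.coe_sub h23
  have e2 : ((t₂ - t₁ : ℝ≥0) : ℝ) = t₂ - t₁ := NNReal.coe_sub h12
  have e3 : c ≤ kap a ^ 2 * |(t₃ : ℝ) - t₁| ^ 2 * Real.exp (2 * δ) := by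
    rw [hc, e1, e2, abs_of_nonneg (by linarith)]
    gcongr
    · nlinarith
    · linarith
  calc c * (Real.exp (2 * t₁) * M)
      ≤ kap a ^ 2 * |(t₃ : ℝ) - t₁| ^ 2 * Real.exp (2 * δ) * (Real.exp (2 * t₁) * M) := by gcongr
    _ = kap a ^ 2 * Real.exp (2 * δ) * M * (Real.exp (2 * t₁) * |(t₃ : ℝ) - t₁| ^ 2) := by ring
    _ ≤ (kap a ^ 2 * Real.exp (2 * δ) * M + 1) * (Real.exp (2 * t₁) * |(t₃ : ℝ) - t₁| ^ 2) := by
        gcongr; linarith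
    _ = _ := by ring

end Tempered

end Kawasaki

/-! ### Compactness in `Γ_*` and tightness of the marginals. -/

namespace Kawasaki

variable {d : ℕ}

/-! ### Compact sets of tempered configurations -/

namespace Configuration

theorem count_mono (γ : Configuration d) {A B : Set (Pt d)} (h : A ⊆ B) : count A γ ≤ count B γ :=
  γ.sum_mono fun _ => indicator_le_indicator_of_subset h (fun _ => zero_le) _

theorem exists_count_eq (γ : Configuration d) {A : Set (Pt d)} (hA : Bornology.IsBounded A) :
    ∃ n : ℕ, count A γ = n := by
  classical
  have hf := γ.locallyFinite _ hA.isCompact_closure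
  refine ⟨∑ x ∈ hf.toFinset, γ.mult x * if x ∈ A then 1 else 0, ?_⟩
  rw [count, sum, tsum_eq_sum (s := hf.toFinset)]
  · push_cast
    refine Finset.sum_congr rfl fun x _ => ?_
    by_cases h : x ∈ A <;> simp [h]
  · intro x hx
    simp only [Finite.mem_toFinset, mem_inter_iff, Function.mem_support, not_and, not_not] at hx
    by_cases h : x ∈ A
    · simp [hx (subset_closure h)]
    · simp [h]

theorem count_add_le (γ : Configuration d) {A B C : Set (Pt d)} (hAB : Disjoint A B) (hA : A ⊆ C)
    (hB : B ⊆ C) : count A γ + count B γ ≤ count C γ := by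
  unfold count
  rw [← sum_add]
  refine γ.sum_mono fun x => ?_
  have := indicator_le_indicator_of_subset (union_subset hA hB) (f := (1 : Pt d → ℝ≥0∞))
    (fun _ => zero_le) x
  rwa [Set.indicator_union_of_disjoint hAB] at this

theorem one_le_count (γ : Configuration d) {A : Set (Pt d)} {x : Pt d} (hx : x ∈ A)
    (h : γ.mult x ≠ 0) : 1 ≤ count A γ := by
  refine le_trans ?_ (γ.le_sum _ h)
  simp [hx]

theorem hasSum_count (γ : Configuration d) {A : Set (Pt d)} (hA : Bornology.IsBounded A) :
    HasSum (fun x => (γ.mult x : ℝ) * A.indicator 1 x) (count A γ).toReal := by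
  obtain ⟨n, hn⟩ := γ.exists_count_eq hA
  have h : ∑' x, (γ.mult x : ℝ≥0∞) * A.indicator 1 x ≠ ∞ := by
    change count A γ ≠ ∞
    simp [hn]
  have h2 := (ENNReal.summable_toReal h).hasSum
  rw [← ENNReal.tsum_toReal_eq fun x => ENNReal.ne_top_of_tsum_ne_top h x] at h2
  refine (h2.congr_fun ?_) 
  intro x
  by_cases hx : x ∈ A <;> simp [hx]

theorem mul_count_le (γ : Configuration d) {A : Set (Pt d)} {w : Pt d → ℝ} {c : ℝ}
    (h : ∀ x ∈ A, c ≤ w x) :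
    ENNReal.ofReal c * count A γ ≤ γ.sum fun x => ENNReal.ofReal (w x) := by
  unfold count
  rw [← sum_const_mul]
  refine γ.sum_mono fun x => ?_
  by_cases hx : x ∈ A
  · simpa [hx] using ENNReal.ofReal_le_ofReal (h x hx)
  · simp [hx]

end Configuration

open Kawasaki.Configuration

/-- A limit multiplicity. -/
theorem exists_limit_mult {w : Pt d → ℝ} (hw : Continuous w) (hw0 : ∀ x, 0 < w x) {R : ℝ≥0}
    {𝒰 : Ultrafilter (Configuration d)}
    (h : ∀ᶠ γ in (𝒰 : Filter (Configuration d)), γ.sum (fun x => ENNReal.ofReal (w x)) ≤ (R : ℝ≥0∞)) (x : Pt d) :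
    ∃ m : ℕ, ∃ ρ > 0, ∀ r, 0 < r → r ≤ ρ →
      ∀ᶠ γ in (𝒰 : Filter (Configuration d)), count (Metric.ball x r) γ = m := by
  -- The multiplicities that persist in every ball around `x`. The bound on the weighted sum makes
  -- some number fail; the last one before a failure is the limit multiplicity, because for an
  -- ultrafilter failure in a ball of radius `ρ` means eventual failure.
  set A : Set ℕ := {k | ∀ r > 0, ∀ᶠ γ in (𝒰 : Filter (Configuration d)), k ≤ count (Metric.ball x r) γ}
    with hA
  have hbdd : ∃ k, k ∉ A := by
    obtain ⟨y, -, hy⟩ := (isCompact_closedBall x 1).exists_isMinOn ⟨x, by simp⟩ hw.continuousOn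
    obtain ⟨k, hk⟩ := exists_nat_gt (R / w y)
    refine ⟨k, fun hkA => ?_⟩
    obtain ⟨γ, h1, h2⟩ := ((hkA 1 one_pos).and h).exists
    have h3 := (γ.mul_count_le (A := Metric.ball x 1) (c := w y) fun z hz =>
      hy (Metric.ball_subset_closedBall hz)).trans h2
    have h4 : ENNReal.ofReal (w y) * k ≤ R := le_trans (by gcongr) h3
    rw [← ENNReal.ofReal_natCast, ← ENNReal.ofReal_mul (hw0 y).le, ← ENNReal.ofReal_coe_nnreal,
      ENNReal.ofReal_le_ofReal_iff R.coe_nonneg] at h4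
    rw [div_lt_iff₀ (hw0 y)] at hk
    linarith
  have hm : ∃ m, m ∈ A ∧ m + 1 ∉ A := by
    by_contra! hc
    obtain ⟨k, hk⟩ := hbdd
    exact hk (Nat.rec (fun r _ => by simp) (fun n hn => hc n hn) k)
  obtain ⟨m, hm1, hm2⟩ := hm
  simp only [hA, mem_ofPred_eq, not_forall] at hm2
  obtain ⟨ρ, hρ, hm2⟩ := hm2
  rw [← Ultrafilter.eventually_not] at hm2
  refine ⟨m, ρ, hρ, fun r hr hrρ => ?_⟩
  filter_upwards [hm1 r hr, hm2] with γ h1 h2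
  obtain ⟨n, hn⟩ := γ.exists_count_eq (Metric.isBounded_ball (x := x) (r := r))
  have h3 := (γ.count_mono (Metric.ball_subset_ball hrρ)).trans_lt (not_le.1 h2)
  rw [hn] at h1 h3 ⊢
  norm_cast at h1 h3 ⊢
  omega

/-- A good cover identifies a configuration up to a small distance. -/
theorem Tempered.abs_nu_sub_le {ε ρ R : ℝ} {r : Pt d → ℝ} {m : Pt d → ℕ} {t : Finset (Pt d)}
    (hε : 0 ≤ ε)
    (hr : ∀ s, ∀ x ∈ Metric.ball s (r s), dist x s + |psi x - psi s| ≤ ε * hwt x)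
    (hρ : ∀ x : Pt d, ρ < ‖x‖ → psi x ≤ ε * hwt x)
    (hd : ∀ s s', m s ≠ 0 → m s' ≠ 0 → s ≠ s' → Disjoint (Metric.ball s (r s)) (Metric.ball s' (r s')))
    (hc : Metric.closedBall 0 ρ ⊆ ⋃ s ∈ t, Metric.ball s (r s))
    {γ : Tempered d} (hγ : ∀ s ∈ t, count (Metric.ball s (r s)) γ.toConfiguration = m s)
    (hR : wsum hwt γ ≤ ENNReal.ofReal R) (hR0 : 0 ≤ R) {g : Pt d → ℝ} (hg : g ∈ unitBL d) :
    |γ.nu g - ∑ s ∈ t with m s ≠ 0, g s * psi s * m s| ≤ ε * R := by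
  classical
  set S := t.filter fun s => m s ≠ 0 with hS
  have hb := abs_le_one_of_mem hg
  have h1 : HasSum (fun x => ∑ s ∈ S, g s * psi s * ((γ.toConfiguration.mult x : ℝ) *
      (Metric.ball s (r s)).indicator 1 x)) (∑ s ∈ S, g s * psi s * m s) := by
    refine hasSum_sum fun s hs => ?_
    have := (γ.toConfiguration.hasSum_count (Metric.isBounded_ball (x := s) (r := r s))).mul_left
      (g s * psi s)
    rwa [hγ s (Finset.mem_filter.1 hs).1, ENNReal.toReal_natCast] at this
  have h2 := (γ.summable_nu hb).hasSum.sub h1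
  have hw : ∑' x, (γ.toConfiguration.mult x : ℝ≥0∞) * ENNReal.ofReal (hwt x) ≠ ∞ :=
    (lt_of_le_of_lt hR ENNReal.ofReal_lt_top).ne
  have h3 : HasSum (fun x => ε * ((γ.toConfiguration.mult x : ℝ) * hwt x)) (ε * (wsum hwt γ).toReal) := by
    refine HasSum.mul_left _ ?_
    have := (ENNReal.summable_toReal hw).hasSum
    rw [← ENNReal.tsum_toReal_eq fun x => ENNReal.ne_top_of_tsum_ne_top hw x] at this
    refine this.congr_fun fun x => ?_
    rw [ENNReal.toReal_mul, ENNReal.toReal_natCast, ENNReal.toReal_ofReal (hwt_pos x).le]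
  have h4 : |γ.nu g - ∑ s ∈ S, g s * psi s * m s| ≤ ε * (wsum hwt γ).toReal := by
    unfold nu
    rw [← h2.tsum_eq, ← Real.norm_eq_abs]
    refine tsum_of_norm_bounded h3 fun x => ?_
    by_cases hx : γ.toConfiguration.mult x = 0
    · simp [hx]
    have e : (γ.toConfiguration.mult x : ℝ) * (g x * psi x) - ∑ s ∈ S, g s * psi s *
        ((γ.toConfiguration.mult x : ℝ) * (Metric.ball s (r s)).indicator 1 x)
        = γ.toConfiguration.mult x * (g x * psi x - ∑ s ∈ S, g s * psi s *
          (Metric.ball s (r s)).indicator 1 x) := by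
      rw [mul_sub, Finset.mul_sum]
      congr 1
      exact Finset.sum_congr rfl fun s _ => by ring
    rw [e, norm_mul, Real.norm_eq_abs, Nat.abs_cast, mul_left_comm]
    gcongr
    have hpx := psi_pos x
    by_cases hxS : ∃ s ∈ S, x ∈ Metric.ball s (r s)
    · obtain ⟨s, hs, hxs⟩ := hxS
      rw [Finset.sum_eq_single s]
      · rw [indicator_of_mem hxs, Pi.one_apply, mul_one, Real.norm_eq_abs]
        obtain ⟨L, M, hLM, hL, hM⟩ := hg
        have h5 : |g x - g s| ≤ dist x s := by
          have := hL.dist_le_mul x s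
          rw [Real.dist_eq] at this
          have hL1 : (L : ℝ) ≤ 1 := by exact_mod_cast le_self_add.trans hLM
          nlinarith [dist_nonneg (x := x) (y := s)]
        have e2 : g x * psi x - g s * psi s = (g x - g s) * psi x + g s * (psi x - psi s) := by ring
        rw [e2]
        refine (abs_add_le _ _).trans (le_trans ?_ (hr s x hxs))
        rw [abs_mul, abs_mul, abs_of_pos hpx]
        have := psi_le_one x
        have := hb s
        gcongr
        · nlinarith [abs_nonneg (g x - g s)]
        · nlinarith [abs_nonneg (psi x - psi s)]
      · intro s' hs' hne
        have := (hd s s' (Finset.mem_filter.1 hs).2 (Finset.mem_filter.1 hs').2 hne.symm)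
        rw [indicator_of_notMem (Set.disjoint_left.1 this hxs), mul_zero]
      · exact fun h => absurd hs h
    · push Not at hxS
      rw [Finset.sum_eq_zero fun s hs => by rw [indicator_of_notMem (hxS s hs), mul_zero], sub_zero,
        Real.norm_eq_abs, abs_mul, abs_of_pos hpx]
      -- A particle in the large ball but in no ball with `m s ≠ 0` would lie in a covering ball
      -- with count zero.
      have hxρ : ρ < ‖x‖ := by
        by_contra! hle
        obtain ⟨s, hs, hxs⟩ := mem_iUnion₂.1 (hc (mem_closedBall_zero_iff.2 hle))
        refine hxS s (Finset.mem_filter.2 ⟨hs, fun h0 => ?_⟩) hxs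
        have := γ.toConfiguration.one_le_count hxs hx
        rw [hγ s hs, h0] at this
        simp at this
      have := hb x
      have := hρ x hxρ
      nlinarith
  refine h4.trans ?_
  gcongr
  exact ENNReal.toReal_le_of_le_ofReal hR0 hR

theorem exists_psi_le {ε : ℝ} (hε : 0 < ε) : ∃ ρ : ℝ, ∀ x : Pt d, ρ < ‖x‖ → psi x ≤ ε * hwt x := by
  have h : Tendsto (fun u : ℝ => 2 ^ (d + 1) * u ^ (-(1 / 2 : ℝ))) atTop (𝓝 (2 ^ (d + 1) * 0)) :=
    (tendsto_rpow_neg_atTop (by norm_num)).const_mul _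
  rw [mul_zero] at h
  obtain ⟨ρ, hρ⟩ := eventually_atTop.1 (h.eventually (gt_mem_nhds hε))
  refine ⟨ρ, fun x hx => ?_⟩
  have h0 := norm_nonneg x
  have h1 := (hρ (1 + ‖x‖) (by linarith)).le
  have h2 : (1 + ‖x‖) ^ (d + 1) ≤ 2 ^ (d + 1) * (1 + ‖x‖ ^ (d + 1)) := by
    have := add_pow_le_two_pow zero_le_one h0 (d + 1)
    rwa [one_pow] at this
  have h3 : psi x ≤ 2 ^ (d + 1) * (1 + ‖x‖) ^ (-((d : ℝ) + 1)) := by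
    unfold psi
    rw [Real.rpow_neg (by positivity), ← Nat.cast_add_one, Real.rpow_natCast, ← div_eq_mul_inv,
      div_le_div_iff₀ (by positivity) (by positivity), one_mul]
    exact h2
  have h4 : (1 + ‖x‖) ^ (-((d : ℝ) + 1)) = (1 + ‖x‖) ^ (-(1 / 2 : ℝ)) * hwt x := by
    unfold hwt
    rw [← Real.rpow_add (by positivity)]
    congr 1
    ring
  rw [h4, ← mul_assoc] at h3
  exact h3.trans (mul_le_mul_of_nonneg_right h1 (hwt_pos x).le)

theorem exists_radius {ε : ℝ} (hε : 0 < ε) (s : Pt d) {ρ : ℝ} (hρ : 0 < ρ) :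
    ∃ r > 0, r ≤ ρ ∧ ∀ x ∈ Metric.ball s r, dist x s + |psi x - psi s| ≤ ε * hwt x := by
  have hc : Continuous fun x : Pt d => ε * hwt x - (dist x s + |psi x - psi s|) := by
    have h1 := continuous_hwt (d := d)
    have h2 := Tempered.continuous_psi (d := d)
    fun_prop
  have h0 : 0 < ε * hwt s - (dist s s + |psi s - psi s|) := by
    simpa using mul_pos hε (hwt_pos s)
  obtain ⟨r, hr, h⟩ := Metric.mem_nhds_iff.1 (hc.continuousAt.eventually (lt_mem_nhds h0))
  refine ⟨min r ρ, lt_min hr hρ, min_le_right _ _, fun x hx => ?_⟩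
  have := h (Metric.ball_subset_ball (min_le_left _ _) hx)
  simp only [mem_ofPred_eq] at this
  linarith

/-- The limit of an ultrafilter. -/
theorem exists_limit {R : ℝ} (hR : 0 ≤ R) {𝒰 : Ultrafilter (Tempered d)}
    (h : ∀ᶠ γ in (𝒰 : Filter (Tempered d)), Tempered.wsum hwt γ ≤ ENNReal.ofReal R) :
    ∃ γ : Tempered d, Tempered.wsum hwt γ ≤ ENNReal.ofReal R ∧ (𝒰 : Filter (Tempered d)) ≤ 𝓝 γ := by
  classical
  have key : ∀ x : Pt d, ∃ m : ℕ, ∃ ρ > 0, ∀ r, 0 < r → r ≤ ρ →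
      ∀ᶠ γ in (𝒰 : Filter (Tempered d)), count (Metric.ball x r) γ.toConfiguration = m :=
    exists_limit_mult (R := R.toNNReal) (𝒰 := 𝒰.map Tempered.toConfiguration) continuous_hwt hwt_pos h
  choose m ρ hρ hm using key
  -- The ball of radius `ρ s` and any smaller ball around `s` eventually contain the same number `m
  -- s` of particles, so nothing is left for a disjoint ball around `x`.
  have hsep : ∀ s x, x ∈ Metric.ball s (ρ s) → x ≠ s → m x = 0 := by
    intro s x hx hne
    have hpos : 0 < dist x s := dist_pos.2 hne
    obtain ⟨r, hr0, hr1⟩ : ∃ r, 0 < r ∧ (r ≤ ρ x ∧ r ≤ ρ s ∧ r ≤ dist x s / 2 ∧ r ≤ ρ s - dist x s) :=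
      ⟨min (min (ρ x) (ρ s)) (min (dist x s / 2) (ρ s - dist x s)), by
        have := sub_pos.2 (Metric.mem_ball.1 hx)
        have := hρ x
        have := hρ s
        positivity, by
        refine ⟨?_, ?_, ?_, ?_⟩ <;> simp⟩
    obtain ⟨γ, h1, h2, h3⟩ := ((hm x r hr0 hr1.1).and ((hm s r hr0 hr1.2.1).and
      (hm s (ρ s) (hρ s) le_rfl))).exists
    have h4 := γ.toConfiguration.count_add_le (A := Metric.ball x r) (B := Metric.ball s r)
      (C := Metric.ball s (ρ s)) (Metric.ball_disjoint_ball (by linarith))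
      (Metric.ball_subset_ball' (by linarith)) (Metric.ball_subset_ball hr1.2.1)
    rw [h1, h2, h3] at h4
    norm_cast at h4
    omega
  let γc : Configuration d := ⟨m, fun Λ hΛ => by
    obtain ⟨t, -, ht⟩ := hΛ.elim_nhds_subcover (fun x => Metric.ball x (ρ x))
      fun x _ => Metric.ball_mem_nhds x (hρ x)
    refine t.finite_toSet.subset fun x hx => ?_
    obtain ⟨s, hs, hxs⟩ := mem_iUnion₂.1 (ht hx.1)
    by_cases hne : x = s
    · rwa [hne]
    · exact absurd (hsep s x hxs hne) hx.2⟩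
  have hcount : ∀ s r, 0 < r → r ≤ ρ s → count (Metric.ball s r) γc = m s := by
    intro s r hr hrs
    unfold count Configuration.sum
    rw [tsum_eq_single s]
    · simp [hr, γc]
    · intro x hx
      by_cases hxs : x ∈ Metric.ball s r
      · simp [γc, hsep s x (Metric.ball_subset_ball hrs hxs) hx]
      · simp [hxs]
  have hdis : ∀ s s', m s ≠ 0 → m s' ≠ 0 → s ≠ s' →
      Disjoint (Metric.ball s (ρ s / 2)) (Metric.ball s' (ρ s' / 2)) := by
    intro s s' hs hs' hne
    have h1 : ρ s ≤ dist s' s := by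
      by_contra! hc
      exact hs' (hsep s s' hc hne.symm)
    have h2 : ρ s' ≤ dist s s' := by
      by_contra! hc
      exact hs (hsep s' s hc hne)
    rw [dist_comm] at h1
    exact Metric.ball_disjoint_ball (by linarith)
  -- Lower semicontinuity: for finitely many points choose disjoint balls on which `hwt` is at least
  -- `θ` times its value at the centre, compare with a nearby configuration, and let `θ` increase to
  -- one.
  have hfatou : γc.sum (fun x => ENNReal.ofReal (hwt x)) ≤ ENNReal.ofReal R := by
    unfold Configuration.sum
    rw [ENNReal.tsum_eq_iSup_sum]
    refine iSup_le fun S => ?_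
    refine ENNReal.le_of_forall_lt_one_mul_le fun θ hθ => ?_
    have hθ' : θ ≠ ∞ := ne_top_of_lt hθ
    have hθ1 : θ.toReal < 1 := by
      rw [← ENNReal.toReal_one]
      exact (ENNReal.toReal_lt_toReal hθ' ENNReal.one_ne_top).2 hθ
    have hrad : ∀ s : Pt d, ∃ r > 0, r ≤ ρ s / 2 ∧ ∀ x ∈ Metric.ball s r, θ.toReal * hwt s ≤ hwt x := by
      intro s
      have h0 : θ.toReal * hwt s < hwt s := mul_lt_of_lt_one_left (hwt_pos s) hθ1
      obtain ⟨r, hr, h⟩ := Metric.mem_nhds_iff.1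
        ((continuous_hwt (d := d)).continuousAt.eventually (lt_mem_nhds h0))
      exact ⟨min r (ρ s / 2), lt_min hr (half_pos (hρ s)), min_le_right _ _, fun x hx =>
        (h (Metric.ball_subset_ball (min_le_left _ _) hx)).le⟩
    choose r hr0 hr1 hr2 using hrad
    have hev : ∀ᶠ γ in (𝒰 : Filter (Tempered d)), ∀ s ∈ S,
        count (Metric.ball s (r s)) γ.toConfiguration = m s :=
      (Filter.eventually_all_finset S).2 fun s _ => hm s (r s) (hr0 s) ((hr1 s).trans (by linarith [hρ s]))
    obtain ⟨γ, h1, h2⟩ := (hev.and h).exists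
    refine le_trans ?_ h2
    calc θ * ∑ s ∈ S, (γc.mult s : ℝ≥0∞) * ENNReal.ofReal (hwt s)
        = ∑ s ∈ S with m s ≠ 0, ENNReal.ofReal (θ.toReal * hwt s) * count (Metric.ball s (r s)) γ.toConfiguration := by
          rw [Finset.mul_sum, Finset.sum_filter]
          refine Finset.sum_congr rfl fun s hs => ?_
          rw [h1 s hs, ENNReal.ofReal_mul ENNReal.toReal_nonneg, ENNReal.ofReal_toReal hθ']
          change θ * ((m s : ℝ≥0∞) * _) = _
          split_ifs with h0
          · ring
          · rw [not_not] at h0; simp [h0]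
      _ = γ.toConfiguration.sum fun x => ∑ s ∈ S with m s ≠ 0,
            ENNReal.ofReal (θ.toReal * hwt s) * (Metric.ball s (r s)).indicator 1 x := by
          unfold count Configuration.sum
          simp only [Finset.mul_sum]
          rw [Summable.tsum_finsetSum fun _ _ => ENNReal.summable]
          refine Finset.sum_congr rfl fun s _ => ?_
          rw [← ENNReal.tsum_mul_left]
          exact tsum_congr fun x => by ring
      _ ≤ _ := by
          refine γ.toConfiguration.sum_mono fun x => ?_
          by_cases hx : ∃ s ∈ S.filter fun s => m s ≠ 0, x ∈ Metric.ball s (r s)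
          · obtain ⟨s, hs, hxs⟩ := hx
            rw [Finset.sum_eq_single s]
            · rw [indicator_of_mem hxs, Pi.one_apply, mul_one]
              exact ENNReal.ofReal_le_ofReal (hr2 s x hxs)
            · intro s' hs' hne
              have := (hdis s s' (Finset.mem_filter.1 hs).2 (Finset.mem_filter.1 hs').2 hne.symm).mono
                (Metric.ball_subset_ball (hr1 s)) (Metric.ball_subset_ball (hr1 s'))
              rw [indicator_of_notMem (Set.disjoint_left.1 this hxs), mul_zero]
            · exact fun h => absurd hs h
          · push Not at hx
            rw [Finset.sum_eq_zero fun s hs => by rw [indicator_of_notMem (hx s hs), mul_zero]]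
            exact zero_le
  have hPsi : Psi γc < ∞ := (Psi_le_hwt γc).trans_lt
    (ENNReal.mul_lt_top (by simp) (hfatou.trans_lt ENNReal.ofReal_lt_top))
  let γt : Tempered d := ⟨γc, hPsi⟩
  refine ⟨γt, hfatou, ?_⟩
  rw [Metric.nhds_basis_closedEBall.ge_iff]
  intro ε hε
  -- The nearby configuration and the limit are each compared with the same finite sum, with error
  -- `ε' R`.
  obtain ⟨ε', hε'0, hε'⟩ : ∃ ε' : ℝ, 0 < ε' ∧ ENNReal.ofReal (ε' * R + ε' * R) ≤ ε := by
    obtain ⟨e, he0, he⟩ := ENNReal.lt_iff_exists_nnreal_btwn.1 hε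
    have he0' : (0 : ℝ) < e := by exact_mod_cast he0
    refine ⟨e / (2 * R + 1), by positivity, le_trans ?_ he.le⟩
    rw [← ENNReal.ofReal_coe_nnreal]
    refine ENNReal.ofReal_le_ofReal ?_
    rw [← mul_two, mul_assoc, div_mul_eq_mul_div, div_le_iff₀ (by positivity)]
    nlinarith
  obtain ⟨ϱ, hϱ⟩ := exists_psi_le (d := d) hε'0
  choose r hr0 hr1 hr2 using fun s => exists_radius hε'0 s (half_pos (hρ s))
  obtain ⟨t, -, ht⟩ := (isCompact_closedBall (0 : Pt d) ϱ).elim_nhds_subcover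
    (fun x => Metric.ball x (r x)) fun x _ => Metric.ball_mem_nhds x (hr0 x)
  have hr3 : ∀ s, r s ≤ ρ s := fun s => (hr1 s).trans (by linarith [hρ s])
  have hev : ∀ᶠ γ in (𝒰 : Filter (Tempered d)), ∀ s ∈ t,
      count (Metric.ball s (r s)) γ.toConfiguration = m s :=
    (Filter.eventually_all_finset t).2 fun s _ => hm s (r s) (hr0 s) (hr3 s)
  have hd : ∀ s s', m s ≠ 0 → m s' ≠ 0 → s ≠ s' → Disjoint (Metric.ball s (r s)) (Metric.ball s' (r s')) :=
    fun s s' hs hs' hne => (hdis s s' hs hs' hne).mono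
      (Metric.ball_subset_ball (hr1 s)) (Metric.ball_subset_ball (hr1 s'))
  filter_upwards [hev, h] with γ hγ hγR
  rw [Metric.mem_closedEBall, Tempered.edist_eq]
  refine iSup₂_le fun g hg => le_trans ?_ hε'
  rw [edist_dist, Real.dist_eq]
  refine ENNReal.ofReal_le_ofReal ?_
  have h1 := Tempered.abs_nu_sub_le hε'0.le hr2 hϱ hd ht hγ hγR hR hg
  have h2 := Tempered.abs_nu_sub_le (γ := γt) hε'0.le hr2 hϱ hd ht
    (fun s _ => hcount s (r s) (hr0 s) (hr3 s)) hfatou hR hg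
  rw [abs_le] at h1 h2 ⊢
  constructor <;> linarith [h1.1, h1.2, h2.1, h2.2]

theorem isCompact_setOf_wsum_hwt_le (R : ℝ≥0) :
    IsCompact {γ : Tempered d | Tempered.wsum hwt γ ≤ R} := by
  rw [isCompact_iff_ultrafilter_le_nhds]
  intro 𝒰 h𝒰
  rw [← ENNReal.ofReal_coe_nnreal] at h𝒰 ⊢
  exact exists_limit R.coe_nonneg (le_principal_iff.1 h𝒰)

theorem exists_div_le {B ε : ℝ≥0∞} (hB : B ≠ ∞) (hε : 0 < ε) : ∃ R : ℝ≥0, 0 < R ∧ B / R ≤ ε := by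
  obtain ⟨e, he0, he⟩ := ENNReal.lt_iff_exists_nnreal_btwn.1 hε
  have he0' : 0 < e := by exact_mod_cast he0
  lift B to ℝ≥0 using hB
  refine ⟨B / e + 1, by positivity, le_trans ?_ he.le⟩
  refine ENNReal.div_le_of_le_mul ?_
  norm_cast
  rw [mul_add, mul_div_cancel₀ _ he0'.ne']
  exact le_self_add

namespace Tempered

variable {a φ : Pt d → ℝ}

theorem lintegral_marginal_hwt_le (hm : IsJumpModel a φ) {α : ℝ} (hα : α ∈ Ioc (0 : ℝ) 1)
    (μ : Measure (Tempered d)) (t : ℝ≥0) :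
    ∫⁻ γ, wsum hwt γ ∂marginal (jumpData hm hα).p μ t
      ≤ ENNReal.ofReal (Real.exp (kap a * t)) * ∫⁻ γ, wsum hwt γ ∂μ := by
  have hw : Measurable (wsum (hwt (d := d))) := measurable_wsum continuous_hwt.measurable
  rw [marginal, Measure.lintegral_bind (Kernel.aemeasurable _) hw.aemeasurable, ← lintegral_const_mul _ hw]
  exact lintegral_mono fun γ => lintegral_p_hwt_le hm hα t γ

/-- Markov's inequality for `∑ hwt`, whose mean at time `t` is bounded independently of `α`. -/
theorem isTight_marginal (hm : IsJumpModel a φ) {μ : Measure (Configuration d)}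
    (hμ : IsSubPoissonian μ) (t : ℝ≥0) :
    IsTightMeasureSet {ν | ∃ α, ∃ hα : α ∈ Ioc (0 : ℝ) 1, ν = marginal (jumpData hm hα).p (lawOn μ) t} := by
  have hw : Measurable (wsum (hwt (d := d))) := measurable_wsum continuous_hwt.measurable
  rw [isTightMeasureSet_iff_exists_isCompact_measure_compl_le]
  intro ε hε
  set B := ENNReal.ofReal (Real.exp (kap a * t)) * ∫⁻ γ, wsum hwt γ ∂lawOn μ with hB
  have hBt : B ≠ ∞ := (ENNReal.mul_lt_top ENNReal.ofReal_lt_top hμ.lintegral_wsum_hwt).ne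
  obtain ⟨R, hR0, hR⟩ : ∃ R : ℝ≥0, 0 < R ∧ B / R ≤ ε := exists_div_le hBt hε
  refine ⟨_, isCompact_setOf_wsum_hwt_le R, ?_⟩
  rintro ν ⟨α, hα, rfl⟩
  refine le_trans ?_ hR
  rw [ENNReal.le_div_iff_mul_le (by simp [hR0.ne']) (by simp), mul_comm]
  refine le_trans ?_ (lintegral_marginal_hwt_le hm hα (lawOn μ) t)
  refine le_trans ?_ (mul_meas_ge_le_lintegral hw R)
  gcongr
  intro γ hγ
  exact (not_le.1 (show ¬ wsum hwt γ ≤ R from hγ)).le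

end Tempered

end Kawasaki

/-! ### Regularity of paths -/

namespace PathRegularity

variable {X : Type*} [PseudoEMetricSpace X]

/-- The points of `N` are at a distance of at least `δ` from each other and from the origin. -/
def Separated (δ : ℝ≥0) (N : Set ℝ≥0) : Prop :=
  (∀ s ∈ N, δ ≤ s) ∧ ∀ s ∈ N, ∀ s' ∈ N, s < s' → s + δ ≤ s'

/-- On `D`, the function `f` varies by at most `η` over the intervals before `k` that are shorter
than `δ` and contain no point of `N`. -/
def Steady (D : Set ℝ≥0) (k δ : ℝ≥0) (η : ℝ≥0∞) (N : Set ℝ≥0) (f : ℝ≥0 → X) : Prop :=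
  ∀ r ∈ D, ∀ t ∈ D, r < t → t < k → t < r + δ → (∀ s ∈ N, ¬ (r ≤ s ∧ s ≤ t)) → edist (f r) (f t) ≤ η

theorem Steady.mono {D D' : Set ℝ≥0} {k δ : ℝ≥0} {η : ℝ≥0∞} {N : Set ℝ≥0} {f : ℝ≥0 → X}
    (h : Steady D k δ η N f) (hD : D' ⊆ D) : Steady D' k δ η N f :=
  fun r hr t ht => h r (hD hr) t (hD ht)

section Limit

variable {ι : Type*} {𝒰 : Ultrafilter ι} {N : ι → Set ℝ≥0}

/-- The limit of a family of sets along an ultrafilter. -/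
def limitNodes (𝒰 : Ultrafilter ι) (N : ι → Set ℝ≥0) : Set ℝ≥0 :=
  {s | ∀ ε : ℝ, 0 < ε → ∀ᶠ i in (𝒰 : Filter ι), ∃ n ∈ N i, dist n s < ε}

/-- Every point of `C` has a neighbourhood eventually free of nodes, and compactness makes this
uniform. For this reason `Steady` is formulated with closed intervals. -/
theorem eventually_notMem_of_isCompact {C : Set ℝ≥0} (hC : IsCompact C)
    (h : ∀ s ∈ limitNodes 𝒰 N, s ∉ C) : ∀ᶠ i in (𝒰 : Filter ι), ∀ n ∈ N i, n ∉ C := by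
  refine hC.induction_on (p := fun B => ∀ᶠ i in (𝒰 : Filter ι), ∀ n ∈ N i, n ∉ B) (by simp)
    (fun A B hAB hB => hB.mono fun i hi n hn hnA => hi n hn (hAB hnA))
    (fun A B hA hB => by
      filter_upwards [hA, hB] with i h1 h2 n hn hnAB
      exact hnAB.elim (h1 n hn) (h2 n hn)) fun x hx => ?_
  have hxN : x ∉ limitNodes 𝒰 N := fun hxN => h x hxN hx
  simp only [limitNodes, mem_ofPred_eq, not_forall] at hxN
  obtain ⟨ε, hε, hx'⟩ := hxN
  rw [← Ultrafilter.eventually_not] at hx'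
  refine ⟨Metric.ball x ε, mem_nhdsWithin_of_mem_nhds (Metric.ball_mem_nhds x hε), ?_⟩
  filter_upwards [hx'] with i hi n hn hnx
  exact hi ⟨n, hn, hnx⟩

theorem separated_limitNodes {δ : ℝ≥0} (h : ∀ᶠ i in (𝒰 : Filter ι), Separated δ (N i)) :
    Separated δ (limitNodes 𝒰 N) := by
  constructor
  · intro s hs
    rw [← NNReal.coe_le_coe]
    refine le_of_forall_pos_le_add fun ε hε => ?_
    obtain ⟨i, hi, n, hn, hns⟩ := (h.and (hs ε hε)).exists
    have h1 : (δ : ℝ) ≤ n := by exact_mod_cast hi.1 n hn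
    rw [NNReal.dist_eq, abs_lt] at hns
    linarith [hns.2]
  · intro s hs s' hs' hss
    rw [← NNReal.coe_le_coe, NNReal.coe_add]
    refine le_of_forall_pos_le_add fun ε hε => ?_
    have hss' : (s : ℝ) < s' := by exact_mod_cast hss
    set κ := min (ε / 2) (((s' : ℝ) - s) / 2) with hκ
    have hκ0 : 0 < κ := lt_min (by linarith) (by linarith)
    have hκ1 : κ ≤ ε / 2 := min_le_left _ _
    have hκ2 : κ ≤ ((s' : ℝ) - s) / 2 := min_le_right _ _
    obtain ⟨i, hi, ⟨n, hn, hns⟩, n', hn', hns'⟩ := (h.and ((hs κ hκ0).and (hs' κ hκ0))).exists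
    rw [NNReal.dist_eq, abs_lt] at hns hns'
    have h1 : n < n' := by
      rw [← NNReal.coe_lt_coe]
      linarith [hns.2, hns'.1]
    have h2 : (n : ℝ) + δ ≤ n' := by exact_mod_cast hi.2 n hn n' hn' h1
    linarith [hns.1, hns'.2]

theorem steady_limitNodes {D : Set ℝ≥0} {k δ : ℝ≥0} {η : ℝ≥0∞} {f : ι → ℝ≥0 → X} {g : ℝ≥0 → X}
    (hf : ∀ q ∈ D, Tendsto (fun i => f i q) (𝒰 : Filter ι) (𝓝 (g q)))
    (h : ∀ r ∈ D, ∀ t ∈ D, r < t → t < k → t < r + δ → ∀ᶠ i in (𝒰 : Filter ι),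
      (∀ s ∈ N i, ¬ (r ≤ s ∧ s ≤ t)) → edist (f i r) (f i t) ≤ η) :
    Steady D k δ η (limitNodes 𝒰 N) g := by
  intro r hr t ht hrt htk htδ hs
  have h1 := eventually_notMem_of_isCompact (𝒰 := 𝒰) (N := N) (isCompact_Icc (a := r) (b := t)) hs
  refine le_of_tendsto ((hf r hr).edist (hf t ht)) ?_
  filter_upwards [h1, h r hr t ht hrt htk htδ] with i h2 h3
  exact h3 h2

end Limit

/-- If the nodes can be found for every finite set of times, they can be found for all times. -/
theorem exists_nodes {D : Set ℝ≥0} {k δ : ℝ≥0} {η : ℝ≥0∞} {f : ℝ≥0 → X}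
    (h : ∀ A : Finset D, ∃ N, Separated δ N ∧ Steady (Subtype.val '' (A : Set D)) k δ η N f) :
    ∃ N, Separated δ N ∧ Steady D k δ η N f := by
  classical
  choose N hN hst using h
  -- Along this ultrafilter any two given times eventually belong to the finite set, so the limit of
  -- the finite node sets serves all times.
  set 𝒰 : Ultrafilter (Finset D) := Ultrafilter.of atTop with h𝒰
  refine ⟨limitNodes 𝒰 N, separated_limitNodes (Eventually.of_forall hN),
    steady_limitNodes (f := fun _ => f) (fun q _ => tendsto_const_nhds) ?_⟩
  intro r hr t ht hrt htk htδ
  have h1 : ∀ᶠ A : Finset D in atTop, ({⟨r, hr⟩, ⟨t, ht⟩} : Finset D) ≤ A := eventually_ge_atTop _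
  filter_upwards [Ultrafilter.of_le atTop h1] with A hA hs
  refine hst A r ⟨⟨r, hr⟩, hA (by simp), rfl⟩ t ⟨⟨t, ht⟩, hA (by simp), rfl⟩ hrt htk htδ hs

variable {D : Set ℝ≥0} {k δ : ℝ≥0} {η : ℝ≥0∞} {N : Set ℝ≥0} {f : ℝ≥0 → X}

/-- At most one node lies in `(t, t + δ)`, so there is a gap immediately to the right of `t`. -/
theorem Separated.eventually_right (hN : Separated δ N) (hδ : 0 < δ) (t : ℝ≥0) :
    ∀ᶠ q in 𝓝[>] t, ∀ s ∈ N, ¬ (t < s ∧ s ≤ q) := by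
  by_cases h : ∃ s ∈ N, t < s ∧ s < t + δ
  · obtain ⟨s, hs, hts, hsδ⟩ := h
    filter_upwards [Ioo_mem_nhdsGT hts] with q hq s' hs' ⟨h1, h2⟩
    have h3 := hN.2 s' hs' s hs (h2.trans_lt hq.2)
    exact absurd (hsδ.trans_le ((add_le_add_left h1.le δ).trans h3)) (lt_irrefl _)
  · push Not at h
    filter_upwards [Ioo_mem_nhdsGT (lt_add_of_pos_right t hδ)] with q hq s' hs' ⟨h1, h2⟩
    exact absurd (h s' hs' h1) (not_le.2 (h2.trans_lt hq.2))

theorem Separated.eventually_left (hN : Separated δ N) (hδ : 0 < δ) (t : ℝ≥0) :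
    ∀ᶠ q in 𝓝[<] t, ∀ s ∈ N, ¬ (q ≤ s ∧ s < t) := by
  by_cases h : ∃ s ∈ N, s < t ∧ t < s + δ
  · obtain ⟨s, hs, hts, hsδ⟩ := h
    filter_upwards [Ioo_mem_nhdsLT hts] with q hq s' hs' ⟨h1, h2⟩
    have h3 := hN.2 s hs s' hs' (hq.1.trans_le h1)
    exact absurd (hsδ.trans_le (h3.trans h2.le)) (lt_irrefl _)
  · push Not at h
    rcases eq_or_ne t 0 with rfl | ht
    · refine Eventually.of_forall fun q s _ ⟨_, h2⟩ => absurd h2 not_lt_zero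
    have h1 : t - δ < t := tsub_lt_self (pos_iff_ne_zero.2 ht) hδ
    filter_upwards [Ioo_mem_nhdsLT h1] with q hq s' hs' ⟨h2, h3⟩
    have h4 := h s' hs' h3
    have h5 : s' ≤ t - δ := le_tsub_of_add_le_right h4
    exact absurd (hq.1.trans_le (h2.trans h5)) (lt_irrefl _)

theorem neBot_right (hD : Dense D) (t : ℝ≥0) : (𝓝[Ioi t ∩ D] t).NeBot := by
  rw [← mem_closure_iff_nhdsWithin_neBot]
  have h := closure_minimal (hD.open_subset_closure_inter (isOpen_Ioi (a := t))) isClosed_closure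
  exact h (by simp)

theorem eventually_right_mem (t : ℝ≥0) {u : ℝ≥0} (h : t < u) :
    ∀ᶠ q in 𝓝[Ioi t ∩ D] t, q ∈ D ∧ t < q ∧ q < u := by
  filter_upwards [self_mem_nhdsWithin, mem_nhdsWithin_of_mem_nhds (Iio_mem_nhds h)] with q h1 h2
  exact ⟨h1.2, h1.1, h2⟩

theorem Separated.eventually_right' (hN : Separated δ N) (hδ : 0 < δ) (t : ℝ≥0) :
    ∀ᶠ q in 𝓝[Ioi t ∩ D] t, ∀ s ∈ N, ¬ (t < s ∧ s ≤ q) :=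
  nhdsWithin_mono t inter_subset_left (hN.eventually_right hδ t)

/-- The right limit at `t` is compared with a value at `q` through points of `D` slightly to the
right of `t`. A node at `t` itself is harmless when `q` lies to its right. -/
theorem Steady.edist_right_le (h : Steady D k δ η N f) (hD : Dense D) (hN : Separated δ N) (hδ : 0 < δ)
    {t q : ℝ≥0} {z : X} (hz : Tendsto f (𝓝[Ioi t ∩ D] t) (𝓝 z)) (hq : q ∈ D) (htk : t < k)
    (hqk : q < k) (htq : t < q + δ) (hqt : q < t + δ) (h1 : ∀ s ∈ N, ¬ (t < s ∧ s ≤ q))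
    (h2 : ∀ s ∈ N, ¬ (q ≤ s ∧ s ≤ t)) : edist (f q) z ≤ η := by
  have := neBot_right hD t
  refine le_of_tendsto (tendsto_const_nhds.edist hz) ?_
  rcases lt_or_ge t q with hlt | hle
  · filter_upwards [eventually_right_mem t hlt] with r hr
    rw [edist_comm]
    exact h r hr.1 q hq hr.2.2 hqk (hqt.trans_le (by gcongr; exact hr.2.1.le))
      fun s hs hrs => h1 s hs ⟨hr.2.1.trans_le hrs.1, hrs.2⟩
  · filter_upwards [eventually_right_mem t htk, eventually_right_mem t htq, hN.eventually_right' hδ t]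
      with r hr hr' hno
    refine h q hq r hr.1 (hle.trans_lt hr.2.1) hr.2.2 hr'.2.2 fun s hs hrs => ?_
    rcases le_or_gt s t with hst | hst
    · exact h2 s hs ⟨hrs.1, hst⟩
    · exact hno s hs ⟨hst, hrs.2⟩

theorem Steady.edist_right_right_le (h : Steady D k δ η N f) (hD : Dense D) (hN : Separated δ N)
    (hδ : 0 < δ) {r t : ℝ≥0} {y z : X} (hy : Tendsto f (𝓝[Ioi r ∩ D] r) (𝓝 y))
    (hz : Tendsto f (𝓝[Ioi t ∩ D] t) (𝓝 z)) (hrt : r < t) (htk : t < k) (htr : t < r + δ)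
    (h1 : ∀ s ∈ N, ¬ (r < s ∧ s ≤ t)) : edist y z ≤ η := by
  have := neBot_right hD r
  refine le_of_tendsto (hy.edist tendsto_const_nhds) ?_
  filter_upwards [eventually_right_mem r hrt] with q hq
  refine h.edist_right_le hD hN hδ hz hq.1 htk (hq.2.2.trans htk)
    (htr.trans_le (by gcongr; exact hq.2.1.le)) (hq.2.2.trans (lt_add_of_pos_right _ hδ)) ?_ ?_
  · exact fun s _ hs => absurd (hs.1.trans_le (hs.2.trans hq.2.2.le)) (lt_irrefl _)
  · exact fun s hs hqs => h1 s hs ⟨hq.2.1.trans_le hqs.1, hqs.2⟩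

/-- Compact sets are complete, so the Cauchy property suffices and completeness of the whole space
is not required. -/
theorem exists_tendsto_of_isCompact {ι : Type*} {l : Filter ι} [l.NeBot] {K : Set X} (hK : IsCompact K)
    {u : ι → X} (hu : ∀ᶠ i in l, u i ∈ K)
    (hc : ∀ ε : ℝ≥0∞, 0 < ε → ∃ S ∈ l, ∀ i ∈ S, ∀ j ∈ S, edist (u i) (u j) < ε) :
    ∃ x ∈ K, Tendsto u l (𝓝 x) := by
  have hC : Cauchy (map u l) := by
    rw [EMetric.cauchy_iff]
    refine ⟨(inferInstance : (map u l).NeBot).ne, fun ε hε => ?_⟩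
    obtain ⟨S, hS, h⟩ := hc ε hε
    refine ⟨u '' S, image_mem_map hS, ?_⟩
    rintro _ ⟨i, hi, rfl⟩ _ ⟨j, hj, rfl⟩
    exact h i hi j hj
  exact hK.isComplete _ hC (le_principal_iff.2 hu)

theorem eventually_floor_right (t : ℝ≥0) : ∀ᶠ q in 𝓝[>] t, ⌊q⌋₊ = ⌊t⌋₊ := by
  filter_upwards [Ioo_mem_nhdsGT (Nat.lt_floor_add_one t)] with q hq
  rw [Nat.floor_eq_iff zero_le]
  exact ⟨(Nat.floor_le zero_le).trans hq.1.le, hq.2⟩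

/-- The compact set that contains the path depends on the integer part of the time, which is
constant just before `t`, also at integer times. -/
theorem eventually_floor_left (t : ℝ≥0) : ∀ᶠ q in 𝓝[<] t, ⌊q⌋₊ = ⌈t⌉₊ - 1 := by
  rcases eq_or_ne t 0 with rfl | ht
  · simp
  have h1 : 1 ≤ ⌈t⌉₊ := Nat.one_le_ceil_iff.2 (pos_iff_ne_zero.2 ht)
  have h2 : ((⌈t⌉₊ - 1 : ℕ) : ℝ≥0) < t := by
    rw [← Nat.lt_ceil]; omega
  filter_upwards [Ioo_mem_nhdsLT h2] with q hq
  rw [Nat.floor_eq_iff zero_le]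
  refine ⟨hq.1.le, hq.2.trans_le ?_⟩
  refine (Nat.le_ceil t).trans ?_
  exact_mod_cast (by omega : ⌈t⌉₊ ≤ ⌈t⌉₊ - 1 + 1)

/-- The right-continuous modification. -/
theorem exists_cadlag (hD : Dense D) {K : ℕ → Set X} (hK : ∀ j, IsCompact (K j))
    (hf : ∀ q ∈ D, f q ∈ K ⌊q⌋₊) {δ : ℕ → ℝ≥0} {η : ℕ → ℝ≥0∞} (hδ : ∀ k, 0 < δ k)
    (hη : ∀ ε > 0, ∀ T : ℝ≥0, ∃ k : ℕ, T < k ∧ η k < ε) {N : ℕ → Set ℝ≥0}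
    (hN : ∀ k, Separated (δ k) (N k)) (h : ∀ k : ℕ, Steady D k (δ k) (η k) (N k) f) :
    ∃ g : ℝ≥0 → X, (∀ t, g t ∈ K ⌊t⌋₊) ∧ (∀ t, Tendsto f (𝓝[Ioi t ∩ D] t) (𝓝 (g t))) ∧
      (∀ t, ContinuousWithinAt g (Ici t) t) ∧ ∀ t, ∃ z, Tendsto g (𝓝[<] t) (𝓝 z) := by
  have h1 : ∀ t, ∃ z ∈ K ⌊t⌋₊, Tendsto f (𝓝[Ioi t ∩ D] t) (𝓝 z) := by
    intro t
    have := neBot_right hD t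
    refine exists_tendsto_of_isCompact (hK _) ?_ fun ε hε => ?_
    · filter_upwards [self_mem_nhdsWithin, nhdsWithin_mono t inter_subset_left (eventually_floor_right t)]
        with q hq hfl
      rw [← hfl]
      exact hf q hq.2
    · obtain ⟨k, hk, hkε⟩ := hη ε hε t
      refine ⟨{q | (q ∈ D ∧ t < q ∧ q < k) ∧ (q ∈ D ∧ t < q ∧ q < t + δ k) ∧
        ∀ s ∈ N k, ¬ (t < s ∧ s ≤ q)}, (eventually_right_mem t hk).and
          ((eventually_right_mem t (lt_add_of_pos_right t (hδ k))).and ((hN k).eventually_right' (hδ k) t)),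
          fun q hq r hr => lt_of_le_of_lt ?_ hkε⟩
      have key : ∀ q r : ℝ≥0, ((q ∈ D ∧ t < q ∧ q < k) ∧ (q ∈ D ∧ t < q ∧ q < t + δ k) ∧
        ∀ s ∈ N k, ¬ (t < s ∧ s ≤ q)) → ((r ∈ D ∧ t < r ∧ r < k) ∧ (r ∈ D ∧ t < r ∧ r < t + δ k) ∧
        ∀ s ∈ N k, ¬ (t < s ∧ s ≤ r)) → q < r → edist (f q) (f r) ≤ η k := fun q r hq hr hqr =>
        h k q hq.1.1 r hr.1.1 hqr hr.1.2.2 (hr.2.1.2.2.trans (by gcongr; exact hq.1.2.1)) fun s hs hs' =>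
          hr.2.2 s hs ⟨hq.1.2.1.trans_le hs'.1, hs'.2⟩
      rcases lt_trichotomy q r with hqr | rfl | hqr
      · exact key q r hq hr hqr
      · simp
      · rw [edist_comm]; exact key r q hr hq hqr
  choose g hgK hg using h1
  refine ⟨g, hgK, hg, fun t => ?_, fun t => ?_⟩
  · rw [← continuousWithinAt_Ioi_iff_Ici, ContinuousWithinAt, EMetric.tendsto_nhds]
    intro ε hε
    obtain ⟨k, hk, hkε⟩ := hη ε hε t
    filter_upwards [Ioo_mem_nhdsGT hk, Ioo_mem_nhdsGT (lt_add_of_pos_right t (hδ k)),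
      (hN k).eventually_right (hδ k) t] with q hq hq' hno
    rw [edist_comm]
    exact lt_of_le_of_lt ((h k).edist_right_right_le hD (hN k) (hδ k) (hg t) (hg q) hq.1 hq.2 hq'.2 hno) hkε
  · rcases eq_or_ne t 0 with rfl | ht
    · exact ⟨g 0, by simp⟩
    have : (𝓝[<] t).NeBot := nhdsLT_neBot_of_exists_lt ⟨0, pos_iff_ne_zero.2 ht⟩
    obtain ⟨z, -, hz⟩ := exists_tendsto_of_isCompact (hK (⌈t⌉₊ - 1)) (l := 𝓝[<] t) (u := g) (by
      filter_upwards [eventually_floor_left t] with q hq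
      rw [← hq]
      exact hgK q) fun ε hε => by
        obtain ⟨k, hk, hkε⟩ := hη ε hε t
        have hlt : t - δ k < t := tsub_lt_self (pos_iff_ne_zero.2 ht) (hδ k)
        refine ⟨{q | q ∈ Ioo (t - δ k) t ∧ ∀ s ∈ N k, ¬ (q ≤ s ∧ s < t)},
          (eventually_of_mem (Ioo_mem_nhdsLT hlt) fun _ h => h).and ((hN k).eventually_left (hδ k) t),
          fun q hq r hr => lt_of_le_of_lt ?_ hkε⟩
        have key : ∀ q r : ℝ≥0, (q ∈ Ioo (t - δ k) t ∧ ∀ s ∈ N k, ¬ (q ≤ s ∧ s < t)) →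
            (r ∈ Ioo (t - δ k) t ∧ ∀ s ∈ N k, ¬ (r ≤ s ∧ s < t)) → q < r → edist (g q) (g r) ≤ η k :=
          fun q r hq hr hqr => (h k).edist_right_right_le hD (hN k) (hδ k) (hg q) (hg r) hqr
            (hr.1.2.trans hk) (hr.1.2.trans (lt_add_of_tsub_lt_right hq.1.1)) fun s hs hs' =>
                hq.2 s hs ⟨hs'.1.le, hs'.2.trans_lt hr.1.2⟩
        rcases lt_trichotomy q r with hqr | rfl | hqr
        · exact key q r hq hr hqr
        · simp
        · rw [edist_comm]; exact key r q hr hq hqr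
    exact ⟨z, hz⟩

end PathRegularity

/-! ### Changes of time and Skorokhod convergence along an ultrafilter. -/

namespace PathRegularity

/-! ### Changes of time -/

/-- A piecewise linear bump. -/
def tent (u : ℝ) : ℝ := max 0 (1 - |u|)

theorem abs_tent_sub_le (u v : ℝ) : |tent u - tent v| ≤ |u - v| := by
  unfold tent
  refine (abs_max_sub_max_le_max _ _ _ _).trans ?_
  rw [sub_self, abs_zero, max_eq_right (abs_nonneg _), sub_sub_sub_cancel_left, abs_sub_comm u v]
  exact abs_abs_sub_abs_le _ _

theorem continuous_tent : Continuous tent := by unfold tent; fun_prop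

theorem tent_zero : tent 0 = 1 := by simp [tent]

theorem tent_of_one_le {u : ℝ} (h : 1 ≤ |u|) : tent u = 0 := max_eq_left (by linarith)

theorem abs_tent_le (u : ℝ) : |tent u| ≤ 1 := by
  unfold tent
  rw [abs_of_nonneg (le_max_left _ _)]
  exact max_le zero_le_one (by linarith [abs_nonneg u])

/-- A change of time that moves finitely many separated points by a small amount. -/
theorem exists_orderIso {ι : Type*} (S : Finset ι) (n s : ι → ℝ≥0) {ρ κ : ℝ} (hρ : 0 < ρ)
    (hκ : S.card * κ < ρ) (h : ∀ i ∈ S, |(s i : ℝ) - n i| ≤ κ) (hn : ∀ i ∈ S, ρ ≤ n i)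
    (hsep : ∀ i ∈ S, ∀ j ∈ S, i ≠ j → ρ ≤ |(n i : ℝ) - n j|) :
    ∃ σ : ℝ≥0 ≃o ℝ≥0, (∀ i ∈ S, σ (n i) = s i) ∧ ∀ t, |(σ t : ℝ) - t| ≤ S.card * κ := by
  -- The identity plus a tent of half-width `ρ` at each node. Since the nodes are `ρ`-separated and
  -- at least `ρ`, at a node only its own tent is nonzero, and `0` is fixed; the slopes sum to less
  -- than one because `S.card * κ < ρ`.
  set σ₀ : ℝ → ℝ := fun t => t + ∑ i ∈ S, ((s i : ℝ) - n i) * tent ((t - n i) / ρ) with hσ₀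
  have hcont : Continuous σ₀ := by
    have := continuous_tent
    fun_prop
  have hdist : ∀ t, |σ₀ t - t| ≤ S.card * κ := by
    intro t
    simp only [hσ₀, add_sub_cancel_left]
    refine (Finset.abs_sum_le_sum_abs _ _).trans ?_
    rw [← nsmul_eq_mul]
    refine Finset.sum_le_card_nsmul _ _ _ fun i hi => ?_
    rw [abs_mul]
    have h1 := h i hi
    have h2 := abs_tent_le ((t - n i) / ρ)
    nlinarith [abs_nonneg ((s i : ℝ) - n i)]
  have hmono : StrictMono σ₀ := by
    intro x y hxy
    have hxy' : 0 < y - x := sub_pos.2 hxy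
    have h1 : |∑ i ∈ S, (((s i : ℝ) - n i) * tent ((y - n i) / ρ) - ((s i : ℝ) - n i) * tent ((x - n i) / ρ))|
        ≤ S.card * (κ * ((y - x) / ρ)) := by
      refine (Finset.abs_sum_le_sum_abs _ _).trans ?_
      rw [← nsmul_eq_mul]
      refine Finset.sum_le_card_nsmul _ _ _ fun i hi => ?_
      rw [← mul_sub, abs_mul]
      have h2 := abs_tent_sub_le ((y - n i) / ρ) ((x - n i) / ρ)
      rw [← sub_div, sub_sub_sub_cancel_right, abs_of_pos (div_pos hxy' hρ)] at h2
      exact mul_le_mul (h i hi) h2 (abs_nonneg _) ((abs_nonneg _).trans (h i hi))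
    rw [Finset.sum_sub_distrib] at h1
    have h3 := neg_le_of_abs_le h1
    have h4 : S.card * (κ * ((y - x) / ρ)) < y - x := by
      rw [← mul_assoc, ← mul_div_assoc, div_lt_iff₀ hρ, mul_comm (y - x)]
      exact mul_lt_mul_of_pos_right hκ hxy'
    simp only [hσ₀]
    linarith
  have hzero : σ₀ 0 = 0 := by
    simp only [hσ₀, zero_add]
    refine Finset.sum_eq_zero fun i hi => ?_
    rw [tent_of_one_le, mul_zero]
    rw [zero_sub, abs_div, abs_neg, abs_of_pos hρ, one_le_div hρ, NNReal.abs_eq]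
    exact hn i hi
  have hnode : ∀ i ∈ S, σ₀ (n i) = s i := by
    intro i hi
    simp only [hσ₀]
    rw [Finset.sum_eq_single i, sub_self, zero_div, tent_zero]
    · ring
    · intro j hj hji
      rw [tent_of_one_le, mul_zero]
      rw [abs_div, abs_of_pos hρ, one_le_div hρ]
      exact hsep i hi j hj hji.symm
    · exact fun h => absurd hi h
  have hnn : ∀ t : ℝ≥0, 0 ≤ σ₀ t := fun t => by
    rw [← hzero]; exact hmono.monotone t.coe_nonneg
  let σ₁ : ℝ≥0 → ℝ≥0 := fun t => ⟨σ₀ t, hnn t⟩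
  have hm1 : StrictMono σ₁ := fun x y hxy => by
    rw [← NNReal.coe_lt_coe]
    exact hmono (by exact_mod_cast hxy)
  have hs1 : Function.Surjective σ₁ := by
    intro y
    have hc : 0 ≤ (S.card : ℝ) * κ := (abs_nonneg _).trans (hdist 0)
    have h1 : (y : ℝ) ≤ σ₀ (y + S.card * κ) := by
      have := neg_le_of_abs_le (hdist (y + S.card * κ))
      linarith
    obtain ⟨x, hx, hxy⟩ := intermediate_value_Icc (f := σ₀) (a := 0) (b := y + S.card * κ)
      (by positivity) hcont.continuousOn ⟨by rw [hzero]; exact y.coe_nonneg, h1⟩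
    exact ⟨⟨x, hx.1⟩, NNReal.coe_injective hxy⟩
  refine ⟨hm1.orderIsoOfSurjective σ₁ hs1, fun i hi => NNReal.coe_injective (hnode i hi), fun t => hdist t⟩

/-- Separated points have different values of `⌊s / δ⌋`. -/
theorem Separated.finite {δ : ℝ≥0} {N : Set ℝ≥0} (hN : Separated δ N) (hδ : 0 < δ) (b : ℝ≥0) :
    (N ∩ Iic b).Finite := by
  refine Set.Finite.of_injOn (f := fun s => ⌊s / δ⌋₊) (t := Iic ⌊b / δ⌋₊) ?_ ?_ (finite_Iic _)
  · intro s hs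
    exact Nat.floor_le_floor (by gcongr; exact hs.2)
  · have key : ∀ s ∈ N, ∀ s' ∈ N, s < s' → ⌊s / δ⌋₊ < ⌊s' / δ⌋₊ := by
      intro s hs s' hs' hss
      rw [Nat.lt_iff_add_one_le, Nat.le_floor_iff zero_le]
      push_cast
      calc (⌊s / δ⌋₊ : ℝ≥0) + 1 ≤ s / δ + 1 := by gcongr; exact Nat.floor_le zero_le
        _ = (s + δ) / δ := by rw [add_div, div_self hδ.ne']
        _ ≤ s' / δ := by gcongr; exact hN.2 s hs s' hs' hss
    intro s hs s' hs' he
    rcases lt_trichotomy s s' with hlt | heq | hlt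
    · exact absurd he (key s hs.1 s' hs'.1 hlt).ne
    · exact heq
    · exact absurd he (key s' hs'.1 s hs.1 hlt).ne'

/-- A reference time near `u`, with no intervening node, that stays away from every node and so
tolerates small changes of time. On a grid of mesh `w = δ/16`: if a node lies within `4w` to the
right of `u`, go three cells to the left, where separation excludes nodes over a length `12w`;
otherwise go two cells to the right. -/
theorem exists_grid_point {δ : ℝ≥0} {N : Set ℝ≥0} (hN : Separated δ N) (hδ : 0 < δ) {q : ℕ → ℝ≥0}
    (hq : ∀ j : ℕ, (j : ℝ) * (δ / 16) < q j ∧ (q j : ℝ) < (j + 1) * (δ / 16)) (u : ℝ≥0) :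
    ∃ j, |(q j : ℝ) - u| ≤ δ / 4 ∧ (∀ s ∈ N, ¬ (u < s ∧ s ≤ q j)) ∧ (∀ s ∈ N, ¬ (q j ≤ s ∧ s ≤ u)) ∧
      ∀ s ∈ N, (δ : ℝ) / 16 ≤ |(s : ℝ) - q j| := by
  have hδ' : (0 : ℝ) < δ := by exact_mod_cast hδ
  have hN1 : ∀ s ∈ N, (δ : ℝ) ≤ s := fun s hs => by exact_mod_cast hN.1 s hs
  have hN2 : ∀ s ∈ N, ∀ s' ∈ N, (s : ℝ) < s' → (s : ℝ) + δ ≤ s' := fun s hs s' hs' h => by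
    exact_mod_cast hN.2 s hs s' hs' (by exact_mod_cast h)
  set w : ℝ := δ / 16 with hw
  have hw0 : 0 < w := by positivity
  have hδw : (δ : ℝ) = 16 * w := by rw [hw]; ring
  set j := ⌊(u : ℝ) / w⌋₊ with hj
  have hj1 : (j : ℝ) * w ≤ u := by
    rw [← le_div_iff₀ hw0]; exact Nat.floor_le (by positivity)
  have hj2 : (u : ℝ) < (j + 1) * w := by
    rw [← div_lt_iff₀ hw0]; exact Nat.lt_floor_add_one _
  simp only [← NNReal.coe_lt_coe, ← NNReal.coe_le_coe]
  by_cases h : ∃ s ∈ N, (u : ℝ) < s ∧ (s : ℝ) < u + 4 * w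
  · obtain ⟨s, hs, hus, hsu⟩ := h
    have hj3 : 3 ≤ j := by
      have h1 := hN1 s hs
      have h2 : (3 : ℝ) * w < (j + 1) * w := by linarith
      have h3 : (3 : ℝ) < j + 1 := lt_of_mul_lt_mul_right h2 hw0.le
      have h4 : 3 < j + 1 := by exact_mod_cast h3
      omega
    obtain ⟨l, hl⟩ : ∃ l, j = l + 3 := ⟨j - 3, by omega⟩
    have hql := hq l
    rw [hl] at hj1 hj2
    push_cast at hj1 hj2
    have hleft : ∀ s' ∈ N, ¬ ((u : ℝ) - 12 * w ≤ s' ∧ (s' : ℝ) ≤ u) := fun s' hs' ⟨h1, h2⟩ => by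
      have := hN2 s' hs' s hs (by linarith)
      linarith
    refine ⟨l, ?_, ?_, ?_, ?_⟩
    · rw [abs_le]; constructor <;> nlinarith
    · intro s' hs' ⟨h1, h2⟩; nlinarith
    · intro s' hs' ⟨h1, h2⟩; exact hleft s' hs' ⟨by nlinarith, h2⟩
    · intro s' hs'
      rcases le_or_gt (s' : ℝ) u with h1 | h1
      · have h2 : (s' : ℝ) < u - 12 * w := by
          by_contra! hc
          exact hleft s' hs' ⟨hc, h1⟩
        rw [abs_sub_comm]
        exact le_trans (by nlinarith) (le_abs_self _)
      · exact le_trans (by nlinarith) (le_abs_self _)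
  · push Not at h
    have hql := hq (j + 2)
    push_cast at hql
    refine ⟨j + 2, ?_, ?_, ?_, ?_⟩
    · rw [abs_le]; constructor <;> nlinarith
    · intro s' hs' ⟨h1, h2⟩
      have := h s' hs' h1
      nlinarith
    · intro s' hs' ⟨h1, h2⟩; nlinarith
    · intro s' hs'
      rcases le_or_gt (s' : ℝ) u with h1 | h1
      · rw [abs_sub_comm]
        exact le_trans (by nlinarith) (le_abs_self _)
      · have := h s' hs' h1
        exact le_trans (by nlinarith) (le_abs_self _)

variable {X : Type*} [PseudoEMetricSpace X]

/-- Convergence along an ultrafilter in the sense of Skorokhod. -/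
theorem eventually_exists_orderIso {ι : Type*} {𝒰 : Ultrafilter ι} {D : Set ℝ≥0} (hD : Dense D)
    {k δ T : ℝ≥0} {η η' : ℝ≥0∞} (hδ : 0 < δ) (hδ1 : δ ≤ 1) (hT : T + 2 ≤ k) {f : ι → ℝ≥0 → X}
    {y g : ℝ≥0 → X} {N : ι → Set ℝ≥0} (hN : ∀ᶠ i in (𝒰 : Filter ι), Separated δ (N i))
    (hf : ∀ᶠ i in (𝒰 : Filter ι), Steady D k δ η (N i) (f i))
    (hfr : ∀ i t, Tendsto (f i) (𝓝[Ioi t ∩ D] t) (𝓝 (f i t)))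
    (hy : ∀ q ∈ D, Tendsto (fun i => f i q) (𝒰 : Filter ι) (𝓝 (y q)))
    (hg : ∀ t, Tendsto y (𝓝[Ioi t ∩ D] t) (𝓝 (g t))) {ε : ℝ} (hε : 0 < ε) (hη' : 0 < η') :
    ∀ᶠ i in (𝒰 : Filter ι), ∃ σ : ℝ≥0 ≃o ℝ≥0, (∀ t, |(σ t : ℝ) - t| < ε) ∧
      ∀ t ≤ T, edist (f i t) (g (σ t)) ≤ η + η' + η := by
  classical
  have hδ' : (0 : ℝ) < δ := by exact_mod_cast hδ
  have hδ1' : (δ : ℝ) ≤ 1 := by exact_mod_cast hδ1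
  have hT' : (T : ℝ) + 2 ≤ k := by exact_mod_cast hT
  set L := limitNodes 𝒰 N with hL
  have hLsep : Separated δ L := separated_limitNodes hN
  have hLst : Steady D k δ η L y := steady_limitNodes hy fun r hr t ht hrt htk htδ => by
    filter_upwards [hf] with i hi hs
    exact hi r hr t ht hrt htk htδ hs
  set S := (hLsep.finite hδ (T + 2)).toFinset with hS
  -- The nodes are matched with precision `κ`. The change of time then moves points by at most
  -- `S.card * κ < ε`, and even with a further `κ` by at most the safety distance `δ/16` of the grid
  -- points.
  set κ : ℝ := min ε (δ / 16) / (S.card + 1) with hκ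
  have hκ0 : 0 < κ := by positivity
  have hκ1 : (S.card + 1) * κ = min ε (δ / 16) := by rw [hκ]; field_simp
  have hκ2 : (S.card : ℝ) * κ < ε := by linarith [min_le_left ε ((δ : ℝ) / 16)]
  have hκ3 : (S.card : ℝ) * κ + κ ≤ δ / 16 := by linarith [min_le_right ε ((δ : ℝ) / 16)]
  have hκ5 : 0 ≤ (S.card : ℝ) * κ := by positivity
  have hgrid : ∀ j : ℕ, ∃ q ∈ D, (j : ℝ) * (δ / 16) < q ∧ (q : ℝ) < (j + 1) * (δ / 16) := by
    intro j
    have h1 : (j : ℝ≥0) * (δ / 16) < (j + 1) * (δ / 16) := by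
      have : 0 < δ / 16 := by positivity
      gcongr
      exact lt_add_one _
    obtain ⟨q, hq1, hq2⟩ := hD.exists_between h1
    exact ⟨q, hq1, by exact_mod_cast hq2.1, by exact_mod_cast hq2.2⟩
  choose q hqD hq using hgrid
  obtain ⟨J, hJ⟩ := exists_nat_ge (((T : ℝ) + 2) / (δ / 16))
  rw [div_le_iff₀ (by positivity)] at hJ
  have hnear : ∀ᶠ i in (𝒰 : Filter ι), ∀ s ∈ S, ∃ n ∈ N i, dist n s < κ :=
    (Filter.eventually_all_finset S).2 fun s hs => ((Set.Finite.mem_toFinset _).1 hs).1 κ hκ0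
  have hfar : ∀ᶠ i in (𝒰 : Filter ι), ∀ n ∈ N i, n ∉ Icc 0 (T + 2) \ ⋃ s ∈ S, Metric.ball s κ := by
    refine eventually_notMem_of_isCompact (isCompact_Icc.diff
      (isOpen_biUnion fun s _ => Metric.isOpen_ball)) fun s hs hsC => hsC.2 ?_
    exact mem_iUnion₂.2 ⟨s, (Set.Finite.mem_toFinset _).2 ⟨hs, hsC.1.2⟩, Metric.mem_ball_self hκ0⟩
  have hcl : ∀ᶠ i in (𝒰 : Filter ι), ∀ j ∈ Finset.range J, edist (f i (q j)) (y (q j)) ≤ η' :=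
    (Filter.eventually_all_finset _).2 fun j _ =>
      ((EMetric.tendsto_nhds.1 (hy (q j) (hqD j))) η' hη').mono fun i hi => hi.le
  filter_upwards [hN, hf, hnear, hfar, hcl] with i hNi hfi hnear hfar hcl
  choose! n hnN hns using hnear
  simp only [NNReal.dist_eq] at hns
  have hNi1 : ∀ s ∈ N i, (δ : ℝ) ≤ s := fun s hs => by exact_mod_cast hNi.1 s hs
  have hNi2 : ∀ s ∈ N i, ∀ s' ∈ N i, s < s' → (s : ℝ) + δ ≤ s' := fun s hs s' hs' h => by
    exact_mod_cast hNi.2 s hs s' hs' h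
  have hL2 : ∀ s ∈ S, ∀ s' ∈ S, s < s' → (s : ℝ) + δ ≤ s' := fun s hs s' hs' h => by
    exact_mod_cast hLsep.2 s ((Set.Finite.mem_toFinset _).1 hs).1 s' ((Set.Finite.mem_toFinset _).1 hs').1 h
  obtain ⟨σ, hσn, hσ⟩ := exists_orderIso S n id (ρ := δ / 4) (κ := κ) (by positivity) (by linarith)
    (fun s hs => by rw [abs_sub_comm]; exact (hns s hs).le)
    (fun s hs => by linarith [hNi1 _ (hnN s hs)]) (fun s hs s' hs' hne => by
      have h1 := abs_lt.1 (hns s hs)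
      have h2 := abs_lt.1 (hns s' hs')
      rcases lt_or_gt_of_ne hne with hlt | hlt
      · have h3 := hL2 s hs s' hs' hlt
        rw [abs_sub_comm]
        exact le_trans (by linarith [h1.1, h1.2, h2.1, h2.2]) (le_abs_self _)
      · have h3 := hL2 s' hs' s hs hlt
        exact le_trans (by linarith [h1.1, h1.2, h2.1, h2.2]) (le_abs_self _))
  -- Every node in this range is close to some limit node `s`. It must be the chosen partner `n s`,
  -- since two nodes within `2κ` of each other would contradict the separation.
  have hnode : ∀ m ∈ N i, m ≤ T + 2 → ∃ s ∈ L, σ m = s ∧ |(m : ℝ) - s| < κ := by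
    intro m hm hmT
    have h1 := hfar m hm
    simp only [Set.mem_sdiff, mem_Icc, zero_le, true_and, not_and, not_not] at h1
    obtain ⟨s, hs, hms⟩ := mem_iUnion₂.1 (h1 hmT)
    rw [Metric.mem_ball, NNReal.dist_eq] at hms
    have h2 : m = n s := by
      have h3 := abs_lt.1 hms
      have h4 := abs_lt.1 (hns s hs)
      rcases lt_trichotomy m (n s) with hlt | heq | hlt
      · have := hNi2 m hm (n s) (hnN s hs) hlt
        linarith [h3.1, h3.2, h4.1, h4.2]
      · exact heq
      · have := hNi2 (n s) (hnN s hs) m hm hlt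
        linarith [h3.1, h3.2, h4.1, h4.2]
    exact ⟨s, ((Set.Finite.mem_toFinset _).1 hs).1, by rw [h2]; exact hσn s hs, hms⟩
  refine ⟨σ, fun t => (hσ t).trans_lt hκ2, fun t ht => ?_⟩
  have ht' : (t : ℝ) ≤ T := by exact_mod_cast ht
  have hσt := abs_le.1 (hσ t)
  -- Both `f i t` and `g (σ t)` are compared with values at the common grid time `q j`, where the
  -- functions converge.
  obtain ⟨j, hj1, hj2, hj3, hj4⟩ := exists_grid_point hLsep hδ hq (σ t)
  have hj5 := abs_le.1 hj1
  have hjJ : j < J := by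
    have h1 : (j : ℝ) * (δ / 16) < J * (δ / 16) := by linarith [(hq j).1]
    exact_mod_cast lt_of_mul_lt_mul_right h1 (by positivity)
  have hqT : (q j : ℝ) < T + 2 := by linarith
  have hlt : ∀ {a b : ℝ≥0}, (a : ℝ) < b → a < b := fun h => by exact_mod_cast h
  have e1 : edist (y (q j)) (g (σ t)) ≤ η := by
    refine hLst.edist_right_le hD hLsep hδ (hg (σ t)) (hqD j) (hlt (by linarith)) (hlt (by linarith))
      (hlt ?_) (hlt ?_) hj2 hj3 <;> push_cast <;> linarith
  have e2 : edist (f i (q j)) (f i t) ≤ η := by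
    refine hfi.edist_right_le hD hNi hδ (hfr i t) (hqD j) (hlt (by linarith)) (hlt (by linarith))
      (hlt ?_) (hlt ?_) ?_ ?_
    · push_cast; linarith
    · push_cast; linarith
    · rintro m hm ⟨h1, h2⟩
      obtain ⟨s, hs, hms, hms'⟩ := hnode m hm (h2.trans (by exact_mod_cast hqT.le))
      have h3 : σ t < s := by rw [← hms]; exact σ.strictMono h1
      -- Otherwise `m ≤ q j < s` with `m` within `κ < δ/16` of `s`, although `q j` keeps the
      -- distance `δ/16` from limit nodes.
      have h4 : s ≤ q j := by
        by_contra! hc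
        have h5 := hj4 s hs
        have hc' : (q j : ℝ) < s := by exact_mod_cast hc
        have h2' : (m : ℝ) ≤ q j := by exact_mod_cast h2
        rw [abs_of_pos (by linarith)] at h5
        linarith [(abs_lt.1 hms').1]
      exact hj2 s hs ⟨h3, h4⟩
    · rintro m hm ⟨h1, h2⟩
      obtain ⟨s, hs, hms, hms'⟩ := hnode m hm (h2.trans (ht.trans le_self_add))
      have h3 : s ≤ σ t := by rw [← hms]; exact σ.monotone h2
      have h4 : q j ≤ s := by
        by_contra! hc
        have h5 := hj4 s hs
        have hc' : (s : ℝ) < q j := by exact_mod_cast hc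
        have h1' : (q j : ℝ) ≤ m := by exact_mod_cast h1
        rw [abs_of_neg (by linarith)] at h5
        linarith [(abs_lt.1 hms').2]
      exact hj3 s hs ⟨h4, h3⟩
  calc edist (f i t) (g (σ t)) ≤ edist (f i t) (f i (q j)) + edist (f i (q j)) (y (q j)) + edist (y (q j)) (g (σ t)) :=
        edist_triangle4 _ _ _ _
    _ ≤ η + η' + η := by
        gcongr
        · rwa [edist_comm]
        · exact hcl j (Finset.mem_range.2 hjJ)

end PathRegularity

/-! ### Compact sets of cadlag paths and the paths of the jump process. -/

namespace Kawasaki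

variable {d : ℕ}

namespace CadlagPath

open PathRegularity

/-! ### Compact sets of paths -/

theorem measurable_eval (t : ℝ≥0) : Measurable fun ω : CadlagPath d => ω.toFun t :=
  (comap_measurable _).mono (le_iSup (fun t : ℝ≥0 => MeasurableSpace.comap
    (fun ω : CadlagPath d => ω.toFun t) inferInstance) t) le_rfl

/-- Paths of controlled regularity. -/
def regular (D : Set ℝ≥0) (K : ℕ → Set (Tempered d)) (δ : ℕ → ℝ≥0) (η : ℕ → ℝ≥0∞) :
    Set (CadlagPath d) :=
  {ω | (∀ q ∈ D, ω.toFun q ∈ K ⌊q⌋₊) ∧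
    ∀ k : ℕ, ∃ N, Separated (δ k) N ∧ Steady D k (δ k) (η k) N ω.toFun}

theorem mem_nbhd_of {ω ω' : CadlagPath d} {T : ℝ≥0} {ε : ℝ≥0∞} {e : ℝ≥0} (he : (e : ℝ≥0∞) < ε)
    (h : ∃ σ : ℝ≥0 ≃o ℝ≥0, (∀ t, |(σ t : ℝ) - t| < e) ∧
      ∀ t ≤ T, edist (ω'.toFun t) (ω.toFun (σ t)) < ε) : ω' ∈ ω.nbhd T ε := by
  obtain ⟨σ, h1, h2⟩ := h
  refine ⟨σ, fun t ht => ⟨?_, h2 t ht⟩⟩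
  rw [edist_dist, NNReal.dist_eq]
  refine lt_of_le_of_lt (ENNReal.ofReal_le_ofReal (h1 t).le) ?_
  rwa [ENNReal.ofReal_coe_nnreal]

/-- For an ultrafilter on the set, the values at times in `D` converge by compactness of `K`, and
the nodes converge to separated nodes that keep the limit steady. Its right-continuous modification
is again regular and is the limit in the Skorokhod topology by `eventually_exists_orderIso`. -/
theorem isCompact_regular {D : Set ℝ≥0} (hD : Dense D) {K : ℕ → Set (Tempered d)}
    (hK : ∀ j, IsCompact (K j)) {δ : ℕ → ℝ≥0} {η : ℕ → ℝ≥0∞} (hδ : ∀ k, 0 < δ k) (hδ1 : ∀ k, δ k ≤ 1)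
    (hη : ∀ ε > 0, ∀ T : ℝ≥0, ∃ k : ℕ, T < k ∧ η k < ε) : IsCompact (regular D K δ η) := by
  classical
  rw [isCompact_iff_ultrafilter_le_nhds]
  intro 𝒰 h𝒰
  have hreg : ∀ᶠ ω in (𝒰 : Filter (CadlagPath d)), ω ∈ regular D K δ η := le_principal_iff.1 h𝒰
  have h1 : ∀ q, ∃ z, q ∈ D → z ∈ K ⌊q⌋₊ ∧
      Tendsto (fun ω : CadlagPath d => ω.toFun q) (𝒰 : Filter (CadlagPath d)) (𝓝 z) := by
    intro q
    by_cases hq : q ∈ D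
    · obtain ⟨z, hz, hz'⟩ := (isCompact_iff_ultrafilter_le_nhds.1 (hK ⌊q⌋₊))
        (𝒰.map fun ω : CadlagPath d => ω.toFun q)
        (le_principal_iff.2 (hreg.mono fun ω hω => hω.1 q hq))
      exact ⟨z, fun _ => ⟨hz, hz'⟩⟩
    · exact ⟨(𝒰.nonempty_of_mem (le_principal_iff.1 h𝒰)).some.toFun 0, fun h => absurd h hq⟩
  choose y hy using h1
  have h2 : ∀ (k : ℕ) (ω : CadlagPath d), ∃ N, ω ∈ regular D K δ η →
      Separated (δ k) N ∧ Steady D k (δ k) (η k) N ω.toFun := by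
    intro k ω
    by_cases hω : ω ∈ regular D K δ η
    · obtain ⟨N, hN⟩ := hω.2 k
      exact ⟨N, fun _ => hN⟩
    · exact ⟨∅, fun h => absurd h hω⟩
  choose N hN using h2
  have hsep : ∀ k, Separated (δ k) (limitNodes 𝒰 (N k)) := fun k =>
    separated_limitNodes (hreg.mono fun ω hω => (hN k ω hω).1)
  have hst : ∀ k : ℕ, Steady D k (δ k) (η k) (limitNodes 𝒰 (N k)) y := fun k =>
    steady_limitNodes (f := fun ω : CadlagPath d => ω.toFun) (fun q hq => (hy q hq).2)
      fun r hr t ht hrt htk htδ => hreg.mono fun ω hω => (hN k ω hω).2 r hr t ht hrt htk htδ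
  obtain ⟨g, hgK, hg, hgr, hgl⟩ := exists_cadlag hD hK (fun q hq => (hy q hq).1) hδ hη hsep hst
  refine ⟨⟨g, hgr, hgl⟩, ⟨fun q _ => hgK q, fun k => ⟨_, hsep k, ?_⟩⟩, ?_⟩
  · intro r _ t _ hrt htk htδ hs
    exact (hst k).edist_right_right_le hD (hsep k) (hδ k) (hg r) (hg t) hrt htk htδ
      fun s hsN hsrt => hs s hsN ⟨hsrt.1.le, hsrt.2⟩
  · rw [le_nhds_iff]
    intro U hU hUo
    obtain ⟨T, ε, hε, hTU⟩ := hUo _ hU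
    refine mem_of_superset ?_ hTU
    obtain ⟨e, he0, he⟩ := ENNReal.lt_iff_exists_nnreal_btwn.1 hε
    have he0' : 0 < e := by exact_mod_cast he0
    have he3 : (0 : ℝ≥0∞) < ((e / 3 : ℝ≥0) : ℝ≥0∞) := by
      have : 0 < e / 3 := by positivity
      exact_mod_cast this
    obtain ⟨k, hk, hkη⟩ := hη _ he3 (T + 2)
    have := eventually_exists_orderIso (f := fun ω : CadlagPath d => ω.toFun) (g := g) (ε := e)
      hD (hδ k) (hδ1 k) hk.le (hreg.mono fun ω hω => (hN k ω hω).1)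
      (hreg.mono fun ω hω => (hN k ω hω).2)
      (fun ω t => ((ω.rightContinuous t).mono_left (nhdsWithin_mono t fun s hs => (mem_Ioi.1 hs.1).le)))
      (fun q hq => (hy q hq).2) hg (by exact_mod_cast he0') he3
    filter_upwards [this] with ω ⟨σ, h1, h2⟩
    refine mem_nbhd_of he ⟨σ, h1, fun t ht => (h2 t ht).trans_lt (lt_of_le_of_lt ?_ he)⟩
    refine (add_le_add (add_le_add hkη.le le_rfl) hkη.le).trans (le_of_eq ?_)
    norm_cast
    rw [← NNReal.coe_inj]
    push_cast
    ring

/-- The uncountable quantifier over node sets matters only through the subset of the finite set `P`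
that a node set constrains, so the event is a finite union. -/
theorem measurableSet_exists_forall_mem {Z ι κ : Type*} [MeasurableSpace Z] (P : Finset ι)
    {E : ι → Set Z} (hE : ∀ p, MeasurableSet (E p)) (b : κ → Prop) (c : κ → ι → Prop) :
    MeasurableSet {z | ∃ N, b N ∧ ∀ p ∈ P, c N p → z ∈ E p} := by
  classical
  have e : {z | ∃ N, b N ∧ ∀ p ∈ P, c N p → z ∈ E p}
      = ⋃ B ∈ P.powerset.filter (fun B => ∃ N, b N ∧ ∀ p ∈ P, c N p → p ∈ B), ⋂ p ∈ B, E p := by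
    ext z
    simp only [mem_ofPred_eq, mem_iUnion, mem_iInter, Finset.mem_filter, Finset.mem_powerset]
    constructor
    · rintro ⟨N, hN, h⟩
      refine ⟨P.filter (c N), ⟨Finset.filter_subset _ _, N, hN, fun p hp hcp =>
        Finset.mem_filter.2 ⟨hp, hcp⟩⟩, fun p hp => ?_⟩
      obtain ⟨hpP, hcp⟩ := Finset.mem_filter.1 hp
      exact h p hpP hcp
    · rintro ⟨B, ⟨-, N, hN, hB⟩, h⟩
      exact ⟨N, hN, fun p hp hcp => h p (hB p hp hcp)⟩
  rw [e]
  exact Finset.measurableSet_biUnion _ fun B _ => Finset.measurableSet_biInter _ fun p _ => hE p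

theorem measurable_edist_comp {Z : Type*} [MeasurableSpace Z] {f g : Z → Tempered d}
    (hf : Measurable f) (hg : Measurable g) : Measurable fun z => edist (f z) (g z) := by
  have h : Measurable fun z => (f z, g z) := hf.prodMk hg
  have h2 := Measurable.comp (g := fun q : Tempered d × Tempered d => edist q.1 q.2)
    Tempered.measurable_edist h
  exact h2

theorem measurableSet_edist_eval (r t : ℝ≥0) (η : ℝ≥0∞) :
    MeasurableSet {ω : CadlagPath d | edist (ω.toFun r) (ω.toFun t) ≤ η} :=
  measurableSet_le (measurable_edist_comp (measurable_eval r) (measurable_eval t)) measurable_const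

theorem measurableSet_steady (D : Set ℝ≥0) (A : Finset D) (k δ : ℝ≥0) (η : ℝ≥0∞) :
    MeasurableSet {ω : CadlagPath d | ∃ N, Separated δ N ∧
      Steady (Subtype.val '' (A : Set D)) k δ η N ω.toFun} := by
  have h := measurableSet_exists_forall_mem (A ×ˢ A)
    (E := fun p => {ω : CadlagPath d | edist (ω.toFun p.1.1) (ω.toFun p.2.1) ≤ η})
    (fun p => measurableSet_edist_eval p.1.1 p.2.1 η)
    (Separated δ) (fun N p => p.1.1 < p.2.1 ∧ p.2.1 < k ∧ p.2.1 < p.1.1 + δ ∧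
      ∀ s ∈ N, ¬ (p.1.1 ≤ s ∧ s ≤ p.2.1))
  convert h using 5 with ω N
  refine and_congr_right fun _ => ?_
  constructor
  · intro hst p hp hc
    obtain ⟨hp1, hp2⟩ := Finset.mem_product.1 hp
    exact hst _ (mem_image_of_mem _ hp1) _ (mem_image_of_mem _ hp2) hc.1 hc.2.1 hc.2.2.1 hc.2.2.2
  · intro h r hr t ht h1 h2 h3 h4
    obtain ⟨r, hr, rfl⟩ := hr
    obtain ⟨t, ht, rfl⟩ := ht
    exact h (r, t) (Finset.mem_product.2 ⟨hr, ht⟩) ⟨h1, h2, h3, h4⟩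

/-- By `exists_nodes`, existence of nodes for `D` is equivalent to their existence for each finite
subset, and a countable set has only countably many of these. -/
theorem measurableSet_regular {D : Set ℝ≥0} (hD : D.Countable) {K : ℕ → Set (Tempered d)}
    (hK : ∀ j, MeasurableSet (K j)) (δ : ℕ → ℝ≥0) (η : ℕ → ℝ≥0∞) :
    MeasurableSet (regular D K δ η) := by
  have := hD.to_subtype
  have e : regular D K δ η = (⋂ q ∈ D, {ω | ω.toFun q ∈ K ⌊q⌋₊}) ∩ ⋂ k : ℕ, ⋂ A : Finset D,
      {ω | ∃ N, Separated (δ k) N ∧ Steady (Subtype.val '' (A : Set D)) k (δ k) (η k) N ω.toFun} := by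
    ext ω
    simp only [regular, mem_inter_iff, mem_iInter, mem_ofPred_eq]
    refine and_congr_right fun _ => forall_congr' fun k => ⟨?_, exists_nodes⟩
    rintro ⟨N, hN, hst⟩ A
    refine ⟨N, hN, hst.mono ?_⟩
    rintro _ ⟨q, -, rfl⟩
    exact q.2
  rw [e]
  exact (MeasurableSet.biInter hD fun q _ => measurable_eval q (hK _)).inter
    (MeasurableSet.iInter fun k => MeasurableSet.iInter fun A => measurableSet_steady D A k (δ k) (η k))

/-! ### The paths of the jump process -/

open JumpPath

theorem val_eq {x : Tempered d} {ω : ℕ → ℝ≥0 × Tempered d} {n : ℕ} {t : ℝ≥0} (h1 : T ω n ≤ t)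
    (h2 : t < T ω (n + 1)) : val x ω t = st x ω n := by
  rw [val, idx_eq h1 h2]

open scoped Classical in
/-- The cadlag path of a sequence of jumps. -/
def ofJumps (x : Tempered d) (ω : ℕ → ℝ≥0 × Tempered d) : CadlagPath d :=
  if hω : ω ∈ NE then
    { toFun := val x ω
      rightContinuous := fun t => by
        have h2 := lt_T_idx hω t
        refine (continuousWithinAt_const (b := val x ω t)).congr_of_eventuallyEq ?_ rfl
        filter_upwards [self_mem_nhdsWithin, mem_nhdsWithin_of_mem_nhds (Iio_mem_nhds h2)] with s hs hs'
        rw [val_eq ((T_idx_le ω t).trans hs) hs', val]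
      leftLimits := fun t => by
        rcases eq_or_ne t 0 with rfl | ht
        · exact ⟨x, by simp⟩
        -- The first jump time not before `t`: on the interval preceding it the path is constant,
        -- which gives the left limit even if a jump occurs at `t`.
        have hex : ∃ n, t ≤ T ω n := ⟨_, (lt_T_idx hω t).le⟩
        have hn := Nat.find_spec hex
        obtain ⟨m, hm⟩ : ∃ m, Nat.find hex = m + 1 := by
          refine Nat.exists_eq_succ_of_ne_zero fun h0 => ?_
          rw [h0, T_zero] at hn
          exact ht (le_antisymm hn zero_le)
        have hlt : T ω m < t := not_le.1 (Nat.find_min hex (by omega))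
        rw [hm] at hn
        refine ⟨st x ω m, tendsto_const_nhds.congr' ?_⟩
        filter_upwards [Ioo_mem_nhdsLT hlt] with s hs
        exact (val_eq hs.1.le (hs.2.trans_le hn)).symm }
  else
    { toFun := fun _ => x
      rightContinuous := fun _ => continuousWithinAt_const
      leftLimits := fun _ => ⟨x, tendsto_const_nhds⟩ }

theorem ofJumps_toFun {x : Tempered d} {ω : ℕ → ℝ≥0 × Tempered d} (hω : ω ∈ NE) :
    (ofJumps x ω).toFun = val x ω := by
  rw [ofJumps, dif_pos hω]

theorem measurable_of_eval {Z : Type*} [MeasurableSpace Z] {g : Z → CadlagPath d}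
    (h : ∀ t, Measurable fun z => (g z).toFun t) : Measurable g := by
  refine measurable_iff_comap_le.2 ?_
  change MeasurableSpace.comap g (⨆ t : ℝ≥0,
    MeasurableSpace.comap (fun ω : CadlagPath d => ω.toFun t) inferInstance) ≤ _
  rw [MeasurableSpace.comap_iSup]
  refine iSup_le fun t => ?_
  rw [MeasurableSpace.comap_comp]
  exact measurable_iff_comap_le.1 (h t)

theorem measurable_ofJumps :
    Measurable fun q : Tempered d × (ℕ → ℝ≥0 × Tempered d) => ofJumps q.1 q.2 := by
  classical
  refine measurable_of_eval fun t => ?_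
  have e : (fun q : Tempered d × (ℕ → ℝ≥0 × Tempered d) => (ofJumps q.1 q.2).toFun t)
      = fun q => if q.2 ∈ NE then val q.1 q.2 t else q.1 := by
    funext q
    by_cases h : q.2 ∈ NE
    · simp [ofJumps, h]
    · simp [ofJumps, h]
  rw [e]
  refine Measurable.ite (measurable_snd measurableSet_NE) ?_ measurable_fst
  exact measurable_val.comp (f := fun q : Tempered d × (ℕ → ℝ≥0 × Tempered d) => (q, t)) (by fun_prop)

end CadlagPath

end Kawasaki

namespace JumpData

open JumpPath

variable {X : Type*} [MeasurableSpace X] (D : JumpData X) (μ : Measure X) [SFinite μ]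

/-! ### Path functionals under a general initial law -/

theorem compProd_exceed_le {F : X → ℝ≥0∞} (hF : Measurable F) {c : ℝ} (hc : 0 ≤ c)
    (h : ∀ x, ENNReal.ofReal (D.rate x) * ∫⁻ y, F y ∂D.K x ≤ ENNReal.ofReal (D.rate x + c) * F x)
    {R : ℝ≥0} (hR : 0 < R) (t : ℝ≥0) :
    (μ ⊗ₘ D.law) {q | ∃ n, T q.2 n ≤ t ∧ R < F (st q.1 q.2 n)}
      ≤ ENNReal.ofReal (Real.exp (c * t)) * (∫⁻ x, F x ∂μ) / R := by
  have hm : MeasurableSet {q : X × (ℕ → ℝ≥0 × X) | ∃ n, T q.2 n ≤ t ∧ R < F (st q.1 q.2 n)} := by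
    have e : {q : X × (ℕ → ℝ≥0 × X) | ∃ n, T q.2 n ≤ t ∧ R < F (st q.1 q.2 n)}
        = ⋃ n, (fun q : X × (ℕ → ℝ≥0 × X) => (((t, q.1), q.2) : (ℝ≥0 × X) × (ℕ → ℝ≥0 × X))) ⁻¹'
          {q | T q.2 n ≤ q.1.1 ∧ R < F (st q.1.2 q.2 n)} := by
      ext q
      simp only [mem_ofPred_eq, mem_iUnion, mem_preimage]
    rw [e]
    have hp : Measurable fun q : X × (ℕ → ℝ≥0 × X) => (((t, q.1), q.2) : (ℝ≥0 × X) × (ℕ → ℝ≥0 × X)) := by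
      fun_prop
    exact MeasurableSet.iUnion fun n => hp (measurableSet_exceed hF R n)
  rw [ENNReal.le_div_iff_mul_le (by simp [hR.ne']) (by simp), mul_comm, Measure.compProd_apply hm,
    ← lintegral_const_mul _ (Kernel.measurable_kernel_prodMk_left hm), ← lintegral_const_mul _ hF]
  exact lintegral_mono fun x => D.mul_law_exceed_le hF hc h R t x

theorem meas_lt_le_lintegral_div {Z : Type*} [MeasurableSpace Z] {ν : Measure Z} {f : Z → ℝ≥0∞}
    (hf : Measurable f) {c : ℝ≥0∞} (hc : c ≠ 0) (hc' : c ≠ ∞) : ν {z | c < f z} ≤ (∫⁻ z, f z ∂ν) / c :=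
  le_trans (measure_mono fun z (hz : c < f z) => hz.le) (meas_ge_le_lintegral_div hf.aemeasurable hc hc')

variable [PseudoEMetricSpace X]

theorem compProd_variation_le (hd : Measurable fun q : X × X => edist q.1 q.2) {W : X → ℝ}
    (hW : Measurable W) (hW0 : ∀ x, 0 ≤ W x) {c κ : ℝ} (hc : 0 ≤ c) (hκ : 0 ≤ κ)
    (h1 : ∀ x, ENNReal.ofReal (D.rate x) * ∫⁻ y, edist x y ∂D.K x ≤ ENNReal.ofReal (κ * W x))
    (h2 : ∀ x, ENNReal.ofReal (D.rate x) * ∫⁻ y, ENNReal.ofReal (W y) ∂D.K x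
      ≤ ENNReal.ofReal ((D.rate x + c) * W x)) (ρ : ℝ≥0) {η : ℝ≥0} (hη : 0 < η) :
    (μ ⊗ₘ D.law) {q | η < variation q.1 q.2 ρ}
      ≤ ENNReal.ofReal (κ * ρ * Real.exp (c * ρ)) * (∫⁻ x, ENNReal.ofReal (W x) ∂μ) / η := by
  have hp : Measurable fun q : X × (ℕ → ℝ≥0 × X) => (((ρ, q.1), q.2) : (ℝ≥0 × X) × (ℕ → ℝ≥0 × X)) := by
    fun_prop
  have hm : Measurable fun q : X × (ℕ → ℝ≥0 × X) => variation q.1 q.2 ρ := (measurable_variation hd).comp hp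
  refine (meas_lt_le_lintegral_div hm (by simp [hη.ne']) (by simp)).trans ?_
  refine ENNReal.div_le_div_right ?_ _
  rw [Measure.lintegral_compProd hm, ← lintegral_const_mul _ hW.ennreal_ofReal]
  refine lintegral_mono fun x => (D.lintegral_variation_le hd hW hW0 hc hκ h1 h2 ρ x).trans (le_of_eq ?_)
  rw [ENNReal.ofReal_mul (by positivity)]

/-- The Markov property at `τ` reduces to windows starting at `0`; there the expected pair sum is
bounded by `W₂`, whose mean grows by at most `e^{cτ}`. Markov's inequality concludes. -/
theorem compProd_pairs_le (hd : Measurable fun q : X × X => edist q.1 q.2) {W W₂ : X → ℝ}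
    (hW : Measurable W) (hW0 : ∀ x, 0 ≤ W x) (hW₂ : Measurable W₂) (hW₂0 : ∀ x, 0 ≤ W₂ x)
    {c κ : ℝ} (hc : 0 ≤ c) (hκ : 0 ≤ κ)
    (h1 : ∀ x, ENNReal.ofReal (D.rate x) * ∫⁻ y, edist x y ∂D.K x ≤ ENNReal.ofReal (κ * W x))
    (h2 : ∀ x, ENNReal.ofReal (D.rate x) * ∫⁻ y, ENNReal.ofReal (W y) ∂D.K x
      ≤ ENNReal.ofReal ((D.rate x + c) * W x))
    (h3 : ∀ x, ENNReal.ofReal (D.rate x) * ∫⁻ y, edist x y * ENNReal.ofReal (W y) ∂D.K x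
      ≤ ENNReal.ofReal (κ * W₂ x))
    (h4 : ∀ x, ENNReal.ofReal (D.rate x) * ∫⁻ y, ENNReal.ofReal (W₂ y) ∂D.K x
      ≤ ENNReal.ofReal ((D.rate x + c) * W₂ x)) (τ ρ : ℝ≥0) {η : ℝ≥0} (hη : 0 < η) :
    (μ ⊗ₘ D.law) {q | (η : ℝ≥0∞) ^ 2 < pairs (val q.1 q.2 τ) (shift q.2 τ) ρ}
      ≤ ENNReal.ofReal (κ ^ 2 * ρ ^ 2 * Real.exp (c * ρ)) *
        (ENNReal.ofReal (Real.exp (c * τ)) * (∫⁻ x, ENNReal.ofReal (W₂ x) ∂μ)) / (η : ℝ≥0∞) ^ 2 := by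
  have hp : Measurable fun q : X × (ℕ → ℝ≥0 × X) => (((ρ, q.1), q.2) : (ℝ≥0 × X) × (ℕ → ℝ≥0 × X)) := by
    fun_prop
  have hm : Measurable fun q : X × (ℕ → ℝ≥0 × X) => pairs q.1 q.2 ρ := (measurable_pairs hd).comp hp
  have hv : Measurable fun q : X × (ℕ → ℝ≥0 × X) => val q.1 q.2 τ :=
    measurable_val.comp (f := fun q : X × (ℕ → ℝ≥0 × X) => (q, τ)) (by fun_prop)
  have hs : Measurable fun q : X × (ℕ → ℝ≥0 × X) => shift q.2 τ :=
    measurable_shift.comp (f := fun q : X × (ℕ → ℝ≥0 × X) => (q.2, τ)) (by fun_prop)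
  have hvs : Measurable fun q : X × (ℕ → ℝ≥0 × X) => (val q.1 q.2 τ, shift q.2 τ) := hv.prodMk hs
  have hm' := Measurable.comp (g := fun q : X × (ℕ → ℝ≥0 × X) => pairs q.1 q.2 ρ) hm hvs
  simp only [Function.comp_def] at hm'
  have hW₂' := hW₂.ennreal_ofReal
  refine (meas_lt_le_lintegral_div hm' (by simp [hη.ne']) (by simp)).trans ?_
  refine ENNReal.div_le_div_right ?_ _
  rw [Measure.lintegral_compProd hm', ← lintegral_const_mul _ hW₂',
    ← lintegral_const_mul _ (hW₂'.const_mul _)]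
  refine lintegral_mono fun x => ?_
  have e := D.lintegral_markov (fun q => pairs q.1 q.2 ρ) hm τ x
  dsimp only at e ⊢
  rw [e]
  calc ∫⁻ y, ∫⁻ ω, pairs y ω ρ ∂D.law y ∂D.p τ x
      ≤ ∫⁻ y, ENNReal.ofReal (κ ^ 2 * ρ ^ 2 * Real.exp (c * ρ)) * ENNReal.ofReal (W₂ y) ∂D.p τ x := by
        refine lintegral_mono fun y =>
          (D.lintegral_pairs_le hd hW hW0 hW₂ hW₂0 hc hκ h1 h2 h3 h4 ρ y).trans (le_of_eq ?_)
        rw [ENNReal.ofReal_mul (by positivity)]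
    _ ≤ _ := by
        rw [lintegral_const_mul _ hW₂']
        gcongr
        refine D.lintegral_p_exp_le hW₂' hc (fun x => (h4 x).trans (le_of_eq ?_)) τ x
        rw [ENNReal.ofReal_mul (by linarith [D.rate_pos x])]

end JumpData

namespace Kawasaki

variable {d : ℕ}

namespace CadlagPath

open JumpPath

/-! ### Finite-dimensional distributions -/

theorem measurableSet_cylinder (l : List (ℝ≥0 × Set (Tempered d))) :
    ∀ s, (∀ q ∈ l, MeasurableSet q.2) → MeasurableSet (cylinder s l) := by
  induction l with
  | nil => intro s _; exact MeasurableSet.univ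
  | cons q l ih =>
    intro s hl
    obtain ⟨h, A⟩ := q
    exact (measurable_eval (s + h) (hl (h, A) (by simp))).inter
      (ih _ fun q hq => hl q (List.mem_cons_of_mem _ hq))

theorem mem_cylinder_shift {ω ω' : CadlagPath d} {h : ℝ≥0} (hω : ∀ s, ω'.toFun s = ω.toFun (h + s))
    (l : List (ℝ≥0 × Set (Tempered d))) : ∀ u, ω ∈ cylinder (h + u) l ↔ ω' ∈ cylinder u l := by
  induction l with
  | nil => intro u; exact Iff.rfl
  | cons q l ih =>
    intro u
    obtain ⟨v, A⟩ := q
    simp only [cylinder, mem_inter_iff, mem_ofPred_eq, hω, add_assoc, ih]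

/-- The law of the paths of the jump process with the initial distribution `μ`. -/
def jumpLaw (J : JumpData (Tempered d)) (μ : Measure (Tempered d)) : Measure (CadlagPath d) :=
  (μ ⊗ₘ J.law).map fun q => ofJumps q.1 q.2

/-- Induction on the list: the Markov property at the first time leaves a cylinder event for the
shifted path. -/
theorem law_cylinder (J : JumpData (Tempered d)) (l : List (ℝ≥0 × Set (Tempered d)))
    (hl : ∀ q ∈ l, MeasurableSet q.2) :
    ∀ γ, J.law γ {ω | ofJumps γ ω ∈ cylinder 0 l} = cylinderMass J.p l γ := by
  induction l with
  | nil => intro γ; simp [cylinder, cylinderMass]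
  | cons q l ih =>
    intro γ
    obtain ⟨h, A⟩ := q
    have hA : MeasurableSet A := hl (h, A) (by simp)
    have ih := ih fun q hq => hl q (by simp [hq])
    have hC : MeasurableSet {q : Tempered d × (ℕ → ℝ≥0 × Tempered d) |
        q.1 ∈ A ∧ ofJumps q.1 q.2 ∈ cylinder 0 l} :=
      (measurable_fst hA).inter (measurable_ofJumps (measurableSet_cylinder l 0
        fun q hq => hl q (by simp [hq])))
    have hae : ({ω | ofJumps γ ω ∈ cylinder 0 ((h, A) :: l)} : Set (ℕ → ℝ≥0 × Tempered d))
        =ᵐ[J.law γ] {ω | (val γ ω h, shift ω h) ∈ {q : Tempered d × (ℕ → ℝ≥0 × Tempered d) |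
          q.1 ∈ A ∧ ofJumps q.1 q.2 ∈ cylinder 0 l}} := by
      filter_upwards [J.ae_NE γ] with ω hω
      refine propext ?_
      change ofJumps γ ω ∈ cylinder 0 ((h, A) :: l) ↔ val γ ω h ∈ A ∧ ofJumps (val γ ω h) (shift ω h) ∈ cylinder 0 l
      rw [← mem_cylinder_shift (ω := ofJumps γ ω) (ω' := ofJumps (val γ ω h) (shift ω h)) (h := h)
        (fun s => by rw [ofJumps_toFun hω, ofJumps_toFun (shift_mem_NE hω h), val_shift γ hω]) l 0, add_zero]
      simp only [cylinder, zero_add, mem_inter_iff, mem_ofPred_eq, ofJumps_toFun hω]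
    rw [measure_congr hae]
    have hms : MeasurableSet {ω | (val γ ω h, shift ω h) ∈ {q : Tempered d × (ℕ → ℝ≥0 × Tempered d) |
          q.1 ∈ A ∧ ofJumps q.1 q.2 ∈ cylinder 0 l}} :=
      ((JumpData.measurable_val_at γ h).prodMk (JumpData.measurable_shift_at h)) hC
    have e := J.lintegral_markov _ (measurable_one.indicator hC) h γ
    rw [← lintegral_indicator_one hms]
    refine Eq.trans ?_ (e.trans ?_)
    · rfl
    · rw [cylinderMass, ← lintegral_indicator hA]
      refine lintegral_congr fun y => ?_
      by_cases hy : y ∈ A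
      · rw [indicator_of_mem hy, ← ih y]
        have hmy : MeasurableSet {ω | ofJumps y ω ∈ cylinder 0 l} :=
          (measurable_ofJumps.comp measurable_prodMk_left) (measurableSet_cylinder l 0
            fun q hq => hl q (by simp [hq]))
        rw [← lintegral_indicator_one hmy]
        refine lintegral_congr fun ω => ?_
        by_cases hω : ofJumps y ω ∈ cylinder 0 l <;> simp [hy, hω]
      · rw [indicator_of_notMem hy]
        simp [hy]

theorem isPathMeasure_jumpLaw (J : JumpData (Tempered d)) (μ : Measure (Tempered d))
    [IsProbabilityMeasure μ] : IsPathMeasure J.p μ (jumpLaw J μ) where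
  isProbabilityMeasure := Measure.isProbabilityMeasure_map measurable_ofJumps.aemeasurable
  finiteDimensional l hl := by
    have hC := measurableSet_cylinder l 0 hl
    rw [jumpLaw, Measure.map_apply measurable_ofJumps hC, Measure.compProd_apply (measurable_ofJumps hC)]
    exact lintegral_congr fun γ => law_cylinder J l hl γ

end CadlagPath

end Kawasaki

/-! ### Tightness of the laws on path space. -/

namespace Kawasaki

variable {d : ℕ}

namespace CadlagPath

open JumpPath PathRegularity Tempered

variable {a φ : Pt d → ℝ}

/-! ### Tightness of the laws of the paths -/

/-- The variation event has probability at most `A₁ δ` and each of the `k n = k / δ` windows at most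
`A₂ δ²`, in total `(A₁ + k A₂) δ`. The constants do not involve `α`. -/
theorem exists_mesh (hm : IsJumpModel a φ) {μ : Measure (Configuration d)} (hμ : IsSubPoissonian μ)
    (k : ℕ) {η : ℝ≥0} (hη : 0 < η) {e : ℝ≥0∞} (he : 0 < e) :
    ∃ δ : ℝ≥0, 0 < δ ∧ δ ≤ 1 ∧ ∃ M : ℕ, (k : ℝ≥0) ≤ M * δ ∧ ∀ α (hα : α ∈ Ioc (0 : ℝ) 1),
      (lawOn μ ⊗ₘ (jumpData hm hα).law) {q | η < variation q.1 q.2 δ ∨ ∃ j < M,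
        (η : ℝ≥0∞) ^ 2 < pairs (val q.1 q.2 (j * δ)) (shift q.2 (j * δ)) (3 * δ)} ≤ e := by
  have := hμ.isProbabilityMeasure_lawOn
  have hκ := kap_nonneg hm
  set B : ℝ≥0∞ := ∫⁻ γ, ENNReal.ofReal (lyap₂ a γ) ∂lawOn μ with hB
  have hBt : B ≠ ∞ := (hμ.lintegral_lyap₂ hm).ne
  set A₁ : ℝ≥0∞ := ENNReal.ofReal (kap a * Real.exp 2) * B / η with hA₁
  -- The `9` is the square of the window length in units of `δ`; the exponent collects `2 · 3δ ≤ 6`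
  -- for the window and `2jδ ≤ 2k` for its starting time.
  set A₂ : ℝ≥0∞ := ENNReal.ofReal (9 * kap a ^ 2 * Real.exp (6 + 2 * k)) * B / (η : ℝ≥0∞) ^ 2 with hA₂
  have hη0 : (η : ℝ≥0∞) ≠ 0 := by simp [hη.ne']
  have hC : A₁ + k * A₂ ≠ ∞ := by
    refine ENNReal.add_ne_top.2 ⟨ENNReal.div_ne_top (ENNReal.mul_ne_top (by simp) hBt) hη0,
      ENNReal.mul_ne_top (by simp) (ENNReal.div_ne_top (ENNReal.mul_ne_top (by simp) hBt) (pow_ne_zero 2 hη0))⟩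
  obtain ⟨R, hR0, hR⟩ := exists_div_le hC he
  obtain ⟨n, hn⟩ := exists_nat_ge (R + 1)
  have hn1 : (1 : ℝ≥0) ≤ n := le_add_self.trans hn
  have hn0 : (n : ℝ≥0) ≠ 0 := (zero_lt_one.trans_le hn1).ne'
  set δ : ℝ≥0 := (n : ℝ≥0)⁻¹ with hδ
  have hδ0 : 0 < δ := by positivity
  have hδ1 : δ ≤ 1 := inv_le_one_of_one_le₀ hn1
  have hδ1' : (δ : ℝ) ≤ 1 := by exact_mod_cast hδ1
  have hnδ : (n : ℝ≥0) * δ = 1 := mul_inv_cancel₀ hn0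
  have hMδ : ((k * n : ℕ) : ℝ≥0) * δ = k := by push_cast; rw [mul_assoc, hnδ, mul_one]
  have hδe : (A₁ + k * A₂) * δ ≤ e := by
    refine le_trans ?_ hR
    rw [div_eq_mul_inv]
    gcongr
    rw [← ENNReal.coe_inv hR0.ne']
    have : δ ≤ R⁻¹ := by
      rw [hδ]
      gcongr
      exact le_self_add.trans hn
    exact_mod_cast this
  refine ⟨δ, hδ0, hδ1, k * n, hMδ.ge, fun α hα => le_trans ?_ hδe⟩
  have h1 : (lawOn μ ⊗ₘ (jumpData hm hα).law) {q | η < variation q.1 q.2 δ} ≤ A₁ * δ := by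
    refine ((jumpData hm hα).compProd_variation_le (lawOn μ) measurable_edist (measurable_lyap hm)
      lyap_nonneg zero_le_two hκ (mul_lintegral_edist_le hm hα) (mul_lintegral_lyap_le_two hm hα) δ hη).trans ?_
    have h2 : ENNReal.ofReal (kap a * δ * Real.exp (2 * δ)) ≤ ENNReal.ofReal (kap a * Real.exp 2) * δ := by
      rw [← ENNReal.ofReal_coe_nnreal, ← ENNReal.ofReal_mul (by positivity)]
      apply ENNReal.ofReal_le_ofReal
      have : Real.exp (2 * δ) ≤ Real.exp 2 := Real.exp_le_exp.2 (by linarith)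
      calc kap a * δ * Real.exp (2 * δ) ≤ kap a * δ * Real.exp 2 := by gcongr
        _ = _ := by ring
    have h3 : ∫⁻ γ, ENNReal.ofReal (lyap a γ) ∂lawOn μ ≤ B := by
      refine lintegral_mono fun γ => ENNReal.ofReal_le_ofReal ?_
      unfold lyap₂
      nlinarith [sq_nonneg (lyap a γ)]
    refine (ENNReal.div_le_div_right (mul_le_mul' h2 h3) _).trans (le_of_eq ?_)
    rw [hA₁, div_eq_mul_inv, div_eq_mul_inv]
    ring
  have h2 : ∀ j < k * n, (lawOn μ ⊗ₘ (jumpData hm hα).law)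
      {q | (η : ℝ≥0∞) ^ 2 < pairs (val q.1 q.2 (j * δ)) (shift q.2 (j * δ)) (3 * δ)} ≤ A₂ * δ ^ 2 := by
    intro j hj
    refine ((jumpData hm hα).compProd_pairs_le (lawOn μ) measurable_edist (measurable_lyap hm)
      lyap_nonneg (measurable_lyap₂ hm) lyap₂_nonneg zero_le_two hκ (mul_lintegral_edist_le hm hα)
      (mul_lintegral_lyap_le_two hm hα) (mul_lintegral_edist_mul_le hm hα) (mul_lintegral_lyap₂_le hm hα)
      (j * δ) (3 * δ) hη).trans ?_
    have hjk : (j : ℝ) * δ ≤ k := by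
      have h3 : (j : ℝ≥0) * δ ≤ k := by
        rw [← hMδ]
        gcongr
      exact_mod_cast h3
    have h4 : Real.exp (2 * (3 * δ)) * Real.exp (2 * (j * δ)) ≤ Real.exp (6 + 2 * k) := by
      rw [← Real.exp_add]
      exact Real.exp_le_exp.2 (by linarith)
    have h5 : ENNReal.ofReal (kap a ^ 2 * (3 * δ : ℝ≥0) ^ 2 * Real.exp (2 * (3 * δ : ℝ≥0)))
        * ENNReal.ofReal (Real.exp (2 * (j * δ : ℝ≥0)))
        ≤ ENNReal.ofReal (9 * kap a ^ 2 * Real.exp (6 + 2 * k)) * δ ^ 2 := by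
      rw [← ENNReal.ofReal_coe_nnreal, ← ENNReal.ofReal_pow δ.coe_nonneg, ← ENNReal.ofReal_mul (by positivity),
        ← ENNReal.ofReal_mul (by positivity)]
      apply ENNReal.ofReal_le_ofReal
      push_cast
      calc kap a ^ 2 * (3 * δ) ^ 2 * Real.exp (2 * (3 * δ)) * Real.exp (2 * (j * δ))
          = 9 * kap a ^ 2 * (δ : ℝ) ^ 2 * (Real.exp (2 * (3 * δ)) * Real.exp (2 * (j * δ))) := by ring
        _ ≤ 9 * kap a ^ 2 * (δ : ℝ) ^ 2 * Real.exp (6 + 2 * k) := by gcongr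
        _ = _ := by ring
    rw [← mul_assoc]
    refine (ENNReal.div_le_div_right (mul_le_mul_left h5 B) _).trans (le_of_eq ?_)
    rw [hA₂, div_eq_mul_inv, div_eq_mul_inv]
    ring
  have hsub : {q : Tempered d × (ℕ → ℝ≥0 × Tempered d) | η < variation q.1 q.2 δ ∨ ∃ j < k * n,
        (η : ℝ≥0∞) ^ 2 < pairs (val q.1 q.2 (j * δ)) (shift q.2 (j * δ)) (3 * δ)}
      ⊆ {q | η < variation q.1 q.2 δ} ∪ ⋃ j ∈ Finset.range (k * n),
        {q | (η : ℝ≥0∞) ^ 2 < pairs (val q.1 q.2 (j * δ)) (shift q.2 (j * δ)) (3 * δ)} := by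
    rintro q (hq | ⟨j, hj, hq⟩)
    · exact Or.inl hq
    · exact Or.inr (mem_iUnion₂.2 ⟨j, Finset.mem_range.2 hj, hq⟩)
  refine (measure_mono hsub).trans ((measure_union_le _ _).trans ?_)
  rw [add_mul]
  refine add_le_add h1 ((measure_biUnion_finset_le _ _).trans ?_)
  refine (Finset.sum_le_sum fun j hj => h2 j (Finset.mem_range.1 hj)).trans (le_of_eq ?_)
  rw [Finset.sum_const, Finset.card_range, nsmul_eq_mul]
  have hnδ' : (n : ℝ≥0∞) * δ = 1 := by exact_mod_cast hnδ
  calc ((k * n : ℕ) : ℝ≥0∞) * (A₂ * δ ^ 2) = k * A₂ * δ * (n * δ) := by push_cast; ring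
    _ = _ := by rw [hnδ', mul_one]

theorem ofJumps_mem_regular (D : Set ℝ≥0) {x : Tempered d} {ω : ℕ → ℝ≥0 × Tempered d} (hω : ω ∈ NE)
    {R : ℕ → ℝ≥0} (hR : ∀ j : ℕ, ∀ n, T ω n ≤ j + 1 → wsum hwt (st x ω n) ≤ R j)
    {δ η : ℕ → ℝ≥0} {M : ℕ → ℕ} (hδ : ∀ k, 0 < δ k) (hM : ∀ k : ℕ, (k : ℝ≥0) ≤ M k * δ k)
    (hV : ∀ k, variation x ω (δ k) ≤ η k)
    (hP : ∀ k, ∀ j < M k, pairs (val x ω (j * δ k)) (shift ω (j * δ k)) (3 * δ k) ≤ (η k : ℝ≥0∞) ^ 2) :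
    ofJumps x ω ∈ regular D (fun j => {γ | wsum hwt γ ≤ R j}) δ fun k => 2 * η k := by
  refine ⟨fun q _ => ?_, fun k => ?_⟩
  · rw [ofJumps_toFun hω]
    exact hR ⌊q⌋₊ (idx ω q) ((T_idx_le ω q).trans (Nat.lt_floor_add_one q).le)
  · obtain ⟨h1, h2, h3⟩ := oscillation hω (hδ k) (hM k) (hV k) (hP k)
    refine ⟨nodes x ω k (η k), ⟨h1, h2⟩, fun r _ t _ hrt htk htδ hs => ?_⟩
    rw [ofJumps_toFun hω]
    exact h3 r t hrt.le htk htδ fun s hsn hrst => hs s hsn ⟨hrst.1.le, hrst.2⟩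

theorem measurableSet_wsum_le (R : ℝ≥0) : MeasurableSet {γ : Tempered d | wsum hwt γ ≤ R} :=
  measurableSet_le (measurable_wsum continuous_hwt.measurable) measurable_const

theorem jumpLaw_compl_regular_le (J : JumpData (Tempered d)) (μ : Measure (Tempered d)) [SFinite μ]
    {D : Set ℝ≥0} (hD : D.Countable) {R : ℕ → ℝ≥0} {δ η : ℕ → ℝ≥0} {M : ℕ → ℕ} (hδ : ∀ k, 0 < δ k)
    (hM : ∀ k : ℕ, (k : ℝ≥0) ≤ M k * δ k) {e : ℕ → ℝ≥0∞}
    (h1 : ∀ j : ℕ, (μ ⊗ₘ J.law) {q | ∃ n, T q.2 n ≤ (j + 1 : ℝ≥0) ∧ R j < wsum hwt (st q.1 q.2 n)} ≤ e j)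
    (h2 : ∀ k, (μ ⊗ₘ J.law) {q | η k < variation q.1 q.2 (δ k) ∨ ∃ j < M k,
      (η k : ℝ≥0∞) ^ 2 < pairs (val q.1 q.2 (j * δ k)) (shift q.2 (j * δ k)) (3 * δ k)} ≤ e k) :
    jumpLaw J μ (regular D (fun j => {γ | wsum hwt γ ≤ R j}) δ fun k => 2 * η k)ᶜ
      ≤ ∑' k, e k + ∑' k, e k := by
  have hmeas := measurableSet_regular hD (fun j => measurableSet_wsum_le (d := d) (R j)) δ
    (fun k => 2 * (η k : ℝ≥0∞))
  rw [jumpLaw, Measure.map_apply measurable_ofJumps hmeas.compl]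
  have hNE : (μ ⊗ₘ J.law) {q | q.2 ∉ NE} = 0 := by
    have hms : MeasurableSet {q : Tempered d × (ℕ → ℝ≥0 × Tempered d) | q.2 ∉ NE} :=
      measurable_snd measurableSet_NE.compl
    rw [Measure.compProd_apply hms, lintegral_eq_zero_of_ae_eq_zero]
    exact Eventually.of_forall fun γ => ae_iff.1 (J.ae_NE γ)
  have hsub : (fun q : Tempered d × (ℕ → ℝ≥0 × Tempered d) => ofJumps q.1 q.2) ⁻¹'
        (regular D (fun j => {γ | wsum hwt γ ≤ R j}) δ fun k => 2 * η k)ᶜ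
      ⊆ {q | q.2 ∉ NE} ∪
        ((⋃ j : ℕ, {q | ∃ n, T q.2 n ≤ (j + 1 : ℝ≥0) ∧ R j < wsum hwt (st q.1 q.2 n)}) ∪
          ⋃ k, {q | η k < variation q.1 q.2 (δ k) ∨ ∃ j < M k,
            (η k : ℝ≥0∞) ^ 2 < pairs (val q.1 q.2 (j * δ k)) (shift q.2 (j * δ k)) (3 * δ k)}) := by
    intro q hq
    by_contra hc
    simp only [mem_union, mem_iUnion, not_or, not_exists, mem_ofPred_eq, not_not, not_and, not_lt] at hc
    obtain ⟨h1, h2, h3⟩ := hc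
    exact hq (ofJumps_mem_regular D h1 h2 hδ hM (fun k => (h3 k).1) fun k => (h3 k).2)
  refine (measure_mono hsub).trans ((measure_union_le _ _).trans ?_)
  rw [hNE, zero_add]
  exact (measure_union_le _ _).trans (add_le_add
    ((measure_iUnion_le _).trans (ENNReal.tsum_le_tsum h1))
    ((measure_iUnion_le _).trans (ENNReal.tsum_le_tsum h2)))

theorem exists_two_mul_inv_lt : ∀ ε > (0 : ℝ≥0∞), ∀ T : ℝ≥0, ∃ k : ℕ, T < k ∧
    (2 * (((k : ℝ≥0) + 1)⁻¹ : ℝ≥0) : ℝ≥0∞) < ε := by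
  intro ε hε T
  obtain ⟨r, hr0, hr⟩ := ENNReal.lt_iff_exists_nnreal_btwn.1 hε
  have hr0' : 0 < r := by exact_mod_cast hr0
  obtain ⟨k, hk⟩ := exists_nat_gt (max T (2 / r))
  refine ⟨k, (le_max_left _ _).trans_lt hk, lt_of_le_of_lt ?_ hr⟩
  have h1 : 2 / r ≤ (k : ℝ≥0) + 1 := ((le_max_right _ _).trans hk.le).trans le_self_add
  have h2 : 2 * ((k : ℝ≥0) + 1)⁻¹ ≤ r := by
    rw [← div_eq_mul_inv, div_le_iff₀ (by positivity), mul_comm]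
    rwa [div_le_iff₀ hr0'] at h1
  calc (2 * (((k : ℝ≥0) + 1)⁻¹ : ℝ≥0) : ℝ≥0∞) = ((2 * ((k : ℝ≥0) + 1)⁻¹ : ℝ≥0) : ℝ≥0∞) := by
        rw [ENNReal.coe_mul]; rfl
    _ ≤ r := ENNReal.coe_le_coe.2 h2

/-- Summable error probabilities `e j` are allotted to containment up to time `j + 1` and to the
mesh condition before time `k` with `η = 1 / (k + 1)`. Each family is allowed total probability `ε /
2`, uniformly in `α`. -/
theorem isTight_jumpLaw (hm : IsJumpModel a φ) {μ : Measure (Configuration d)} (hμ : IsSubPoissonian μ) :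
    IsTightMeasureSet {ν | ∃ α, ∃ hα : α ∈ Ioc (0 : ℝ) 1, ν = jumpLaw (jumpData hm hα) (lawOn μ)} := by
  have := hμ.isProbabilityMeasure_lawOn
  have hw : Measurable (wsum (hwt (d := d))) := measurable_wsum continuous_hwt.measurable
  rw [isTightMeasureSet_iff_exists_isCompact_measure_compl_le]
  intro ε hε
  obtain ⟨e, he0, heε⟩ := ENNReal.exists_pos_sum_of_countable' (ENNReal.half_pos hε.ne').ne' ℕ
  have hRex : ∀ j : ℕ, ∃ R : ℝ≥0, 0 < R ∧ ENNReal.ofReal (Real.exp (kap a * (j + 1 : ℝ≥0)))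
      * (∫⁻ γ, wsum hwt γ ∂lawOn μ) / R ≤ e j := fun j =>
    exists_div_le (ENNReal.mul_lt_top ENNReal.ofReal_lt_top hμ.lintegral_wsum_hwt).ne (he0 j)
  choose R hR0 hR using hRex
  have hη0 : ∀ k : ℕ, 0 < ((k : ℝ≥0) + 1)⁻¹ := fun k => by positivity
  choose δ hδ0 hδ1 M hM hmesh using fun k => exists_mesh hm hμ k (hη0 k) (he0 k)
  obtain ⟨D, hDc, hD⟩ := TopologicalSpace.exists_countable_dense ℝ≥0
  refine ⟨regular D (fun j => {γ | wsum hwt γ ≤ R j}) δ fun k => 2 * (((k : ℝ≥0) + 1)⁻¹ : ℝ≥0),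
    isCompact_regular hD (fun j => isCompact_setOf_wsum_hwt_le (R j)) hδ0 hδ1 exists_two_mul_inv_lt, ?_⟩
  rintro ν ⟨α, hα, rfl⟩
  refine (jumpLaw_compl_regular_le (jumpData hm hα) (lawOn μ) hDc hδ0 hM (e := e) (fun j => ?_)
    fun k => hmesh k α hα).trans ?_
  · exact ((jumpData hm hα).compProd_exceed_le (lawOn μ) hw (kap_nonneg hm) (mul_lintegral_hwt_le hm hα)
      (hR0 j) (j + 1)).trans (hR j)
  · exact (add_le_add heε.le heε.le).trans (ENNReal.add_halves ε).le

end CadlagPath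

end Kawasaki

end
theorem mainTheorem7 (d : ℕ) (hd : 1 ≤ d) (a φ : Kawasaki.Pt d → ℝ)
    (hmodel : Kawasaki.IsJumpModel a φ) :
    ∃ (S : ℝ → ℝ≥0 → SignedMeasure (Kawasaki.Tempered d) →ₗ[ℝ]
          SignedMeasure (Kawasaki.Tempered d))
      (p : ℝ → ℝ≥0 → Kernel (Kawasaki.Tempered d) (Kawasaki.Tempered d)),
      (∀ α ∈ Ioc (0 : ℝ) 1,
        Kawasaki.IsStochasticSemigroup (S α) ∧
        Kawasaki.generatorGraph (S α) = Kawasaki.tvClosure (Kawasaki.predualGraph a φ α) ∧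
        Kawasaki.IsTransitionFunction (S α) (p α)) ∧
      ∀ μ : Measure (Kawasaki.Configuration d), Kawasaki.IsSubPoissonian μ →
        (∀ δ : ℝ, 0 < δ → ∃ C : ℝ, 0 < C ∧ ∀ α ∈ Ioc (0 : ℝ) 1,
          ∀ t₁ t₂ t₃ : ℝ≥0, t₁ ≤ t₂ → t₂ ≤ t₃ → (t₃ : ℝ) - t₁ < δ →
            Kawasaki.chentsovTriple (p α) (Kawasaki.Tempered.lawOn μ) t₁ t₂ t₃ ≤
              ENNReal.ofReal (C * Real.exp (2 * t₁) * |(t₃ : ℝ) - t₁| ^ 2)) ∧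
        (∀ t : ℝ≥0, IsTightMeasureSet
          ((fun α => Kawasaki.marginal (p α) (Kawasaki.Tempered.lawOn μ) t) '' Ioc (0 : ℝ) 1)) ∧
        ∃ P : ℝ → Measure (Kawasaki.CadlagPath d),
          (∀ α ∈ Ioc (0 : ℝ) 1, Kawasaki.CadlagPath.IsPathMeasure (p α) (Kawasaki.Tempered.lawOn μ) (P α)) ∧
          IsTightMeasureSet (P '' Ioc (0 : ℝ) 1) := by
  classical
  -- The values outside `(0, 1]` are arbitrary; identity operators and kernels make the families
  -- total.
  set S : ℝ → ℝ≥0 → SignedMeasure (Kawasaki.Tempered d) →ₗ[ℝ] SignedMeasure (Kawasaki.Tempered d) :=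
    fun α => if h : α ∈ Ioc (0 : ℝ) 1 then (Kawasaki.Tempered.jumpData hmodel h).semigroup
      else fun _ => LinearMap.id with hS
  set p : ℝ → ℝ≥0 → Kernel (Kawasaki.Tempered d) (Kawasaki.Tempered d) :=
    fun α => if h : α ∈ Ioc (0 : ℝ) 1 then (Kawasaki.Tempered.jumpData hmodel h).p
      else fun _ => Kernel.id with hp
  have hSα : ∀ α (h : α ∈ Ioc (0 : ℝ) 1), S α = (Kawasaki.Tempered.jumpData hmodel h).semigroup :=
    fun α h => dif_pos h
  have hpα : ∀ α (h : α ∈ Ioc (0 : ℝ) 1), p α = (Kawasaki.Tempered.jumpData hmodel h).p :=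
    fun α h => dif_pos h
  refine ⟨S, p, fun α hα => ?_, fun μ hμ => ⟨fun δ hδ => ?_, fun t => ?_, ?_⟩⟩
  · rw [hSα α hα, hpα α hα, Kawasaki.Tempered.predualGraph_eq hmodel hα]
    exact ⟨JumpData.isStochasticSemigroup _, JumpData.generatorGraph_eq _,
      JumpData.isTransitionFunction _⟩
  · obtain ⟨C, hC, h⟩ := Kawasaki.Tempered.chentsovTriple_le hmodel hμ δ hδ
    refine ⟨C, hC, fun α hα t₁ t₂ t₃ h₁ h₂ h₃ => ?_⟩
    rw [hpα α hα]
    exact h α hα t₁ t₂ t₃ h₁ h₂ h₃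
  · refine (Kawasaki.Tempered.isTight_marginal hmodel hμ t).subset ?_
    rintro _ ⟨α, hα, rfl⟩
    exact ⟨α, hα, by simp only [hpα α hα]⟩
  · have := hμ.isProbabilityMeasure_lawOn
    refine ⟨fun α => if h : α ∈ Ioc (0 : ℝ) 1 then
      Kawasaki.CadlagPath.jumpLaw (Kawasaki.Tempered.jumpData hmodel h) (Kawasaki.Tempered.lawOn μ)
      else 0, fun α hα => ?_, (Kawasaki.CadlagPath.isTight_jumpLaw hmodel hμ).subset ?_⟩
    · beta_reduce
      rw [hpα α hα, dif_pos hα]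
      exact Kawasaki.CadlagPath.isPathMeasure_jumpLaw _ _
    · rintro _ ⟨α, hα, rfl⟩
      exact ⟨α, hα, dif_pos hα⟩
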